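/- Let $\ell\ge 2$, $K=\mathbb{C}[[h,\beta]]$, $q=e^{h}$, $t=e^{h\beta}$, and let $\mathfrak g$ be of type $B_\ell$ with simple roots $\alpha_i$, fundamental weights $\omega_i$, invariant form normalized so that long roots have square length $2$, $r=2$, $r_i=(\alpha_i,\alpha_i)$ (so $r_1=\dots=r_{\ell-1}=2$, $r_\ell=1$), $C$ the Cartan matrix with $\operatorname{diag}(r_i)\,C$ symmetric, $[n]_q=\frac{q^n-q^{-n}}{q-q^{-1}}$, and $$C_{ij}(q,t)=(q^{r_i}t^{-1}+q^{-r_i}t)\delta_{ij}-[2\delta_{ij}-C_{ij}]_q,\qquad B_{ij}(q,t)=[r_i]_q\,C_{ij}(q,t).$$ **Heisenberg algebra and Fock modules.** Let $P=\mathbb{C}[\beta]\otimes\mathfrak h^*$. For $\mu\in P$ the Fock module $\pi_\mu$ is the polynomial ring in the creation modes $x_i[-n]$ ($1\le i\le \ell$, $n>0$) applied to a vacuum $v_\mu$. On $\bigoplus_{\mu}\pi_\mu$ act the modes $x_i[m]$ ($m\neq0$), with $[x_i[n],x_j[m]]=n\frac{t^n-t^{-n}}{q^n-q^{-n}}B_{ij}(q^n,t^n)\delta_{n,-m}$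 and $x_i[n]v_\mu=0$ for $n>0$, the zero modes $q^{\xi y_i[0]}$, equal to $q^{\xi(\mu,\omega_i)}$ on $\pi_\mu$, and, for $\gamma\in\beta^{-1}\mathbb{C}[\beta]$, the shifts $e^{\gamma Q_i}$, which commute with all $x_j[n]$ and send $v_\mu$ to $v_{\mu+\gamma\beta r\alpha_i}$. Put $a_i[m]=\frac{q^m-q^{-m}}{m}x_i[m]$ and define $y_i[m]$ by $a_j[m]=\sum_iC_{ij}(q^m,t^m)y_i[m]$. Let $$Y_i(z)=t^{2(\rho^\vee,\omega_i)}q^{-2r(\rho,\omega_i)+2y_i[0]}\exp\Big(\sum_{m\ne0}y_i[m]z^{-m}\Big),$$ and let $\mathbf H_{q,t}(\mathfrak g)$ be the $K$-span of the normally ordered monomials $:\prod Y_i(za)^{d_{i,a}}:$ with $d_{i,a}\in\mathbb Z$ (finitely many nonzero) and $a\in\mathbb C^*q^{\mathbb Z}t^{\mathbb Z}$ (creation modes to the left of annihilation modes). Let $$S_i^+(w)=e^{-Q_i/r_i}:\exp\Big(\sum_{m\ne0}\tfrac{a_i[m]}{q^{mr_i}-q^{-mr_i}}w^{-m}\Big):,\qquad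 S_i^-(w)=e^{Q_i/\beta}:\exp\Big(-\sum_{m\ne0}\tfrac{a_i[m]}{t^{m}-t^{-m}}w^{-m}\Big):,$$ and let the screening operator $S_i^\pm$ be the coefficient of $w^{-1}$, a map on $\pi_0$ with values in another Fock module (for $S_i^-$ one extends scalars to invert $\beta$). Then $\mathbf W_{q,t}(\mathfrak g)$ is the set of fields $A(z)=\sum_n A_nz^n\in\mathbf H_{q,t}(\mathfrak g)$ such that $A_nS_i^\pm=S_i^\pm A_n$ on $\pi_0$ for all $n$, $i$ and both signs. From now on products of monomials are normally ordered. **The monomials.** Put $Y_0=1$, $\bar i=2\ell+2-i$ and \begin{align*} \Lambda_i(z)&=Y_i(zq^{-2i+2}t^{i-1})Y_{i-1}(zq^{-2i}t^i)^{-1}\quad(1\le i\le\ell-1),\\ \Lambda_\ell(z)&=Y_\ell(zq^{-2\ell+3}t^{\ell-1})Y_\ell(zq^{-2\ell+1}t^{\ell-1})Y_{\ell-1}(zq^{-2\ell}t^\ell)^{-1},\\ \Lambda_{\ell+1}(z)&=Y_\ell(zq^{-2\ell+3}t^{\ell-1})Y_\ell(zq^{-2\ell-1}t^{\ell+1})^{-1},\\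 \Lambda_{\bar\ell}(z)&=Y_{\ell-1}(zq^{-2\ell+2}t^\ell)Y_\ell(zq^{-2\ell+1}t^{\ell+1})^{-1}Y_\ell(zq^{-2\ell-1}t^{\ell+1})^{-1},\\ \Lambda_{\bar i}(z)&=Y_{i-1}(zq^{-4\ell+2i+2}t^{2\ell-i})Y_i(zq^{-4\ell+2i}t^{2\ell-i+1})^{-1}\quad(1\le i\le\ell-1). \end{align*} For $1\le i\le\ell-1$ let $S$ be the set of $\mathbf j=(j_1,\dots,j_i)$ with $1\le j_1\le\dots\le j_i\le2\ell+1$ and, for all $\alpha$, $j_\alpha<j_{\alpha+1}$ or $j_\alpha=j_{\alpha+1}=\ell+1$, and put $$\Lambda_{\mathbf j}=\Lambda_{j_1}(zq^{-2(i-1)}t^{i-1})\Lambda_{j_2}(zq^{-2(i-3)}t^{i-3})\cdots\Lambda_{j_i}(zq^{2(i-1)}t^{-(i-1)}).$$ For $i=\ell$ let $S=\{\pm1\}^\ell$ and, for $\sigma\in S$, $$\Lambda_\sigma=b_{\sigma_1}(z|1)\,b_{\sigma_2}(zq^{-2\sigma_1}t^{\sigma_1}|2)\cdots b_{\sigma_\ell}(zq^{-2\sigma_1-\dots-2\sigma_{\ell-1}}t^{\sigma_1+\dots+\sigma_{\ell-1}}|\ell),$$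 where $b_1(z|k)=1$ and $b_{-1}(z|k)=Y_{k-1}(zq^{-2\ell+1}t^\ell)^{-1}Y_k(zq^{-2\ell+3}t^{\ell-1})$ for $k<\ell$, $b_1(z|\ell)=Y_\ell(zq^{-2\ell}t^{\ell+1})^{-1}$, and $b_{-1}(z|\ell)=Y_{\ell-1}(zq^{-2\ell+1}t^\ell)^{-1}Y_\ell(zq^{-2\ell+2}t^{\ell-1})$. **The algorithm.** Let $A_i(z)$ be the monomial $Y_i(zq^{r_i}t^{-1})Y_i(zq^{-r_i}t)\prod_{j:C_{ji}=-1}Y_j(z)^{-1}\prod_{j:C_{ji}=-2}Y_j(zq)^{-1}Y_j(zq^{-1})^{-1}$. A monomial $M$ with exponents $d_{i,a}$ is *dominant* if all $d_{i,a}\ge0$; *generic* if all $d_{i,a}\in\{-1,0,1\}$; *regular* if for all $i,a$: $d_{i,a}>0$ implies $d_{i,aq^{-2r_i}},d_{i,at^2}\ge0$; if $d_{i,a}$ and $d_{i,aq^{-2r_i}t^2}$ are both positive (both negative), then so are $d_{i,aq^{-2r_i}}$ and $d_{i,at^2}$. The variable $Y_i(za)$ is *admissible* in $M$ if $d_{i,a}>0$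 and $d_{i,aq^{-2r_i}}=d_{i,at^2}=0$. The algorithm starts from a monomial with coefficient $1$ and, for every $Y_i(za)$ admissible in an already created $M$ with coefficient $\lambda$, creates $M A_i(zaq^{-r_i}t)^{-1}$ with coefficient $$\lambda\prod_{b\neq a}\left(\frac{(1-q^{-2r_i}ab^{-1})(1-t^2ab^{-1})}{(1-ab^{-1})(1-q^{-2r_i}t^2ab^{-1})}\right)^{d_{i,b}};$$ it fails if some created monomial is not generic or not regular. **Proposition (type $B_\ell$).** For every $1\le i\le\ell$ there exist coefficients $c_{\mathbf j}(q,t)\in K$, $\mathbf j\in S$, all invertible in $K$, such that $$T_i(z)=\sum_{\mathbf j\in S}c_{\mathbf j}(q,t)\,\Lambda_{\mathbf j}$$ belongs to $\mathbf W_{q,t}(\mathfrak g)$. The monomials $\Lambda_{\mathbf j}$ are pairwise distinct, and $T_i(z)$ is fundamental: $Y_i(z)$ is one of the $\Lambda_{\mathbf j}$, it is the only dominant one, and its coefficient is $1$. Moreover, the algorithm started from $Y_i(z)$ never fails, the monomials it creates are exactly the $\Lambda_{\mathbf j}$, $\mathbf j\in S$, and it assigns to $\Lambda_{\mathbf j}$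 the coefficient $c_{\mathbf j}(q,t)$, whichever sequence of steps leads to it. -/

import Mathlib

noncomputable section

namespace DeformedW

open Polynomial PowerSeries

/-! ### Coefficients -/

/-- The ring `K = ℂ[[h, β]]`, realised as power series in `h` over `ℂ[[β]]`. -/
abbrev K : Type := PowerSeries (PowerSeries ℂ)

/-- The fraction field of `K`. It contains `K` as well as `ℂ[[h]]((β)) = K[β⁻¹]`, the ring over which
the currents `S_i⁻` are defined. The Fock modules below are free, so extending their scalars from `K`
or from `K[β⁻¹]` to `KK` is injective and does not change which operators commute. -/
abbrev KK : Type := FractionRing K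

/-- `q^f = e^{h f}` for `f ∈ ℂ[[β]]`. -/
def qPow (f : PowerSeries ℂ) : K := rescale f (PowerSeries.exp (PowerSeries ℂ))

/-- `q = e^h`. -/
def q : KK := algebraMap K KK (qPow 1)

/-- `t = e^{hβ}`. -/
def t : KK := algebraMap K KK (qPow PowerSeries.X)

/-- The `x`-integer `[n]_x = (x^n - x^{-n}) / (x - x⁻¹)`. -/
def qInt (x : KK) (n : ℤ) : KK := (x ^ n - x ^ (-n)) / (x - x⁻¹)

/-! ### Lie data of type `B_ℓ`

`𝔥*` is identified with `ℂ^ℓ` with its standard bilinear form; the simple root `α_i` (`1 ≤ i ≤ ℓ`)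
corresponds to the index `i - 1 : Fin ℓ`. Long roots have square length `2`, and `r = 2`. -/

/-- `α_i = ε_i - ε_{i+1}` for `i < ℓ`, and `α_ℓ = ε_ℓ`. -/
def simpleRoot (ℓ : ℕ) (i : Fin ℓ) : Fin ℓ → ℂ := fun k =>
  if k = i then 1 else if k.val = i.val + 1 then -1 else 0

/-- `ω_i = ε_1 + ⋯ + ε_i` for `i < ℓ`, and `ω_ℓ = (ε_1 + ⋯ + ε_ℓ) / 2`. -/
def fundWeight (ℓ : ℕ) (i : Fin ℓ) : Fin ℓ → ℂ := fun k =>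
  if i.val + 1 = ℓ then 1 / 2 else if k ≤ i then 1 else 0

/-- `ρ`, the sum of the fundamental weights. -/
def rho (ℓ : ℕ) : Fin ℓ → ℂ := ∑ i, fundWeight ℓ i

/-- `ρ^∨`, the sum of the fundamental coweights `2 ω_i / (α_i, α_i)`. -/
def rhoCheck (ℓ : ℕ) : Fin ℓ → ℂ :=
  ∑ i, (2 / (simpleRoot ℓ i ⬝ᵥ simpleRoot ℓ i)) • fundWeight ℓ i

/-- The Cartan matrix `C_ij = 2 (α_i, α_j) / (α_i, α_i)`; thus `C_{ℓ,ℓ-1} = -2`, `C_{ℓ-1,ℓ} = -1`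
(Mathlib uses the transposed convention). -/
def cartan (ℓ : ℕ) : Matrix (Fin ℓ) (Fin ℓ) ℤ := (CartanMatrix.B ℓ).transpose

/-- The incidence matrix `2 - C`. -/
def incidence (ℓ : ℕ) : Matrix (Fin ℓ) (Fin ℓ) ℤ := 2 - cartan ℓ

/-- `r_i = r (α_i, α_i) / 2`: the diagonal matrix `D = diag(2, …, 2, 1)`. -/
def rr (ℓ : ℕ) (i : Fin ℓ) : ℤ := if i.val + 1 = ℓ then 1 else 2

/-- The deformed Cartan matrix `C(q^n, t^n)`. -/
def cartanQT (ℓ : ℕ) (n : ℤ) : Matrix (Fin ℓ) (Fin ℓ) KK := Matrix.of fun i j =>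
  (if i = j then (q ^ n) ^ rr ℓ i * (t ^ n)⁻¹ + (q ^ n) ^ (-rr ℓ i) * t ^ n else 0)
    - qInt (q ^ n) (incidence ℓ i j)

/-- The symmetrised deformed Cartan matrix `B(q^n, t^n) = D(q^n, t^n) C(q^n, t^n)`. -/
def symCartanQT (ℓ : ℕ) (n : ℤ) : Matrix (Fin ℓ) (Fin ℓ) KK := Matrix.of fun i j =>
  qInt (q ^ n) (rr ℓ i) * cartanQT ℓ n i j

/-! ### The Heisenberg algebra acting on the direct sum of the Fock modules -/

/-- `P = ℂ[β] ⊗ 𝔥*`. -/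
abbrev P (ℓ : ℕ) : Type := Fin ℓ → ℂ[X]

/-- The pairing `(μ, λ) ∈ ℂ[β] ⊆ ℂ[[β]]` for `μ ∈ P`, `λ ∈ 𝔥*`. -/
def pair {ℓ : ℕ} (μ : P ℓ) (v : Fin ℓ → ℂ) : PowerSeries ℂ :=
  ((∑ k, μ k * Polynomial.C (v k) : ℂ[X]) : PowerSeries ℂ)

/-- The underlying space of every Fock module `π_μ`: polynomials in the creation modes, the variable
`(i, n)` standing for `x_i[-(n+1)]`; the polynomial `1` is the vacuum `v_μ`. -/
abbrev FockV (ℓ : ℕ) : Type := MvPolynomial (Fin ℓ × ℕ) KK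

/-- The direct sum `⊕_{μ ∈ P} π_μ`. -/
abbrev Fock (ℓ : ℕ) : Type := P ℓ →₀ FockV ℓ

/-- The action of `x_i[m]`, `m ≠ 0`, on a Fock module: creation modes act by multiplication, and the
annihilation mode `x_i[m]`, `m > 0`, is the derivation determined by
`[x_i[m], x_j[-m]] = m (t^m - t^{-m}) / (q^m - q^{-m}) B_ij(q^m, t^m)`, killing the vacuum.
The value at `m = 0` is a convention and is never used. -/
def xV (ℓ : ℕ) (i : Fin ℓ) : ℤ → Module.End KK (FockV ℓ)
  | Int.negSucc n => LinearMap.mulLeft KK (MvPolynomial.X (i, n))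
  | Int.ofNat 0 => 0
  | Int.ofNat (n + 1) => ∑ j : Fin ℓ,
      (((n + 1 : ℕ) : KK) * ((t ^ (n + 1) - (t ^ (n + 1))⁻¹) / (q ^ (n + 1) - (q ^ (n + 1))⁻¹))
        * symCartanQT ℓ (n + 1) i j) •
        (MvPolynomial.pderiv (R := KK) (j, n)).toLinearMap

/-- `x_i[m]` on the direct sum of the Fock modules. -/
def x (ℓ : ℕ) (i : Fin ℓ) (m : ℤ) : Module.End KK (Fock ℓ) :=
  Finsupp.mapRange.linearMap (xV ℓ i m)

/-- `a_i[m] = (q^m - q^{-m}) / m · x_i[m]`, the simple root type modes. -/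
def a (ℓ : ℕ) (i : Fin ℓ) (m : ℤ) : Module.End KK (Fock ℓ) :=
  ((q ^ m - q ^ (-m)) / (m : KK)) • x ℓ i m

/-- The fundamental weight type modes `y_i[m]`, determined by `a_j[m] = ∑_i C_ij(q^m, t^m) y_i[m]`. -/
def y (ℓ : ℕ) (i : Fin ℓ) (m : ℤ) : Module.End KK (Fock ℓ) :=
  ∑ j, ((cartanQT ℓ m)⁻¹ j i) • a ℓ j m

/-- The zero mode `q^{∑_i ξ_i y_i[0]}`: as `q^{ξ a_j[0]}` acts on `π_μ` by `q^{ξ (μ, α_j)}` and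
`α_j = ∑_i C_ij ω_i`, it acts on `π_μ` by `q^{∑_i ξ_i (μ, ω_i)}`. -/
def zeroMode (ℓ : ℕ) (ξ : Fin ℓ → PowerSeries ℂ) : Module.End KK (Fock ℓ) :=
  Finsupp.lsum KK fun μ =>
    algebraMap K KK (qPow (∑ i, ξ i * pair μ (fundWeight ℓ i))) • Finsupp.lsingle μ

/-- The shift generator `e^{γ Q_i}` with `γ = δ / β`, `δ ∈ ℂ[β]`: it maps `π_μ` to `π_{μ + δ r α_i}`,
fixing the creation modes and sending the vacuum to the vacuum. -/
def shift (ℓ : ℕ) (i : Fin ℓ) (δ : ℂ[X]) : Module.End KK (Fock ℓ) :=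
  Finsupp.lmapDomain (FockV ℓ) KK
    fun μ : P ℓ => μ + fun k => δ * Polynomial.C (2 * simpleRoot ℓ i k)

/-! ### Formal series of operators -/

/-- A formal series `∑ A_n z^n`, `n ∈ ℤ`, of operators on the direct sum of the Fock modules. -/
abbrev Series (ℓ : ℕ) : Type := ℤ → Fock ℓ → Fock ℓ

/-- The coefficient of `u^n` in `exp (∑_{m ≥ 1} φ_m u^m)`. -/
def expCoeff {ℓ : ℕ} (φ : ℕ → Module.End KK (Fock ℓ)) (n : ℕ) : Module.End KK (Fock ℓ) :=
  ∑ k ∈ Finset.range (n + 1), ((k.factorial : KK)⁻¹) •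
    PowerSeries.coeff n ((PowerSeries.mk fun m => if m = 0 then 0 else φ m) ^ k)

/-- The normally ordered exponential
`:exp (∑_{m ≠ 0} φ_m z^{-m}): = exp (∑_{m < 0} φ_m z^{-m}) exp (∑_{m > 0} φ_m z^{-m})`.
The coefficient of `z^n` applied to a vector is a sum over `(b, c)` with `b - c = n`, in which only
finitely many terms are nonzero when the `φ_m`, `m > 0`, are combinations of annihilation modes
`x_i[m]`. -/
def normalExp {ℓ : ℕ} (φ : ℤ → Module.End KK (Fock ℓ)) : Series ℓ := fun n v =>
  ∑ᶠ (p : ℕ × ℕ) (_ : (p.1 : ℤ) - (p.2 : ℤ) = n),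
    expCoeff (fun m => φ (-(m : ℤ))) p.1 (expCoeff (fun m => φ (m : ℤ)) p.2 v)

/-! ### Monomials in the `Y_i(za)` -/

/-- Spectral parameters: `(c, m, n)` stands for `c q^m t^n ∈ ℂ^* q^ℤ t^ℤ` (uniquely). -/
abbrev Spec : Type := ℂˣ × ℤ × ℤ

/-- The value `c q^m t^n` of a spectral parameter. -/
def Spec.eval (s : Spec) : KK := algebraMap ℂ KK (s.1 : ℂ) * q ^ s.2.1 * t ^ s.2.2

/-- The spectral parameter multiplied by `q^m t^n`. -/
def Spec.mulQT (s : Spec) (m n : ℤ) : Spec := (s.1, s.2.1 + m, s.2.2 + n)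

/-- Monomials `:∏ Y_i(za)^{d_{i,a}}:`, given by their exponents `d_{i,a} ∈ ℤ` (written additively). -/
abbrev Mon (ℓ : ℕ) : Type := (Fin ℓ × Spec) →₀ ℤ

/-- The field `:∏ Y_i(za)^{d_{i,a}}:`, where
`Y_i(z) = t^{2(ρ^∨, ω_i)} q^{-2r(ρ, ω_i) + 2 y_i[0]} exp (∑_{m ≠ 0} y_i[m] z^{-m})` and `r = 2`. -/
def monField {ℓ : ℕ} (M : Mon ℓ) : Series ℓ := fun n v =>
  algebraMap K KK (qPow (M.sum fun p d => (d : PowerSeries ℂ) *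
      (PowerSeries.C (2 * (rhoCheck ℓ ⬝ᵥ fundWeight ℓ p.1)) * PowerSeries.X
        - PowerSeries.C (2 * 2 * (rho ℓ ⬝ᵥ fundWeight ℓ p.1))))) •
    zeroMode ℓ (fun i => M.sum fun p d => if p.1 = i then (2 * d : PowerSeries ℂ) else 0)
      (normalExp (fun m => M.sum fun p d => ((d : KK) * p.2.eval ^ (-m)) • y ℓ p.1 m) n v)

/-- `𝐇_{q,t}(B_ℓ)`: the `K`-span of the monomials. -/
def HH (ℓ : ℕ) : Submodule K (Series ℓ) := Submodule.span K (Set.range (monField (ℓ := ℓ)))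

/-! ### Screening currents and the deformed `W`-algebra -/

/-- `:S_i⁺(w): = e^{-Q_i/r_i} :exp (∑_{m ≠ 0} s_i⁺[m] w^{-m}):`,
with `s_i⁺[m] = a_i[m] / (q^{m r_i} - q^{-m r_i})`. -/
def screenPlus (ℓ : ℕ) (i : Fin ℓ) : Series ℓ := fun n v =>
  shift ℓ i (-Polynomial.C (1 / (rr ℓ i : ℂ)) * Polynomial.X)
    (normalExp (fun m => (q ^ (m * rr ℓ i) - q ^ (-(m * rr ℓ i)))⁻¹ • a ℓ i m) n v)

/-- `:S_i⁻(w): = e^{Q_i/β} :exp (-∑_{m ≠ 0} s_i⁻[m] w^{-m}):`,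
with `s_i⁻[m] = a_i[m] / (t^m - t^{-m})`. -/
def screenMinus (ℓ : ℕ) (i : Fin ℓ) : Series ℓ := fun n v =>
  shift ℓ i 1 (normalExp (fun m => (-(t ^ m - t ^ (-m))⁻¹) • a ℓ i m) n v)

/-- The field `A` commutes with the screening operator of the current `S`, i.e. with the coefficient
of `w^{-1}` in `S(w)`, regarded as a linear map defined on the Fock module `π_0`. -/
def CommutesWithScreening {ℓ : ℕ} (A S : Series ℓ) : Prop :=
  ∀ (n : ℤ) (v : FockV ℓ),
    A n (S (-1) (Finsupp.single 0 v)) = S (-1) (A n (Finsupp.single 0 v))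

/-- The deformed `W`-algebra `𝐖_{q,t}(B_ℓ)`: the fields of `𝐇_{q,t}(B_ℓ)` commuting with all the
screening operators `S_i^±`. -/
def WW (ℓ : ℕ) : Set (Series ℓ) :=
  {A | A ∈ HH ℓ ∧ ∀ i, CommutesWithScreening A (screenPlus ℓ i) ∧
    CommutesWithScreening A (screenMinus ℓ i)}

/-! ### The algorithm -/

/-- `A_i(za)` as a monomial in the `Y_j`, according to `a_i[m] = ∑_j C_ji(q^m, t^m) y_j[m]`. -/
def aMon {ℓ : ℕ} (i : Fin ℓ) (s : Spec) : Mon ℓ :=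
  Finsupp.single (i, s.mulQT (rr ℓ i) (-1)) 1 + Finsupp.single (i, s.mulQT (-rr ℓ i) 1) 1
    - ∑ j, (if incidence ℓ j i = 1 then Finsupp.single (j, s) 1
        else if incidence ℓ j i = 2 then
          Finsupp.single (j, s.mulQT 1 0) 1 + Finsupp.single (j, s.mulQT (-1) 0) 1
        else 0)

/-- A monomial is dominant if all its exponents are nonnegative. -/
def IsDominant {ℓ : ℕ} (M : Mon ℓ) : Prop := ∀ p, 0 ≤ M p

/-- A monomial is generic if all its exponents are `-1`, `0` or `1`. -/
def IsGeneric {ℓ : ℕ} (M : Mon ℓ) : Prop := ∀ p, M p = -1 ∨ M p = 0 ∨ M p = 1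

/-- Regular monomials. -/
def IsRegular {ℓ : ℕ} (M : Mon ℓ) : Prop :=
  ∀ (i : Fin ℓ) (s : Spec),
    (0 < M (i, s) → 0 ≤ M (i, s.mulQT (-2 * rr ℓ i) 0) ∧ 0 ≤ M (i, s.mulQT 0 2)) ∧
    (0 < M (i, s) → 0 < M (i, s.mulQT (-2 * rr ℓ i) 2) →
      0 < M (i, s.mulQT (-2 * rr ℓ i) 0) ∧ 0 < M (i, s.mulQT 0 2)) ∧
    (M (i, s) < 0 → M (i, s.mulQT (-2 * rr ℓ i) 2) < 0 →
      M (i, s.mulQT (-2 * rr ℓ i) 0) < 0 ∧ M (i, s.mulQT 0 2) < 0)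

/-- `Y_i(zs)` is admissible in `M`. -/
def IsAdmissible {ℓ : ℕ} (M : Mon ℓ) (i : Fin ℓ) (s : Spec) : Prop :=
  0 < M (i, s) ∧ M (i, s.mulQT (-2 * rr ℓ i) 0) = 0 ∧ M (i, s.mulQT 0 2) = 0

/-- The factor by which the coefficient is multiplied when `Y_i(zs)` is expanded in `M`: the product,
over the other `Y_i(zb)^{±1}` in `M`, with `u = s b⁻¹`, of
`((1 - q^{-2r_i} u) (1 - t^2 u) / ((1 - u) (1 - q^{-2r_i} t^2 u)))^{±1}`. -/
def stepFactor {ℓ : ℕ} (M : Mon ℓ) (i : Fin ℓ) (s : Spec) : KK :=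
  M.prod fun p d => if p.1 = i ∧ p.2 ≠ s then
    ((1 - q ^ (-2 * rr ℓ i) * (s.eval / p.2.eval)) * (1 - t ^ 2 * (s.eval / p.2.eval)) /
      ((1 - s.eval / p.2.eval) * (1 - q ^ (-2 * rr ℓ i) * t ^ 2 * (s.eval / p.2.eval)))) ^ d
    else 1

/-- `Created m M c`: starting from the monomial `m` with coefficient `1`, and passing repeatedly from a
monomial `M` in which `Y_i(zs)` is admissible to `M · A_i(z s q^{-r_i} t)⁻¹`, one obtains the monomial
`M` with coefficient `c`. -/
inductive Created {ℓ : ℕ} (m : Mon ℓ) : Mon ℓ → KK → Prop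
  | start : Created m m 1
  | step {M : Mon ℓ} {c : KK} (i : Fin ℓ) (s : Spec) (hM : Created m M c)
      (hs : IsAdmissible M i s) :
      Created m (M - aMon i (s.mulQT (-rr ℓ i) 1)) (c * stepFactor M i s)

/-! ### The monomials of the fundamental fields of type `B_ℓ` -/

/-- The monomial `Y_k(z q^m t^n)` for `1 ≤ k ≤ ℓ`, with the convention `Y_0 = 1`. -/
def Y (ℓ k : ℕ) (m n : ℤ) : Mon ℓ :=
  if hk : 1 ≤ k ∧ k ≤ ℓ then
    Finsupp.single ((⟨k - 1, by omega⟩ : Fin ℓ), ((1, m, n) : Spec)) 1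
  else 0

/-- `Λ_j(z q^m t^n)` for `1 ≤ j ≤ 2ℓ + 1`, where `j = 2ℓ + 2 - i` is also written `\bar i`. -/
def Lam (ℓ j : ℕ) (m n : ℤ) : Mon ℓ :=
  if j < ℓ then
    Y ℓ j (m - 2 * j + 2) (n + j - 1) - Y ℓ (j - 1) (m - 2 * j) (n + j)
  else if j = ℓ then
    Y ℓ ℓ (m - 2 * ℓ + 3) (n + ℓ - 1) + Y ℓ ℓ (m - 2 * ℓ + 1) (n + ℓ - 1)
      - Y ℓ (ℓ - 1) (m - 2 * ℓ) (n + ℓ)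
  else if j = ℓ + 1 then
    Y ℓ ℓ (m - 2 * ℓ + 3) (n + ℓ - 1) - Y ℓ ℓ (m - 2 * ℓ - 1) (n + ℓ + 1)
  else if j = ℓ + 2 then
    Y ℓ (ℓ - 1) (m - 2 * ℓ + 2) (n + ℓ) - Y ℓ ℓ (m - 2 * ℓ + 1) (n + ℓ + 1)
      - Y ℓ ℓ (m - 2 * ℓ - 1) (n + ℓ + 1)
  else
    Y ℓ (2 * ℓ + 2 - j - 1) (m - 4 * ℓ + 2 * (2 * ℓ + 2 - j) + 2) (n + 2 * ℓ - (2 * ℓ + 2 - j))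
      - Y ℓ (2 * ℓ + 2 - j) (m - 4 * ℓ + 2 * (2 * ℓ + 2 - j)) (n + 2 * ℓ - (2 * ℓ + 2 - j) + 1)

/-- The set `S` of tuples `1 ≤ j_1 ≤ ⋯ ≤ j_i ≤ 2ℓ + 1` with `j_α < j_{α+1}` or
`j_α = j_{α+1} = ℓ + 1` for all `α`. -/
abbrev Tableau (ℓ i : ℕ) : Type :=
  {j : Fin i → Finset.Icc 1 (2 * ℓ + 1) // ∀ α β : Fin i, α.val + 1 = β.val →
    ((j α : ℕ) < j β ∨ ((j α : ℕ) = ℓ + 1 ∧ (j β : ℕ) = ℓ + 1))}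

/-- `Λ_𝐣 = Λ_{j_1}(z q^{-2(i-1)} t^{i-1}) Λ_{j_2}(z q^{-2(i-3)} t^{i-3}) ⋯ Λ_{j_i}(z q^{2(i-1)} t^{-(i-1)})`;
the factor at the position `α : Fin i` (counted from `0`) has argument `z q^{-2(i-1-2α)} t^{i-1-2α}`. -/
def tableauMon (ℓ i : ℕ) (j : Tableau ℓ i) : Mon ℓ :=
  ∑ α : Fin i, Lam ℓ (j.1 α) (-2 * ((i : ℤ) - 1 - 2 * α)) ((i : ℤ) - 1 - 2 * α)

/-- The factors `b_{±1}(z q^m t^n | k)`, `1 ≤ k ≤ ℓ`, of the spinor monomials. -/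
def spinorFactor (ℓ : ℕ) (σ : ℤˣ) (k : ℕ) (m n : ℤ) : Mon ℓ :=
  if σ = 1 then
    if k = ℓ then -Y ℓ ℓ (m - 2 * ℓ) (n + ℓ + 1) else 0
  else
    if k = ℓ then Y ℓ ℓ (m - 2 * ℓ + 2) (n + ℓ - 1) - Y ℓ (ℓ - 1) (m - 2 * ℓ + 1) (n + ℓ)
    else Y ℓ k (m - 2 * ℓ + 3) (n + ℓ - 1) - Y ℓ (k - 1) (m - 2 * ℓ + 1) (n + ℓ)

/-- `b_{σ_1}(z|1) b_{σ_2}(z q^{-2σ_1} t^{σ_1}|2) ⋯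
b_{σ_ℓ}(z q^{-2σ_1-⋯-2σ_{ℓ-1}} t^{σ_1+⋯+σ_{ℓ-1}}|ℓ)`. -/
def spinorMon (ℓ : ℕ) (σ : Fin ℓ → ℤˣ) : Mon ℓ :=
  ∑ k : Fin ℓ, spinorFactor ℓ (σ k) (k.val + 1)
    (-2 * ∑ p ∈ Finset.univ.filter (fun p => p < k), (σ p : ℤ))
    (∑ p ∈ Finset.univ.filter (fun p => p < k), (σ p : ℤ))

/-- `T(z) = ∑_{j ∈ J} c_j m_j` belongs to `𝐖_{q,t}(B_ℓ)`, is fundamental with unique dominant monomial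
`Y_i(z)`, and is produced by the algorithm. -/
structure IsFundamentalField (ℓ i : ℕ) {J : Type} [Fintype J] (mon : J → Mon ℓ) (c : J → K) :
    Prop where
  /-- `T(z)` belongs to the deformed `W`-algebra. -/
  mem_W : (∑ j, c j • monField (mon j)) ∈ WW ℓ
  /-- The monomials are pairwise distinct, so that the sum is the expansion of `T(z)`. -/
  mon_injective : Function.Injective mon
  /-- All the coefficients are invertible in `K`; in particular all the monomials appear. -/
  coeff_isUnit : ∀ j, IsUnit (c j)
  /-- `Y_i(z)` is the unique dominant monomial. -/
  dominant_iff : ∀ j, IsDominant (mon j) ↔ mon j = Y ℓ i 0 0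
  /-- `Y_i(z)` appears with coefficient `1`. -/
  top : ∃ j, mon j = Y ℓ i 0 0 ∧ c j = 1
  /-- The algorithm does not fail. -/
  regular : ∀ M d, Created (Y ℓ i 0 0) M d → IsGeneric M ∧ IsRegular M
  /-- The algorithm creates exactly the monomials `m_j`, with the coefficients `c_j`. -/
  created_iff : ∀ M d, Created (Y ℓ i 0 0) M d ↔ ∃ j, mon j = M ∧ algebraMap K KK (c j) = d

end DeformedW

end

/-! The contraction of a monomial `M` with a screening current `S_k(w)` is a rational function of
`w/z` with one zero and one pole for every factor of `M` at the node `k`. The products in the two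
orders are its expansions at `0` and at `∞`, up to a constant, and the zero mode of `M`, which sees
the charge of `S_k`, supplies exactly that constant. Hence the commutator is a sum of delta
functions, one for each pole, with a residue as coefficient and the exponential fused at the pole as
value (`Heis.vertex_commutator`, `monField_commutator`). A combination of monomials commutes with
the screening operator as soon as these pole terms cancel.

Let `M` contain `Y_k(X)`, and pass to `M A_k⁻¹`, which contains `Y_k(X q^{-2r} t^2)⁻¹` instead.
Since `A_k` is a ratio of two values of `S_k`, the two fused exponentials agree (`fuse_sub_aMon`),
and the residues are opposite exactly when the coefficients differ by the factor of the algorithm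
(`poleCoeff_flip`, `poleTerm_flip`). This factor is symmetric in `q^{-2r}` and `t^2`, so the same
coefficients serve for `S_k⁺` and `S_k⁻`. There is one exception: at the short root, `Y(X) Y(X q^2)`
starts a string of three monomials rather than a square of four. The unmatched poles at its two ends
cancel each other for `S⁺` (`Heis.poleCoeff_string`) and are absent for `S⁻`.

`NodeSystem` records this situation at one node: two factors, each with a sign in `{0, 1, -1}` that
can be flipped unless the flip is blocked by the exception. If a family carries such a system at all
nodes and only one member has no negative factor, everything follows
(`isFundamentalField_of_nodeSystem`). The pole terms cancel under an involution
(`NodeSystem.term_pairing`). The admissible variables are the positive factors whose flip is not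
blocked, so the algorithm performs flips and stays in the family. Every other member arises by a
flip from one whose height is larger by one, which shows that all members are created and that their
monomials are distinct.

For spinors the flips exchange two adjacent signs or change the last one; there is at most one
factor at each node, so all coefficients are `1`. A tableau is the lattice path `N`, with `N L` the
number of entries at most `L`, and flips reflect corners of the path. The node `k < ℓ` sees the
corners at `k` and `2ℓ + 1 - k`; the node `ℓ` sees the block of letters `ℓ`, `ℓ + 1`, `ℓ + 2`, in
which the letters `ℓ + 1` telescope and leave one factor at each end. The coefficient `pathCoeff` is
an explicit product, with a factor for each pair of letters `j`, `2ℓ + 2 - j` and one for the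
letters `ℓ + 1`. It is invertible because it is built from quotients of elements `1 - q^m t^n` with
`m ≠ 0`, each of which is `h` times a unit. -/

noncomputable section

namespace DeformedW

open Polynomial PowerSeries

/-! ### The scalars `q^m t^n` -/

theorem qPow_add (f g : PowerSeries ℂ) : qPow (f + g) = qPow f * qPow g :=
  (PowerSeries.exp_mul_exp_eq_exp_add f g).symm

theorem qPow_zero : qPow 0 = 1 := by
  simp [qPow]

theorem constantCoeff_qPow (f : PowerSeries ℂ) : PowerSeries.constantCoeff (qPow f) = 1 := by
  rw [← PowerSeries.coeff_zero_eq_constantCoeff_apply, qPow, PowerSeries.coeff_rescale]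
  simp

theorem coeff_one_qPow (f : PowerSeries ℂ) : PowerSeries.coeff 1 (qPow f) = f := by
  simp [qPow, PowerSeries.coeff_rescale]

theorem algebraMap_qPow_add (f g : PowerSeries ℂ) :
    algebraMap K KK (qPow (f + g)) = algebraMap K KK (qPow f) * algebraMap K KK (qPow g) := by
  rw [qPow_add, map_mul]

theorem algebraMap_qPow_ne_zero (f : PowerSeries ℂ) : algebraMap K KK (qPow f) ≠ 0 := by
  intro h
  have := algebraMap_qPow_add f (-f)
  rw [add_neg_cancel, qPow_zero, map_one, h, zero_mul] at this
  exact one_ne_zero this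

theorem algebraMap_qPow_neg (f : PowerSeries ℂ) :
    algebraMap K KK (qPow (-f)) = (algebraMap K KK (qPow f))⁻¹ := by
  apply eq_inv_of_mul_eq_one_left
  rw [← algebraMap_qPow_add, neg_add_cancel, qPow_zero, map_one]

theorem algebraMap_qPow_zsmul (n : ℤ) (f : PowerSeries ℂ) :
    algebraMap K KK (qPow (n * f)) = (algebraMap K KK (qPow f)) ^ n := by
  induction n with
  | zero => simp [qPow_zero]
  | succ n ih =>
    rw [zpow_add_one₀ (algebraMap_qPow_ne_zero f), ← ih, ← algebraMap_qPow_add]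
    congr 2; push_cast; ring
  | pred n ih =>
    rw [zpow_sub_one₀ (algebraMap_qPow_ne_zero f), ← ih, ← algebraMap_qPow_neg,
      ← algebraMap_qPow_add]
    congr 2; push_cast; ring

theorem q_ne_zero : q ≠ 0 := algebraMap_qPow_ne_zero _

theorem t_ne_zero : t ≠ 0 := algebraMap_qPow_ne_zero _

/-- The monomial `q^m t^n`. -/
def qt (m n : ℤ) : KK := q ^ m * t ^ n

theorem qt_eq (m n : ℤ) :
    qt m n = algebraMap K KK (qPow (m + n * (PowerSeries.X : PowerSeries ℂ))) := by
  rw [algebraMap_qPow_add, algebraMap_qPow_zsmul]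
  have := algebraMap_qPow_zsmul m 1
  rw [mul_one] at this
  rw [this]; rfl

theorem qt_ne_zero (m n : ℤ) : qt m n ≠ 0 :=
  mul_ne_zero (zpow_ne_zero _ q_ne_zero) (zpow_ne_zero _ t_ne_zero)

theorem qt_add (m n m' n' : ℤ) : qt (m + m') (n + n') = qt m n * qt m' n' := by
  simp only [qt, zpow_add₀ q_ne_zero, zpow_add₀ t_ne_zero]; ring

theorem qt_zero : qt 0 0 = 1 := by simp [qt]

theorem qt_neg (m n : ℤ) : qt (-m) (-n) = (qt m n)⁻¹ := by
  simp [qt, zpow_neg, mul_comm]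

theorem qt_sub (m n m' n' : ℤ) : qt (m - m') (n - n') = qt m n / qt m' n' := by
  rw [sub_eq_add_neg, sub_eq_add_neg, qt_add, qt_neg, div_eq_mul_inv]

theorem qt_zpow (m n k : ℤ) : qt m n ^ k = qt (k * m) (k * n) := by
  simp only [qt, mul_zpow, ← zpow_mul, mul_comm]

theorem linear_eq_zero {m n : ℤ}
    (h : (m : PowerSeries ℂ) + n * (PowerSeries.X : PowerSeries ℂ) = 0) : m = 0 ∧ n = 0 := by
  have e : (m : PowerSeries ℂ) = PowerSeries.C (m : ℂ) := by simp
  have e' : (n : PowerSeries ℂ) = PowerSeries.C (n : ℂ) := by simp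
  rw [e, e'] at h
  have h0 := congrArg (PowerSeries.coeff 0) h
  have h1 := congrArg (PowerSeries.coeff 1) h
  rw [map_add, PowerSeries.coeff_C_mul, PowerSeries.coeff_C, PowerSeries.coeff_X] at h0 h1
  simp at h0 h1
  exact ⟨h0, h1⟩

/-- The coefficient of `h` in `e^{h(m + nβ)}` is `m + nβ`, so `q` and `t` are multiplicatively
independent. Every later coincidence of zeros, poles or spectral parameters thereby becomes a system
of linear equations between integer exponents. -/
theorem qt_eq_one_iff (m n : ℤ) : qt m n = 1 ↔ m = 0 ∧ n = 0 := by
  refine ⟨fun h => ?_, fun ⟨hm, hn⟩ => by rw [hm, hn, qt_zero]⟩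
  rw [qt_eq, ← map_one (algebraMap K KK)] at h
  have h2 := IsFractionRing.injective K KK h
  have h3 := congrArg (PowerSeries.coeff 1) h2
  rw [coeff_one_qPow] at h3
  apply linear_eq_zero
  rw [h3, PowerSeries.coeff_one]; simp

theorem qt_inj {m n m' n' : ℤ} : qt m n = qt m' n' ↔ m = m' ∧ n = n' := by
  rw [← div_eq_one_iff_eq (qt_ne_zero _ _), ← qt_sub, qt_eq_one_iff, sub_eq_zero, sub_eq_zero]

theorem one_sub_qt_ne_zero {m n : ℤ} (h : m ≠ 0 ∨ n ≠ 0) : 1 - qt m n ≠ 0 := by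
  intro e
  have := (qt_eq_one_iff m n).1 (sub_eq_zero.1 e).symm
  tauto

theorem Spec.eval_ne_zero (s : Spec) : s.eval ≠ 0 := by
  unfold Spec.eval
  refine mul_ne_zero (mul_ne_zero ?_ (zpow_ne_zero _ q_ne_zero)) (zpow_ne_zero _ t_ne_zero)
  rw [Ne, _root_.map_eq_zero]; exact s.1.ne_zero

theorem Spec.eval_mulQT (s : Spec) (m n : ℤ) : (s.mulQT m n).eval = s.eval * qt m n := by
  simp only [Spec.eval, Spec.mulQT, qt, zpow_add₀ q_ne_zero, zpow_add₀ t_ne_zero]; ring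

/-! ### Invertible elements of `K` -/

/-- The elements of the fraction field that are invertible in `K`. -/
def IsKUnit (u : KK) : Prop := ∃ c : K, IsUnit c ∧ algebraMap K KK c = u

theorem IsKUnit.one : IsKUnit 1 := ⟨1, isUnit_one, map_one _⟩

theorem IsKUnit.mul {u v : KK} (hu : IsKUnit u) (hv : IsKUnit v) : IsKUnit (u * v) := by
  obtain ⟨c, hc, rfl⟩ := hu
  obtain ⟨d, hd, rfl⟩ := hv
  exact ⟨c * d, hc.mul hd, map_mul _ _ _⟩

theorem IsKUnit.prod {ι : Type*} (s : Finset ι) (f : ι → KK) (h : ∀ i ∈ s, IsKUnit (f i)) :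
    IsKUnit (∏ i ∈ s, f i) :=
  Finset.prod_induction _ _ (fun _ _ => IsKUnit.mul) IsKUnit.one h

theorem one_sub_qPow (f : PowerSeries ℂ) :
    ∃ w : K, 1 - qPow f = PowerSeries.X * w ∧ PowerSeries.constantCoeff w = -f := by
  have h : PowerSeries.X ∣ (1 - qPow f) := by
    rw [PowerSeries.X_dvd_iff]; simp [constantCoeff_qPow]
  obtain ⟨w, hw⟩ := h
  refine ⟨w, hw, ?_⟩
  have := congrArg (PowerSeries.coeff 1) hw
  rw [map_sub, coeff_one_qPow, PowerSeries.coeff_one, ← zero_add 1,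
    PowerSeries.coeff_succ_X_mul] at this
  simpa using this.symm

/-- The coefficient of `h` is `-(m + nβ)`, a unit of `ℂ[[β]]` because its constant term `-m` is
nonzero. For `m = 0` it would only be a multiple of `β`. -/
theorem one_sub_qt_eq {m : ℤ} (hm : m ≠ 0) (n : ℤ) :
    ∃ w : K, IsUnit w ∧ 1 - qt m n = algebraMap K KK PowerSeries.X * algebraMap K KK w := by
  obtain ⟨w, hw, hw0⟩ := one_sub_qPow (m + n * (PowerSeries.X : PowerSeries ℂ))
  refine ⟨w, ?_, ?_⟩
  · rw [PowerSeries.isUnit_iff_constantCoeff, hw0, IsUnit.neg_iff,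
      PowerSeries.isUnit_iff_constantCoeff]
    have : PowerSeries.constantCoeff (m : PowerSeries ℂ) = (m : ℂ) := map_intCast _ _
    simp [this, hm]
  · rw [qt_eq, ← map_mul, ← hw, map_sub, map_one]

theorem isKUnit_div {m m' : ℤ} (hm : m ≠ 0) (hm' : m' ≠ 0) (n n' : ℤ) :
    IsKUnit ((1 - qt m n) / (1 - qt m' n')) := by
  obtain ⟨w, hw, e⟩ := one_sub_qt_eq hm n
  obtain ⟨w', hw', e'⟩ := one_sub_qt_eq hm' n'
  obtain ⟨u, rfl⟩ := hw'
  refine ⟨w * ↑u⁻¹, hw.mul (Units.isUnit _), ?_⟩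
  rw [e, e', map_mul]
  have hX : algebraMap K KK PowerSeries.X ≠ 0 := by
    rw [Ne, map_eq_zero_iff _ (IsFractionRing.injective K KK)]; exact PowerSeries.X_ne_zero
  have hu : algebraMap K KK (↑u⁻¹ : K) * algebraMap K KK (u : K) = 1 := by
    rw [← map_mul]; simp
  have hu0 : algebraMap K KK (u : K) ≠ 0 := right_ne_zero_of_mul_eq_one hu
  rw [mul_div_mul_left _ _ hX, eq_div_iff hu0, mul_assoc, hu, mul_one]

/-- The factor `(1 - q^{-2r} u) (1 - t² u) / ((1 - u) (1 - q^{-2r} t² u))` at `u = q^m t^n`. -/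
def ratioFactor (r m n : ℤ) : KK :=
  ((1 - qt (m - 2 * r) n) * (1 - qt m (n + 2))) / ((1 - qt m n) * (1 - qt (m - 2 * r) (n + 2)))

/-- The exponents of `q` that occur are `m` and `m - 2r`, so all four factors are `h` times a unit,
and the powers of `h` cancel. -/
theorem isKUnit_ratioFactor {r m : ℤ} (hm : m ≠ 0) (hm' : m ≠ 2 * r) (n : ℤ) :
    IsKUnit (ratioFactor r m n) := by
  rw [ratioFactor, mul_comm (1 - qt m n), mul_div_mul_comm]
  exact (isKUnit_div (by omega) (by omega) _ _).mul (isKUnit_div hm hm _ _)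

theorem isKUnit_ne_zero {u : KK} (h : IsKUnit u) : u ≠ 0 := by
  obtain ⟨c, hc, rfl⟩ := h
  exact (hc.map (algebraMap K KK)).ne_zero

/-- The symmetry of the factor under `u ↦ q^{2r} t^{-2} u⁻¹`. -/
theorem ratioFactor_symm (r m n : ℤ) : ratioFactor r (2 * r - m) (-2 - n) = ratioFactor r m n := by
  -- Inverting the arguments permutes the four factors up to monomials, and the monomials cancel in
  -- the quotient.
  have inv (a b : ℤ) : 1 - qt (-a) (-b) = -(qt (-a) (-b)) * (1 - qt a b) := by
    rw [mul_sub, mul_one, neg_mul, ← qt_add]; simp [qt_zero]; ring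
  unfold ratioFactor
  have e1 : 2 * r - m - 2 * r = -m := by ring
  have e2 : -2 - n + 2 = -n := by ring
  have e3 : 2 * r - m = -(m - 2 * r) := by ring
  have e4 : -2 - n = -(n + 2) := by ring
  rw [e1, e2, e3, e4, inv, inv, inv, inv]
  have : qt (-m) (-(n + 2)) * qt (-(m - 2 * r)) (-n) =
      qt (-(m - 2 * r)) (-(n + 2)) * qt (-m) (-n) := by
    rw [← qt_add, ← qt_add]; congr 1; ring
  have h1 := qt_ne_zero (-(m - 2 * r)) (-(n + 2))
  have h2 := qt_ne_zero (-m) (-n)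
  rw [show (-qt (-m) (-(n + 2)) * (1 - qt m (n + 2)) * (-qt (-(m - 2 * r)) (-n) *
      (1 - qt (m - 2 * r) n))) = (qt (-m) (-(n + 2)) * qt (-(m - 2 * r)) (-n)) *
      ((1 - qt (m - 2 * r) n) * (1 - qt m (n + 2))) by ring, this,
    show (-qt (-(m - 2 * r)) (-(n + 2)) * (1 - qt (m - 2 * r) (n + 2)) *
      (-qt (-m) (-n) * (1 - qt m n))) = (qt (-(m - 2 * r)) (-(n + 2)) * qt (-m) (-n)) *
      ((1 - qt m n) * (1 - qt (m - 2 * r) (n + 2))) by ring,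
    mul_div_mul_left _ _ (mul_ne_zero h1 h2)]

end DeformedW

end

/-! ### The root system of type `B_ℓ` and its deformed Cartan matrix. -/

noncomputable section

namespace DeformedW

open Polynomial PowerSeries

/-! ### Lie data -/

theorem incidence_apply (ℓ : ℕ) (j i : Fin ℓ) : incidence ℓ j i =
    if j.val = i.val + 1 then (if j.val + 1 = ℓ then 2 else 1)
    else if i.val = j.val + 1 then 1 else 0 := by
  have := j.2
  have := i.2
  simp only [incidence, cartan, CartanMatrix.B, Matrix.sub_apply, Matrix.transpose_apply,
    Matrix.of_apply, Matrix.ofNat_apply, Fin.ext_iff]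
  split_ifs <;> omega

/-- A column of the incidence matrix is supported on the neighbours of `a` in the Dynkin diagram,
with the entry `2` only towards the short root. `F` is arbitrary so that the lemma applies to
weights as well as to monomials. -/
theorem sum_incidence {A : Type*} [AddCommMonoid A] {ℓ : ℕ} (F : Fin ℓ → ℤ → A)
    (hF : ∀ j, F j 0 = 0) (a : Fin ℓ) :
    ∑ j, F j (incidence ℓ j a) =
      (if h : 1 ≤ a.val then F ⟨a.val - 1, by omega⟩ 1 else 0) +
      (if h : a.val + 1 < ℓ then F ⟨a.val + 1, h⟩ (if a.val + 2 = ℓ then 2 else 1) else 0) := by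
  classical
  have key : ∀ j : Fin ℓ, F j (incidence ℓ j a) =
      (if a.val = j.val + 1 then F j 1 else 0) +
      (if j.val = a.val + 1 then F j (if a.val + 2 = ℓ then 2 else 1) else 0) := by
    intro j
    rw [incidence_apply]
    by_cases h1 : j.val = a.val + 1
    · rw [if_pos h1, if_neg (show ¬ a.val = j.val + 1 by omega), if_pos h1, zero_add]
      congr 1
      split_ifs <;> omega
    · rw [if_neg h1, if_neg h1, add_zero]
      split_ifs <;> simp [hF]
  rw [Finset.sum_congr rfl fun j _ => key j, Finset.sum_add_distrib]
  congr 1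
  · split_ifs with h
    · rw [Finset.sum_eq_single ⟨a.val - 1, by omega⟩]
      · rw [if_pos (by simp; omega)]
      · intro j _ hj
        rw [if_neg]
        intro h'
        exact hj (Fin.ext (by simp; omega))
      · simp
    · exact Finset.sum_eq_zero fun j _ => if_neg (by omega)
  · by_cases h : a.val + 1 < ℓ
    · rw [dif_pos h, Finset.sum_eq_single ⟨a.val + 1, h⟩]
      · rw [if_pos rfl]
      · intro j _ hj
        rw [if_neg]
        intro h'
        exact hj (Fin.ext (by simp; omega))
      · simp
    · rw [dif_neg h]
      exact Finset.sum_eq_zero fun j _ => if_neg (by omega)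

theorem dotProduct_simpleRoot {ℓ : ℕ} (v : Fin ℓ → ℂ) (a : Fin ℓ) :
    v ⬝ᵥ simpleRoot ℓ a = v a - (if h : a.val + 1 < ℓ then v ⟨a.val + 1, h⟩ else 0) := by
  classical
  have key : ∀ k : Fin ℓ, v k * simpleRoot ℓ a k =
      (if k = a then v k else 0) - (if k.val = a.val + 1 then v k else 0) := by
    intro k
    unfold simpleRoot
    by_cases h : k = a
    · subst h; simp
    · simp only [h, if_false]; split_ifs <;> simp
  rw [dotProduct, Finset.sum_congr rfl fun k _ => key k, Finset.sum_sub_distrib]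
  congr 1
  · simp
  · split_ifs with h
    · rw [Finset.sum_eq_single ⟨a.val + 1, h⟩]
      · simp
      · intro k _ hk
        rw [if_neg]
        intro h'
        exact hk (Fin.ext h')
      · simp
    · exact Finset.sum_eq_zero fun j _ => if_neg (by omega)

theorem fundWeight_dot_simpleRoot {ℓ : ℕ} (i a : Fin ℓ) :
    fundWeight ℓ i ⬝ᵥ simpleRoot ℓ a = if i = a then (rr ℓ a : ℂ) / 2 else 0 := by
  have := i.2
  have := a.2
  rw [dotProduct_simpleRoot]
  simp only [fundWeight, rr, Fin.le_def, Fin.ext_iff]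
  split_ifs <;> first | omega | norm_num

theorem simpleRoot_dot_self {ℓ : ℕ} (a : Fin ℓ) :
    simpleRoot ℓ a ⬝ᵥ simpleRoot ℓ a = (rr ℓ a : ℂ) := by
  have := a.2
  rw [dotProduct_simpleRoot]
  simp only [simpleRoot, rr, Fin.ext_iff]
  split_ifs <;> first | omega | norm_num

theorem rr_ne_zero (ℓ : ℕ) (a : Fin ℓ) : rr ℓ a ≠ 0 := by
  unfold rr; split_ifs <;> norm_num

theorem rho_dot_simpleRoot {ℓ : ℕ} (a : Fin ℓ) :
    rho ℓ ⬝ᵥ simpleRoot ℓ a = (rr ℓ a : ℂ) / 2 := by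
  rw [rho, sum_dotProduct]
  simp [fundWeight_dot_simpleRoot]

theorem rhoCheck_dot_simpleRoot {ℓ : ℕ} (a : Fin ℓ) :
    rhoCheck ℓ ⬝ᵥ simpleRoot ℓ a = 1 := by
  rw [rhoCheck, sum_dotProduct]
  simp only [smul_dotProduct, fundWeight_dot_simpleRoot, simpleRoot_dot_self]
  rw [Finset.sum_eq_single a (by intro b _ hb; simp [hb]) (by simp)]
  have : (rr ℓ a : ℂ) ≠ 0 := by exact_mod_cast rr_ne_zero ℓ a
  simp [this]

/-- The coefficients form a column of the Cartan matrix. Through this expansion, a quantity linear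
in the fundamental weights takes on `A_k` the value attached to `α_k`; the constant prefactors and
the heights are computed in this way. -/
theorem simpleRoot_eq {ℓ : ℕ} (a : Fin ℓ) : simpleRoot ℓ a =
    (2 : ℂ) • fundWeight ℓ a - ∑ j, (incidence ℓ j a : ℂ) • fundWeight ℓ j := by
  ext k
  rw [sum_incidence (fun j z => (z : ℂ) • fundWeight ℓ j) (by simp) a]
  have := a.2
  have := k.2
  simp only [Pi.sub_apply, Pi.smul_apply, Pi.add_apply]
  by_cases h1 : 1 ≤ a.val <;> by_cases h2 : a.val + 1 < ℓ <;> by_cases h3 : a.val + 2 = ℓ <;>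
    simp only [h1, h2, h3, dif_pos, dif_neg, if_true, if_false, Pi.smul_apply, not_false_eq_true,
      Pi.zero_apply] <;>
    simp only [fundWeight, simpleRoot, Fin.le_def, Fin.ext_iff] <;>
    split_ifs <;> first | omega | norm_num

/-! ### The deformed Cartan matrix -/

theorem qInt_neg (x : KK) (n : ℤ) : qInt x⁻¹ n = qInt x n := by
  simp only [qInt, inv_inv, inv_zpow, zpow_neg]
  rw [← neg_sub (x ^ n), ← neg_sub x, neg_div_neg_eq (x ^ n - (x ^ n)⁻¹)]

theorem qInt_zero (x : KK) : qInt x 0 = 0 := by simp [qInt]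

theorem q_zpow_eq (n : ℤ) : q ^ n = qt n 0 := by simp [qt]

theorem t_zpow_eq (n : ℤ) : t ^ n = qt 0 n := by simp [qt]

theorem q_zpow_sub_ne_zero {n : ℤ} (hn : n ≠ 0) : q ^ n - (q ^ n)⁻¹ ≠ 0 := by
  rw [q_zpow_eq, ← qt_neg, sub_ne_zero, Ne, qt_inj]
  omega

theorem qInt_one {n : ℤ} (hn : n ≠ 0) : qInt (q ^ n) 1 = 1 := by
  rw [qInt, zpow_one, zpow_neg_one, div_self (q_zpow_sub_ne_zero hn)]

theorem qInt_two {n : ℤ} (hn : n ≠ 0) : qInt (q ^ n) 2 = q ^ n + (q ^ n)⁻¹ := by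
  rw [qInt, div_eq_iff (q_zpow_sub_ne_zero hn)]
  have := zpow_ne_zero n q_ne_zero
  rw [zpow_neg, show (2 : ℤ) = ((2 : ℕ) : ℤ) by rfl, zpow_natCast]
  ring

theorem cartanQT_neg (ℓ : ℕ) (n : ℤ) : cartanQT ℓ (-n) = cartanQT ℓ n := by
  ext i j
  simp only [cartanQT, Matrix.of_apply, zpow_neg, qInt_neg, inv_inv, inv_zpow]
  congr 2
  ring

/-- A matrix over `K` whose image in the fraction field is the deformed Cartan matrix. -/
def cartanK (ℓ : ℕ) (n : ℤ) : Matrix (Fin ℓ) (Fin ℓ) K := Matrix.of fun i j =>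
  (if i = j then qPow ((n * rr ℓ i : ℤ) + (-n : ℤ) * (PowerSeries.X : PowerSeries ℂ)) +
      qPow ((-(n * rr ℓ i) : ℤ) + (n : ℤ) * (PowerSeries.X : PowerSeries ℂ)) else 0)
    - (if incidence ℓ i j = 2 then qPow (n : ℤ) + qPow (-n : ℤ)
        else (incidence ℓ i j : K))

theorem incidence_mem (ℓ : ℕ) (i j : Fin ℓ) :
    incidence ℓ i j = 0 ∨ incidence ℓ i j = 1 ∨ incidence ℓ i j = 2 := by
  rw [incidence_apply]; split_ifs <;> simp

theorem qt_zero_right (n : ℤ) : qt n 0 = algebraMap K KK (qPow n) := by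
  rw [qt_eq]; simp

theorem map_cartanK (ℓ : ℕ) {n : ℤ} (hn : n ≠ 0) :
    (cartanK ℓ n).map (algebraMap K KK) = cartanQT ℓ n := by
  ext i j
  simp only [cartanK, cartanQT, Matrix.map_apply, Matrix.of_apply, map_sub]
  congr 1
  · split_ifs
    · rw [map_add, ← qt_eq, ← qt_eq, q_zpow_eq, t_zpow_eq, qt_zpow, qt_zpow, ← qt_neg, ← qt_add,
        ← qt_add]
      congr 2 <;> ring_nf
    · simp
  · rcases incidence_mem ℓ i j with h | h | h
    · simp [h, qInt_zero]
    · simp [h, qInt_one hn]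
    · rw [h, if_pos rfl, qInt_two hn, map_add, q_zpow_eq, ← qt_neg, qt_zero_right,
        neg_zero, qt_zero_right]

/-- The symmetrised Cartan matrix is the Gram matrix of the simple roots, and these are
unitriangular in the basis `ε_i`. -/
theorem det_cartan_ne_zero (ℓ : ℕ) : ((cartan ℓ).map (Int.castRingHom ℂ)).det ≠ 0 := by
  set R : Matrix (Fin ℓ) (Fin ℓ) ℂ := Matrix.of (simpleRoot ℓ) with hR
  have hdet : R.det = 1 := by
    rw [Matrix.det_of_isUpperTriangular]
    · apply Finset.prod_eq_one
      intro i _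
      simp [hR, simpleRoot]
    · intro i j hij
      have hij : j < i := hij
      rw [hR, Matrix.of_apply, simpleRoot, if_neg hij.ne, if_neg]
      have := Fin.lt_def.1 hij
      omega
  have e : Matrix.diagonal (fun i => (rr ℓ i : ℂ) / 2) * (cartan ℓ).map (Int.castRingHom ℂ) =
      R * R.transpose := by
    ext i j
    rw [Matrix.diagonal_mul, Matrix.mul_apply]
    change _ = simpleRoot ℓ i ⬝ᵥ simpleRoot ℓ j
    rw [dotProduct_simpleRoot]
    have := i.2
    have := j.2
    simp only [cartan, CartanMatrix.B, Matrix.map_apply, Matrix.transpose_apply,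
      Matrix.of_apply, Fin.ext_iff, rr, simpleRoot, Int.coe_castRingHom]
    split_ifs <;> first | omega | norm_num
  have h := congrArg Matrix.det e
  rw [Matrix.det_mul, Matrix.det_mul, Matrix.det_transpose, hdet, mul_one] at h
  exact right_ne_zero_of_mul_eq_one h

/-- At `h = 0` the matrix becomes the ordinary Cartan matrix. The specialisation is applied to the
form `cartanK` over `K`, because `qInt` has a denominator that vanishes at `h = 0`. -/
theorem det_cartanQT_ne_zero (ℓ : ℕ) {n : ℤ} (hn : n ≠ 0) : (cartanQT ℓ n).det ≠ 0 := by
  rw [← map_cartanK ℓ hn]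
  have : ((cartanK ℓ n).map (algebraMap K KK)).det = algebraMap K KK (cartanK ℓ n).det :=
    (RingHom.map_det _ _).symm
  rw [this, Ne, map_eq_zero_iff _ (IsFractionRing.injective K KK)]
  intro h
  set φ : K →+* ℂ := (PowerSeries.constantCoeff (R := ℂ)).comp PowerSeries.constantCoeff
  have h2 := congrArg φ h
  rw [RingHom.map_det, map_zero] at h2
  apply det_cartan_ne_zero ℓ
  convert h2 using 2
  ext i j
  have hq : ∀ f, φ (qPow f) = 1 := by
    intro f
    simp [φ, constantCoeff_qPow]
  simp only [RingHom.mapMatrix_apply, Matrix.map_apply, cartanK, Matrix.of_apply, map_sub,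
    apply_ite φ, map_add, hq, map_zero, map_intCast]
  have : cartan ℓ i j = 2 * (if i = j then 1 else 0) - incidence ℓ i j := by
    simp [incidence, Matrix.sub_apply, Matrix.ofNat_apply]
  rw [this]
  split_ifs with h1 h2 <;> simp_all <;> norm_num

theorem isUnit_det_cartanQT (ℓ : ℕ) {n : ℤ} (hn : n ≠ 0) : IsUnit (cartanQT ℓ n).det :=
  (det_cartanQT_ne_zero ℓ hn).isUnit

/-- The only entries with `r_i ≠ r_j` that do not vanish join the two last nodes; they are `-[2]_q
[1]_q` and `-[1]_q [2]_q`. -/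
theorem symCartanQT_symm (ℓ : ℕ) {n : ℤ} (hn : n ≠ 0) (i j : Fin ℓ) :
    symCartanQT ℓ n i j = symCartanQT ℓ n j i := by
  by_cases hij : i = j
  · rw [hij]
  have := i.2
  have := j.2
  rw [Fin.ext_iff] at hij
  simp only [symCartanQT, cartanQT, Matrix.of_apply, Fin.ext_iff, hij, Ne.symm hij, if_false,
    zero_sub, incidence_apply, rr]
  split_ifs <;> first | omega | simp [qInt_one hn, qInt_two hn, qInt_zero]

end DeformedW

end

/-! ### Vertex operators of a Heisenberg algebra over a field of characteristic zero. -/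

noncomputable section

namespace DeformedW

open Polynomial PowerSeries

/-! ### Exponentials of power series over noncommutative rings -/

section PExp

variable {𝕜 : Type*} [Field 𝕜] {R : Type*} [Semiring R] [Algebra 𝕜 R]

theorem coeff_pow_mul_pow_eq_zero {f g : PowerSeries R} (hf : PowerSeries.coeff 0 f = 0)
    (hg : PowerSeries.coeff 0 g = 0) {i j n : ℕ} (h : n < i + j) :
    PowerSeries.coeff n (f ^ i * g ^ j) = 0 := by
  induction i generalizing n with
  | zero =>
    rw [pow_zero, one_mul]
    rw [zero_add] at h
    induction j generalizing n with
    | zero => omega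
    | succ j ih =>
      rw [pow_succ', PowerSeries.coeff_mul]
      refine Finset.sum_eq_zero fun p hp => ?_
      rw [Finset.HasAntidiagonal.mem_antidiagonal] at hp
      rcases Nat.eq_zero_or_pos p.1 with h0 | h0
      · rw [h0, hg, zero_mul]
      · rw [ih (by omega), mul_zero]
  | succ i ih =>
    rw [pow_succ', mul_assoc, PowerSeries.coeff_mul]
    refine Finset.sum_eq_zero fun p hp => ?_
    rw [Finset.HasAntidiagonal.mem_antidiagonal] at hp
    rcases Nat.eq_zero_or_pos p.1 with h0 | h0
    · rw [h0, hf, zero_mul]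
    · rw [ih (by omega), mul_zero]

theorem coeff_pow_eq_zero {f : PowerSeries R} (hf : PowerSeries.coeff 0 f = 0) {k n : ℕ}
    (h : n < k) : PowerSeries.coeff n (f ^ k) = 0 := by
  have := coeff_pow_mul_pow_eq_zero hf hf (i := k) (j := 0) (n := n) (by omega)
  rwa [pow_zero, mul_one] at this

variable (𝕜) in
/-- The exponential `∑ f^k / k!` of a power series without constant term. -/
def pexp (f : PowerSeries R) : PowerSeries R :=
  PowerSeries.mk fun n => ∑ k ∈ Finset.range (n + 1), ((k.factorial : 𝕜)⁻¹) •
    PowerSeries.coeff n (f ^ k)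

/-- The truncation may be any `N ≥ n`, so that sums belonging to different coefficients can be taken
over a common range. -/
theorem coeff_pexp {f : PowerSeries R} (hf : PowerSeries.coeff 0 f = 0) {n N : ℕ} (h : n ≤ N) :
    PowerSeries.coeff n (pexp 𝕜 f) = ∑ k ∈ Finset.range (N + 1), ((k.factorial : 𝕜)⁻¹) •
      PowerSeries.coeff n (f ^ k) := by
  rw [pexp, PowerSeries.coeff_mk]
  apply Finset.sum_subset
  · exact Finset.range_mono (by omega)
  · intro k _ hk
    rw [Finset.mem_range] at hk
    rw [coeff_pow_eq_zero hf (by omega), smul_zero]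

theorem coeff_zero_pexp {f : PowerSeries R} : PowerSeries.coeff 0 (pexp 𝕜 f) = 1 := by
  simp [pexp]

theorem pexp_add [CharZero 𝕜] {f g : PowerSeries R} (hf : PowerSeries.coeff 0 f = 0)
    (hg : PowerSeries.coeff 0 g = 0) (hc : Commute f g) :
    pexp 𝕜 (f + g) = pexp 𝕜 f * pexp 𝕜 g := by
  ext n
  have hL : PowerSeries.coeff n (pexp 𝕜 (f + g)) =
      ∑ k ∈ Finset.range (n + 1), ∑ p ∈ Finset.HasAntidiagonal.antidiagonal k,
        ((p.1.factorial : 𝕜)⁻¹ * (p.2.factorial : 𝕜)⁻¹) •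
          PowerSeries.coeff n (f ^ p.1 * g ^ p.2) := by
    rw [coeff_pexp (by rw [map_add, hf, hg, add_zero]) le_rfl]
    refine Finset.sum_congr rfl fun k _ => ?_
    rw [hc.add_pow', map_sum, Finset.smul_sum]
    refine Finset.sum_congr rfl fun p hp => ?_
    rw [Finset.HasAntidiagonal.mem_antidiagonal] at hp
    subst hp
    rw [map_nsmul, ← Nat.cast_smul_eq_nsmul 𝕜, smul_smul, Nat.choose_symm_add, Nat.add_choose,
      Nat.cast_div (Nat.factorial_mul_factorial_dvd_factorial_add _ _)
        (by exact_mod_cast (Nat.mul_pos (Nat.factorial_pos _) (Nat.factorial_pos _)).ne')]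
    congr 1
    have h1 : ((p.1 + p.2).factorial : 𝕜) ≠ 0 := by exact_mod_cast Nat.factorial_ne_zero _
    have h2 : (p.1.factorial : 𝕜) ≠ 0 := by exact_mod_cast Nat.factorial_ne_zero _
    have h3 : (p.2.factorial : 𝕜) ≠ 0 := by exact_mod_cast Nat.factorial_ne_zero _
    push_cast
    field_simp
  have hR : PowerSeries.coeff n (pexp 𝕜 f * pexp 𝕜 g) =
      ∑ p ∈ Finset.range (n + 1) ×ˢ Finset.range (n + 1),
        ((p.1.factorial : 𝕜)⁻¹ * (p.2.factorial : 𝕜)⁻¹) •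
          PowerSeries.coeff n (f ^ p.1 * g ^ p.2) := by
    rw [PowerSeries.coeff_mul]
    simp_rw [PowerSeries.coeff_mul, Finset.smul_sum]
    rw [Finset.sum_comm]
    refine Finset.sum_congr rfl fun ab hab => ?_
    rw [Finset.HasAntidiagonal.mem_antidiagonal] at hab
    rw [coeff_pexp hf (show ab.1 ≤ n by omega), coeff_pexp hg (show ab.2 ≤ n by omega),
      Finset.sum_mul_sum, Finset.sum_product]
    refine Finset.sum_congr rfl fun i _ => Finset.sum_congr rfl fun j _ => ?_
    rw [smul_mul_smul_comm]
  rw [hL, hR, Finset.sum_sigma']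
  -- The left side runs over the triangle `i + j ≤ n`, the right side over the square `i, j ≤ n`.
  -- Outside the triangle `f^i g^j` has order greater than `n`.
  refine Finset.sum_of_injOn (fun x => x.2) ?_ ?_ ?_ ?_
  · rintro ⟨k, p⟩ hx ⟨k', p'⟩ hx' h
    simp only [Finset.coe_sigma, Set.mem_sigma_iff, Finset.mem_coe,
      Finset.HasAntidiagonal.mem_antidiagonal] at hx hx' h
    obtain rfl : p = p' := h
    obtain ⟨-, rfl⟩ := hx
    obtain ⟨-, rfl⟩ := hx'
    rfl
  · rintro ⟨k, p⟩ hx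
    simp only [Finset.coe_sigma, Set.mem_sigma_iff, Finset.mem_coe, Finset.HasAntidiagonal.mem_antidiagonal,
      Finset.mem_range] at hx
    simp only [Finset.coe_product, Set.mem_prod, Finset.mem_coe, Finset.mem_range]
    omega
  · rintro p _ hp'
    rw [coeff_pow_mul_pow_eq_zero hf hg, smul_zero]
    by_contra hlt
    apply hp'
    exact ⟨⟨p.1 + p.2, p⟩, Finset.mem_coe.2 (Finset.mem_sigma.2 ⟨Finset.mem_range.2
      (show p.1 + p.2 < n + 1 by omega), Finset.HasAntidiagonal.mem_antidiagonal.2 rfl⟩), rfl⟩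
  · intros; rfl

theorem map_pexp {S : Type*} [Semiring S] [Algebra 𝕜 S] (φ : R →ₐ[𝕜] S) (f : PowerSeries R) :
    PowerSeries.map (φ : R →+* S) (pexp 𝕜 f) = pexp 𝕜 (PowerSeries.map (φ : R →+* S) f) := by
  ext n
  simp only [pexp, PowerSeries.coeff_map, PowerSeries.coeff_mk, map_sum, ← map_pow]
  refine Finset.sum_congr rfl fun k _ => ?_
  exact map_smul φ _ _

theorem rescale_pexp {R : Type*} [CommSemiring R] [Algebra 𝕜 R] (a : R) (f : PowerSeries R) :
    rescale a (pexp 𝕜 f) = pexp 𝕜 (rescale a f) := by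
  ext n
  simp only [pexp, PowerSeries.coeff_rescale, PowerSeries.coeff_mk, ← map_pow, Finset.mul_sum,
    mul_smul_comm]

theorem commute_coeff_pow {r : R} {f : PowerSeries R} (h : ∀ n, Commute r (PowerSeries.coeff n f))
    (k n : ℕ) : Commute r (PowerSeries.coeff n (f ^ k)) := by
  induction k generalizing n with
  | zero =>
    rw [pow_zero, PowerSeries.coeff_one]
    split_ifs
    · exact Commute.one_right r
    · exact Commute.zero_right r
  | succ k ih =>
    rw [pow_succ, PowerSeries.coeff_mul]
    exact Commute.sum_right _ _ _ fun p _ => (ih _).mul_right (h _)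

theorem commute_coeff_pexp {r : R} {f : PowerSeries R}
    (h : ∀ n, Commute r (PowerSeries.coeff n f)) (n : ℕ) :
    Commute r (PowerSeries.coeff n (pexp 𝕜 f)) := by
  rw [pexp, PowerSeries.coeff_mk]
  exact Commute.sum_right _ _ _ fun k _ => (commute_coeff_pow h k n).smul_right _

theorem commute_of_coeff {f g : PowerSeries R}
    (h : ∀ m n, Commute (PowerSeries.coeff m f) (PowerSeries.coeff n g)) : Commute f g := by
  ext n
  rw [PowerSeries.coeff_mul, PowerSeries.coeff_mul, ← Finset.Nat.sum_antidiagonal_swap]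
  exact Finset.sum_congr rfl fun p _ => h _ _

/-- If `[f, x] = c` is central, then `[exp f, x] = c exp f`. -/
theorem pexp_mul_of_commutator [CharZero 𝕜] {f x c : PowerSeries R}
    (hf : PowerSeries.coeff 0 f = 0) (hx : f * x = x * f + c) (hc : Commute f c) :
    pexp 𝕜 f * x = x * pexp 𝕜 f + c * pexp 𝕜 f := by
  have hpow : ∀ k : ℕ, f ^ (k + 1) * x = x * f ^ (k + 1) + (k + 1) • (c * f ^ k) := by
    intro k
    induction k with
    | zero => simp [hx]
    | succ k ih =>
      rw [pow_succ', mul_assoc, ih, mul_add, ← mul_assoc, hx, mul_smul_comm, ← mul_assoc, hc.eq,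
        mul_assoc c f, ← pow_succ', add_mul, mul_assoc, ← pow_succ', succ_nsmul _ (k + 1)]
      abel
  ext n
  -- One vanishing power is kept, so that after splitting off `k = 0` the remaining `n + 1` terms
  -- match those of `c * pexp 𝕜 f` with index `k - 1`.
  have e1 : ∀ y : PowerSeries R, PowerSeries.coeff n (pexp 𝕜 f * y) =
      ∑ k ∈ Finset.range (n + 2), ((k.factorial : 𝕜)⁻¹) • PowerSeries.coeff n (f ^ k * y) := by
    intro y
    simp_rw [PowerSeries.coeff_mul, Finset.smul_sum]
    rw [Finset.sum_comm]
    refine Finset.sum_congr rfl fun p hp => ?_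
    rw [Finset.HasAntidiagonal.mem_antidiagonal] at hp
    rw [coeff_pexp hf (show p.1 ≤ n + 1 by omega), Finset.sum_mul]
    simp_rw [smul_mul_assoc]
  have e2 : ∀ (y : PowerSeries R) (N : ℕ), n ≤ N → PowerSeries.coeff n (y * pexp 𝕜 f) =
      ∑ k ∈ Finset.range (N + 1), ((k.factorial : 𝕜)⁻¹) • PowerSeries.coeff n (y * f ^ k) := by
    intro y N hN
    simp_rw [PowerSeries.coeff_mul, Finset.smul_sum]
    rw [Finset.sum_comm]
    refine Finset.sum_congr rfl fun p hp => ?_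
    rw [Finset.HasAntidiagonal.mem_antidiagonal] at hp
    rw [coeff_pexp hf (show p.2 ≤ N by omega), Finset.mul_sum]
    simp_rw [mul_smul_comm]
  rw [map_add, e1, e2 x (n + 1) (by omega), e2 c n le_rfl, Finset.sum_range_succ',
    Finset.sum_range_succ' _ (n + 1)]
  simp only [hpow, map_add, smul_add, Finset.sum_add_distrib, pow_zero, one_mul, mul_one]
  rw [add_right_comm]
  congr 1
  refine Finset.sum_congr rfl fun k _ => ?_
  rw [map_nsmul, ← Nat.cast_smul_eq_nsmul 𝕜, smul_smul, Nat.factorial_succ]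
  congr 1
  have h2 : (k.factorial : 𝕜) ≠ 0 := by exact_mod_cast Nat.factorial_ne_zero _
  have h3 : ((k + 1 : ℕ) : 𝕜) ≠ 0 := by exact_mod_cast Nat.succ_ne_zero k
  push_cast at h3 ⊢
  field_simp

end PExp

/-! ### Scalar exponentials -/

section Scalar

variable {𝕜 : Type*} [Field 𝕜] [CharZero 𝕜]

theorem derivative_pexp {f : PowerSeries 𝕜} (hf : PowerSeries.coeff 0 f = 0) :
    d⁄dX 𝕜 (pexp 𝕜 f) = pexp 𝕜 f * d⁄dX 𝕜 f := by
  ext n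
  have e1 : PowerSeries.coeff n (pexp 𝕜 f * d⁄dX 𝕜 f) =
      ∑ k ∈ Finset.range (n + 1), ((k.factorial : 𝕜)⁻¹) •
        PowerSeries.coeff n (f ^ k * d⁄dX 𝕜 f) := by
    simp_rw [PowerSeries.coeff_mul, Finset.smul_sum]
    rw [Finset.sum_comm]
    refine Finset.sum_congr rfl fun p hp => ?_
    rw [Finset.HasAntidiagonal.mem_antidiagonal] at hp
    rw [coeff_pexp hf (show p.1 ≤ n by omega), Finset.sum_mul]
    simp_rw [smul_mul_assoc]
  rw [e1, PowerSeries.coeff_derivative, coeff_pexp hf le_rfl, Finset.sum_mul,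
    Finset.sum_range_succ']
  have h0 : ((Nat.factorial 0 : 𝕜)⁻¹ • PowerSeries.coeff (n + 1) (f ^ 0)) * ((n : 𝕜) + 1) = 0 := by
    simp [PowerSeries.coeff_one]
  rw [h0, add_zero]
  refine Finset.sum_congr rfl fun k _ => ?_
  rw [smul_mul_assoc, ← PowerSeries.coeff_derivative, Derivation.leibniz_pow, add_tsub_cancel_right,
    map_nsmul, ← Nat.cast_smul_eq_nsmul 𝕜, smul_smul, Nat.factorial_succ, smul_eq_mul (f ^ k)]
  congr 1
  have h2 : (k.factorial : 𝕜) ≠ 0 := by exact_mod_cast Nat.factorial_ne_zero _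
  have h3 : ((k + 1 : ℕ) : 𝕜) ≠ 0 := by exact_mod_cast Nat.succ_ne_zero k
  push_cast at h3 ⊢
  field_simp

/-- The power series `-log (1 - a u)`. -/
def nlog (a : 𝕜) : PowerSeries 𝕜 := PowerSeries.mk fun n => a ^ n / n

/-- The coefficient at `n = 0` is `1 / 0`, which is `0` by convention, as it should be for a
logarithm. -/
theorem coeff_zero_nlog (a : 𝕜) : PowerSeries.coeff 0 (nlog a) = 0 := by simp [nlog]

omit [CharZero 𝕜] in
theorem mk_pow_mul (a : 𝕜) :
    PowerSeries.mk (fun n => a ^ n) * (1 - PowerSeries.C a * PowerSeries.X) = 1 := by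
  ext n
  cases n with
  | zero => simp
  | succ n =>
    rw [mul_sub, mul_one, map_sub, ← mul_assoc, PowerSeries.coeff_succ_mul_X,
      PowerSeries.coeff_mul_C, PowerSeries.coeff_mk, PowerSeries.coeff_mk, PowerSeries.coeff_one]
    simp; ring

/-- The derivative of the left side vanishes, because `nlog a` has derivative `a / (1 - a u)`, and
the constant term is `1`. -/
theorem pexp_nlog (a : 𝕜) : pexp 𝕜 (nlog a) * (1 - PowerSeries.C a * PowerSeries.X) = 1 := by
  apply PowerSeries.derivative.ext
  · have h : d⁄dX 𝕜 (nlog a) = PowerSeries.C a * PowerSeries.mk (fun n => a ^ n) := by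
      ext n
      rw [PowerSeries.coeff_derivative, nlog, PowerSeries.coeff_mk, PowerSeries.coeff_C_mul,
        PowerSeries.coeff_mk]
      have : (n + 1 : 𝕜) ≠ 0 := by exact_mod_cast Nat.succ_ne_zero n
      push_cast
      field_simp
      ring
    have hd : d⁄dX 𝕜 (1 - PowerSeries.C a * PowerSeries.X) = - PowerSeries.C a := by
      rw [map_sub, Derivation.leibniz, PowerSeries.derivative_C, PowerSeries.derivative_X]
      simp
    rw [Derivation.leibniz, derivative_pexp (coeff_zero_nlog a), h, hd]
    have := mk_pow_mul a
    rw [Derivation.map_one_eq_zero]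
    simp only [smul_eq_mul]
    linear_combination (pexp 𝕜 (nlog a)) * (PowerSeries.C a) * this
  · have := coeff_zero_pexp (𝕜 := 𝕜) (f := nlog a)
    rw [PowerSeries.coeff_zero_eq_constantCoeff_apply] at this
    simp [this]

end Scalar

end DeformedW

end

noncomputable section

namespace DeformedW

open Polynomial PowerSeries

set_option linter.unusedSectionVars false

/-! ### Creation and annihilation exponentials on a polynomial Fock space -/

namespace Heis

variable {𝕜 : Type*} [Field 𝕜] [CharZero 𝕜] {I : Type*} [Fintype I]

/-- Polynomials in the creation modes `x_j[-(n+1)]`. -/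
abbrev Poly (𝕜 : Type*) [Field 𝕜] (I : Type*) : Type _ := MvPolynomial (I × ℕ) 𝕜

/-- The Heisenberg modes `x_i[m]` with structure constants `H`. -/
def mode (H : ℕ → I → I → 𝕜) (i : I) : ℤ → Module.End 𝕜 (Poly 𝕜 I)
  | Int.negSucc n => LinearMap.mulLeft 𝕜 (MvPolynomial.X (i, n))
  | Int.ofNat 0 => 0
  | Int.ofNat (n + 1) => ∑ j : I, H (n + 1) i j •
        (MvPolynomial.pderiv (R := 𝕜) (j, n)).toLinearMap

variable (H : ℕ → I → I → 𝕜)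

/-- The operator `∑_j ψ_j(m) x_j[m]`. -/
def modeOp (ψ : ℤ → I → 𝕜) (m : ℤ) : Module.End 𝕜 (Poly 𝕜 I) := ∑ j, ψ m j • mode H j m

/-- The creation part of a mode family, as a series of polynomials. -/
def crea (ψ : ℤ → I → 𝕜) : PowerSeries (Poly 𝕜 I) := PowerSeries.mk fun m =>
  if m = 0 then 0 else ∑ j, ψ (-(m : ℤ)) j • MvPolynomial.X (j, m - 1)

/-- The annihilation part of a mode family. -/
def anni (ψ : ℤ → I → 𝕜) : PowerSeries (Module.End 𝕜 (Poly 𝕜 I)) := PowerSeries.mk fun m =>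
  if m = 0 then 0 else modeOp H ψ m

/-- The coefficients of the exponential of the creation part. -/
def creaExp (ψ : ℤ → I → 𝕜) (b : ℕ) : Poly 𝕜 I := PowerSeries.coeff b (pexp 𝕜 (crea ψ))

/-- The coefficients of the exponential of the creation part, extended by zero. -/
def creaExpZ (ψ : ℤ → I → 𝕜) (b : ℤ) : Poly 𝕜 I := if 0 ≤ b then creaExp ψ b.toNat else 0

/-- The coefficients of the exponential of the annihilation part. -/
def anniExp (ψ : ℤ → I → 𝕜) (c : ℕ) : Module.End 𝕜 (Poly 𝕜 I) :=
  PowerSeries.coeff c (pexp 𝕜 (anni H ψ))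

theorem coeff_zero_crea (ψ : ℤ → I → 𝕜) : PowerSeries.coeff 0 (crea ψ) = 0 := by simp [crea]

theorem coeff_zero_anni (ψ : ℤ → I → 𝕜) : PowerSeries.coeff 0 (anni H ψ) = 0 := by simp [anni]

theorem mode_succ (i : I) (n : ℕ) : mode H i ((n + 1 : ℕ) : ℤ) =
    ∑ j : I, H (n + 1) i j • (MvPolynomial.pderiv (R := 𝕜) (j, n)).toLinearMap := by
  rfl

theorem mode_neg_succ (i : I) (n : ℕ) : mode H i (-((n + 1 : ℕ) : ℤ)) =
    LinearMap.mulLeft 𝕜 (MvPolynomial.X (i, n)) := rfl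

/-- The commutator of the annihilation mode of degree `m` with `x_j[-m]`. -/
def contraction (ψ : ℤ → I → 𝕜) (j : I) (m : ℕ) : 𝕜 := ∑ i, ψ m i * H m i j

theorem modeOp_succ_apply_X_mul (ψ : ℤ → I → 𝕜) (n : ℕ) (j : I) (k : ℕ) (v : Poly 𝕜 I) :
    modeOp H ψ ((n + 1 : ℕ) : ℤ) (MvPolynomial.X (j, k) * v) =
      MvPolynomial.X (j, k) * modeOp H ψ ((n + 1 : ℕ) : ℤ) v +
        (if n = k then contraction H ψ j (n + 1) else 0) • v := by
  classical
  simp only [modeOp, mode_succ, LinearMap.sum_apply, LinearMap.smul_apply, Derivation.coeFn_coe,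
    Derivation.leibniz, MvPolynomial.pderiv_X, smul_eq_mul, smul_add, Finset.sum_add_distrib,
    Finset.mul_sum, mul_smul_comm]
  congr 1
  have : ∀ i i' : I, H (n + 1) i i' • (v * (Pi.single (i', n) 1 : I × ℕ → Poly 𝕜 I) (j, k)) =
      if i' = j then (if n = k then H (n + 1) i j • v else 0) else 0 := by
    intro i i'
    rw [Pi.single_apply]
    simp only [Prod.mk.injEq]
    by_cases h1 : i' = j
    · subst h1
      by_cases h2 : n = k
      · simp [h2]
      · simp [h2, Ne.symm h2]
    · simp [h1, Ne.symm h1]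
  simp only [this, Finset.sum_ite_eq', Finset.mem_univ, if_true]
  split_ifs with h
  · rw [contraction, Finset.sum_smul]
    exact Finset.sum_congr rfl fun i _ => by rw [smul_smul]
  · simp

theorem modeOp_succ_one (ψ : ℤ → I → 𝕜) (n : ℕ) : modeOp H ψ ((n + 1 : ℕ) : ℤ) (1 : Poly 𝕜 I) = 0 := by
  simp only [modeOp, mode_succ, LinearMap.sum_apply, LinearMap.smul_apply, Derivation.coeFn_coe,
    Derivation.map_one_eq_zero, smul_zero, Finset.sum_const_zero]

theorem anni_mul_X (ψ : ℤ → I → 𝕜) (j : I) (k : ℕ) :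
    anni H ψ * PowerSeries.C (LinearMap.mulLeft 𝕜 (MvPolynomial.X (j, k) : Poly 𝕜 I)) =
      PowerSeries.C (LinearMap.mulLeft 𝕜 (MvPolynomial.X (j, k) : Poly 𝕜 I)) * anni H ψ +
        PowerSeries.monomial (k + 1) (contraction H ψ j (k + 1) • 1) := by
  ext n : 1
  rw [map_add, PowerSeries.coeff_mul_C, PowerSeries.coeff_C_mul, PowerSeries.coeff_monomial, anni,
    PowerSeries.coeff_mk]
  cases n with
  | zero => simp
  | succ n =>
    rw [if_neg (Nat.succ_ne_zero n)]
    refine LinearMap.ext fun v => ?_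
    change modeOp H ψ _ (MvPolynomial.X (j, k) * v) = MvPolynomial.X (j, k) * modeOp H ψ _ v + _
    rw [modeOp_succ_apply_X_mul]
    congr 1
    by_cases h : n = k
    · subst h; simp
    · simp [h]

/-- The commutator of the annihilation part with a creation mode is scalar, so its exponential
translates that mode by a multiple of `u^{k+1}`, where `u` is the formal variable. -/
theorem anniExp_X_mul (ψ : ℤ → I → 𝕜) (c : ℕ) (j : I) (k : ℕ) (v : Poly 𝕜 I) :
    anniExp H ψ c (MvPolynomial.X (j, k) * v) = MvPolynomial.X (j, k) * anniExp H ψ c v +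
      (if k + 1 ≤ c then contraction H ψ j (k + 1) • anniExp H ψ (c - (k + 1)) v else 0) := by
  have hmon : PowerSeries.monomial (k + 1) (contraction H ψ j (k + 1) •
      (1 : Module.End 𝕜 (Poly 𝕜 I))) = PowerSeries.C (contraction H ψ j (k + 1) •
      (1 : Module.End 𝕜 (Poly 𝕜 I))) * PowerSeries.X ^ (k + 1) := by
    rw [PowerSeries.monomial_eq_mk, PowerSeries.X_pow_eq]
    ext n : 1
    rw [PowerSeries.coeff_C_mul, PowerSeries.coeff_mk, PowerSeries.coeff_monomial]
    split_ifs <;> simp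
  have hcomm : Commute (anni H ψ) (PowerSeries.monomial (k + 1) (contraction H ψ j (k + 1) •
      (1 : Module.End 𝕜 (Poly 𝕜 I)))) := by
    apply commute_of_coeff
    intro m n
    rw [PowerSeries.coeff_monomial]
    split_ifs
    · exact (Commute.one_right _).smul_right _
    · exact Commute.zero_right _
  have h := pexp_mul_of_commutator (𝕜 := 𝕜) (coeff_zero_anni H ψ) (anni_mul_X H ψ j k) hcomm
  have h2 := congrArg (PowerSeries.coeff c) h
  rw [map_add, PowerSeries.coeff_mul_C, PowerSeries.coeff_C_mul, hmon, mul_assoc,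
    PowerSeries.coeff_C_mul, PowerSeries.coeff_X_pow_mul'] at h2
  have h3 := LinearMap.congr_fun h2 v
  change anniExp H ψ c (MvPolynomial.X (j, k) * v) = MvPolynomial.X (j, k) * anniExp H ψ c v + _ at h3
  rw [h3]
  congr 1
  split_ifs
  · simp [anniExp]
  · simp

theorem anniExp_one (ψ : ℤ → I → 𝕜) (c : ℕ) :
    anniExp H ψ c (1 : Poly 𝕜 I) = if c = 0 then 1 else 0 := by
  have hpow : ∀ k n : ℕ, PowerSeries.coeff n (anni H ψ ^ (k + 1)) (1 : Poly 𝕜 I) = 0 := by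
    intro k n
    rw [pow_succ, PowerSeries.coeff_mul, LinearMap.sum_apply]
    refine Finset.sum_eq_zero fun p _ => ?_
    rw [Module.End.mul_apply, anni, PowerSeries.coeff_mk (n := p.2)]
    obtain h | ⟨m, hm⟩ : p.2 = 0 ∨ ∃ m, p.2 = m + 1 := by
      cases p.2 <;> simp
    · simp [h]
    · rw [hm, if_neg (Nat.succ_ne_zero m), modeOp_succ_one, map_zero]
  rw [anniExp, coeff_pexp (coeff_zero_anni H ψ) le_rfl, LinearMap.sum_apply, Finset.sum_range_succ',
    Finset.sum_eq_zero, zero_add]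
  · simp only [Nat.factorial_zero, pow_zero, PowerSeries.coeff_one]
    split_ifs <;> simp
  · intro k _
    rw [LinearMap.smul_apply, hpow, smul_zero]

theorem anniExp_C (ψ : ℤ → I → 𝕜) (c : ℕ) (a : 𝕜) :
    anniExp H ψ c (MvPolynomial.C a : Poly 𝕜 I) = if c = 0 then MvPolynomial.C a else 0 := by
  rw [← mul_one (MvPolynomial.C a), ← MvPolynomial.smul_eq_C_mul, map_smul, anniExp_one]
  split_ifs <;> simp

/-- Annihilation lowers the degree. The bound does not depend on `ψ`, so one bound controls both
exponentials in a product. -/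
theorem exists_anniExp_bound (v : Poly 𝕜 I) :
    ∃ B : ℕ, ∀ (ψ : ℤ → I → 𝕜) (c : ℕ), B ≤ c → anniExp H ψ c v = 0 := by
  induction v using MvPolynomial.induction_on with
  | C a => exact ⟨1, fun ψ c hc => by rw [anniExp_C, if_neg (by omega)]⟩
  | add p r hp hr =>
    obtain ⟨B, hB⟩ := hp
    obtain ⟨B', hB'⟩ := hr
    exact ⟨max B B', fun ψ c hc => by
      rw [map_add, hB ψ c (le_trans (le_max_left _ _) hc),
        hB' ψ c (le_trans (le_max_right _ _) hc), add_zero]⟩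
  | mul_X p jk hp =>
    obtain ⟨j, k⟩ := jk
    obtain ⟨B, hB⟩ := hp
    refine ⟨B + (k + 1), fun ψ c hc => ?_⟩
    rw [mul_comm, anniExp_X_mul, hB ψ c (by omega), if_pos (by omega), hB ψ _ (by omega)]
    simp

/-- The exponential of the annihilation part as an algebra homomorphism. -/
def anniHom (ψ : ℤ → I → 𝕜) : Poly 𝕜 I →ₐ[𝕜] Polynomial (Poly 𝕜 I) :=
  MvPolynomial.aeval fun jk : I × ℕ => Polynomial.C (MvPolynomial.X jk : Poly 𝕜 I) +
    Polynomial.C (MvPolynomial.C (contraction H ψ jk.1 (jk.2 + 1)) : Poly 𝕜 I) *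
      Polynomial.X ^ (jk.2 + 1)

/-- The annihilation part consists of commuting derivations, and the exponential of such a sum is an
algebra homomorphism, determined by its values on the generators. Being multiplicative, it can be
moved past a creation exponential. -/
theorem coeff_anniHom (ψ : ℤ → I → 𝕜) (c : ℕ) (v : Poly 𝕜 I) :
    (anniHom H ψ v).coeff c = anniExp H ψ c v := by
  induction v using MvPolynomial.induction_on generalizing c with
  | C a =>
    rw [anniExp_C, anniHom, MvPolynomial.aeval_C]
    change (Polynomial.C (MvPolynomial.C a)).coeff c = _
    rw [Polynomial.coeff_C]
  | add p r hp hr => rw [map_add, Polynomial.coeff_add, hp, hr, map_add]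
  | mul_X p jk hp =>
    obtain ⟨j, k⟩ := jk
    rw [mul_comm, map_mul, anniExp_X_mul]
    have : anniHom H ψ (MvPolynomial.X (j, k)) = Polynomial.C (MvPolynomial.X (j, k) : Poly 𝕜 I) +
        Polynomial.C (MvPolynomial.C (contraction H ψ j (k + 1)) : Poly 𝕜 I) *
          Polynomial.X ^ (k + 1) := by
      rw [anniHom, MvPolynomial.aeval_X]
    rw [this, add_mul, Polynomial.coeff_add, Polynomial.coeff_C_mul, hp, mul_assoc,
      Polynomial.coeff_C_mul, Polynomial.coeff_X_pow_mul']
    congr 1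
    split_ifs
    · rw [hp, MvPolynomial.smul_eq_C_mul]
    · simp

/-- The pairing `[ψ[n], χ[-n]]`. -/
def pairing (ψ χ : ℤ → I → 𝕜) (n : ℕ) : 𝕜 := ∑ j, χ (-(n : ℤ)) j * contraction H ψ j n

/-- The contraction series `exp (∑_{n > 0} [ψ[n], χ[-n]] u^n)`. -/
def contr (ψ χ : ℤ → I → 𝕜) : PowerSeries 𝕜 :=
  pexp 𝕜 (PowerSeries.mk fun n => if n = 0 then 0 else pairing H ψ χ n)

theorem map_anniHom_crea (ψ χ : ℤ → I → 𝕜) :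
    PowerSeries.map (anniHom H ψ : Poly 𝕜 I →+* Polynomial (Poly 𝕜 I)) (crea χ) =
      PowerSeries.map (Polynomial.CAlgHom (R := 𝕜) (A := Poly 𝕜 I) :
        Poly 𝕜 I →+* Polynomial (Poly 𝕜 I)) (crea χ) +
      rescale (Polynomial.X : Polynomial (Poly 𝕜 I))
        (PowerSeries.map (Algebra.ofId 𝕜 (Polynomial (Poly 𝕜 I)) : 𝕜 →+* Polynomial (Poly 𝕜 I))
          (PowerSeries.mk fun n => if n = 0 then 0 else pairing H ψ χ n)) := by
  ext n : 1
  rw [map_add, PowerSeries.coeff_map, PowerSeries.coeff_map, PowerSeries.coeff_rescale,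
    PowerSeries.coeff_map, PowerSeries.coeff_mk, crea, PowerSeries.coeff_mk]
  obtain h | ⟨m, rfl⟩ : n = 0 ∨ ∃ m, n = m + 1 := by cases n <;> simp
  · simp [h]
  · rw [if_neg (Nat.succ_ne_zero m), if_neg (Nat.succ_ne_zero m)]
    simp only [AlgHom.coe_toRingHom, map_sum, map_smul, pairing, Finset.mul_sum,
      ← Finset.sum_add_distrib, add_tsub_cancel_right]
    refine Finset.sum_congr rfl fun j _ => ?_
    rw [anniHom, MvPolynomial.aeval_X, smul_add]
    congr 1
    change _ = Polynomial.X ^ (m + 1) * Polynomial.C (MvPolynomial.C _)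
    rw [map_mul, map_mul, ← mul_assoc, mul_comm (Polynomial.X ^ (m + 1)), mul_assoc,
      mul_comm (Polynomial.X ^ (m + 1)), Algebra.smul_def]
    rfl

theorem anniHom_creaExp (ψ χ : ℤ → I → 𝕜) (b : ℕ) : anniHom H ψ (creaExp χ b) =
    ∑ p ∈ Finset.HasAntidiagonal.antidiagonal b, Polynomial.C (creaExp χ p.1) *
      (Polynomial.X ^ p.2 * Polynomial.C (MvPolynomial.C (PowerSeries.coeff p.2 (contr H ψ χ)))) := by
  have h := map_pexp (𝕜 := 𝕜) (anniHom H ψ) (crea χ)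
  rw [map_anniHom_crea, pexp_add (by simp [coeff_zero_crea]) (by simp) (Commute.all _ _),
    ← map_pexp, ← rescale_pexp, ← map_pexp] at h
  have h2 := congrArg (PowerSeries.coeff b) h
  rw [PowerSeries.coeff_map, PowerSeries.coeff_mul] at h2
  refine h2.trans (Finset.sum_congr rfl fun p _ => ?_)
  rw [PowerSeries.coeff_map, PowerSeries.coeff_rescale, PowerSeries.coeff_map]
  rfl

/-- Wick's theorem: the annihilation exponential translates the exponent `crea χ` by scalars, and
the exponential of these scalars is the series `contr`. -/
theorem anniExp_creaExp_mul (ψ χ : ℤ → I → 𝕜) (b c : ℕ) (v : Poly 𝕜 I) :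
    anniExp H ψ c (creaExp χ b * v) = ∑ k ∈ Finset.range (b + 1), PowerSeries.coeff k (contr H ψ χ) •
      (if k ≤ c then creaExp χ (b - k) * anniExp H ψ (c - k) v else 0) := by
  rw [← coeff_anniHom, map_mul, anniHom_creaExp, Finset.sum_mul, Polynomial.finsetSum_coeff,
    ← Finset.Nat.sum_antidiagonal_swap, Finset.Nat.sum_antidiagonal_eq_sum_range_succ_mk]
  refine Finset.sum_congr rfl fun k _ => ?_
  rw [Prod.fst_swap, Prod.snd_swap, mul_comm (Polynomial.X ^ _), mul_assoc, mul_assoc,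
    Polynomial.coeff_C_mul, Polynomial.coeff_C_mul, Polynomial.coeff_X_pow_mul', coeff_anniHom,
    MvPolynomial.smul_eq_C_mul]
  dsimp only
  split_ifs <;> ring

end Heis

end DeformedW

end

noncomputable section

namespace DeformedW

open Polynomial PowerSeries

set_option linter.unusedSectionVars false

namespace Heis

variable {𝕜 : Type*} [Field 𝕜] [CharZero 𝕜] {I : Type*} [Fintype I]
variable (H : ℕ → I → I → 𝕜)

/-! ### Normally ordered exponentials -/

theorem commute_mode_succ (i j : I) (m n : ℕ) :
    Commute (mode H i ((m + 1 : ℕ) : ℤ)) (mode H j ((n + 1 : ℕ) : ℤ)) := by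
  rw [mode_succ, mode_succ]
  refine Commute.sum_left _ _ _ fun i' _ => Commute.sum_right _ _ _ fun j' _ => ?_
  refine Commute.smul_left (Commute.smul_right ?_ _) _
  refine LinearMap.ext fun v => ?_
  change MvPolynomial.pderiv (R := 𝕜) (i', m) (MvPolynomial.pderiv (R := 𝕜) (j', n) v) =
    MvPolynomial.pderiv (R := 𝕜) (j', n) (MvPolynomial.pderiv (R := 𝕜) (i', m) v)
  have h : ⁅MvPolynomial.pderiv (R := 𝕜) (i', m), MvPolynomial.pderiv (R := 𝕜) (j', n)⁆ = 0 := by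
    classical
    refine MvPolynomial.derivation_ext fun k => ?_
    rw [Derivation.commutator_apply, MvPolynomial.pderiv_X, MvPolynomial.pderiv_X]
    simp only [Pi.single_apply, apply_ite (MvPolynomial.pderiv _), map_zero,
      Derivation.map_one_eq_zero, ite_self, sub_self, Derivation.zero_apply]
  have h2 := congrArg (fun D => D v) h
  rw [Derivation.commutator_apply, Derivation.zero_apply] at h2
  exact sub_eq_zero.1 h2

theorem commute_anniExp (ψ χ : ℤ → I → 𝕜) (c c' : ℕ) :
    Commute (anniExp H ψ c) (anniExp H χ c') := by
  have h : ∀ m n, Commute (PowerSeries.coeff m (anni H ψ)) (PowerSeries.coeff n (anni H χ)) := by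
    intro m n
    rw [anni, anni, PowerSeries.coeff_mk, PowerSeries.coeff_mk]
    obtain rfl | ⟨m, rfl⟩ : m = 0 ∨ ∃ k, m = k + 1 := by cases m <;> simp
    · rw [if_pos rfl]; exact Commute.zero_left _
    obtain rfl | ⟨n, rfl⟩ : n = 0 ∨ ∃ k, n = k + 1 := by cases n <;> simp
    · rw [if_pos rfl]; exact Commute.zero_right _
    rw [if_neg (Nat.succ_ne_zero _), if_neg (Nat.succ_ne_zero _), modeOp, modeOp]
    exact Commute.sum_left _ _ _ fun i _ => Commute.sum_right _ _ _ fun j _ =>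
      Commute.smul_left (Commute.smul_right (commute_mode_succ H i j m n) _) _
  exact commute_coeff_pexp (fun n => (commute_coeff_pexp (fun m => (h m n).symm) c).symm) c'

/-- `B` bounds the degrees in which the annihilation exponentials act nontrivially on `v`. -/
def IsBound (v : Poly 𝕜 I) (B : ℕ) : Prop :=
  ∀ (ψ : ℤ → I → 𝕜) (c : ℕ), B ≤ c → anniExp H ψ c v = 0

variable {H} in
theorem IsBound.mono {v : Poly 𝕜 I} {B B' : ℕ} (h : IsBound H v B) (hB : B ≤ B') :
    IsBound H v B' := fun ψ c hc => h ψ c (hB.trans hc)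

variable {H} in
theorem IsBound.anniExp {v : Poly 𝕜 I} {B : ℕ} (h : IsBound H v B) (χ : ℤ → I → 𝕜) (c' : ℕ) :
    IsBound H (anniExp H χ c' v) B := fun ψ c hc => by
  rw [← Module.End.mul_apply, (commute_anniExp H ψ χ c c').eq, Module.End.mul_apply, h ψ c hc,
    map_zero]

/-- The coefficient of `z^n` in the normally ordered exponential of a mode family. -/
def vertex (ψ : ℤ → I → 𝕜) (n : ℤ) (v : Poly 𝕜 I) : Poly 𝕜 I :=
  ∑ᶠ c : ℕ, creaExpZ ψ (n + c) * anniExp H ψ c v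

variable {H}

theorem vertex_eq {v : Poly 𝕜 I} {B : ℕ} (h : IsBound H v B) (ψ : ℤ → I → 𝕜) (n : ℤ) :
    vertex H ψ n v = ∑ c ∈ Finset.range B, creaExpZ ψ (n + c) * anniExp H ψ c v := by
  apply finsum_eq_sum_of_support_subset
  intro c hc
  by_contra hcB
  rw [Finset.mem_coe, Finset.mem_range, not_lt] at hcB
  exact hc (show creaExpZ ψ (n + c) * anniExp H ψ c v = 0 by rw [h ψ c hcB, mul_zero])

variable (H)

theorem exists_isBound (v : Poly 𝕜 I) : ∃ B, IsBound H v B := exists_anniExp_bound H v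

theorem vertex_add (ψ : ℤ → I → 𝕜) (n : ℤ) (v w : Poly 𝕜 I) :
    vertex H ψ n (v + w) = vertex H ψ n v + vertex H ψ n w := by
  obtain ⟨B, hB⟩ := exists_isBound H v
  obtain ⟨B', hB'⟩ := exists_isBound H w
  have h1 := hB.mono (le_max_left B B')
  have h2 := hB'.mono (le_max_right B B')
  have h3 : IsBound H (v + w) (max B B') := fun ψ c hc => by
    rw [map_add, h1 ψ c hc, h2 ψ c hc, add_zero]
  rw [vertex_eq h1, vertex_eq h2, vertex_eq h3, ← Finset.sum_add_distrib]
  simp only [map_add, mul_add]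

theorem vertex_smul (ψ : ℤ → I → 𝕜) (n : ℤ) (a : 𝕜) (v : Poly 𝕜 I) :
    vertex H ψ n (a • v) = a • vertex H ψ n v := by
  obtain ⟨B, hB⟩ := exists_isBound H v
  have h3 : IsBound H (a • v) B := fun ψ c hc => by
    rw [map_smul, hB ψ c hc, smul_zero]
  rw [vertex_eq hB, vertex_eq h3, Finset.smul_sum]
  simp only [map_smul, mul_smul_comm]

theorem vertex_sum {ι : Type*} (ψ : ℤ → I → 𝕜) (n : ℤ) (s : Finset ι) (v : ι → Poly 𝕜 I) :
    vertex H ψ n (∑ i ∈ s, v i) = ∑ i ∈ s, vertex H ψ n (v i) := by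
  classical
  induction s using Finset.induction_on with
  | empty =>
    rw [Finset.sum_empty, Finset.sum_empty]
    have := vertex_smul H ψ n 0 0
    rwa [zero_smul, zero_smul] at this
  | insert a s ha ih => rw [Finset.sum_insert ha, Finset.sum_insert ha, vertex_add, ih]

theorem vertex_creaExp_mul (ψ χ : ℤ → I → 𝕜) (n : ℤ) (b : ℕ) (v : Poly 𝕜 I) :
    vertex H ψ n (creaExp χ b * v) = ∑ k ∈ Finset.range (b + 1),
      PowerSeries.coeff k (contr H ψ χ) • (creaExp χ (b - k) * vertex H ψ (n + k) v) := by
  obtain ⟨B₀, hB₀⟩ := exists_isBound H v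
  obtain ⟨B₁, hB₁⟩ := exists_isBound H (creaExp χ b * v)
  obtain ⟨B, hB0, hB1⟩ : ∃ B, B₀ + b ≤ B ∧ B₁ ≤ B := ⟨max (B₀ + b) B₁, by simp, by simp⟩
  rw [vertex_eq (hB₁.mono hB1)]
  simp only [anniExp_creaExp_mul, Finset.mul_sum, mul_smul_comm]
  rw [Finset.sum_comm]
  refine Finset.sum_congr rfl fun k hk => ?_
  rw [← Finset.smul_sum]
  congr 1
  rw [Finset.mem_range] at hk
  obtain ⟨B', rfl⟩ : ∃ B', B = k + B' := ⟨B - k, by omega⟩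
  rw [Finset.sum_range_add, Finset.sum_eq_zero, zero_add,
    vertex_eq (hB₀.mono (show B₀ ≤ B' by omega)), Finset.mul_sum]
  · refine Finset.sum_congr rfl fun c _ => ?_
    rw [if_pos (Nat.le_add_right k c), Nat.add_sub_cancel_left]
    push_cast
    rw [add_assoc]
    ring
  · intro c hc
    rw [Finset.mem_range] at hc
    rw [if_neg (by omega), mul_zero]

theorem creaExpZ_of_neg (ψ : ℤ → I → 𝕜) {b : ℤ} (hb : b < 0) : creaExpZ ψ b = 0 :=
  if_neg (by omega)

theorem creaExpZ_natCast (ψ : ℤ → I → 𝕜) (b : ℕ) : creaExpZ ψ b = creaExp ψ b := by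
  simp [creaExpZ]

theorem vertex_creaExpZ_mul (ψ χ : ℤ → I → 𝕜) (n b : ℤ) (v : Poly 𝕜 I) {N : ℕ} (hN : b < N) :
    vertex H ψ n (creaExpZ χ b * v) = ∑ k ∈ Finset.range N,
      PowerSeries.coeff k (contr H ψ χ) • (creaExpZ χ (b - k) * vertex H ψ (n + k) v) := by
  rcases lt_or_ge b 0 with hb | hb
  · rw [creaExpZ_of_neg χ hb, zero_mul, Finset.sum_eq_zero]
    · simpa using vertex_smul H ψ n 0 0
    · intro k _
      rw [creaExpZ_of_neg χ (by omega), zero_mul, smul_zero]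
  · lift b to ℕ using hb
    rw [creaExpZ_natCast, vertex_creaExp_mul]
    have hN' : b < N := by exact_mod_cast hN
    rw [← Finset.sum_subset (Finset.range_mono (show b + 1 ≤ N by omega))]
    · refine Finset.sum_congr rfl fun k hk => ?_
      rw [Finset.mem_range] at hk
      rw [← Nat.cast_sub (by omega), creaExpZ_natCast]
    · intro k _ hk
      rw [Finset.mem_range] at hk
      rw [creaExpZ_of_neg χ (by omega), zero_mul, smul_zero]

/-- The coefficient of `z^n w^m` in the normally ordered product of two exponentials, applied to a
vector with bound `B`. -/
def normalProd (B : ℕ) (ψ χ : ℤ → I → 𝕜) (n m : ℤ) (v : Poly 𝕜 I) : Poly 𝕜 I :=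
  ∑ c ∈ Finset.range B, ∑ c' ∈ Finset.range B,
    creaExpZ ψ (n + c) * (creaExpZ χ (m + c') * anniExp H ψ c (anniExp H χ c' v))

/-- Creation modes commute with each other, and so do annihilation modes. The two orders of a
product therefore expand in the same operators and differ only in their scalar coefficients. -/
theorem normalProd_comm (B : ℕ) (ψ χ : ℤ → I → 𝕜) (n m : ℤ) (v : Poly 𝕜 I) :
    normalProd H B ψ χ n m v = normalProd H B χ ψ m n v := by
  rw [normalProd, normalProd, Finset.sum_comm]
  refine Finset.sum_congr rfl fun c _ => Finset.sum_congr rfl fun c' _ => ?_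
  rw [← Module.End.mul_apply, (commute_anniExp H ψ χ c' c).eq, Module.End.mul_apply]
  ring

variable {H}

/-- A contraction of degree `k` consumes a creation term of degree `m + c` with `c < B`, so only `k
< m + B` contributes. -/
theorem vertex_vertex {v : Poly 𝕜 I} {B : ℕ} (hB : IsBound H v B) (ψ χ : ℤ → I → 𝕜) (n m : ℤ)
    {N : ℕ} (hN : m + B ≤ N) :
    vertex H ψ n (vertex H χ m v) = ∑ k ∈ Finset.range N,
      PowerSeries.coeff k (contr H ψ χ) • normalProd H B ψ χ (n + k) (m - k) v := by
  rw [vertex_eq hB χ m, vertex_sum]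
  have : ∀ c ∈ Finset.range B, vertex H ψ n (creaExpZ χ (m + c) * anniExp H χ c v) =
      ∑ k ∈ Finset.range N, PowerSeries.coeff k (contr H ψ χ) •
        ∑ c' ∈ Finset.range B, creaExpZ ψ (n + k + c') *
          (creaExpZ χ (m - k + c) * anniExp H ψ c' (anniExp H χ c v)) := by
    intro c hc
    rw [Finset.mem_range] at hc
    rw [vertex_creaExpZ_mul H ψ χ n (m + c) _ (show m + c < N by omega)]
    refine Finset.sum_congr rfl fun k _ => ?_
    rw [vertex_eq (hB.anniExp χ c), Finset.mul_sum]
    congr 1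
    refine Finset.sum_congr rfl fun c' _ => ?_
    rw [show m + (c : ℤ) - k = m - k + c by ring]
    ring
  rw [Finset.sum_congr rfl this, Finset.sum_comm]
  refine Finset.sum_congr rfl fun k _ => ?_
  rw [← Finset.smul_sum, normalProd, Finset.sum_comm]

/-! ### Fusing two exponentials -/

theorem coeff_pexp_scale {R : Type*} [Ring R] [Algebra 𝕜 R] {f g : PowerSeries R} {b : 𝕜}
    (h : ∀ n, PowerSeries.coeff n g = b ^ n • PowerSeries.coeff n f) (n : ℕ) :
    PowerSeries.coeff n (pexp 𝕜 g) = b ^ n • PowerSeries.coeff n (pexp 𝕜 f) := by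
  have hpow : ∀ k n, PowerSeries.coeff n (g ^ k) = b ^ n • PowerSeries.coeff n (f ^ k) := by
    intro k
    induction k with
    | zero =>
      intro n
      rw [pow_zero, pow_zero, PowerSeries.coeff_one]
      split_ifs with h0
      · simp [h0]
      · simp
    | succ k ih =>
      intro n
      rw [pow_succ, pow_succ, PowerSeries.coeff_mul, PowerSeries.coeff_mul, Finset.smul_sum]
      refine Finset.sum_congr rfl fun p hp => ?_
      rw [Finset.HasAntidiagonal.mem_antidiagonal] at hp
      rw [ih, h, smul_mul_smul_comm, ← pow_add, hp]
  rw [pexp, pexp, PowerSeries.coeff_mk, PowerSeries.coeff_mk, Finset.smul_sum]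
  refine Finset.sum_congr rfl fun k _ => ?_
  rw [hpow, smul_comm]

/-- The mode family of `:exp(∑ ψ(m) z^{-m}) exp(∑ χ(m) w^{-m}):` at `w = z / b`. -/
def fuse (ψ χ : ℤ → I → 𝕜) (b : 𝕜) : ℤ → I → 𝕜 := fun m => ψ m + b ^ m • χ m

theorem creaExp_fuse (ψ χ : ℤ → I → 𝕜) (b : 𝕜) (n : ℕ) : creaExp (fuse ψ χ b) n =
    ∑ p ∈ Finset.HasAntidiagonal.antidiagonal n,
      creaExp ψ p.1 * ((b⁻¹) ^ p.2 • creaExp χ p.2) := by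
  set χ' : ℤ → I → 𝕜 := fun m => b ^ m • χ m
  have hsum : crea (fuse ψ χ b) = crea ψ + crea χ' := by
    ext n : 1
    rw [map_add, crea, crea, crea, PowerSeries.coeff_mk, PowerSeries.coeff_mk, PowerSeries.coeff_mk]
    split_ifs
    · rw [add_zero]
    · rw [← Finset.sum_add_distrib]
      exact Finset.sum_congr rfl fun j _ => add_smul _ _ _
  have hs : ∀ n, PowerSeries.coeff n (crea χ') = (b⁻¹) ^ n • PowerSeries.coeff n (crea χ) := by
    intro n
    rw [crea, crea, PowerSeries.coeff_mk, PowerSeries.coeff_mk]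
    split_ifs
    · rw [smul_zero]
    · rw [Finset.smul_sum]
      refine Finset.sum_congr rfl fun j _ => ?_
      simp only [χ', Pi.smul_apply, smul_smul, smul_eq_mul, zpow_neg, zpow_natCast, inv_pow]
  rw [creaExp, hsum, pexp_add (coeff_zero_crea _) (coeff_zero_crea _) (Commute.all _ _),
    PowerSeries.coeff_mul]
  refine Finset.sum_congr rfl fun p _ => ?_
  rw [coeff_pexp_scale hs]
  rfl

theorem anniExp_fuse (ψ χ : ℤ → I → 𝕜) (b : 𝕜) (n : ℕ) : anniExp H (fuse ψ χ b) n =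
    ∑ p ∈ Finset.HasAntidiagonal.antidiagonal n,
      anniExp H ψ p.1 * (b ^ p.2 • anniExp H χ p.2) := by
  set χ' : ℤ → I → 𝕜 := fun m => b ^ m • χ m
  have hsum : anni H (fuse ψ χ b) = anni H ψ + anni H χ' := by
    ext n : 1
    rw [map_add, anni, anni, anni, PowerSeries.coeff_mk, PowerSeries.coeff_mk, PowerSeries.coeff_mk]
    split_ifs
    · rw [add_zero]
    · rw [modeOp, modeOp, modeOp, ← Finset.sum_add_distrib]
      exact Finset.sum_congr rfl fun j _ => add_smul _ _ _
  have hs : ∀ n, PowerSeries.coeff n (anni H χ') = b ^ n • PowerSeries.coeff n (anni H χ) := by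
    intro n
    rw [anni, anni, PowerSeries.coeff_mk, PowerSeries.coeff_mk]
    split_ifs
    · rw [smul_zero]
    · rw [modeOp, modeOp, Finset.smul_sum]
      refine Finset.sum_congr rfl fun j _ => ?_
      simp only [χ', Pi.smul_apply, smul_smul, smul_eq_mul, zpow_natCast]
  have hc : Commute (anni H ψ) (anni H χ') := by
    apply commute_of_coeff
    intro m n
    rw [anni, anni, PowerSeries.coeff_mk, PowerSeries.coeff_mk]
    obtain rfl | ⟨m, rfl⟩ : m = 0 ∨ ∃ k, m = k + 1 := by cases m <;> simp
    · rw [if_pos rfl]; exact Commute.zero_left _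
    obtain rfl | ⟨n, rfl⟩ : n = 0 ∨ ∃ k, n = k + 1 := by cases n <;> simp
    · rw [if_pos rfl]; exact Commute.zero_right _
    rw [if_neg (Nat.succ_ne_zero _), if_neg (Nat.succ_ne_zero _), modeOp, modeOp]
    exact Commute.sum_left _ _ _ fun i _ => Commute.sum_right _ _ _ fun j _ =>
      Commute.smul_left (Commute.smul_right (commute_mode_succ H i j m n) _) _
  rw [DeformedW.Heis.anniExp, hsum, pexp_add (coeff_zero_anni H _) (coeff_zero_anni H _) hc,
    PowerSeries.coeff_mul]
  refine Finset.sum_congr rfl fun p _ => ?_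
  rw [coeff_pexp_scale hs]
  rfl

theorem creaExpZ_fuse (ψ χ : ℤ → I → 𝕜) {b : 𝕜} {x y : ℤ} {N : ℕ} (hx : |x| ≤ N)
    (hy : |y| ≤ N) : creaExpZ (fuse ψ χ b) (x + y) =
      ∑ k ∈ Finset.Icc (-(N : ℤ)) N,
        b ^ (k - y) • (creaExpZ ψ (x + k) * creaExpZ χ (y - k)) := by
  rw [abs_le] at hx hy
  rcases lt_or_ge (x + y) 0 with h | h
  · rw [creaExpZ_of_neg _ h, Finset.sum_eq_zero]
    intro k _
    rcases lt_or_ge (x + k) 0 with h' | h'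
    · rw [creaExpZ_of_neg _ h', zero_mul, smul_zero]
    · rw [creaExpZ_of_neg χ (show y - k < 0 by omega), mul_zero, smul_zero]
  · obtain ⟨s, hs⟩ : ∃ s : ℕ, x + y = s := ⟨(x + y).toNat, by omega⟩
    rw [hs, creaExpZ_natCast, creaExp_fuse]
    refine Finset.sum_of_injOn (fun p => (p.1 : ℤ) - x) ?_ ?_ ?_ ?_
    · rintro ⟨p, p'⟩ hp ⟨r, r'⟩ hr h
      simp only [Finset.mem_coe, Finset.HasAntidiagonal.mem_antidiagonal] at hp hr h
      simp only [Prod.mk.injEq]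
      omega
    · rintro ⟨p, p'⟩ hp
      simp only [Finset.mem_coe, Finset.HasAntidiagonal.mem_antidiagonal, Finset.mem_Icc] at hp ⊢
      omega
    · intro k _ hk
      rcases lt_or_ge (x + k) 0 with h1 | h1
      · rw [creaExpZ_of_neg _ h1, zero_mul, smul_zero]
      rcases lt_or_ge (y - k) 0 with h2 | h2
      · rw [creaExpZ_of_neg _ h2, mul_zero, smul_zero]
      exfalso
      apply hk
      refine ⟨((x + k).toNat, (y - k).toNat), ?_, ?_⟩
      · simp only [Finset.mem_coe, Finset.HasAntidiagonal.mem_antidiagonal]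
        omega
      · dsimp only
        omega
    · rintro ⟨p, p'⟩ hp
      rw [Finset.HasAntidiagonal.mem_antidiagonal] at hp
      dsimp only at hp ⊢
      rw [show x + ((p : ℤ) - x) = (p : ℤ) by ring, show y - ((p : ℤ) - x) = (p' : ℤ) by omega,
        show (p : ℤ) - x - y = -(p' : ℤ) by omega, creaExpZ_natCast, creaExpZ_natCast,
        zpow_neg, zpow_natCast, mul_smul_comm, inv_pow]

/-- With `δ(x) = ∑ x^k`, the right side is the coefficient of `z^n w^m` in `δ(b w / z)` times the
normally ordered product; the delta function sets `w = z / b`. The sum over `k` is finite because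
the creation parts vanish in negative degrees. -/
theorem vertex_fuse {v : Poly 𝕜 I} {B : ℕ} (hB : IsBound H v B) (ψ χ : ℤ → I → 𝕜) {b : 𝕜}
    (hb : b ≠ 0) (n m : ℤ) {N : ℕ} (hn : |n| + B ≤ N) (hm : |m| + B ≤ N) :
    b ^ m • vertex H (fuse ψ χ b) (n + m) v =
      ∑ k ∈ Finset.Icc (-(N : ℤ)) N, b ^ k • normalProd H B ψ χ (n + k) (m - k) v := by
  have key : vertex H (fuse ψ χ b) (n + m) v = ∑ c ∈ Finset.range B, ∑ c' ∈ Finset.range B,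
      b ^ c' • (creaExpZ (fuse ψ χ b) (n + m + (c + c')) *
        anniExp H ψ c (anniExp H χ c' v)) := by
    -- A single fused exponential has total degree `c + c'` with `c, c' < B`, so the bound `2 * B`
    -- covers all terms.
    rw [vertex_eq (hB.mono (show B ≤ 2 * B by omega)), ← Finset.sum_product']
    simp only [anniExp_fuse, LinearMap.sum_apply, Finset.mul_sum]
    rw [Finset.sum_sigma']
    symm
    refine Finset.sum_of_injOn (fun p => ⟨p.1 + p.2, p⟩) ?_ ?_ ?_ ?_
    · rintro p _ p' _ h
      simp only [Sigma.mk.injEq] at h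
      exact eq_of_heq h.2
    · rintro ⟨c, c'⟩ h
      simp only [Finset.coe_product, Set.mem_prod, Finset.mem_coe, Finset.mem_range] at h
      exact Finset.mem_coe.2 (Finset.mem_sigma.2 ⟨Finset.mem_range.2
        (show c + c' < 2 * B by omega), Finset.HasAntidiagonal.mem_antidiagonal.2 rfl⟩)
    · rintro ⟨s, p⟩ hs hp
      rw [Finset.mem_sigma, Finset.HasAntidiagonal.mem_antidiagonal] at hs
      obtain ⟨-, hs⟩ := hs
      dsimp only at hs
      subst hs
      have : B ≤ p.1 ∨ B ≤ p.2 := by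
        by_contra hlt
        exact hp ⟨p, by simp; omega, rfl⟩
      dsimp only
      rw [Module.End.mul_apply, LinearMap.smul_apply, map_smul]
      rcases this with h | h
      · rw [hB.anniExp χ p.2 ψ p.1 h, smul_zero, mul_zero]
      · rw [hB χ p.2 h, map_zero, smul_zero, mul_zero]
    · rintro ⟨c, c'⟩ _
      dsimp only
      rw [Module.End.mul_apply, LinearMap.smul_apply, map_smul, mul_smul_comm]
      push_cast
      rfl
  rw [key]
  simp only [normalProd, Finset.smul_sum]
  rw [Finset.sum_comm' (t' := Finset.range B) (s' := fun _ => Finset.Icc (-(N : ℤ)) N)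
    (by simp [and_comm])]
  refine Finset.sum_congr rfl fun c hc => ?_
  rw [Finset.sum_comm' (t' := Finset.range B) (s' := fun _ => Finset.Icc (-(N : ℤ)) N)
    (by simp [and_comm])]
  refine Finset.sum_congr rfl fun c' hc' => ?_
  rw [Finset.mem_range] at hc hc'
  have hx : |n + c| ≤ (N : ℤ) := by
    have := abs_add_le n c
    rw [Nat.abs_cast] at this
    omega
  have hy : |m + c'| ≤ (N : ℤ) := by
    have := abs_add_le m c'
    rw [Nat.abs_cast] at this
    omega
  rw [show n + m + ((c : ℤ) + c') = (n + c) + (m + c') by ring, creaExpZ_fuse ψ χ hx hy,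
    Finset.sum_mul, Finset.smul_sum, Finset.smul_sum]
  refine Finset.sum_congr rfl fun k _ => ?_
  rw [smul_mul_assoc, smul_smul, smul_smul, ← zpow_natCast, ← zpow_add₀ hb, ← zpow_add₀ hb,
    show m + (c' : ℤ) + (k - (m + c')) = k by ring, show n + (c : ℤ) + k = n + k + c by ring,
    show m + (c' : ℤ) - k = m - k + c' by ring, mul_assoc]

end Heis

end DeformedW

end

noncomputable section

namespace DeformedW

open Polynomial PowerSeries

set_option linter.unusedSectionVars false

namespace Heis

variable {𝕜 : Type*} [Field 𝕜] [CharZero 𝕜] {I : Type*} [Fintype I]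
variable (H : ℕ → I → I → 𝕜)

/-! ### Commutators of normally ordered exponentials -/

/-- The coefficient of the pole `u = 1 / b₁` in
`(b₁ b₂ / (a₁ a₂)) (1 - a₁ u) (1 - a₂ u) / ((1 - b₁ u) (1 - b₂ u))`. -/
def poleCoeff (a₁ a₂ b₁ b₂ : 𝕜) : 𝕜 := (b₁ - a₁) * (b₁ - a₂) * b₂ / (a₁ * a₂ * (b₁ - b₂))

/-- The sequence `(b₁ⁿ + b₂ⁿ - a₁ⁿ - a₂ⁿ) / n`. -/
def logSeq (a₁ a₂ b₁ b₂ : 𝕜) (n : ℕ) : 𝕜 := (b₁ ^ n + b₂ ^ n - a₁ ^ n - a₂ ^ n) / n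

theorem contr_mul {ψ χ : ℤ → I → 𝕜} {a₁ a₂ b₁ b₂ : 𝕜}
    (hp : ∀ n : ℕ, n ≠ 0 → pairing H ψ χ n = logSeq a₁ a₂ b₁ b₂ n) :
    contr H ψ χ * ((1 - PowerSeries.C b₁ * PowerSeries.X) * (1 - PowerSeries.C b₂ * PowerSeries.X))
      = (1 - PowerSeries.C a₁ * PowerSeries.X) * (1 - PowerSeries.C a₂ * PowerSeries.X) := by
  set f : PowerSeries 𝕜 := PowerSeries.mk fun n => if n = 0 then 0 else pairing H ψ χ n
  -- The zeros are moved to the other side before exponentiating, so that no power series has to be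
  -- inverted.
  have hf : f + (nlog a₁ + nlog a₂) = nlog b₁ + nlog b₂ := by
    ext n
    simp only [map_add, nlog, f, PowerSeries.coeff_mk]
    split_ifs with h
    · simp [h]
    · rw [hp n h, logSeq]; ring
  have hf0 : PowerSeries.coeff 0 f = 0 := by simp [f]
  have h0 := coeff_zero_nlog (𝕜 := 𝕜)
  have e := congrArg (pexp 𝕜) hf
  rw [pexp_add hf0 (by rw [map_add, h0, h0, add_zero]) (Commute.all _ _),
    pexp_add (h0 _) (h0 _) (Commute.all _ _), pexp_add (h0 _) (h0 _) (Commute.all _ _)] at e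
  have e1 := pexp_nlog a₁
  have e2 := pexp_nlog a₂
  have e3 := pexp_nlog b₁
  have e4 := pexp_nlog b₂
  change pexp 𝕜 f * _ = _
  set A₁ := (1 - PowerSeries.C a₁ * PowerSeries.X)
  set A₂ := (1 - PowerSeries.C a₂ * PowerSeries.X)
  set B₁ := (1 - PowerSeries.C b₁ * PowerSeries.X)
  set B₂ := (1 - PowerSeries.C b₂ * PowerSeries.X)
  calc pexp 𝕜 f * (B₁ * B₂) = pexp 𝕜 f * (B₁ * B₂) * ((pexp 𝕜 (nlog a₁) * A₁) *
        (pexp 𝕜 (nlog a₂) * A₂)) := by rw [e1, e2, mul_one, mul_one]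
    _ = (pexp 𝕜 f * (pexp 𝕜 (nlog a₁) * pexp 𝕜 (nlog a₂))) * (B₁ * B₂) * (A₁ * A₂) := by ring
    _ = (pexp 𝕜 (nlog b₁) * B₁) * (pexp 𝕜 (nlog b₂) * B₂) * (A₁ * A₂) := by rw [e]; ring
    _ = A₁ * A₂ := by rw [e3, e4]; ring

theorem one_sub_C_mul_X_ne_zero (b : 𝕜) : (1 - PowerSeries.C b * PowerSeries.X) ≠ 0 := by
  intro h
  have := congrArg (PowerSeries.coeff 0) h
  simp at this

theorem coeff_contr {ψ χ : ℤ → I → 𝕜} {a₁ a₂ b₁ b₂ : 𝕜} (hb₁ : b₁ ≠ 0) (hb₂ : b₂ ≠ 0)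
    (hb : b₁ ≠ b₂) (hp : ∀ n : ℕ, n ≠ 0 → pairing H ψ χ n = logSeq a₁ a₂ b₁ b₂ n) (n : ℕ) :
    PowerSeries.coeff n (contr H ψ χ) =
      (b₁ - a₁) * (b₁ - a₂) / (b₁ * (b₁ - b₂)) * b₁ ^ n +
      (b₂ - a₁) * (b₂ - a₂) / (b₂ * (b₂ - b₁)) * b₂ ^ n +
      (if n = 0 then a₁ * a₂ / (b₁ * b₂) else 0) := by
  set k₁ := (b₁ - a₁) * (b₁ - a₂) / (b₁ * (b₁ - b₂)) with hk₁
  set k₂ := (b₂ - a₁) * (b₂ - a₂) / (b₂ * (b₂ - b₁)) with hk₂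
  set k₀ := a₁ * a₂ / (b₁ * b₂) with hk₀
  have h12 := sub_ne_zero.2 hb
  have h21 := sub_ne_zero.2 hb.symm
  -- Partial fractions; `k₀` is the value at infinity, since numerator and denominator have the same
  -- degree. `r0`, `r1`, `r2` compare the coefficients of `1`, `u`, `u²` in `k₁ (1 - b₂ u) + k₂ (1 -
  -- b₁ u) + k₀ (1 - b₁ u) (1 - b₂ u) = (1 - a₁ u) (1 - a₂ u)`.
  have r0 : k₁ + k₂ + k₀ = 1 := by
    rw [hk₁, hk₂, hk₀, ← neg_sub b₁ b₂]; field_simp; ring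
  have r1 : k₁ * b₂ + k₂ * b₁ + k₀ * (b₁ + b₂) = a₁ + a₂ := by
    rw [hk₁, hk₂, hk₀, ← neg_sub b₁ b₂]; field_simp; ring
  have r2 : k₀ * (b₁ * b₂) = a₁ * a₂ := by rw [hk₀]; field_simp
  set G : PowerSeries 𝕜 := PowerSeries.C k₁ * PowerSeries.mk (fun n => b₁ ^ n) +
    PowerSeries.C k₂ * PowerSeries.mk (fun n => b₂ ^ n) + PowerSeries.C k₀ with hG
  have e1 := mk_pow_mul b₁
  have e2 := mk_pow_mul b₂
  have hGe : contr H ψ χ = G := by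
    have hne := mul_ne_zero (one_sub_C_mul_X_ne_zero b₁) (one_sub_C_mul_X_ne_zero b₂)
    apply mul_right_cancel₀ hne
    rw [contr_mul H hp]
    have r0' := congrArg (PowerSeries.C (R := 𝕜)) r0
    have r1' := congrArg (PowerSeries.C (R := 𝕜)) r1
    have r2' := congrArg (PowerSeries.C (R := 𝕜)) r2
    simp only [map_add, map_mul, map_one] at r0' r1' r2'
    rw [hG]
    linear_combination (-PowerSeries.C k₁ * (1 - PowerSeries.C b₂ * PowerSeries.X)) * e1 -
      PowerSeries.C k₂ * (1 - PowerSeries.C b₁ * PowerSeries.X) * e2 - r0' + PowerSeries.X * r1' -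
      PowerSeries.X ^ 2 * r2'
  rw [hGe, hG, map_add, map_add, PowerSeries.coeff_C_mul, PowerSeries.coeff_C_mul,
    PowerSeries.coeff_C, PowerSeries.coeff_mk, PowerSeries.coeff_mk]

/-- The commutator of two exponentials whose contraction has two simple poles. -/
theorem vertex_commutator (ψ χ : ℤ → I → 𝕜) {a₁ a₂ b₁ b₂ : 𝕜} (ha₁ : a₁ ≠ 0) (ha₂ : a₂ ≠ 0)
    (hb₁ : b₁ ≠ 0) (hb₂ : b₂ ≠ 0) (hb : b₁ ≠ b₂)
    (hp : ∀ n : ℕ, n ≠ 0 → pairing H ψ χ n = logSeq a₁ a₂ b₁ b₂ n)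
    (hp' : ∀ n : ℕ, n ≠ 0 → pairing H χ ψ n = logSeq a₁⁻¹ a₂⁻¹ b₁⁻¹ b₂⁻¹ n)
    (n m : ℤ) (v : Poly 𝕜 I) :
    (b₁ * b₂ / (a₁ * a₂)) • vertex H ψ n (vertex H χ m v) - vertex H χ m (vertex H ψ n v) =
      (poleCoeff a₁ a₂ b₁ b₂ * b₁ ^ m) • vertex H (fuse ψ χ b₁) (n + m) v +
      (poleCoeff a₁ a₂ b₂ b₁ * b₂ ^ m) • vertex H (fuse ψ χ b₂) (n + m) v := by
  obtain ⟨B, hB⟩ := exists_isBound H v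
  obtain ⟨N, hnN, hmN⟩ : ∃ N : ℕ, |n| + B ≤ N ∧ |m| + B ≤ N :=
    ⟨n.natAbs + m.natAbs + B,
      by push_cast [Int.natCast_natAbs]; linarith [abs_nonneg m],
      by push_cast [Int.natCast_natAbs]; linarith [abs_nonneg n]⟩
  have h1 := vertex_vertex hB ψ χ n m (N := N + 1)
    (by have := le_abs_self m; push_cast; omega)
  have h2 := vertex_vertex hB χ ψ m n (N := N + 1)
    (by have := le_abs_self n; push_cast; omega)
  rw [h1, h2, mul_smul, mul_smul, vertex_fuse hB ψ χ hb₁ n m hnN hmN,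
    vertex_fuse hB ψ χ hb₂ n m hnN hmN]
  set T : ℤ → Poly 𝕜 I := fun k => normalProd H B ψ χ (n + k) (m - k) v with hT
  have hT' : ∀ k : ℕ, normalProd H B χ ψ (m + k) (n - k) v = T (-k) := by
    intro k
    rw [hT, normalProd_comm]
    dsimp only
    rw [sub_neg_eq_add, ← sub_eq_add_neg]
  simp only [hT']
  -- `d₁` and `d₂` are the expansions at `u = 0` and at `u = ∞` of the same rational function, so
  -- `d₁ - d₂` is a combination of the two sequences `b₁^k` and `b₂^k`, `k ∈ ℤ`.
  set d₁ : ℤ → 𝕜 := fun k => if 0 ≤ k then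
    (b₁ * b₂ / (a₁ * a₂)) * PowerSeries.coeff k.toNat (contr H ψ χ) else 0 with hd₁
  set d₂ : ℤ → 𝕜 := fun k => if k ≤ 0 then
    PowerSeries.coeff (-k).toNat (contr H χ ψ) else 0 with hd₂
  have e1 : (b₁ * b₂ / (a₁ * a₂)) • ∑ k ∈ Finset.range (N + 1),
      PowerSeries.coeff k (contr H ψ χ) • T k = ∑ k ∈ Finset.Icc (-(N : ℤ)) N, d₁ k • T k := by
    rw [Finset.smul_sum]
    refine Finset.sum_of_injOn (fun k => (k : ℤ)) ?_ ?_ ?_ ?_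
    · intro k _ k' _ h
      exact Int.ofNat_inj.1 h
    · intro k hk
      simp only [Finset.coe_range, Set.mem_Iio, Finset.coe_Icc, Set.mem_Icc] at hk ⊢
      omega
    · intro k hk hk'
      rw [Finset.mem_Icc] at hk
      rw [hd₁]
      dsimp only
      rw [if_neg, zero_smul]
      intro h0
      exact hk' ⟨k.toNat, by simp; omega, by dsimp only; omega⟩
    · intro k _
      simp only [hd₁, Int.natCast_nonneg, if_true, Int.toNat_natCast, smul_smul]
  have e2 : ∑ k ∈ Finset.range (N + 1),
      PowerSeries.coeff k (contr H χ ψ) • T (-k) = ∑ k ∈ Finset.Icc (-(N : ℤ)) N, d₂ k • T k := by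
    refine Finset.sum_of_injOn (fun k => -(k : ℤ)) ?_ ?_ ?_ ?_
    · intro k _ k' _ h
      have h : -(k : ℤ) = -(k' : ℤ) := h
      omega
    · intro k hk
      simp only [Finset.coe_range, Set.mem_Iio, Finset.coe_Icc, Set.mem_Icc] at hk ⊢
      omega
    · intro k hk hk'
      rw [Finset.mem_Icc] at hk
      rw [hd₂]
      dsimp only
      rw [if_neg, zero_smul]
      intro h0
      exact hk' ⟨(-k).toNat, by simp; omega, by dsimp only; omega⟩
    · intro k _
      simp only [hd₂, Left.neg_nonpos_iff, Int.natCast_nonneg, if_true, neg_neg, Int.toNat_natCast]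
  rw [e1, e2, ← Finset.sum_sub_distrib, Finset.smul_sum, Finset.smul_sum, ← Finset.sum_add_distrib]
  refine Finset.sum_congr rfl fun k _ => ?_
  rw [← sub_smul, smul_smul, smul_smul, ← add_smul]
  congr 1
  have h12 := sub_ne_zero.2 hb
  have h21 := sub_ne_zero.2 hb.symm
  have hbi : b₁⁻¹ ≠ b₂⁻¹ := fun h => hb (inv_injective h)
  have c1 := coeff_contr H hb₁ hb₂ hb hp
  have c2 := coeff_contr H (inv_ne_zero hb₁) (inv_ne_zero hb₂) hbi hp'
  have s1 : (b₁ * b₂ / (a₁ * a₂)) * ((b₁ - a₁) * (b₁ - a₂) / (b₁ * (b₁ - b₂))) =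
      poleCoeff a₁ a₂ b₁ b₂ := by
    rw [poleCoeff]; field_simp
  have s2 : (b₁ * b₂ / (a₁ * a₂)) * ((b₂ - a₁) * (b₂ - a₂) / (b₂ * (b₂ - b₁))) =
      poleCoeff a₁ a₂ b₂ b₁ := by
    rw [poleCoeff]; field_simp
  have inv_sub (x y : 𝕜) (hx : x ≠ 0) (hy : y ≠ 0) : x⁻¹ - y⁻¹ = (y - x) / (x * y) := by
    field_simp
  have s3 : (b₁⁻¹ - a₁⁻¹) * (b₁⁻¹ - a₂⁻¹) / (b₁⁻¹ * (b₁⁻¹ - b₂⁻¹)) = - poleCoeff a₁ a₂ b₁ b₂ := by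
    rw [poleCoeff, inv_sub _ _ hb₁ ha₁, inv_sub _ _ hb₁ ha₂, inv_sub _ _ hb₁ hb₂, ← neg_sub b₁ b₂]
    field_simp
    ring
  have s4 : (b₂⁻¹ - a₁⁻¹) * (b₂⁻¹ - a₂⁻¹) / (b₂⁻¹ * (b₂⁻¹ - b₁⁻¹)) = - poleCoeff a₁ a₂ b₂ b₁ := by
    rw [poleCoeff, inv_sub _ _ hb₂ ha₁, inv_sub _ _ hb₂ ha₂, inv_sub _ _ hb₂ hb₁, ← neg_sub b₂ b₁]
    field_simp
    ring
  rw [s3, s4] at c2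
  have s0 : (b₁ * b₂ / (a₁ * a₂)) * (a₁ * a₂ / (b₁ * b₂)) = 1 := by field_simp
  -- The value at `0` minus the value at `∞`, the latter being normalised to `1`, is the sum of the
  -- two pole coefficients. This is the case `k = 0`.
  have s5 : poleCoeff a₁ a₂ b₁ b₂ + poleCoeff a₁ a₂ b₂ b₁ = b₁ * b₂ / (a₁ * a₂) - 1 := by
    rw [poleCoeff, poleCoeff, ← neg_sub b₁ b₂]; field_simp; ring
  rcases lt_trichotomy k 0 with hk | hk | hk
  · obtain ⟨j, rfl⟩ : ∃ j : ℕ, k = -((j + 1 : ℕ) : ℤ) := ⟨(-k - 1).toNat, by push_cast; omega⟩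
    simp only [hd₁, hd₂]
    rw [if_neg (by omega), if_pos (by omega), neg_neg, Int.toNat_natCast, c2,
      if_neg (Nat.succ_ne_zero j), zpow_neg, zpow_neg, zpow_natCast, zpow_natCast, inv_pow, inv_pow]
    ring
  · subst hk
    simp only [hd₁, hd₂, le_refl, if_true, Int.toNat_zero, neg_zero, zpow_zero]
    rw [c1, c2, if_pos rfl, if_pos rfl]
    have s0' : a₁⁻¹ * a₂⁻¹ / (b₁⁻¹ * b₂⁻¹) = b₁ * b₂ / (a₁ * a₂) := by field_simp
    rw [s0', mul_add, s0, mul_add, ← mul_assoc, ← mul_assoc, s1, s2]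
    simp only [pow_zero, mul_one]
    linear_combination s5
  · obtain ⟨j, rfl⟩ : ∃ j : ℕ, k = ((j + 1 : ℕ) : ℤ) := ⟨(k - 1).toNat, by push_cast; omega⟩
    simp only [hd₁, hd₂]
    rw [if_pos (by omega), if_neg (by omega), Int.toNat_natCast, c1,
      if_neg (Nat.succ_ne_zero j), zpow_natCast, zpow_natCast, add_zero, sub_zero, mul_add,
      ← mul_assoc, ← mul_assoc, s1, s2]

end Heis

end DeformedW

end

/-! ### Monomials and screening currents of type `B_ℓ` as vertex operators. -/

noncomputable section

namespace DeformedW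

open Polynomial PowerSeries

variable {ℓ : ℕ}

instance : CharZero KK := charZero_of_injective_algebraMap (algebraMap ℂ KK).injective

/-! ### Fields on the direct sum of the Fock modules -/

/-- The structure constants of the Heisenberg algebra of type `B_ℓ`. -/
def heis (ℓ : ℕ) (n : ℕ) (i j : Fin ℓ) : KK :=
  (n : KK) * ((t ^ n - (t ^ n)⁻¹) / (q ^ n - (q ^ n)⁻¹)) * symCartanQT ℓ n i j

theorem xV_eq_mode (i : Fin ℓ) (m : ℤ) : xV ℓ i m = Heis.mode (heis ℓ) i m := by
  match m with
  | Int.negSucc n => rfl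
  | Int.ofNat 0 => rfl
  | Int.ofNat (n + 1) =>
    simp only [xV, Heis.mode, heis]
    push_cast
    rfl

/-- The action of an endomorphism of the polynomial Fock space on every Fock module. -/
def liftEnd (ℓ : ℕ) : Module.End KK (FockV ℓ) →ₐ[KK] Module.End KK (Fock ℓ) where
  toFun T := Finsupp.mapRange.linearMap T
  map_one' := by ext; simp
  map_mul' S T := by
    refine Finsupp.lhom_ext fun μ v => ?_
    simp [Finsupp.mapRange.linearMap_apply, Module.End.mul_apply]
  map_zero' := by
    refine Finsupp.lhom_ext fun μ v => ?_
    simp [Finsupp.mapRange.linearMap_apply]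
  map_add' S T := by
    refine Finsupp.lhom_ext fun μ v => ?_
    simp [Finsupp.mapRange.linearMap_apply]
  commutes' a := by
    refine Finsupp.lhom_ext fun μ v => ?_
    simp [Finsupp.mapRange.linearMap_apply, Module.algebraMap_end_apply]

theorem liftEnd_single (T : Module.End KK (FockV ℓ)) (μ : P ℓ) (v : FockV ℓ) :
    liftEnd ℓ T (Finsupp.single μ v) = Finsupp.single μ (T v) := by
  change Finsupp.mapRange.linearMap T (Finsupp.single μ v) = _
  simp [Finsupp.mapRange.linearMap_apply]

theorem x_eq (i : Fin ℓ) (m : ℤ) : x ℓ i m = liftEnd ℓ (Heis.mode (heis ℓ) i m) := by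
  rw [← xV_eq_mode]; rfl

theorem expCoeff_eq {φ : ℕ → Module.End KK (Fock ℓ)} {f : PowerSeries (Module.End KK (FockV ℓ))}
    (h0 : PowerSeries.coeff 0 f = 0)
    (h : ∀ m, m ≠ 0 → φ m = liftEnd ℓ (PowerSeries.coeff m f)) (n : ℕ) :
    expCoeff φ n = liftEnd ℓ (PowerSeries.coeff n (pexp KK f)) := by
  have e : (PowerSeries.mk fun m => if m = 0 then 0 else φ m) =
      PowerSeries.map (liftEnd ℓ : Module.End KK (FockV ℓ) →+* Module.End KK (Fock ℓ)) f := by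
    ext m : 1
    rw [PowerSeries.coeff_mk, PowerSeries.coeff_map]
    split_ifs with hm
    · rw [hm, h0, map_zero]
    · exact h m hm
  have h2 := congrArg (PowerSeries.coeff n) (map_pexp (𝕜 := KK) (S := Module.End KK (Fock ℓ)) (liftEnd ℓ) f)
  rw [PowerSeries.coeff_map] at h2
  refine Eq.trans ?_ h2.symm
  rw [← e, expCoeff, pexp, PowerSeries.coeff_mk]

theorem expCoeff_anni {φ : ℤ → Module.End KK (Fock ℓ)} {ψ : ℤ → Fin ℓ → KK}
    (h : ∀ m, m ≠ 0 → φ m = liftEnd ℓ (Heis.modeOp (heis ℓ) ψ m)) (c : ℕ) (μ : P ℓ)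
    (v : FockV ℓ) : expCoeff (fun m => φ (m : ℤ)) c (Finsupp.single μ v) =
      Finsupp.single μ (Heis.anniExp (heis ℓ) ψ c v) := by
  rw [expCoeff_eq (f := Heis.anni (heis ℓ) ψ) (Heis.coeff_zero_anni _ ψ), liftEnd_single]
  · rfl
  · intro m hm
    rw [h m (by exact_mod_cast hm), Heis.anni, PowerSeries.coeff_mk, if_neg hm]

theorem expCoeff_crea {φ : ℤ → Module.End KK (Fock ℓ)} {ψ : ℤ → Fin ℓ → KK}
    (h : ∀ m, m ≠ 0 → φ m = liftEnd ℓ (Heis.modeOp (heis ℓ) ψ m)) (b : ℕ) (μ : P ℓ)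
    (v : FockV ℓ) : expCoeff (fun m => φ (-(m : ℤ))) b (Finsupp.single μ v) =
      Finsupp.single μ (Heis.creaExp ψ b * v) := by
  set L : FockV ℓ →ₐ[KK] Module.End KK (FockV ℓ) := Algebra.lmul KK (FockV ℓ)
  have h0 := Heis.coeff_zero_crea (𝕜 := KK) ψ
  rw [expCoeff_eq (f := PowerSeries.map (L : FockV ℓ →+* Module.End KK (FockV ℓ)) (Heis.crea ψ)),
    liftEnd_single]
  · congr 1
    have := congrArg (PowerSeries.coeff b) (map_pexp (𝕜 := KK)
      (S := Module.End KK (FockV ℓ)) L (Heis.crea ψ))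
    rw [PowerSeries.coeff_map] at this
    exact (LinearMap.congr_fun this v).symm
  · rw [PowerSeries.coeff_map, h0, map_zero]
  · intro m hm
    rw [h _ (by simpa using hm), PowerSeries.coeff_map, Heis.crea, PowerSeries.coeff_mk, if_neg hm]
    congr 1
    obtain ⟨k, rfl⟩ : ∃ k, m = k + 1 := ⟨m - 1, by omega⟩
    rw [map_sum, Heis.modeOp]
    refine Finset.sum_congr rfl fun j _ => ?_
    rw [Heis.mode_neg_succ]
    exact (map_smul L _ _).symm

/-- A pair `(b, c)` with `b - c = n` is determined by `c`, and only `c` below the bound of `v`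
contributes. The `finsum` in the definition thus has finite support and equals the vertex operator
on each Fock module. -/
theorem normalExp_single {φ : ℤ → Module.End KK (Fock ℓ)} {ψ : ℤ → Fin ℓ → KK}
    (h : ∀ m, m ≠ 0 → φ m = liftEnd ℓ (Heis.modeOp (heis ℓ) ψ m)) (n : ℤ) (μ : P ℓ)
    (v : FockV ℓ) : normalExp φ n (Finsupp.single μ v) =
      Finsupp.single μ (Heis.vertex (heis ℓ) ψ n v) := by
  obtain ⟨B, hB⟩ := Heis.exists_isBound (heis ℓ) v
  rw [Heis.vertex_eq hB, normalExp]
  simp only [expCoeff_anni h, expCoeff_crea h, finsum_eq_if]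
  rw [Finsupp.single_finsetSum, finsum_eq_sum_of_support_subset (s := ((Finset.range B).filter
    fun c : ℕ => 0 ≤ n + c).image fun c : ℕ => ((n + c).toNat, c))]
  · rw [Finset.sum_image (by intro a _ b _ hab; exact (Prod.mk.inj hab).2), Finset.sum_filter]
    refine Finset.sum_congr rfl fun c _ => ?_
    by_cases hc : 0 ≤ n + (c : ℤ)
    · rw [if_pos hc, if_pos (by dsimp only; omega), Heis.creaExpZ, if_pos hc]
    · rw [if_neg hc, Heis.creaExpZ, if_neg hc, zero_mul, Finsupp.single_zero]
  · rintro ⟨b, c⟩ hp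
    rw [Function.mem_support] at hp
    dsimp only at hp
    have h1 : (b : ℤ) - c = n := by
      by_contra h1
      exact hp (if_neg h1)
    rw [if_pos h1] at hp
    have h2 : c < B := by
      by_contra h2
      exact hp (by rw [hB ψ c (not_lt.1 h2), mul_zero, Finsupp.single_zero])
    simp only [Finset.coe_image, Finset.coe_filter, Finset.mem_range, Set.mem_image,
      Set.mem_ofPred_eq, Prod.mk.injEq]
    exact ⟨c, ⟨h2, by omega⟩, by omega, rfl⟩

end DeformedW

end

noncomputable section

namespace DeformedW

open Polynomial PowerSeries

variable {ℓ : ℕ}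

/-! ### The mode families of monomials and screening currents -/

/-- The coefficients of `a_i[m]`. -/
def aModes (ℓ : ℕ) (i : Fin ℓ) : ℤ → Fin ℓ → KK := fun m j =>
  if j = i then (q ^ m - q ^ (-m)) / (m : KK) else 0

/-- The coefficients of `y_i[m]`. -/
def yModes (ℓ : ℕ) (i : Fin ℓ) : ℤ → Fin ℓ → KK := fun m j =>
  (cartanQT ℓ m)⁻¹ j i * ((q ^ m - q ^ (-m)) / (m : KK))

/-- The coefficients of the exponent of a monomial. -/
def monModes (M : Mon ℓ) : ℤ → Fin ℓ → KK := fun m j =>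
  M.sum fun p d => ((d : KK) * p.2.eval ^ (-m)) * yModes ℓ p.1 m j

/-- The coefficients of `a_i[m] / (u^m - u^{-m})`. -/
def screenModes (ℓ : ℕ) (u : KK) (i : Fin ℓ) : ℤ → Fin ℓ → KK := fun m j =>
  (u ^ m - u ^ (-m))⁻¹ * aModes ℓ i m j

theorem liftEnd_modeOp (ψ : ℤ → Fin ℓ → KK) (m : ℤ) :
    liftEnd ℓ (Heis.modeOp (heis ℓ) ψ m) = ∑ j, ψ m j • x ℓ j m := by
  rw [Heis.modeOp, map_sum]
  refine Finset.sum_congr rfl fun j _ => ?_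
  rw [x_eq]
  exact map_smul (liftEnd ℓ) _ _

theorem a_eq (i : Fin ℓ) (m : ℤ) : a ℓ i m = ∑ j, aModes ℓ i m j • x ℓ j m := by
  simp only [aModes, ite_smul, zero_smul, Finset.sum_ite_eq', Finset.mem_univ, if_true]
  rfl

theorem y_eq (i : Fin ℓ) (m : ℤ) : y ℓ i m = ∑ j, yModes ℓ i m j • x ℓ j m := by
  rw [y]
  refine Finset.sum_congr rfl fun j _ => ?_
  rw [a, smul_smul]
  rfl

theorem mon_modes_eq (M : Mon ℓ) (m : ℤ) :
    (M.sum fun p d => ((d : KK) * p.2.eval ^ (-m)) • y ℓ p.1 m) =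
      liftEnd ℓ (Heis.modeOp (heis ℓ) (monModes M) m) := by
  rw [liftEnd_modeOp]
  simp only [monModes, Finsupp.sum, Finset.sum_smul, y_eq, Finset.smul_sum, smul_smul]
  rw [Finset.sum_comm]

/-! ### Pairings -/

/-- The structure constants are a scalar times `D C`, while the `y_i` are defined through `C⁻¹`. The
two cancel, so `Y_i` has contractions only with the screening current at its own node. -/
theorem pairing_y_a (i k : Fin ℓ) {n : ℕ} (hn : n ≠ 0) :
    Heis.pairing (heis ℓ) (yModes ℓ i) (aModes ℓ k) n =
      if i = k then (q ^ (n * rr ℓ k) - q ^ (-(n * rr ℓ k))) * (t ^ (n : ℤ) - t ^ (-(n : ℤ))) / n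
      else 0 := by
  have hn' : (n : ℤ) ≠ 0 := by exact_mod_cast hn
  have hq := q_zpow_sub_ne_zero hn'
  have hnK : (n : KK) ≠ 0 := by exact_mod_cast hn
  have hC := congrFun (congrFun (Matrix.mul_nonsing_inv _ (isUnit_det_cartanQT ℓ hn')) k) i
  rw [Matrix.mul_apply] at hC
  have e : Heis.contraction (heis ℓ) (yModes ℓ i) k n =
      (q ^ (n * rr ℓ k) - q ^ (-(n * rr ℓ k))) * (t ^ (n : ℤ) - t ^ (-(n : ℤ))) /
        (q ^ (n : ℤ) - (q ^ (n : ℤ))⁻¹) * (1 : Matrix (Fin ℓ) (Fin ℓ) KK) k i := by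
    rw [← hC, Heis.contraction, Finset.mul_sum]
    refine Finset.sum_congr rfl fun j _ => ?_
    rw [heis, symCartanQT_symm ℓ hn', symCartanQT, Matrix.of_apply, yModes, qInt, ← zpow_mul,
      ← zpow_mul, ← zpow_natCast, ← zpow_natCast, zpow_neg t, mul_neg, Int.cast_natCast, zpow_neg q]
    field_simp
  rw [Heis.pairing, Finset.sum_eq_single k]
  · rw [e, aModes, if_pos rfl, Matrix.one_apply]
    push_cast
    rw [neg_neg, zpow_neg q (n : ℤ)]
    by_cases h : i = k
    · rw [if_pos h, if_pos h.symm, mul_one]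
      have e2 : (q ^ (n : ℤ))⁻¹ - q ^ (n : ℤ) = -(q ^ (n : ℤ) - (q ^ (n : ℤ))⁻¹) := (neg_sub _ _).symm
      rw [e2]
      generalize q ^ (n : ℤ) - (q ^ (n : ℤ))⁻¹ = z at hq ⊢
      field_simp
    · rw [if_neg h, if_neg (Ne.symm h), mul_zero, mul_zero]
  · intro j _ hj
    rw [aModes, if_neg hj, zero_mul]
  · simp

/-- The value for the opposite order is the same, because `B` is symmetric and `C(q^n, t^n)` is even
in `n`. -/
theorem pairing_a_y (i k : Fin ℓ) {n : ℕ} (hn : n ≠ 0) :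
    Heis.pairing (heis ℓ) (aModes ℓ k) (yModes ℓ i) n =
      if i = k then (q ^ (n * rr ℓ k) - q ^ (-(n * rr ℓ k))) * (t ^ (n : ℤ) - t ^ (-(n : ℤ))) / n
      else 0 := by
  have hn' : (n : ℤ) ≠ 0 := by exact_mod_cast hn
  have e1 : Heis.pairing (heis ℓ) (yModes ℓ i) (aModes ℓ k) n =
      aModes ℓ k (-n) k * Heis.contraction (heis ℓ) (yModes ℓ i) k n := by
    rw [Heis.pairing, Finset.sum_eq_single k]
    · intro j _ hj
      rw [aModes, if_neg hj, zero_mul]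
    · simp
  have e2 : ∀ j, Heis.contraction (heis ℓ) (aModes ℓ k) j n = aModes ℓ k n k * heis ℓ n k j := by
    intro j
    rw [Heis.contraction, Finset.sum_eq_single k]
    · intro j _ hj
      rw [aModes, if_neg hj, zero_mul]
    · simp
  have e3 : ∀ m : ℤ, (q ^ (-m) - q ^ (- -m)) / ((-m : ℤ) : KK) = (q ^ m - q ^ (-m)) / (m : KK) := by
    intro m
    push_cast
    rw [neg_neg, ← neg_sub (q ^ m)]
    exact neg_div_neg_eq _ _
  rw [← pairing_y_a i k hn, e1, Heis.pairing, Heis.contraction, Finset.mul_sum]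
  refine Finset.sum_congr rfl fun j _ => ?_
  rw [e2]
  simp only [heis, yModes, aModes, if_true, cartanQT_neg, e3]
  rw [symCartanQT_symm ℓ hn' k j]
  ring

/-- The parameters `(p, u)` of the screening current `:exp(∑ a_i[m] / (u^m - u^{-m}) w^{-m}):`,
which satisfies `[y_i[n], s_i[-n]] = (p^n - p^{-n}) / n`. -/
def IsScreenPair (r : ℤ) (p u : KK) : Prop :=
  (p = qt 0 (-1) ∧ u = qt r 0) ∨ (p = qt r 0 ∧ u = qt 0 (-1))

theorem IsScreenPair.mul_eq {r : ℤ} {p u : KK} (h : IsScreenPair r p u) (n : ℤ) :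
    (q ^ (n * r) - q ^ (-(n * r))) * (t ^ n - t ^ (-n)) =
      -((u ^ n - u ^ (-n)) * (p ^ n - p ^ (-n))) := by
  have e1 : q ^ (n * r) = qt r 0 ^ n := by rw [qt_zpow, q_zpow_eq, mul_zero]
  have e2 : q ^ (-(n * r)) = qt r 0 ^ (-n) := by rw [qt_zpow, q_zpow_eq, mul_zero, neg_mul]
  have e3 : t ^ n = qt 0 (-1) ^ (-n) := by rw [qt_zpow, t_zpow_eq]; simp
  have e4 : t ^ (-n) = qt 0 (-1) ^ n := by rw [qt_zpow, t_zpow_eq]; simp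
  rw [e1, e2, e3, e4]
  rcases h with ⟨rfl, rfl⟩ | ⟨rfl, rfl⟩ <;> ring

theorem IsScreenPair.sub_ne_zero {r : ℤ} {p u : KK} (h : IsScreenPair r p u) (hr : r ≠ 0) {n : ℤ}
    (hn : n ≠ 0) : u ^ n - u ^ (-n) ≠ 0 := by
  rw [_root_.sub_ne_zero]
  rcases h with ⟨rfl, rfl⟩ | ⟨rfl, rfl⟩ <;> rw [qt_zpow, qt_zpow, Ne, qt_inj]
  · intro h'
    have h1 : (n + n) * r = 0 := by linear_combination h'.1
    rcases mul_eq_zero.1 h1 with h2 | h2 <;> omega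
  · omega

theorem IsScreenPair.left_ne_zero {r : ℤ} {p u : KK} (h : IsScreenPair r p u) : p ≠ 0 := by
  rcases h with ⟨rfl, rfl⟩ | ⟨rfl, rfl⟩ <;> exact qt_ne_zero _ _

theorem IsScreenPair.right_ne_zero {r : ℤ} {p u : KK} (h : IsScreenPair r p u) : u ≠ 0 := by
  rcases h with ⟨rfl, rfl⟩ | ⟨rfl, rfl⟩ <;> exact qt_ne_zero _ _

/-- This product is the same for both screening currents. The shift `q^{-r} t` of the algorithm is
its inverse, which allows both to be treated at once. -/
theorem IsScreenPair.mul_left_right {r : ℤ} {p u : KK} (h : IsScreenPair r p u) :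
    p * u = qt r (-1) := by
  rcases h with ⟨rfl, rfl⟩ | ⟨rfl, rfl⟩ <;> rw [← qt_add] <;> simp

theorem pairing_smul_right (H : ℕ → Fin ℓ → Fin ℓ → KK) (ψ χ : ℤ → Fin ℓ → KK) (f : ℤ → KK)
    (n : ℕ) : Heis.pairing H ψ (fun m j => f m * χ m j) n = f (-n) * Heis.pairing H ψ χ n := by
  simp only [Heis.pairing, Finset.mul_sum, mul_assoc]

theorem pairing_smul_left (H : ℕ → Fin ℓ → Fin ℓ → KK) (ψ χ : ℤ → Fin ℓ → KK) (f : ℤ → KK)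
    (n : ℕ) : Heis.pairing H (fun m j => f m * ψ m j) χ n = f n * Heis.pairing H ψ χ n := by
  simp only [Heis.pairing, Heis.contraction, Finset.mul_sum]
  refine Finset.sum_congr rfl fun j _ => Finset.sum_congr rfl fun i _ => by ring

theorem pairing_y_screen {p u : KK} (i k : Fin ℓ) (h : IsScreenPair (rr ℓ k) p u) {n : ℕ}
    (hn : n ≠ 0) : Heis.pairing (heis ℓ) (yModes ℓ i) (screenModes ℓ u k) n =
      if i = k then (p ^ (n : ℤ) - p ^ (-(n : ℤ))) / n else 0 := by
  have hn' : (n : ℤ) ≠ 0 := by exact_mod_cast hn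
  have hu := h.sub_ne_zero (rr_ne_zero ℓ k) hn'
  refine (pairing_smul_right _ _ _ _ _).trans ?_
  rw [pairing_y_a i k hn]
  split_ifs
  · have e2 : u ^ (-(n : ℤ)) - u ^ (n : ℤ) = -(u ^ (n : ℤ) - u ^ (-(n : ℤ))) := (neg_sub _ _).symm
    rw [h.mul_eq, neg_neg, e2]
    generalize u ^ (n : ℤ) - u ^ (-(n : ℤ)) = z at hu ⊢
    field_simp
  · rw [mul_zero]

theorem pairing_screen_y {p u : KK} (i k : Fin ℓ) (h : IsScreenPair (rr ℓ k) p u) {n : ℕ}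
    (hn : n ≠ 0) : Heis.pairing (heis ℓ) (screenModes ℓ u k) (yModes ℓ i) n =
      if i = k then -((p ^ (n : ℤ) - p ^ (-(n : ℤ))) / n) else 0 := by
  have hn' : (n : ℤ) ≠ 0 := by exact_mod_cast hn
  have hu := h.sub_ne_zero (rr_ne_zero ℓ k) hn'
  refine (pairing_smul_left _ _ _ _ _).trans ?_
  rw [pairing_a_y i k hn]
  split_ifs
  · rw [h.mul_eq]
    generalize u ^ (n : ℤ) - u ^ (-(n : ℤ)) = z at hu ⊢
    field_simp
  · rw [mul_zero]

/-- The part of a monomial in the variables `Y_i`, for a fixed node `i`. -/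
def nodePart (M : Mon ℓ) (i : Fin ℓ) : Spec →₀ ℤ :=
  M.comapDomain (Prod.mk i) (Prod.mk_right_injective i).injOn

theorem nodePart_apply (M : Mon ℓ) (i : Fin ℓ) (s : Spec) : nodePart M i s = M (i, s) := rfl

theorem sum_nodePart {A : Type*} [AddCommMonoid A] (M : Mon ℓ) (i : Fin ℓ) (g : Spec → ℤ → A) :
    (M.sum fun p d => if p.1 = i then g p.2 d else 0) = (nodePart M i).sum g := by
  classical
  rw [Finsupp.sum, Finsupp.sum]
  symm
  refine Finset.sum_of_injOn (fun s => (i, s)) ?_ ?_ ?_ ?_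
  · intro s _ s' _ h
    exact (Prod.mk.inj h).2
  · intro s hs
    rw [Finset.mem_coe, Finsupp.mem_support_iff] at hs ⊢
    exact hs
  · rintro ⟨j, s⟩ hj hs
    dsimp only
    split_ifs with h
    · exfalso
      subst h
      apply hs
      refine ⟨s, ?_, rfl⟩
      rw [Finset.mem_coe, Finsupp.mem_support_iff, nodePart_apply]
      exact Finsupp.mem_support_iff.1 hj
    · rfl
  · intro s _
    simp [nodePart_apply]

theorem pairing_mon_screen {p u : KK} (M : Mon ℓ) (k : Fin ℓ) (h : IsScreenPair (rr ℓ k) p u)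
    {n : ℕ} (hn : n ≠ 0) : Heis.pairing (heis ℓ) (monModes M) (screenModes ℓ u k) n =
      (nodePart M k).sum fun s d =>
        (d : KK) * (s.eval ^ (-(n : ℤ)) * ((p ^ (n : ℤ) - p ^ (-(n : ℤ))) / n)) := by
  rw [← sum_nodePart M k (fun s d =>
        (d : KK) * (s.eval ^ (-(n : ℤ)) * ((p ^ (n : ℤ) - p ^ (-(n : ℤ))) / n)))]
  have e : Heis.pairing (heis ℓ) (monModes M) (screenModes ℓ u k) n =
      M.sum fun s d => ((d : KK) * s.2.eval ^ (-(n : ℤ))) *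
        Heis.pairing (heis ℓ) (yModes ℓ s.1) (screenModes ℓ u k) n := by
    simp only [Heis.pairing, Heis.contraction, monModes, Finsupp.sum, Finset.mul_sum,
      Finset.sum_mul]
    refine Eq.trans ?_ Finset.sum_comm
    refine Finset.sum_congr rfl fun j _ => ?_
    refine Eq.trans ?_ Finset.sum_comm
    refine Finset.sum_congr rfl fun i _ => Finset.sum_congr rfl fun p _ => by ring
  rw [e]
  refine Finset.sum_congr rfl fun s _ => ?_
  dsimp only
  rw [pairing_y_screen s.1 k h hn]
  split_ifs
  · ring
  · ring

theorem pairing_screen_mon {p u : KK} (M : Mon ℓ) (k : Fin ℓ) (h : IsScreenPair (rr ℓ k) p u)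
    {n : ℕ} (hn : n ≠ 0) : Heis.pairing (heis ℓ) (screenModes ℓ u k) (monModes M) n =
      (nodePart M k).sum fun s d =>
        (d : KK) * (s.eval ^ (n : ℤ) * (-((p ^ (n : ℤ) - p ^ (-(n : ℤ))) / n))) := by
  rw [← sum_nodePart M k (fun s d =>
        (d : KK) * (s.eval ^ (n : ℤ) * (-((p ^ (n : ℤ) - p ^ (-(n : ℤ))) / n))))]
  have e : Heis.pairing (heis ℓ) (screenModes ℓ u k) (monModes M) n =
      M.sum fun s d => ((d : KK) * s.2.eval ^ (n : ℤ)) *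
        Heis.pairing (heis ℓ) (screenModes ℓ u k) (yModes ℓ s.1) n := by
    simp only [Heis.pairing, Heis.contraction, monModes, Finsupp.sum, Finset.mul_sum,
      Finset.sum_mul, neg_neg]
    refine Eq.trans ?_ Finset.sum_comm
    refine Eq.trans ?_ (Finset.sum_congr rfl fun _ _ => Finset.sum_comm)
    refine Finset.sum_congr rfl fun j _ => ?_
    refine Finset.sum_congr rfl fun i _ => Finset.sum_congr rfl fun p _ => by ring
  rw [e]
  refine Finset.sum_congr rfl fun s _ => ?_
  dsimp only
  rw [pairing_screen_y s.1 k h hn]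
  split_ifs
  · ring
  · ring

end DeformedW

end

noncomputable section

namespace DeformedW

open Polynomial PowerSeries

/-! ### The zeros and poles of the contraction of a monomial with a screening current -/

namespace Heis

variable {𝕜 : Type*} [Field 𝕜]

/-- The zero of the contraction attached to a factor of sign `ε` at the point `x`. -/
def zeroPt (p u x : 𝕜) : SignType → 𝕜
  -- For the sign `0` the zero and the pole coincide and cancel; in this way the formula with two
  -- zeros and two poles also covers monomials with fewer factors.
  | .zero => p / x
  | .pos => p⁻¹ / x
  | .neg => p ^ 3 * u ^ 2 / x

/-- The pole of the contraction attached to a factor of sign `ε` at the point `x`. -/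
def polePt (p u x : 𝕜) : SignType → 𝕜
  | .zero => p / x
  | .pos => p / x
  | .neg => p * u ^ 2 / x

theorem zeroPt_ne_zero {p u x : 𝕜} (hp : p ≠ 0) (hu : u ≠ 0) (hx : x ≠ 0) (ε : SignType) :
    zeroPt p u x ε ≠ 0 := by
  cases ε <;> simp [zeroPt, *]

theorem polePt_ne_zero {p u x : 𝕜} (hp : p ≠ 0) (hu : u ≠ 0) (hx : x ≠ 0) (ε : SignType) :
    polePt p u x ε ≠ 0 := by
  cases ε <;> simp [polePt, *]

/-- The quotient of the coefficients of two monomials related by a flip at `x`, when the other factor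
has the zero `a` and the pole `b`. -/
def flipFactor (p u x a b : 𝕜) : 𝕜 :=
  (p / x - a) * (p * u ^ 2 / x - b) / ((p / x - b) * (p * u ^ 2 / x - a))

/-- This identity explains the coefficients of the algorithm: `flipFactor` is the ratio for which
the residues at the two poles become opposite. The power `(p * u) ^ 2` comes from the constant
prefactors of the monomials. -/
theorem poleCoeff_flip {p u x a b : 𝕜} (hp : p ≠ 0) (hu : u ≠ 0) (hx : x ≠ 0) (ha : a ≠ 0)
    (h1 : polePt p u x 1 ≠ b) (h2 : polePt p u x (-1) ≠ b) (h3 : polePt p u x (-1) ≠ a) :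
    flipFactor p u x a b * (p * u) ^ 2 *
        (poleCoeff (zeroPt p u x (-1)) a (polePt p u x (-1)) b * (polePt p u x (-1))⁻¹) =
      -(poleCoeff (zeroPt p u x 1) a (polePt p u x 1) b * (polePt p u x 1)⁻¹) := by
  change p / x ≠ b at h1
  change p * u ^ 2 / x ≠ b at h2
  change p * u ^ 2 / x ≠ a at h3
  change _ * (poleCoeff (p ^ 3 * u ^ 2 / x) a (p * u ^ 2 / x) b * (p * u ^ 2 / x)⁻¹) =
    -(poleCoeff (p⁻¹ / x) a (p / x) b * (p / x)⁻¹)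
  rw [← sub_ne_zero] at h1 h2 h3
  rw [flipFactor, poleCoeff, poleCoeff]
  have e1 : p * u ^ 2 / x - p ^ 3 * u ^ 2 / x = (1 - p ^ 2) * (p * u ^ 2) / x := by
    field_simp
  have e2 : p / x - p⁻¹ / x = (p ^ 2 - 1) / (p * x) := by
    field_simp
  rw [e1, e2]
  generalize p / x - b = A at *
  generalize p * u ^ 2 / x - b = B at *
  generalize p * u ^ 2 / x - a = C at *
  generalize p / x - a = D at *
  field_simp
  ring

theorem flipFactor_self {p u x a : 𝕜} (h1 : polePt p u x 1 ≠ a) (h2 : polePt p u x (-1) ≠ a) :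
    flipFactor p u x a a = 1 := by
  change p / x ≠ a at h1
  change p * u ^ 2 / x ≠ a at h2
  rw [← sub_ne_zero] at h1 h2
  rw [flipFactor, div_self (mul_ne_zero h1 h2)]

theorem mul_div_mul_cancel₄ {A B : 𝕜} (hA : A ≠ 0) (hB : B ≠ 0) (a b c d : 𝕜) :
    A * a * (B * b) / (A * c * (B * d)) = a * b / (c * d) := by
  rw [mul_mul_mul_comm A a, mul_mul_mul_comm A c, mul_div_mul_left _ _ (mul_ne_zero hA hB)]

/-- This and `flipFactor_neg` identify the ratio of residues with the factor of the algorithm. A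
negative factor at `y` is the variable at `y (p u)⁻²` with exponent `-1`, whence the inverse there.
-/
theorem flipFactor_pos {p u x y : 𝕜} (hp : p ≠ 0) (hu : u ≠ 0) (hx : x ≠ 0) (hy : y ≠ 0) :
    flipFactor p u x (zeroPt p u y 1) (polePt p u y 1) =
      (1 - (p ^ 2)⁻¹ * (x / y)) * (1 - (u ^ 2)⁻¹ * (x / y)) /
        ((1 - x / y) * (1 - (p ^ 2)⁻¹ * (u ^ 2)⁻¹ * (x / y))) := by
  change flipFactor p u x (p⁻¹ / y) (p / y) = _
  have e1 : p / x - p⁻¹ / y = p / x * (1 - (p ^ 2)⁻¹ * (x / y)) := by field_simp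
  have e2 : p * u ^ 2 / x - p / y = p * u ^ 2 / x * (1 - (u ^ 2)⁻¹ * (x / y)) := by field_simp
  have e3 : p / x - p / y = p / x * (1 - x / y) := by field_simp
  have e4 : p * u ^ 2 / x - p⁻¹ / y =
      p * u ^ 2 / x * (1 - (p ^ 2)⁻¹ * (u ^ 2)⁻¹ * (x / y)) := by field_simp
  have h1 : p / x ≠ 0 := div_ne_zero hp hx
  have h2 : p * u ^ 2 / x ≠ 0 := div_ne_zero (mul_ne_zero hp (pow_ne_zero _ hu)) hx
  rw [flipFactor, e1, e2, e3, e4, mul_div_mul_cancel₄ h1 h2]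

theorem flipFactor_neg {p u x y : 𝕜} (hp : p ≠ 0) (hu : u ≠ 0) (hx : x ≠ 0) (hy : y ≠ 0) :
    flipFactor p u x (zeroPt p u y (-1)) (polePt p u y (-1)) =
      ((1 - (p ^ 2)⁻¹ * (x / (y * ((p * u) ^ 2)⁻¹))) * (1 - (u ^ 2)⁻¹ * (x / (y * ((p * u) ^ 2)⁻¹))) /
        ((1 - x / (y * ((p * u) ^ 2)⁻¹)) *
          (1 - (p ^ 2)⁻¹ * (u ^ 2)⁻¹ * (x / (y * ((p * u) ^ 2)⁻¹)))))⁻¹ := by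
  change flipFactor p u x (p ^ 3 * u ^ 2 / y) (p * u ^ 2 / y) = _
  have e1 : p / x - p ^ 3 * u ^ 2 / y = p / x * (1 - x / (y * ((p * u) ^ 2)⁻¹)) := by
    field_simp
  have e2 : p * u ^ 2 / x - p * u ^ 2 / y =
      p * u ^ 2 / x * (1 - (p ^ 2)⁻¹ * (u ^ 2)⁻¹ * (x / (y * ((p * u) ^ 2)⁻¹))) := by
    field_simp
  have e3 : p / x - p * u ^ 2 / y = p / x * (1 - (p ^ 2)⁻¹ * (x / (y * ((p * u) ^ 2)⁻¹))) := by
    field_simp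
  have e4 : p * u ^ 2 / x - p ^ 3 * u ^ 2 / y =
      p * u ^ 2 / x * (1 - (u ^ 2)⁻¹ * (x / (y * ((p * u) ^ 2)⁻¹))) := by field_simp
  have h1 : p / x ≠ 0 := div_ne_zero hp hx
  have h2 : p * u ^ 2 / x ≠ 0 := div_ne_zero (mul_ne_zero hp (pow_ne_zero _ hu)) hx
  rw [flipFactor, e1, e2, e3, e4, mul_div_mul_cancel₄ h1 h2, inv_div]

/-- The remaining two poles of a string of three monomials cancel, if `b = x u²`. -/
theorem poleCoeff_string {p u x : 𝕜} (hp : p ≠ 0) (hu : u ≠ 0) (hx : x ≠ 0)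
    (h1 : 1 - u ^ 2 ≠ 0) (h2 : 1 - u ^ 4 ≠ 0) (h3 : 1 - p ^ 2 * u ^ 2 ≠ 0)
    (h4 : 1 - p ^ 2 * u ^ 4 ≠ 0) :
    flipFactor p u x (zeroPt p u (x * u ^ 2) 1) (polePt p u (x * u ^ 2) 1) *
      flipFactor p u (x * u ^ 2) (zeroPt p u x (-1)) (polePt p u x (-1)) * (p * u) ^ 4 *
        (poleCoeff (zeroPt p u x (-1)) (zeroPt p u (x * u ^ 2) (-1)) (polePt p u x (-1))
          (polePt p u (x * u ^ 2) (-1)) * (polePt p u x (-1))⁻¹) =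
      -(poleCoeff (zeroPt p u (x * u ^ 2) 1) (zeroPt p u x 1) (polePt p u (x * u ^ 2) 1)
          (polePt p u x 1) * (polePt p u (x * u ^ 2) 1)⁻¹) := by
  change flipFactor p u x (p⁻¹ / (x * u ^ 2)) (p / (x * u ^ 2)) *
    flipFactor p u (x * u ^ 2) (p ^ 3 * u ^ 2 / x) (p * u ^ 2 / x) * (p * u) ^ 4 *
        (poleCoeff (p ^ 3 * u ^ 2 / x) (p ^ 3 * u ^ 2 / (x * u ^ 2)) (p * u ^ 2 / x)
          (p * u ^ 2 / (x * u ^ 2)) * (p * u ^ 2 / x)⁻¹) =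
      -(poleCoeff (p⁻¹ / (x * u ^ 2)) (p⁻¹ / x) (p / (x * u ^ 2)) (p / x) *
        (p / (x * u ^ 2))⁻¹)
  have hu2 : u ^ 2 - 1 ≠ 0 := by rwa [← neg_sub, neg_ne_zero] at h1
  -- The factors of the two steps along the string are inverse to each other, so the monomials at
  -- its ends have equal coefficients.
  have E : flipFactor p u x (p⁻¹ / (x * u ^ 2)) (p / (x * u ^ 2)) *
    flipFactor p u (x * u ^ 2) (p ^ 3 * u ^ 2 / x) (p * u ^ 2 / x) = 1 := by
    have e1 : p / x - p⁻¹ / (x * u ^ 2) = -(1 - p ^ 2 * u ^ 2) / (p * x * u ^ 2) := by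
      field_simp; ring
    have e2 : p * u ^ 2 / x - p / (x * u ^ 2) = -p * (1 - u ^ 4) / (x * u ^ 2) := by
      field_simp; ring
    have e3 : p / x - p / (x * u ^ 2) = -p * (1 - u ^ 2) / (x * u ^ 2) := by field_simp; ring
    have e4 : p * u ^ 2 / x - p⁻¹ / (x * u ^ 2) = -(1 - p ^ 2 * u ^ 4) / (p * x * u ^ 2) := by
      field_simp; ring
    have e5 : p / (x * u ^ 2) - p ^ 3 * u ^ 2 / x = p * (1 - p ^ 2 * u ^ 4) / (x * u ^ 2) := by
      field_simp
    have e6 : p * u ^ 2 / (x * u ^ 2) - p * u ^ 2 / x = p * (1 - u ^ 2) / x := by field_simp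
    have e7 : p / (x * u ^ 2) - p * u ^ 2 / x = p * (1 - u ^ 4) / (x * u ^ 2) := by field_simp
    have e8 : p * u ^ 2 / (x * u ^ 2) - p ^ 3 * u ^ 2 / x = p * (1 - p ^ 2 * u ^ 2) / x := by
      field_simp
    rw [flipFactor, flipFactor, e1, e2, e3, e4, e5, e6, e7, e8]
    generalize 1 - p ^ 2 * u ^ 2 = A at *
    generalize 1 - p ^ 2 * u ^ 4 = B at *
    generalize 1 - u ^ 2 = C at *
    generalize 1 - u ^ 4 = D at *
    field_simp
  rw [E, one_mul, poleCoeff, poleCoeff]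
  have e1 : p * u ^ 2 / x - p ^ 3 * u ^ 2 / x = p * u ^ 2 * (1 - p ^ 2) / x := by field_simp
  have e2 : p * u ^ 2 / x - p ^ 3 * u ^ 2 / (x * u ^ 2) = p * (u ^ 2 - p ^ 2) / x := by field_simp
  have e3 : p * u ^ 2 / x - p * u ^ 2 / (x * u ^ 2) = p * (u ^ 2 - 1) / x := by field_simp
  have e4 : p / (x * u ^ 2) - p⁻¹ / (x * u ^ 2) = -(1 - p ^ 2) / (p * x * u ^ 2) := by
    field_simp; ring
  have e5 : p / (x * u ^ 2) - p⁻¹ / x = -(u ^ 2 - p ^ 2) / (p * x * u ^ 2) := by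
    field_simp; ring
  have e6 : p / (x * u ^ 2) - p / x = -p * (u ^ 2 - 1) / (x * u ^ 2) := by field_simp; ring
  rw [e1, e2, e3, e4, e5, e6]
  generalize u ^ 2 - 1 = C at *
  field_simp

theorem poleCoeff_eq_zero {a₁ a₂ b₁ b₂ : 𝕜} (h : b₁ = a₁ ∨ b₁ = a₂) :
    poleCoeff a₁ a₂ b₁ b₂ = 0 := by
  rcases h with rfl | rfl <;> simp [poleCoeff]

end Heis

variable {ℓ : ℕ}

/-- The part at a node of a factor of sign `ε` at the point `X`. -/
def dbl (r : ℤ) (X : Spec) : SignType → (Spec →₀ ℤ)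
  | .zero => 0
  | .pos => Finsupp.single X 1
  | .neg => -Finsupp.single (X.mulQT (-2 * r) 2) 1

theorem sum_dbl {A : Type*} [AddCommGroup A] (r : ℤ) (X : Spec) (ε : SignType)
    (g : Spec → ℤ → A) (g0 : ∀ s, g s 0 = 0) (gneg : ∀ s, g s (-1) = -g s 1) :
    (dbl r X ε).sum g = match ε with
      | .zero => 0
      | .pos => g X 1
      | .neg => -g (X.mulQT (-2 * r) 2) 1 := by
  cases ε
  · simp [dbl]
  · simp only [dbl]
    rw [← Finsupp.single_neg, Finsupp.sum_single_index (g0 _), gneg]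
  · simp only [dbl]
    rw [Finsupp.sum_single_index (g0 _)]

theorem IsScreenPair.eval_neg {r : ℤ} {p u : KK} (h : IsScreenPair r p u) (X : Spec) :
    (X.mulQT (-2 * r) 2).eval = X.eval * ((p * u) ^ 2)⁻¹ := by
  rw [Spec.eval_mulQT, h.mul_left_right]
  congr 1
  rw [← zpow_natCast, qt_zpow, ← qt_neg]
  congr 1 <;> (push_cast; ring)

/-- The numbers `q^{-2r}` and `t^2` are `p⁻²` and `u⁻²` in one order or the other, and the factor is
symmetric in them. This is why one choice of coefficients works for both screening operators. -/
theorem IsScreenPair.factor_eq {r : ℤ} {p u : KK} (h : IsScreenPair r p u) (x : KK) :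
    (1 - q ^ (-2 * r) * x) * (1 - t ^ 2 * x) / ((1 - x) * (1 - q ^ (-2 * r) * t ^ 2 * x)) =
      (1 - (p ^ 2)⁻¹ * x) * (1 - (u ^ 2)⁻¹ * x) /
        ((1 - x) * (1 - (p ^ 2)⁻¹ * (u ^ 2)⁻¹ * x)) := by
  have e1 : (qt r 0 ^ 2)⁻¹ = q ^ (-2 * r) := by
    rw [← zpow_natCast, qt_zpow, ← qt_neg, q_zpow_eq]
    congr 1 <;> (push_cast; ring)
  have e2 : (qt 0 (-1) ^ 2)⁻¹ = t ^ 2 := by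
    rw [← zpow_natCast, ← zpow_natCast, qt_zpow, ← qt_neg, t_zpow_eq]
    congr 1
  rcases h with ⟨rfl, rfl⟩ | ⟨rfl, rfl⟩
  · rw [e1, e2]
    ring
  · rw [e1, e2]

theorem logSeq_profile {p u : KK} {M : Mon ℓ} {k : Fin ℓ} (h : IsScreenPair (rr ℓ k) p u)
    {X Z : Spec} {ε δ : SignType} (hM : nodePart M k = dbl (rr ℓ k) X ε + dbl (rr ℓ k) Z δ) {n : ℕ}
    (hn : n ≠ 0) : Heis.pairing (heis ℓ) (monModes M) (screenModes ℓ u k) n =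
      Heis.logSeq (Heis.zeroPt p u X.eval ε) (Heis.zeroPt p u Z.eval δ)
        (Heis.polePt p u X.eval ε) (Heis.polePt p u Z.eval δ) n := by
  have hp := h.left_ne_zero
  have hu := h.right_ne_zero
  have hX := X.eval_ne_zero
  have hZ := Z.eval_ne_zero
  have hnK : (n : KK) ≠ 0 := by exact_mod_cast hn
  rw [pairing_mon_screen M k h hn, hM, Finsupp.sum_add_index' (by simp) (by intros; push_cast; ring),
    sum_dbl _ _ _ _ (by simp) (by intros; push_cast; ring),
    sum_dbl _ _ _ _ (by simp) (by intros; push_cast; ring)]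
  have key : ∀ (W : Spec) (ε : SignType), (match ε with
      | .zero => (0 : KK)
      | .pos => ((1 : ℤ) : KK) * (W.eval ^ (-(n : ℤ)) * ((p ^ (n : ℤ) - p ^ (-(n : ℤ))) / n))
      | .neg => -(((1 : ℤ) : KK) * ((W.mulQT (-2 * rr ℓ k) 2).eval ^ (-(n : ℤ)) *
          ((p ^ (n : ℤ) - p ^ (-(n : ℤ))) / n)))) =
      ((Heis.polePt p u W.eval ε) ^ n - (Heis.zeroPt p u W.eval ε) ^ n) / n := by
    intro W ε
    have hW := W.eval_ne_zero
    rw [h.eval_neg]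
    generalize W.eval = w at hW ⊢
    cases ε <;> simp only [Heis.polePt, Heis.zeroPt, zpow_neg, zpow_natCast, Int.cast_one, one_mul]
    · simp
    · simp only [div_pow, mul_pow, inv_pow]
      field_simp
      ring
    · simp only [div_pow, inv_pow]
      field_simp
  rw [key, key, Heis.logSeq]
  ring

theorem logSeq_profile' {p u : KK} {M : Mon ℓ} {k : Fin ℓ} (h : IsScreenPair (rr ℓ k) p u)
    {X Z : Spec} {ε δ : SignType} (hM : nodePart M k = dbl (rr ℓ k) X ε + dbl (rr ℓ k) Z δ) {n : ℕ}
    (hn : n ≠ 0) : Heis.pairing (heis ℓ) (screenModes ℓ u k) (monModes M) n =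
      Heis.logSeq (Heis.zeroPt p u X.eval ε)⁻¹ (Heis.zeroPt p u Z.eval δ)⁻¹
        (Heis.polePt p u X.eval ε)⁻¹ (Heis.polePt p u Z.eval δ)⁻¹ n := by
  have hp := h.left_ne_zero
  have hu := h.right_ne_zero
  have hX := X.eval_ne_zero
  have hZ := Z.eval_ne_zero
  have hnK : (n : KK) ≠ 0 := by exact_mod_cast hn
  rw [pairing_screen_mon M k h hn, hM, Finsupp.sum_add_index' (by simp) (by intros; push_cast; ring),
    sum_dbl _ _ _ _ (by simp) (by intros; push_cast; ring),
    sum_dbl _ _ _ _ (by simp) (by intros; push_cast; ring)]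
  have key : ∀ (W : Spec) (ε : SignType), (match ε with
      | .zero => (0 : KK)
      | .pos => ((1 : ℤ) : KK) * (W.eval ^ (n : ℤ) * (-((p ^ (n : ℤ) - p ^ (-(n : ℤ))) / n)))
      | .neg => -(((1 : ℤ) : KK) * ((W.mulQT (-2 * rr ℓ k) 2).eval ^ (n : ℤ) *
          (-((p ^ (n : ℤ) - p ^ (-(n : ℤ))) / n))))) =
      ((Heis.polePt p u W.eval ε)⁻¹ ^ n - (Heis.zeroPt p u W.eval ε)⁻¹ ^ n) / n := by
    intro W ε
    have hW := W.eval_ne_zero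
    rw [h.eval_neg]
    generalize W.eval = w at hW ⊢
    cases ε <;> simp only [Heis.polePt, Heis.zeroPt, zpow_neg, zpow_natCast, Int.cast_one, one_mul]
    · simp
    · simp only [div_pow, mul_pow, inv_pow]
      field_simp
      ring
    · simp only [div_pow, inv_pow]
      field_simp
      ring
  rw [key, key, Heis.logSeq]
  ring

end DeformedW

end

noncomputable section

namespace DeformedW

open Polynomial PowerSeries

variable {ℓ : ℕ}

/-! ### Prefactors and modes of products -/

/-- The exponent of the constant prefactor of `Y_i(z)`. -/
def varExp (ℓ : ℕ) (i : Fin ℓ) : PowerSeries ℂ :=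
  PowerSeries.C (2 * (rhoCheck ℓ ⬝ᵥ fundWeight ℓ i)) * PowerSeries.X
    - PowerSeries.C (2 * 2 * (rho ℓ ⬝ᵥ fundWeight ℓ i))

/-- The constant prefactor of a monomial. -/
def prefactor (M : Mon ℓ) : KK :=
  algebraMap K KK (qPow (M.sum fun p d => (d : PowerSeries ℂ) * varExp ℓ p.1))

theorem prefactor_add (M N : Mon ℓ) : prefactor (M + N) = prefactor M * prefactor N := by
  rw [prefactor, prefactor, prefactor, ← algebraMap_qPow_add,
    Finsupp.sum_add_index' (by simp) (by intros; push_cast; ring)]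

theorem aMon_sum {A : Type*} [AddCommGroup A] (F : Fin ℓ × Spec → ℤ → A)
    (h0 : ∀ p, F p 0 = 0) (hadd : ∀ p m n, F p (m + n) = F p m + F p n) (k : Fin ℓ) (s : Spec) :
    (aMon k s).sum F = F (k, s.mulQT (rr ℓ k) (-1)) 1 + F (k, s.mulQT (-rr ℓ k) 1) 1
      - ∑ j, (if incidence ℓ j k = 1 then F (j, s) 1
        else if incidence ℓ j k = 2 then F (j, s.mulQT 1 0) 1 + F (j, s.mulQT (-1) 0) 1
        else 0) := by
  have hsub : ∀ M N : Mon ℓ, (M - N).sum F = M.sum F - N.sum F := by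
    intro M N
    rw [eq_sub_iff_add_eq, ← Finsupp.sum_add_index' h0 hadd, sub_add_cancel]
  have hs : ∀ p, (Finsupp.single p 1 : Mon ℓ).sum F = F p 1 := fun p =>
    Finsupp.sum_single_index (h0 p)
  rw [aMon, hsub, Finsupp.sum_add_index' h0 hadd, hs, hs, ← Finsupp.sum_finsetSum_index h0 hadd]
  congr 1
  refine Finset.sum_congr rfl fun j _ => ?_
  split_ifs
  · rw [hs]
  · rw [Finsupp.sum_add_index' h0 hadd, hs, hs]
  · rw [Finsupp.sum_zero_index]

theorem sum_ite_incidence {A : Type*} [AddCommGroup A] (k : Fin ℓ) (F : Fin ℓ → A) :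
    (∑ j, (if incidence ℓ j k = 1 then F j else if incidence ℓ j k = 2 then F j + F j else 0)) =
      ∑ j, incidence ℓ j k • F j := by
  refine Finset.sum_congr rfl fun j _ => ?_
  rcases incidence_mem ℓ j k with h | h | h <;> simp [h, two_zsmul]

/-- The prefactor of `Y_i` is `q` to the power `2β (ρ^∨, ω_i) - 4 (ρ, ω_i)`, so that of `A_k` is
obtained by replacing `ω_i` by `α_k`, where `(ρ^∨, α_k) = 1` and `(ρ, α_k) = r_k / 2`. -/
theorem prefactor_aMon (k : Fin ℓ) (s : Spec) : prefactor (aMon k s) = qt (-2 * rr ℓ k) 2 := by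
  rw [prefactor, qt_eq, aMon_sum _ (by simp) (by intros; push_cast; ring)]
  dsimp only
  rw [sum_ite_incidence k (fun j => ((1 : ℤ) : PowerSeries ℂ) * varExp ℓ j)]
  congr 2
  have hl : ∀ v : Fin ℓ → ℂ, v ⬝ᵥ simpleRoot ℓ k =
      2 * (v ⬝ᵥ fundWeight ℓ k) - ∑ j, (incidence ℓ j k : ℂ) * (v ⬝ᵥ fundWeight ℓ j) := by
    intro v
    conv_lhs => rw [simpleRoot_eq]
    rw [dotProduct_sub, dotProduct_sum]
    simp [dotProduct_smul]
  have h1 := hl (rho ℓ)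
  have h2 := hl (rhoCheck ℓ)
  rw [rho_dot_simpleRoot] at h1
  rw [rhoCheck_dot_simpleRoot] at h2
  have e : ∀ j, incidence ℓ j k • (((1 : ℤ) : PowerSeries ℂ) * varExp ℓ j) =
      PowerSeries.C (2 * ((incidence ℓ j k : ℂ) * (rhoCheck ℓ ⬝ᵥ fundWeight ℓ j))) * PowerSeries.X
        - PowerSeries.C (4 * ((incidence ℓ j k : ℂ) * (rho ℓ ⬝ᵥ fundWeight ℓ j))) := by
    intro j
    rw [varExp, zsmul_eq_mul]
    simp only [map_mul, map_ofNat, map_intCast]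
    push_cast
    ring
  simp only [e]
  rw [Finset.sum_sub_distrib, ← Finset.sum_mul, ← map_sum, ← map_sum, ← Finset.mul_sum,
    ← Finset.mul_sum]
  rw [show (∑ j, (incidence ℓ j k : ℂ) * (rhoCheck ℓ ⬝ᵥ fundWeight ℓ j)) =
    2 * (rhoCheck ℓ ⬝ᵥ fundWeight ℓ k) - 1 by linear_combination h2,
    show (∑ j, (incidence ℓ j k : ℂ) * (rho ℓ ⬝ᵥ fundWeight ℓ j)) =
    2 * (rho ℓ ⬝ᵥ fundWeight ℓ k) - (rr ℓ k : ℂ) / 2 by linear_combination h1, varExp]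
  have e2 : (4 : ℂ) * (2 * (rho ℓ ⬝ᵥ fundWeight ℓ k) - (rr ℓ k : ℂ) / 2) =
    8 * (rho ℓ ⬝ᵥ fundWeight ℓ k) - 2 * (rr ℓ k : ℂ) := by ring
  rw [e2]
  simp only [map_mul, map_ofNat, map_intCast, map_sub, map_one]
  push_cast
  ring

theorem monModes_add (M N : Mon ℓ) (m : ℤ) : monModes (M + N) m = monModes M m + monModes N m := by
  funext j
  rw [Pi.add_apply, monModes, monModes, monModes,
    Finsupp.sum_add_index' (by simp) (by intros; push_cast; ring)]

/-- By definition of the `y_i` the exponents in `aMon` recombine through `C C⁻¹ = 1` to the root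
mode `a_k[m]`; the two factors at a neighbour of type `-2` give the entry `[2]_q`. -/
theorem monModes_aMon (k : Fin ℓ) (s : Spec) (m : ℤ) (j : Fin ℓ) :
    monModes (aMon k s) m j = s.eval ^ (-m) * aModes ℓ k m j := by
  by_cases hm : m = 0
  · subst hm
    simp [monModes, aModes, yModes]
  have hC := congrFun (congrFun (Matrix.nonsing_inv_mul _ (isUnit_det_cartanQT ℓ hm)) j) k
  rw [Matrix.mul_apply] at hC
  have ha : aModes ℓ k m j = ∑ i, cartanQT ℓ m i k * yModes ℓ i m j := by
    have : ∑ i, cartanQT ℓ m i k * yModes ℓ i m j =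
        (∑ i, (cartanQT ℓ m)⁻¹ j i * cartanQT ℓ m i k) * ((q ^ m - q ^ (-m)) / (m : KK)) := by
      rw [Finset.sum_mul]
      refine Finset.sum_congr rfl fun i _ => ?_
      rw [yModes]; ring
    rw [this, hC, Matrix.one_apply, aModes]
    split_ifs <;> simp
  have hev : ∀ x y : ℤ, (s.mulQT x y).eval ^ (-m) = s.eval ^ (-m) * qt (-m * x) (-m * y) := by
    intro x y
    rw [Spec.eval_mulQT, mul_zpow, qt_zpow]
  rw [monModes, aMon_sum _ (by simp) (by intros; push_cast; ring), ha, Finset.mul_sum]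
  simp only [hev]
  have e : ∀ i, s.eval ^ (-m) * (cartanQT ℓ m i k * yModes ℓ i m j) =
      (if i = k then s.eval ^ (-m) * ((qt (m * rr ℓ i) (-m) + qt (m * -rr ℓ i) m) * yModes ℓ i m j)
        else 0) - (if incidence ℓ i k = 1 then ((1 : ℤ) : KK) * s.eval ^ (-m) * yModes ℓ i m j
        else if incidence ℓ i k = 2 then
          ((1 : ℤ) : KK) * (s.eval ^ (-m) * qt (-m * 1) (-m * 0)) * yModes ℓ i m j +
          ((1 : ℤ) : KK) * (s.eval ^ (-m) * qt (-m * -1) (-m * 0)) * yModes ℓ i m j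
        else 0) := by
    intro i
    have c1 : (q ^ m) ^ rr ℓ i * (t ^ m)⁻¹ = qt (m * rr ℓ i) (-m) := by
      rw [qt, zpow_mul, zpow_neg]
    have c2 : (q ^ m) ^ (-rr ℓ i) * t ^ m = qt (m * -rr ℓ i) m := by
      rw [qt, zpow_mul]
    have c3 : qt (-m * 1) (-m * 0) = (q ^ m)⁻¹ := by simp [qt]
    have c4 : qt (-m * -1) (-m * 0) = q ^ m := by simp [qt]
    rw [cartanQT, Matrix.of_apply, c1, c2, c3, c4]
    rcases incidence_mem ℓ i k with h | h | h
    · rw [h, qInt_zero]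
      split_ifs <;> first | omega | ring
    · rw [h, qInt_one hm]
      split_ifs <;> first | omega | (push_cast; ring)
    · rw [h, qInt_two hm]
      split_ifs <;> first | omega | (push_cast; ring)
  rw [Finset.sum_congr rfl fun i _ => e i, Finset.sum_sub_distrib, Finset.sum_ite_eq' Finset.univ k,
    if_pos (Finset.mem_univ k)]
  congr 1
  have c1 : qt (-m * rr ℓ k) (-m * -1) = qt (m * -rr ℓ k) m := by congr 1 <;> ring
  have c2 : qt (-m * -rr ℓ k) (-m * 1) = qt (m * rr ℓ k) (-m) := by congr 1 <;> ring
  rw [c1, c2]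
  push_cast
  ring

/-- The poles of the two signs differ by the factor `u^2`, and the screening current satisfies a
difference equation: its values at two such points have the ratio `A_k`, since `(u^{2m} - 1) / (u^m
- u^{-m}) = u^m`. -/
theorem fuse_sub_aMon {p u : KK} {k : Fin ℓ} (h : IsScreenPair (rr ℓ k) p u) (M : Mon ℓ)
    (X : Spec) :
    Heis.fuse (monModes (M - aMon k (X.mulQT (-rr ℓ k) 1))) (screenModes ℓ u k)
        (Heis.polePt p u X.eval (-1)) =
      Heis.fuse (monModes M) (screenModes ℓ u k) (Heis.polePt p u X.eval 1) := by
  have hp := h.left_ne_zero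
  have hu := h.right_ne_zero
  have hX := X.eval_ne_zero
  funext m j
  set A := aMon k (X.mulQT (-rr ℓ k) 1) with hA
  have hM : monModes M m j = monModes (M - A) m j + monModes A m j := by
    rw [← Pi.add_apply, ← monModes_add, sub_add_cancel]
  rw [Heis.fuse, Heis.fuse, Pi.add_apply, Pi.add_apply, Pi.smul_apply, Pi.smul_apply, hM, add_assoc]
  congr 1
  rw [hA, monModes_aMon, smul_eq_mul, smul_eq_mul]
  have hev : (X.mulQT (-rr ℓ k) 1).eval = X.eval * (p * u)⁻¹ := by
    rw [Spec.eval_mulQT, h.mul_left_right, ← qt_neg, neg_neg]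
  rw [hev]
  change (p * u ^ 2 / X.eval) ^ m * _ = _ + (p / X.eval) ^ m * _
  by_cases hm : m = 0
  · subst hm
    simp [screenModes, aModes]
  have hd := h.sub_ne_zero (rr_ne_zero ℓ k) hm
  rw [screenModes]
  have e1 : (p * u ^ 2 / X.eval) ^ m = (p / X.eval) ^ m * u ^ m * u ^ m := by
    rw [← mul_zpow, ← mul_zpow]; congr 1; ring
  have e2 : (X.eval * (p * u)⁻¹) ^ (-m) = (p / X.eval) ^ m * u ^ m := by
    rw [zpow_neg, ← inv_zpow, ← mul_zpow]; congr 1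
    field_simp
  have e3 : u ^ m * (u ^ m - u ^ (-m)) = u ^ m * u ^ m - 1 := by
    rw [mul_sub, ← zpow_add₀ hu m (-m), add_neg_cancel, zpow_zero]
  rw [e1, e2]
  generalize (p / X.eval) ^ m = B
  have e4 : u ^ m * u ^ m * (u ^ m - u ^ (-m))⁻¹ = u ^ m + (u ^ m - u ^ (-m))⁻¹ := by
    rw [← sub_eq_zero]
    generalize u ^ (-m) = w at *
    generalize u ^ m = z at *
    have : z * z = z * (z - w) + 1 := by rw [e3]; ring
    rw [this, add_mul, one_mul, mul_assoc, mul_inv_cancel₀ hd]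
    ring
  calc B * u ^ m * u ^ m * ((u ^ m - u ^ (-m))⁻¹ * aModes ℓ k m j)
      = B * aModes ℓ k m j * (u ^ m * u ^ m * (u ^ m - u ^ (-m))⁻¹) := by ring
    _ = _ := by rw [e4]; ring

/-! ### The fields on the Fock modules -/

/-- The factor by which the zero modes of a monomial act on `π_μ`. -/
def zeroFactor (M : Mon ℓ) (μ : P ℓ) : KK :=
  algebraMap K KK (qPow (∑ i, (M.sum fun p d => if p.1 = i then (2 * d : PowerSeries ℂ) else 0) *
    pair μ (fundWeight ℓ i)))

theorem monField_single (M : Mon ℓ) (n : ℤ) (μ : P ℓ) (v : FockV ℓ) :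
    monField M n (Finsupp.single μ v) =
      Finsupp.single μ ((prefactor M * zeroFactor M μ) • Heis.vertex (heis ℓ) (monModes M) n v) := by
  rw [monField, normalExp_single fun m _ => mon_modes_eq M m, zeroMode, Finsupp.lsum_single,
    LinearMap.smul_apply, Finsupp.lsingle_apply, smul_smul, Finsupp.smul_single]
  rfl

/-- On `π_0` the zero modes act trivially, so in the commutator they only count on the target of the
screening operator. -/
theorem zeroFactor_zero (M : Mon ℓ) : zeroFactor M 0 = 1 := by
  simp [zeroFactor, pair, qPow_zero]

/-- The weight `δ r α_k`. -/
def shiftWeight (ℓ : ℕ) (k : Fin ℓ) (δ : ℂ[X]) : P ℓ :=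
  0 + fun j => δ * Polynomial.C (2 * simpleRoot ℓ k j)

theorem pair_shiftWeight (k i : Fin ℓ) (δ : ℂ[X]) :
    pair (shiftWeight ℓ k δ) (fundWeight ℓ i) = if i = k then (rr ℓ k : PowerSeries ℂ) * δ else 0 := by
  have e : (∑ j, shiftWeight ℓ k δ j * Polynomial.C (fundWeight ℓ i j)) =
      δ * Polynomial.C (2 * (fundWeight ℓ i ⬝ᵥ simpleRoot ℓ k)) := by
    rw [dotProduct, Finset.mul_sum, map_sum, Finset.mul_sum]
    refine Finset.sum_congr rfl fun j _ => ?_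
    rw [shiftWeight, zero_add, mul_assoc, ← Polynomial.C_mul]
    congr 2
    ring
  rw [pair, e, fundWeight_dot_simpleRoot]
  split_ifs
  · rw [mul_div_cancel₀ _ (two_ne_zero), Polynomial.coe_mul, Polynomial.coe_C, mul_comm, map_intCast]
  · simp

theorem zeroFactor_shiftWeight (M : Mon ℓ) (k : Fin ℓ) (δ : ℂ[X]) :
    zeroFactor M (shiftWeight ℓ k δ) = algebraMap K KK (qPow
      (((2 * (nodePart M k).sum fun _ d => d : ℤ) : PowerSeries ℂ) * (rr ℓ k * δ))) := by
  rw [zeroFactor]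
  congr 2
  simp only [pair_shiftWeight, mul_ite, mul_zero]
  rw [Finset.sum_ite_eq' Finset.univ k, if_pos (Finset.mem_univ k),
    sum_nodePart M k (fun _ d => (2 * d : PowerSeries ℂ))]
  congr 1
  push_cast [Finsupp.sum]
  rw [Finset.mul_sum]

/-- The screening current with parameter `u` and shift `δ`. -/
def screen (ℓ : ℕ) (u : KK) (k : Fin ℓ) (δ : ℂ[X]) : Series ℓ := fun n v =>
  shift ℓ k δ (normalExp (fun m => (u ^ m - u ^ (-m))⁻¹ • a ℓ k m) n v)

theorem screenPlus_eq (k : Fin ℓ) : screenPlus ℓ k =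
    screen ℓ (qt (rr ℓ k) 0) k (-Polynomial.C (1 / (rr ℓ k : ℂ)) * Polynomial.X) := by
  have e : ∀ m : ℤ, qt (rr ℓ k) 0 ^ m = q ^ (m * rr ℓ k) := fun m => by
    rw [qt_zpow, q_zpow_eq, mul_zero]
  funext n v
  rw [screenPlus, screen]
  simp only [e, neg_mul]

theorem screenMinus_eq (k : Fin ℓ) : screenMinus ℓ k = screen ℓ (qt 0 (-1)) k 1 := by
  have e : ∀ m : ℤ, qt 0 (-1) ^ m = t ^ (-m) := fun m => by
    rw [qt_zpow, t_zpow_eq, mul_zero, mul_neg_one]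
  have e2 : ∀ m : ℤ, -(t ^ m - t ^ (-m))⁻¹ = (t ^ (-m) - t ^ (- -m))⁻¹ := fun m => by
    rw [neg_neg, ← neg_sub (t ^ m), neg_inv]
  funext n v
  rw [screenMinus, screen]
  simp only [e, e2]

theorem screen_single (u : KK) (k : Fin ℓ) (δ : ℂ[X]) (n : ℤ) (v : FockV ℓ) :
    screen ℓ u k δ n (Finsupp.single 0 v) =
      Finsupp.single (shiftWeight ℓ k δ) (Heis.vertex (heis ℓ) (screenModes ℓ u k) n v) := by
  have h : ∀ m : ℤ, m ≠ 0 → (u ^ m - u ^ (-m))⁻¹ • a ℓ k m =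
      liftEnd ℓ (Heis.modeOp (heis ℓ) (screenModes ℓ u k) m) := by
    intro m _
    rw [liftEnd_modeOp, a_eq, Finset.smul_sum]
    refine Finset.sum_congr rfl fun j _ => ?_
    rw [smul_smul]
    rfl
  rw [screen, normalExp_single h, shift, Finsupp.lmapDomain_apply, Finsupp.mapDomain_single]
  rfl

end DeformedW

end

noncomputable section

namespace DeformedW

open Polynomial PowerSeries

variable {ℓ : ℕ}

/-! ### The commutator of a monomial with a screening operator -/

theorem sum_profile {r : ℤ} (X Z : Spec) (ε σ : SignType) :
    ((dbl r X ε + dbl r Z σ).sum fun _ d => d) = (ε : ℤ) + (σ : ℤ) := by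
  have key : ∀ (W : Spec) (ε : SignType), ((dbl r W ε).sum fun _ d => d) = (ε : ℤ) := by
    intro W ε
    rw [sum_dbl _ _ _ _ (by simp) (by simp)]
    cases ε <;> rfl
  rw [Finsupp.sum_add_index' (by simp) (by simp), key, key]

theorem polePt_eq {p u x : KK} (hp : p ≠ 0) (hu : u ≠ 0) (hx : x ≠ 0) (ε : SignType) :
    Heis.polePt p u x ε = p ^ (2 * (ε : ℤ)) * Heis.zeroPt p u x ε := by
  cases ε
  · change p / x = p ^ (0 : ℤ) * (p / x)
    rw [zpow_zero, one_mul]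
  · change p * u ^ 2 / x = p ^ (-2 : ℤ) * (p ^ 3 * u ^ 2 / x)
    rw [zpow_neg]
    field_simp
  · change p / x = p ^ (2 : ℤ) * (p⁻¹ / x)
    field_simp

theorem Heis.poleCoeff_comm {𝕜 : Type*} [Field 𝕜] (a₁ a₂ b₁ b₂ : 𝕜) :
    Heis.poleCoeff a₁ a₂ b₁ b₂ = Heis.poleCoeff a₂ a₁ b₁ b₂ := by
  rw [Heis.poleCoeff, Heis.poleCoeff, mul_comm (b₁ - a₁), mul_comm a₁]

/-- The contribution of a pole to the commutator of a monomial with a screening operator. -/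
def poleTerm (p u : KK) (k : Fin ℓ) (M : Mon ℓ) (X : Spec) (ε : SignType) (Z : Spec) (σ : SignType)
    (n : ℤ) (v : FockV ℓ) : FockV ℓ :=
  (Heis.poleCoeff (Heis.zeroPt p u X.eval ε) (Heis.zeroPt p u Z.eval σ)
    (Heis.polePt p u X.eval ε) (Heis.polePt p u Z.eval σ) * (Heis.polePt p u X.eval ε)⁻¹) •
    Heis.vertex (heis ℓ) (Heis.fuse (monModes M) (screenModes ℓ u k) (Heis.polePt p u X.eval ε))
      (n + -1) v

/-- The shift `δ` belongs to the screening current with parameters `(p, u)`. -/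
def IsScreenShift (r : ℤ) (p : KK) (δ : ℂ[X]) : Prop :=
  ∀ D : ℤ, algebraMap K KK (qPow (((2 * D : ℤ) : PowerSeries ℂ) * (r * δ))) = p ^ (2 * D)

theorem isScreenShift_plus {r : ℤ} (hr : r ≠ 0) :
    IsScreenShift r (qt 0 (-1)) (-Polynomial.C (1 / (r : ℂ)) * Polynomial.X) := by
  intro D
  rw [qt_zpow, qt_eq]
  congr 2
  have hr' : (r : ℂ) ≠ 0 := by exact_mod_cast hr
  have e : (r : PowerSeries ℂ) * PowerSeries.C (1 / (r : ℂ)) = 1 := by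
    rw [← map_intCast (PowerSeries.C (R := ℂ)), ← map_mul, mul_one_div_cancel hr', map_one]
  rw [neg_mul, Polynomial.coe_neg, Polynomial.coe_mul, Polynomial.coe_C, Polynomial.coe_X, mul_neg,
    ← mul_assoc (r : PowerSeries ℂ), e]
  push_cast
  ring

theorem isScreenShift_minus (r : ℤ) : IsScreenShift r (qt r 0) 1 := by
  intro D
  rw [qt_zpow, qt_eq, Polynomial.coe_one]
  congr 2
  push_cast
  ring

theorem monField_commutator {p u : KK} {k : Fin ℓ} {δ : ℂ[X]} (h : IsScreenPair (rr ℓ k) p u)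
    (hδ : IsScreenShift (rr ℓ k) p δ) {M : Mon ℓ} {X Z : Spec} {ε σ : SignType}
    (hM : nodePart M k = dbl (rr ℓ k) X ε + dbl (rr ℓ k) Z σ)
    (hne : Heis.polePt p u X.eval ε ≠ Heis.polePt p u Z.eval σ) (n : ℤ) (v : FockV ℓ) :
    monField M n (screen ℓ u k δ (-1) (Finsupp.single 0 v)) =
      screen ℓ u k δ (-1) (monField M n (Finsupp.single 0 v)) +
      Finsupp.single (shiftWeight ℓ k δ)
        (prefactor M • (poleTerm p u k M X ε Z σ n v + poleTerm p u k M Z σ X ε n v)) := by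
  have hp := h.left_ne_zero
  have hu := h.right_ne_zero
  have hX := X.eval_ne_zero
  have hZ := Z.eval_ne_zero
  have a1 := Heis.zeroPt_ne_zero hp hu hX ε
  have a2 := Heis.zeroPt_ne_zero hp hu hZ σ
  have key := Heis.vertex_commutator (heis ℓ) (monModes M) (screenModes ℓ u k) a1 a2
    (Heis.polePt_ne_zero hp hu hX ε) (Heis.polePt_ne_zero hp hu hZ σ) hne
    (fun n hn => logSeq_profile h hM hn) (fun n hn => logSeq_profile' h hM hn) n (-1) v
  -- A factor of sign `ε` has quotient `p^{2ε}` of pole by zero, and the zero mode acts by `p^{2D}`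
  -- with `D` the total exponent at the node. This is the constant required by
  -- `Heis.vertex_commutator`.
  have e : Heis.polePt p u X.eval ε * Heis.polePt p u Z.eval σ /
      (Heis.zeroPt p u X.eval ε * Heis.zeroPt p u Z.eval σ) =
      zeroFactor M (shiftWeight ℓ k δ) := by
    rw [zeroFactor_shiftWeight, hδ, hM, sum_profile, polePt_eq hp hu hX, polePt_eq hp hu hZ,
      mul_mul_mul_comm, mul_div_cancel_right₀ _ (mul_ne_zero a1 a2), ← zpow_add₀ hp, mul_add]
  rw [e, zpow_neg_one, zpow_neg_one] at key
  rw [screen_single, monField_single, monField_single, zeroFactor_zero, mul_one, screen_single,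
    Heis.vertex_smul, ← Finsupp.single_add, ← smul_add, mul_smul]
  congr 2
  rw [poleTerm, poleTerm, Heis.poleCoeff_comm (Heis.zeroPt p u Z.eval σ), ← key]
  abel

theorem prod_nodePart {A : Type*} [CommMonoid A] (M : Mon ℓ) (i : Fin ℓ) (g : Spec → ℤ → A) :
    (M.prod fun p d => if p.1 = i then g p.2 d else 1) = (nodePart M i).prod g :=
  congrArg Additive.toMul (sum_nodePart (A := Additive A) M i fun s d => Additive.ofMul (g s d))

/-- The factor `((1 - q^{-2r} u) (1 - t² u)) / ((1 - u) (1 - q^{-2r} t² u))`. -/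
def baseFactor (r : ℤ) (u : KK) : KK :=
  (1 - q ^ (-2 * r) * u) * (1 - t ^ 2 * u) / ((1 - u) * (1 - q ^ (-2 * r) * t ^ 2 * u))

theorem stepFactor_eq_prod (M : Mon ℓ) (k : Fin ℓ) (X : Spec) : stepFactor M k X =
    (nodePart M k).prod fun s d => if s ≠ X then baseFactor (rr ℓ k) (X.eval / s.eval) ^ d else 1 := by
  rw [← prod_nodePart, stepFactor]
  refine Finset.prod_congr rfl fun s _ => ?_
  by_cases hs : s.1 = k
  · by_cases hs' : s.2 = X <;> simp [baseFactor, hs, hs']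
  · simp [hs]

theorem stepFactor_single {M : Mon ℓ} {k : Fin ℓ} {X : Spec}
    (hM : nodePart M k = Finsupp.single X 1) : stepFactor M k X = 1 := by
  rw [stepFactor_eq_prod, hM, Finsupp.prod_single_index (by simp)]
  simp

theorem stepFactor_add_single {M : Mon ℓ} {k : Fin ℓ} {X W : Spec} {d : ℤ} (hW : X ≠ W) (hd : d ≠ 0)
    (hM : nodePart M k = Finsupp.single X 1 + Finsupp.single W d) :
    stepFactor M k X = baseFactor (rr ℓ k) (X.eval / W.eval) ^ d := by
  rw [stepFactor_eq_prod, hM, Finsupp.prod_add_index_of_disjoint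
    ((Finsupp.support_single_disjoint one_ne_zero hd).2 hW), Finsupp.prod_single_index (by simp),
    Finsupp.prod_single_index (by simp), if_neg (by simp), if_pos hW.symm, one_mul]

theorem stepFactor_eq {p u : KK} {k : Fin ℓ} (h : IsScreenPair (rr ℓ k) p u) {M : Mon ℓ}
    {X Z : Spec} {σ : SignType} (hM : nodePart M k = dbl (rr ℓ k) X 1 + dbl (rr ℓ k) Z σ)
    (h1 : Heis.polePt p u X.eval 1 ≠ Heis.polePt p u Z.eval σ)
    (h2 : Heis.polePt p u X.eval (-1) ≠ Heis.polePt p u Z.eval σ)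
    (h4 : σ = -1 → X ≠ Z.mulQT (-2 * rr ℓ k) 2) :
    stepFactor M k X =
      Heis.flipFactor p u X.eval (Heis.zeroPt p u Z.eval σ) (Heis.polePt p u Z.eval σ) := by
  have hp := h.left_ne_zero
  have hu := h.right_ne_zero
  have hX := X.eval_ne_zero
  have hZ := Z.eval_ne_zero
  have hd1 : dbl (rr ℓ k) X 1 = Finsupp.single X 1 := rfl
  rw [hd1] at hM
  cases σ
  · rw [stepFactor_single (hM.trans (add_zero _))]
    exact (Heis.flipFactor_self h1 h2).symm
  · change _ = Finsupp.single X 1 + -Finsupp.single (Z.mulQT (-2 * rr ℓ k) 2) 1 at hM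
    rw [← Finsupp.single_neg] at hM
    rw [stepFactor_add_single (h4 rfl) (by norm_num) hM, zpow_neg_one, baseFactor, h.factor_eq,
      h.eval_neg]
    exact (Heis.flipFactor_neg hp hu hX hZ).symm
  · have hXZ : X ≠ Z := by
      rintro rfl
      exact h1 rfl
    rw [stepFactor_add_single hXZ one_ne_zero hM, zpow_one, baseFactor, h.factor_eq]
    exact (Heis.flipFactor_pos hp hu hX hZ).symm

theorem prefactor_sub_aMon {p u : KK} {k : Fin ℓ} (h : IsScreenPair (rr ℓ k) p u) (M : Mon ℓ)
    (X : Spec) :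
    prefactor (M - aMon k (X.mulQT (-rr ℓ k) 1)) = prefactor M * (p * u) ^ 2 := by
  have e := prefactor_add (M - aMon k (X.mulQT (-rr ℓ k) 1)) (aMon k (X.mulQT (-rr ℓ k) 1))
  rw [sub_add_cancel, prefactor_aMon] at e
  rw [e, mul_assoc, h.mul_left_right, ← zpow_natCast, qt_zpow, ← qt_add]
  have : qt (-2 * rr ℓ k + (2 : ℕ) * rr ℓ k) (2 + (2 : ℕ) * -1) = 1 := by
    rw [← qt_zero]; congr 1; push_cast; ring
  rw [this, mul_one]

/-- The contributions of the poles of two monomials related by a flip cancel. -/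
theorem poleTerm_flip {p u : KK} {k : Fin ℓ} (h : IsScreenPair (rr ℓ k) p u) (M : Mon ℓ)
    {X Z : Spec} {σ : SignType}
    (h1 : Heis.polePt p u X.eval 1 ≠ Heis.polePt p u Z.eval σ)
    (h2 : Heis.polePt p u X.eval (-1) ≠ Heis.polePt p u Z.eval σ)
    (h3 : Heis.polePt p u X.eval (-1) ≠ Heis.zeroPt p u Z.eval σ) (n : ℤ) (v : FockV ℓ) :
    (Heis.flipFactor p u X.eval (Heis.zeroPt p u Z.eval σ) (Heis.polePt p u Z.eval σ) *
        prefactor (M - aMon k (X.mulQT (-rr ℓ k) 1))) •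
      poleTerm p u k (M - aMon k (X.mulQT (-rr ℓ k) 1)) X (-1) Z σ n v =
      -(prefactor M • poleTerm p u k M X 1 Z σ n v) := by
  have hp := h.left_ne_zero
  have hu := h.right_ne_zero
  have hX := X.eval_ne_zero
  have hZ := Z.eval_ne_zero
  have key := Heis.poleCoeff_flip hp hu hX (Heis.zeroPt_ne_zero hp hu hZ σ) h1 h2 h3
  have hpre := prefactor_sub_aMon h M X
  rw [poleTerm, poleTerm, fuse_sub_aMon h, smul_smul, smul_smul, ← neg_smul]
  congr 1
  rw [hpre]
  linear_combination prefactor M * key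

end DeformedW

end

/-! ### Systems of flips: cancellation of poles, the algorithm, distinctness. -/

noncomputable section

namespace DeformedW

open Polynomial PowerSeries

variable {ℓ : ℕ}

/-! ### Families of monomials closed under flips at a node -/

/-- The two points at a node: `X` and `X q^{4m+2} t^{-2m}`. -/
def pairPt (X : Spec) (m : ℤ) : Bool → Spec
  | true => X
  | false => X.mulQT (4 * m + 2) (-2 * m)

/-- A family of monomials, with coefficients, whose parts at the node `k` consist of one factor at each
of two points, which is closed under changing the sign of either factor, unless the factors
interfere. -/
structure NodeSystem (k : Fin ℓ) {J : Type} (mon : J → Mon ℓ) (c : J → KK) where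
  /-- the first point -/
  X : J → Spec
  /-- the distance of the two points -/
  gap : J → ℤ
  /-- the signs of the two factors -/
  sg : Bool → J → SignType
  /-- the change of the sign of a factor -/
  flip : Bool → J → J
  nodePart_eq : ∀ j, nodePart (mon j) k =
    dbl (rr ℓ k) (pairPt (X j) (gap j) true) (sg true j) +
      dbl (rr ℓ k) (pairPt (X j) (gap j) false) (sg false j)
  gap_nonneg : ∀ j, rr ℓ k = 1 → 0 ≤ gap j
  sg_ne : ∀ j, rr ℓ k = 1 → gap j = 0 → sg false j = -1 → sg true j = -1
  X_flip : ∀ κ j, sg κ j ≠ 0 → ¬(rr ℓ k = 1 ∧ gap j = 0 ∧ sg κ j = (if κ then -1 else 1) ∧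
    sg (!κ) j = sg κ j) → X (flip κ j) = X j
  gap_flip : ∀ κ j, sg κ j ≠ 0 → ¬(rr ℓ k = 1 ∧ gap j = 0 ∧ sg κ j = (if κ then -1 else 1) ∧
    sg (!κ) j = sg κ j) → gap (flip κ j) = gap j
  sg_flip : ∀ κ j, sg κ j ≠ 0 → ¬(rr ℓ k = 1 ∧ gap j = 0 ∧ sg κ j = (if κ then -1 else 1) ∧
    sg (!κ) j = sg κ j) → sg κ (flip κ j) = -sg κ j
  sg_not_flip : ∀ κ j, sg κ j ≠ 0 → ¬(rr ℓ k = 1 ∧ gap j = 0 ∧ sg κ j = (if κ then -1 else 1) ∧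
    sg (!κ) j = sg κ j) → sg (!κ) (flip κ j) = sg (!κ) j
  flip_flip : ∀ κ j, sg κ j ≠ 0 → ¬(rr ℓ k = 1 ∧ gap j = 0 ∧ sg κ j = (if κ then -1 else 1) ∧
    sg (!κ) j = sg κ j) → flip κ (flip κ j) = j
  mon_flip : ∀ κ j, sg κ j = 1 → ¬(rr ℓ k = 1 ∧ gap j = 0 ∧ sg κ j = (if κ then -1 else 1) ∧
    sg (!κ) j = sg κ j) →
    mon (flip κ j) = mon j - aMon k ((pairPt (X j) (gap j) κ).mulQT (-rr ℓ k) 1)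
  coeff_flip : ∀ κ j, sg κ j = 1 → ¬(rr ℓ k = 1 ∧ gap j = 0 ∧ sg κ j = (if κ then -1 else 1) ∧
    sg (!κ) j = sg κ j) →
    c (flip κ j) = c j * stepFactor (mon j) k (pairPt (X j) (gap j) κ)

theorem qt_div_eq_iff {x : KK} (hx : x ≠ 0) {A B A' B' m n : ℤ} :
    qt A B / x = qt A' B' / (x * qt m n) ↔ A = A' - m ∧ B = B' - n := by
  rw [← qt_inj, qt_sub, mul_comm x, ← div_div, div_left_inj' hx]

theorem rr_eq (ℓ : ℕ) (k : Fin ℓ) : rr ℓ k = 1 ∨ rr ℓ k = 2 := by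
  rw [rr]; split_ifs <;> simp

/-- The exponents of `p^a u^b`. -/
theorem IsScreenPair.eq_qt {r : ℤ} {p u : KK} (h : IsScreenPair r p u) :
    ∃ P Q P' Q' : ℤ, p = qt P Q ∧ u = qt P' Q' ∧
      ((P = 0 ∧ Q = -1 ∧ P' = r ∧ Q' = 0) ∨ (P = r ∧ Q = 0 ∧ P' = 0 ∧ Q' = -1)) := by
  rcases h with ⟨rfl, rfl⟩ | ⟨rfl, rfl⟩
  · exact ⟨0, -1, r, 0, rfl, rfl, Or.inl ⟨rfl, rfl, rfl, rfl⟩⟩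
  · exact ⟨r, 0, 0, -1, rfl, rfl, Or.inr ⟨rfl, rfl, rfl, rfl⟩⟩

/-- The exponent of `p^a u^b` in `polePt`. -/
def poleExp (P P' : ℤ) : SignType → ℤ
  | .zero => P
  | .pos => P
  | .neg => P + 2 * P'

/-- The exponent of `p^a u^b` in `zeroPt`. -/
def zeroExp (P P' : ℤ) : SignType → ℤ
  | .zero => P
  | .pos => -P
  | .neg => 3 * P + 2 * P'

theorem polePt_qt (P Q P' Q' : ℤ) (x : KK) (ε : SignType) :
    Heis.polePt (qt P Q) (qt P' Q') x ε = qt (poleExp P P' ε) (poleExp Q Q' ε) / x := by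
  cases ε <;> simp only [Heis.polePt, poleExp]
  rw [qt_add, ← zpow_natCast, qt_zpow]
  rfl

theorem zeroPt_qt (P Q P' Q' : ℤ) (x : KK) (ε : SignType) :
    Heis.zeroPt (qt P Q) (qt P' Q') x ε = qt (zeroExp P P' ε) (zeroExp Q Q' ε) / x := by
  cases ε <;> simp only [Heis.zeroPt, zeroExp]
  · rw [qt_add, ← zpow_natCast, ← zpow_natCast, qt_zpow, qt_zpow]
    rfl
  · rw [qt_neg]

/-- Poles of equal sign differ by `q^{4m+2} t^{-2m} ≠ 1`. Poles of opposite signs involve a further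
factor `u^{±2}`, and they can meet only for `4m + 2 = 2r`, `m = 0`, that is `r = 1`; the sign
pattern concerned, which includes the dummy pole of sign `0`, is excluded by `h0`. -/
theorem pole_ne_pole {r : ℤ} (hr : r = 1 ∨ r = 2) {p u : KK} (h : IsScreenPair r p u) (X : Spec)
    {m : ℤ} {ε σ : SignType} (h0 : r = 1 → m = 0 → σ = -1 → ε = -1) :
    Heis.polePt p u (pairPt X m true).eval ε ≠ Heis.polePt p u (pairPt X m false).eval σ := by
  obtain ⟨P, Q, P', Q', rfl, rfl, hP⟩ := h.eq_qt
  rw [polePt_qt, polePt_qt, pairPt, pairPt, Spec.eval_mulQT, Ne, qt_div_eq_iff X.eval_ne_zero]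
  rintro ⟨e1, e2⟩
  by_cases h1 : r = 1 <;> by_cases h2 : m = 0 <;> cases ε <;> cases σ <;>
    simp only [h1, h2, true_imp_iff, false_imp_iff, SignType.neg_eq_neg_one, reduceCtorEq] at h0 <;>
    simp only [poleExp] at e1 e2 <;> omega

theorem pole_ne_zero_true {r : ℤ} (hr : r = 1 ∨ r = 2) {p u : KK} (h : IsScreenPair r p u) (X : Spec)
    {m : ℤ} (hm : r = 1 → 0 ≤ m) {σ : SignType} (h0 : r = 1 → m = 0 → σ ≠ -1) :
    Heis.polePt p u (pairPt X m true).eval (-1) ≠ Heis.zeroPt p u (pairPt X m false).eval σ := by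
  obtain ⟨P, Q, P', Q', rfl, rfl, hP⟩ := h.eq_qt
  rw [polePt_qt, zeroPt_qt, pairPt, pairPt, Spec.eval_mulQT, Ne, qt_div_eq_iff X.eval_ne_zero]
  rintro ⟨e1, e2⟩
  change P + 2 * P' = _ at e1
  change Q + 2 * Q' = _ at e2
  by_cases h1 : r = 1 <;> by_cases h2 : m = 0 <;> cases σ <;>
    simp only [h1, h2, true_imp_iff, false_imp_iff, SignType.neg_eq_neg_one, ne_eq,
      not_true_eq_false] at h0 <;>
    simp only [zeroExp] at e1 e2 <;> omega

theorem pole_ne_zero_false {r : ℤ} (hr : r = 1 ∨ r = 2) {p u : KK} (h : IsScreenPair r p u)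
    (X : Spec) {m : ℤ} {σ : SignType} (h0 : r = 1 → m = 0 → σ = -1) :
    Heis.polePt p u (pairPt X m false).eval (-1) ≠ Heis.zeroPt p u (pairPt X m true).eval σ := by
  obtain ⟨P, Q, P', Q', rfl, rfl, hP⟩ := h.eq_qt
  rw [polePt_qt, zeroPt_qt, pairPt, pairPt, Spec.eval_mulQT, Ne, eq_comm,
    qt_div_eq_iff X.eval_ne_zero]
  rintro ⟨e1, e2⟩
  change _ = P + 2 * P' - _ at e1
  change _ = Q + 2 * Q' - _ at e2
  by_cases h1 : r = 1 <;> by_cases h2 : m = 0 <;> cases σ <;>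
    simp only [h1, h2, true_imp_iff, false_imp_iff, SignType.neg_eq_neg_one, reduceCtorEq] at h0 <;>
    simp only [zeroExp] at e1 e2 <;> omega

namespace NodeSystem

variable {k : Fin ℓ} {J : Type} {mon : J → Mon ℓ} {c : J → KK} (S : NodeSystem k mon c)

/-- The points of the factors. -/
def pt (κ : Bool) (j : J) : Spec := pairPt (S.X j) (S.gap j) κ

/-- The factor cannot be flipped although it is present. -/
def IsBlocked (κ : Bool) (j : J) : Prop :=
  rr ℓ k = 1 ∧ S.gap j = 0 ∧ S.sg κ j = (if κ then -1 else 1) ∧ S.sg (!κ) j = S.sg κ j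

theorem pt_flip {κ : Bool} {j : J} (h : S.sg κ j ≠ 0) (hb : ¬S.IsBlocked κ j) (κ' : Bool) :
    S.pt κ' (S.flip κ j) = S.pt κ' j := by
  rw [pt, pt, S.X_flip κ j h hb, S.gap_flip κ j h hb]

theorem nodePart_mon (κ : Bool) (j : J) : nodePart (mon j) k =
    dbl (rr ℓ k) (S.pt κ j) (S.sg κ j) + dbl (rr ℓ k) (S.pt (!κ) j) (S.sg (!κ) j) := by
  cases κ
  · rw [add_comm]; exact S.nodePart_eq j
  · exact S.nodePart_eq j

theorem polePt_ne {p u : KK} (h : IsScreenPair (rr ℓ k) p u) (κ : Bool) (j : J) : Heis.polePt p u (S.pt κ j).eval (S.sg κ j) ≠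
    Heis.polePt p u (S.pt (!κ) j).eval (S.sg (!κ) j) := by
  have := pole_ne_pole (rr_eq ℓ k) h (S.X j) (S.sg_ne j)
  cases κ
  · exact this.symm
  · exact this

/-- If the flip led to a blocked state, the state before it would have the sign `-1` at the second
point and `+1` at the first, with gap `0` at the short root. This is the pattern excluded by
`sg_ne`. -/
theorem not_isBlocked_flip {κ : Bool} {j : J} (h : S.sg κ j ≠ 0) (hb : ¬S.IsBlocked κ j) :
    ¬S.IsBlocked κ (S.flip κ j) := by
  rintro ⟨h1, h2, h3, h4⟩
  rw [S.sg_flip κ j h hb] at h3 h4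
  rw [S.sg_not_flip κ j h hb] at h4
  rw [S.gap_flip κ j h hb] at h2
  have h5 := S.sg_ne j h1 h2
  have h6 := S.sg_ne (S.flip κ j) h1 (by rw [S.gap_flip κ j h hb, h2])
  cases κ
  · simp only [Bool.not_false, Bool.false_eq_true, if_false] at *
    rw [h4] at h5
    have h7 : S.sg false j = -1 := by rw [← neg_neg (S.sg false j), h3]
    rw [h7] at h5
    exact absurd (h5 rfl) (by decide)
  · simp only [Bool.not_true, if_true] at *
    have h7 : S.sg true j = 1 := by rw [← neg_neg (S.sg true j), h3]; rfl
    rw [h4, h7] at h5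
    exact absurd (h5 rfl) (by decide)

theorem sg_flip_ne {κ : Bool} {j : J} (h : S.sg κ j ≠ 0) (hb : ¬S.IsBlocked κ j) :
    S.sg κ (S.flip κ j) ≠ 0 := by
  rw [S.sg_flip κ j h hb]
  revert h
  generalize S.sg κ j = e
  revert e
  decide

/-- The involution under which the contributions of the poles are antisymmetric. -/
def pairing (x : J × Bool) : J × Bool := by
  classical
  exact if S.sg x.2 x.1 = 0 then x else if S.IsBlocked x.2 x.1 then
    (S.flip x.2 (S.flip (!x.2) x.1), !x.2) else (S.flip x.2 x.1, x.2)

theorem IsBlocked.not {κ : Bool} {j : J} (hb : S.IsBlocked κ j) : ¬S.IsBlocked (!κ) j := by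
  rintro ⟨-, -, h1, -⟩
  obtain ⟨-, -, h2, h3⟩ := hb
  rw [h3, h2] at h1
  cases κ <;> exact absurd h1 (by decide)

/-- This passes from one end of a string to the other: first the other factor is flipped, then the
one that was blocked. The result has both signs reversed and is blocked at the other factor. -/
theorem blocked_flip {κ : Bool} {j : J} (hs : S.sg κ j ≠ 0) (hb : S.IsBlocked κ j) :
    ¬ S.IsBlocked (!κ) j ∧ S.sg (!κ) j ≠ 0 ∧ ¬S.IsBlocked κ (S.flip (!κ) j) ∧
      S.sg κ (S.flip (!κ) j) = S.sg κ j ∧ S.sg (!κ) (S.flip (!κ) j) = -S.sg κ j ∧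
      S.sg κ (S.flip κ (S.flip (!κ) j)) = -S.sg κ j ∧
      S.sg (!κ) (S.flip κ (S.flip (!κ) j)) = -S.sg κ j ∧
      S.IsBlocked (!κ) (S.flip κ (S.flip (!κ) j)) := by
  have hb' := IsBlocked.not S hb
  obtain ⟨b1, b2, b3, b4⟩ := hb
  have hs' : S.sg (!κ) j ≠ 0 := b4 ▸ hs
  have e1 := S.sg_not_flip (!κ) j hs' hb'
  have e2 := S.sg_flip (!κ) j hs' hb'
  have e0 := S.gap_flip (!κ) j hs' hb'
  rw [Bool.not_not] at e1
  rw [b4] at e2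
  have hn : ∀ e : SignType, e ≠ 0 → -e ≠ e := by decide
  have hb2 : ¬S.IsBlocked κ (S.flip (!κ) j) := by
    rintro ⟨-, -, -, h⟩
    rw [e1, e2] at h
    exact hn _ hs h
  have hs2 : S.sg κ (S.flip (!κ) j) ≠ 0 := e1 ▸ hs
  have e3 := S.sg_flip κ _ hs2 hb2
  have e4 := S.sg_not_flip κ _ hs2 hb2
  have e5 := S.gap_flip κ _ hs2 hb2
  rw [e1] at e3
  rw [e2] at e4
  refine ⟨hb', hs', hb2, e1, e2, e3, e4, b1, by rw [e5, e0, b2], ?_, ?_⟩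
  · rw [e4, b3]
    cases κ <;> rfl
  · rw [Bool.not_not, e3, e4]

theorem pairing_involutive : Function.Involutive S.pairing := by
  classical
  rintro ⟨j, κ⟩
  by_cases hs : S.sg κ j = 0
  · simp [pairing, hs]
  by_cases hb : S.IsBlocked κ j
  · obtain ⟨b1, b2, b3, b4, b5, b6, b7, b8⟩ := S.blocked_flip hs hb
    have e : S.pairing (j, κ) = (S.flip κ (S.flip (!κ) j), !κ) := by
      simp only [pairing]
      rw [if_neg hs, if_pos hb]
    have hs2 : S.sg κ (S.flip (!κ) j) ≠ 0 := b4 ▸ hs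
    rw [e, pairing]
    dsimp only
    rw [if_neg, if_pos b8, Bool.not_not, S.flip_flip κ _ hs2 b3, S.flip_flip (!κ) j b2 b1]
    rw [b7]
    revert hs
    generalize S.sg κ j = e
    revert e
    decide
  · have e : S.pairing (j, κ) = (S.flip κ j, κ) := by
      simp only [pairing]
      rw [if_neg hs, if_neg hb]
    rw [e, pairing]
    dsimp only
    rw [if_neg (S.sg_flip_ne hs hb), if_neg (S.not_isBlocked_flip hs hb), S.flip_flip κ j hs hb]

/-- The contribution of a pole to the commutator. -/
def term (p u : KK) (n : ℤ) (v : FockV ℓ) (x : J × Bool) : FockV ℓ :=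
  (c x.1 * prefactor (mon x.1)) • poleTerm p u k (mon x.1) (S.pt x.2 x.1) (S.sg x.2 x.1)
    (S.pt (!x.2) x.1) (S.sg (!x.2) x.1) n v

theorem term_eq_zero {p u : KK} (n : ℤ) (v : FockV ℓ) {κ : Bool} {j : J} (hs : S.sg κ j = 0) :
    S.term p u n v (j, κ) = 0 := by
  rw [term, poleTerm]
  dsimp only
  have e : Heis.polePt p u (S.pt κ j).eval 0 = Heis.zeroPt p u (S.pt κ j).eval 0 := rfl
  rw [hs, Heis.poleCoeff_eq_zero (Or.inl e), zero_mul, zero_smul, smul_zero]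

/-- A positive factor could meet the variable of a negative one only if `q^{4m+2} t^{-2m}` were
`q^{-2r} t^2` or its inverse with the roles exchanged. This leaves `r = 1`, `m = -1`, which
`gap_nonneg` excludes. -/
theorem pt_ne {κ : Bool} {j : J} (hs : S.sg κ j = 1) (hb : ¬S.IsBlocked κ j) :
    (S.sg (!κ) j = -1 → S.pt κ j ≠ (S.pt (!κ) j).mulQT (-2 * rr ℓ k) 2) := by
  intro h1 h2
  have hr := rr_eq ℓ k
  have h3 := congrArg (fun s : Spec => s.2.1) h2
  have h4 := congrArg (fun s : Spec => s.2.2) h2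
  have h5 := S.gap_nonneg j
  cases κ <;> simp only [pt, pairPt, Spec.mulQT, Bool.not_true, Bool.not_false] at h3 h4 <;> omega

theorem flip_data {p u : KK} (h : IsScreenPair (rr ℓ k) p u) {κ : Bool} {j : J} (hs : S.sg κ j = 1) (hb : ¬S.IsBlocked κ j) :
    Heis.polePt p u (S.pt κ j).eval 1 ≠ Heis.polePt p u (S.pt (!κ) j).eval (S.sg (!κ) j) ∧
    Heis.polePt p u (S.pt κ j).eval (-1) ≠ Heis.polePt p u (S.pt (!κ) j).eval (S.sg (!κ) j) ∧
    Heis.polePt p u (S.pt κ j).eval (-1) ≠ Heis.zeroPt p u (S.pt (!κ) j).eval (S.sg (!κ) j) ∧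
    stepFactor (mon j) k (S.pt κ j) = Heis.flipFactor p u (S.pt κ j).eval
      (Heis.zeroPt p u (S.pt (!κ) j).eval (S.sg (!κ) j))
      (Heis.polePt p u (S.pt (!κ) j).eval (S.sg (!κ) j)) := by
  have hs0 : S.sg κ j ≠ 0 := by rw [hs]; decide
  have h1 := S.polePt_ne h κ j
  have h2 := S.polePt_ne h κ (S.flip κ j)
  rw [hs] at h1
  rw [S.sg_flip κ j hs0 hb, S.sg_not_flip κ j hs0 hb, S.pt_flip hs0 hb, S.pt_flip hs0 hb, hs] at h2
  refine ⟨h1, h2, ?_, ?_⟩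
  · cases κ
    · refine pole_ne_zero_false (rr_eq ℓ k) h _ fun hr hm => ?_
      have := S.sg_ne (S.flip false j) hr (by rw [S.gap_flip false j hs0 hb, hm])
        (by rw [S.sg_flip false j hs0 hb, hs])
      rw [← this]
      exact (S.sg_not_flip false j hs0 hb).symm
    · refine pole_ne_zero_true (rr_eq ℓ k) h _ (S.gap_nonneg j) fun hr hm hs' => ?_
      have := S.sg_ne j hr hm hs'
      rw [this] at hs
      exact absurd hs (by decide)
  · have hM := S.nodePart_mon κ j
    rw [hs] at hM
    exact stepFactor_eq h hM h1 h2 (S.pt_ne hs hb)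

theorem term_flip {p u : KK} (h : IsScreenPair (rr ℓ k) p u) (n : ℤ) (v : FockV ℓ) {κ : Bool}
    {j : J} (hs : S.sg κ j = 1) (hb : ¬S.IsBlocked κ j) :
    S.term p u n v (S.flip κ j, κ) = -S.term p u n v (j, κ) := by
  have hs0 : S.sg κ j ≠ 0 := by rw [hs]; decide
  obtain ⟨h1, h2, h3, h4⟩ := S.flip_data h hs hb
  have key := congrArg (c j • ·) (poleTerm_flip h (mon j) h1 h2 h3 n v)
  rw [term, term]
  dsimp only
  rw [S.sg_flip κ j hs0 hb, S.sg_not_flip κ j hs0 hb, S.pt_flip hs0 hb, S.pt_flip hs0 hb, hs,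
    S.coeff_flip κ j hs hb]
  have hm := S.mon_flip κ j hs hb
  change mon (S.flip κ j) = mon j - aMon k ((S.pt κ j).mulQT (-rr ℓ k) 1) at hm
  rw [hm]
  change (c j * stepFactor (mon j) k (S.pt κ j) * _) • _ = _
  rw [h4, mul_assoc (c j), mul_smul (c j), key, smul_neg, mul_smul (c j)]

/-- The second pole of the first monomial of a string has no partner one flip away. It cancels
against the first pole of the last monomial, which is also unmatched. -/
theorem term_string {p u : KK} (h : IsScreenPair (rr ℓ k) p u) (n : ℤ) (v : FockV ℓ)
    {j : J} (hs : S.sg false j = 1) (hb : S.IsBlocked false j) :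
    S.term p u n v (S.flip false (S.flip true j), true) = -S.term p u n v (j, false) := by
  have hs0 : S.sg false j ≠ 0 := by rw [hs]; decide
  obtain ⟨b1, b2, b3, b4, b5, b6, b7, b8⟩ := S.blocked_flip hs0 hb
  rw [Bool.not_false] at *
  obtain ⟨hr, hg, -, hst⟩ := hb
  rw [Bool.not_false, hs] at hst
  rw [hs] at b4 b5 b6 b7
  have b2' : S.sg false (S.flip true j) ≠ 0 := by rw [b4]; decide
  set x := (S.X j).eval with hx
  have hp := h.left_ne_zero
  have hu := h.right_ne_zero
  have hx0 : x ≠ 0 := Spec.eval_ne_zero _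
  have pt1 : (S.pt true j).eval = x := rfl
  have pt2 : (S.pt false j).eval = x * qt 2 0 := by
    rw [pt, pairPt, Spec.eval_mulQT, hg]
    rfl
  rw [term, term]
  dsimp only
  rw [Bool.not_true, Bool.not_false, b6, b7, hs, hst, S.pt_flip b2' b3, S.pt_flip b2 b1,
    S.pt_flip b2' b3, S.pt_flip b2 b1]
  rcases h with ⟨rfl, rfl⟩ | ⟨rfl, rfl⟩
  · have h : IsScreenPair (rr ℓ k) (qt 0 (-1)) (qt (rr ℓ k) 0) := Or.inl ⟨rfl, rfl⟩
    obtain ⟨-, -, -, f1⟩ := S.flip_data h hst b1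
    obtain ⟨-, -, -, f2⟩ := S.flip_data h b4 b3
    rw [Bool.not_true, hs, pt1, pt2] at f1
    rw [Bool.not_false, b5, S.pt_flip b2 b1, S.pt_flip b2 b1, pt1, pt2] at f2
    have m1 : mon (S.flip true j) = mon j - aMon k ((S.pt true j).mulQT (-rr ℓ k) 1) :=
      S.mon_flip true j hst b1
    have m2 : mon (S.flip false (S.flip true j)) =
        mon (S.flip true j) - aMon k ((S.pt false j).mulQT (-rr ℓ k) 1) := by
      rw [← S.pt_flip b2 b1]
      exact S.mon_flip false _ b4 b3
    have c1 : c (S.flip true j) = c j * stepFactor (mon j) k (S.pt true j) :=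
      S.coeff_flip true j hst b1
    have c2 : c (S.flip false (S.flip true j)) =
        c (S.flip true j) * stepFactor (mon (S.flip true j)) k (S.pt false j) := by
      rw [← S.pt_flip b2 b1]
      exact S.coeff_flip false _ b4 b3
    have p1 := prefactor_sub_aMon h (mon j) (S.pt true j)
    have p2 := prefactor_sub_aMon h (mon (S.flip true j)) (S.pt false j)
    have g1 := fuse_sub_aMon h (mon j) (S.pt true j)
    have g2 := fuse_sub_aMon h (mon (S.flip true j)) (S.pt false j)
    have hu2 : qt 2 0 = qt (rr ℓ k) 0 ^ 2 := by
      rw [hr, ← zpow_natCast, qt_zpow]; rfl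
    rw [← m1] at p1 g1
    rw [← m2] at p2 g2
    rw [pt1] at g1
    rw [pt2] at g2
    rw [hu2] at f1 f2 g2 pt2
    rw [c2, c1, f1, f2, p2, p1, poleTerm, poleTerm, pt1, pt2]
    have n1 : 1 - qt (rr ℓ k) 0 ^ 2 ≠ 0 := by
      rw [← zpow_natCast, qt_zpow, hr]
      exact one_sub_qt_ne_zero (Or.inl (by decide))
    have n2 : 1 - qt (rr ℓ k) 0 ^ 4 ≠ 0 := by
      rw [← zpow_natCast, qt_zpow, hr]
      exact one_sub_qt_ne_zero (Or.inl (by decide))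
    have n3 : 1 - qt 0 (-1) ^ 2 * qt (rr ℓ k) 0 ^ 2 ≠ 0 := by
      rw [← zpow_natCast, ← zpow_natCast, qt_zpow, qt_zpow, hr, ← qt_add]
      exact one_sub_qt_ne_zero (Or.inl (by decide))
    have n4 : 1 - qt 0 (-1) ^ 2 * qt (rr ℓ k) 0 ^ 4 ≠ 0 := by
      rw [← zpow_natCast, ← zpow_natCast, qt_zpow, qt_zpow, hr, ← qt_add]
      exact one_sub_qt_ne_zero (Or.inl (by decide))
    have key := Heis.poleCoeff_string hp hu hx0 n1 n2 n3 n4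
    generalize qt 0 (-1) = p at *
    generalize qt (rr ℓ k) 0 = u at *
    -- The negative pole at `x u^2` is the positive pole at `x`. Hence the relations of the two
    -- steps can be added, and they connect the first with the last monomial.
    have hfuse : Heis.fuse (monModes (mon (S.flip false (S.flip true j)))) (screenModes ℓ u k)
        (Heis.polePt p u x (-1)) =
        Heis.fuse (monModes (mon j)) (screenModes ℓ u k) (Heis.polePt p u (x * u ^ 2) 1) := by
      have hpt : Heis.polePt p u (x * u ^ 2) (-1) = Heis.polePt p u x 1 := by
        change p * u ^ 2 / (x * u ^ 2) = p / x
        exact mul_div_mul_right _ _ (pow_ne_zero 2 hu)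
      rw [hpt] at g2
      funext m i
      have g1' := congrFun (congrFun g1 m) i
      have g2' := congrFun (congrFun g2 m) i
      simp only [Heis.fuse, Pi.add_apply, Pi.smul_apply, smul_eq_mul] at g1' g2' ⊢
      linear_combination g1' + g2'
    rw [hfuse, smul_smul, smul_smul, ← neg_smul]
    congr 1
    linear_combination (c j * prefactor (mon j)) * key
  -- For the screening current with `u = t⁻¹` each of the two poles lies on the zero of the other
  -- factor, so neither contributes.
  · have e1 : Heis.polePt (qt (rr ℓ k) 0) (qt 0 (-1)) (S.pt true j).eval (-1) =
        Heis.zeroPt (qt (rr ℓ k) 0) (qt 0 (-1)) (S.pt false j).eval (-1) := by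
      rw [polePt_qt, zeroPt_qt, pt1, pt2, qt_div_eq_iff hx0, hr]
      decide
    have e2 : Heis.polePt (qt (rr ℓ k) 0) (qt 0 (-1)) (S.pt false j).eval 1 =
        Heis.zeroPt (qt (rr ℓ k) 0) (qt 0 (-1)) (S.pt true j).eval 1 := by
      rw [polePt_qt, zeroPt_qt, pt1, pt2, eq_comm, qt_div_eq_iff hx0, hr]
      decide
    rw [poleTerm, poleTerm, Heis.poleCoeff_eq_zero (Or.inr e1), Heis.poleCoeff_eq_zero (Or.inr e2)]
    simp only [zero_mul, zero_smul, smul_zero, neg_zero]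

theorem term_pairing {p u : KK} (h : IsScreenPair (rr ℓ k) p u) (n : ℤ) (v : FockV ℓ) (x : J × Bool) :
    S.term p u n v (S.pairing x) = -S.term p u n v x := by
  classical
  obtain ⟨j, κ⟩ := x
  by_cases hs : S.sg κ j = 0
  · simp only [pairing]
    rw [if_pos hs, S.term_eq_zero n v hs, neg_zero]
  have hs' : S.sg κ j = 1 ∨ S.sg κ j = -1 := by
    revert hs
    generalize S.sg κ j = e
    revert e
    decide
  by_cases hb : S.IsBlocked κ j
  · have e : S.pairing (j, κ) = (S.flip κ (S.flip (!κ) j), !κ) := by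
      simp only [pairing]
      rw [if_neg hs, if_pos hb]
    rw [e]
    cases κ
    · refine S.term_string h n v ?_ hb
      exact hb.2.2.1
    · obtain ⟨b1, b2, b3, b4, b5, b6, b7, b8⟩ := S.blocked_flip hs hb
      have e3 : S.sg false (S.flip true (S.flip false j)) = 1 := b8.2.2.1
      have key := S.term_string h n v e3 b8
      have hs2 : S.sg true (S.flip false j) ≠ 0 := by
        rw [Bool.not_true] at b4
        rwa [b4]
      rw [Bool.not_true] at *
      rw [S.flip_flip true _ hs2 b3, S.flip_flip false j b2 b1] at key
      rw [key, neg_neg]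
  · have e : S.pairing (j, κ) = (S.flip κ j, κ) := by
      simp only [pairing]
      rw [if_neg hs, if_neg hb]
    rw [e]
    rcases hs' with hs' | hs'
    · exact S.term_flip h n v hs' hb
    · have hs2 : S.sg κ (S.flip κ j) = 1 := by
        rw [S.sg_flip κ j hs hb, hs', neg_neg]
      have key := S.term_flip h n v hs2 (S.not_isBlocked_flip hs hb)
      rw [S.flip_flip κ j hs hb] at key
      rw [key, neg_neg]

/-- The sum equals its own negative under the involution, and `2` is invertible. Fixed points have
sign `0`, hence no pole. -/
theorem sum_term [Fintype J] {p u : KK} (h : IsScreenPair (rr ℓ k) p u) (n : ℤ) (v : FockV ℓ) :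
    ∑ x, S.term p u n v x = 0 := by
  have e : ∑ x, S.term p u n v x = -∑ x, S.term p u n v x := by
    rw [← Finset.sum_neg_distrib]
    simp only [← S.term_pairing h]
    exact (Equiv.sum_comp S.pairing_involutive.toPerm (S.term p u n v)).symm
  have e2 : (2 : KK) • ∑ x, S.term p u n v x = 0 := by
    rw [two_smul]
    nth_rewrite 2 [e]
    exact add_neg_cancel _
  exact (smul_eq_zero.1 e2).resolve_left two_ne_zero

theorem commutator (S : NodeSystem k mon c) [Fintype J] {p u : KK} {δ : ℂ[X]} (h : IsScreenPair (rr ℓ k) p u)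
    (hδ : IsScreenShift (rr ℓ k) p δ) (n : ℤ) (v : FockV ℓ) :
    ∑ j, c j • monField (mon j) n (screen ℓ u k δ (-1) (Finsupp.single 0 v)) =
      ∑ j, c j • screen ℓ u k δ (-1) (monField (mon j) n (Finsupp.single 0 v)) := by
  have e : ∀ j, c j • monField (mon j) n (screen ℓ u k δ (-1) (Finsupp.single 0 v)) =
      c j • screen ℓ u k δ (-1) (monField (mon j) n (Finsupp.single 0 v)) +
      Finsupp.single (shiftWeight ℓ k δ) (S.term p u n v (j, true) + S.term p u n v (j, false)) := by
    intro j
    rw [monField_commutator h hδ (S.nodePart_mon true j) (S.polePt_ne h true j), smul_add,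
      Finsupp.smul_single, smul_smul, smul_add]
    rfl
  rw [Finset.sum_congr rfl fun j _ => e j, Finset.sum_add_distrib, ← Finsupp.single_finsetSum]
  have e2 : ∑ j, (S.term p u n v (j, true) + S.term p u n v (j, false)) = 0 := by
    rw [← S.sum_term h n v, Fintype.sum_prod_type]
    refine Finset.sum_congr rfl fun j _ => ?_
    rw [Fintype.sum_bool]
  rw [e2, Finsupp.single_zero, add_zero]

end NodeSystem

theorem sum_smul_apply {J : Type} [Fintype J] (mon : J → Mon ℓ) (c : J → K) (n : ℤ) (w : Fock ℓ) :
    (∑ j, c j • monField (mon j)) n w = ∑ j, algebraMap K KK (c j) • monField (mon j) n w := by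
  rw [Finset.sum_apply, Finset.sum_apply]
  refine Finset.sum_congr rfl fun j _ => ?_
  rw [algebraMap_smul]
  rfl

theorem screen_sum {J : Type} [Fintype J] (u : KK) (k : Fin ℓ) (δ : ℂ[X]) (mon : J → Mon ℓ)
    (c : J → KK) (m n : ℤ) (v : FockV ℓ) :
    screen ℓ u k δ m (∑ j, c j • monField (mon j) n (Finsupp.single 0 v)) =
      ∑ j, c j • screen ℓ u k δ m (monField (mon j) n (Finsupp.single 0 v)) := by
  simp only [monField_single, Finsupp.smul_single, screen_single, ← Heis.vertex_smul,
    ← Finsupp.single_finsetSum, ← Heis.vertex_sum]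

/-- A family of monomials which is closed under flips at all nodes gives an element of the deformed
`W`-algebra. -/
theorem mem_WW_of_nodeSystem {J : Type} [Fintype J] {mon : J → Mon ℓ} {c : J → K}
    (S : ∀ k, NodeSystem k mon fun j => algebraMap K KK (c j)) :
    (∑ j, c j • monField (mon j)) ∈ WW ℓ := by
  refine ⟨Submodule.sum_mem _ fun j _ => Submodule.smul_mem _ _ (Submodule.subset_span ⟨_, rfl⟩),
    fun k => ⟨fun n v => ?_, fun n v => ?_⟩⟩
  · rw [screenPlus_eq, sum_smul_apply, sum_smul_apply, screen_sum]
    exact (S k).commutator (Or.inl ⟨rfl, rfl⟩) (isScreenShift_plus (rr_ne_zero ℓ k)) n v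
  · rw [screenMinus_eq, sum_smul_apply, sum_smul_apply, screen_sum]
    exact (S k).commutator (Or.inr ⟨rfl, rfl⟩) (isScreenShift_minus _) n v

end DeformedW

end

noncomputable section

namespace DeformedW

open Polynomial PowerSeries

variable {ℓ : ℕ}

/-! ### Positive and negative exponents at a node -/

theorem Spec.mulQT_injective (m n : ℤ) : Function.Injective fun s : Spec => s.mulQT m n := by
  rintro ⟨a, b, c⟩ ⟨a', b', c'⟩ h
  simp only [Spec.mulQT, Prod.mk.injEq] at h ⊢
  exact ⟨h.1, by omega, by omega⟩

theorem dbl_apply (r : ℤ) (X : Spec) (ε : SignType) (s : Spec) :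
    (dbl r X ε s = 1 ∧ ε = 1 ∧ s = X) ∨ (dbl r X ε s = -1 ∧ ε = -1 ∧ s = X.mulQT (-2 * r) 2) ∨
      (dbl r X ε s = 0 ∧ ¬(ε = 1 ∧ s = X) ∧ ¬(ε = -1 ∧ s = X.mulQT (-2 * r) 2)) := by
  cases ε
  · exact Or.inr (Or.inr ⟨rfl, by simp, by simp⟩)
  · by_cases h : s = X.mulQT (-2 * r) 2
    · exact Or.inr (Or.inl ⟨by rw [h]; simp [dbl], rfl, h⟩)
    · exact Or.inr (Or.inr ⟨by simp only [dbl, Finsupp.neg_apply, Finsupp.single_apply, if_neg (Ne.symm h), neg_zero],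
        fun h' => absurd h'.1 (by decide), fun h' => h h'.2⟩)
  · by_cases h : s = X
    · exact Or.inl ⟨by rw [h]; simp [dbl], rfl, h⟩
    · exact Or.inr (Or.inr ⟨by simp [dbl, Ne.symm h], by simp [h], by simp⟩)

namespace NodeSystem

variable {k : Fin ℓ} {J : Type} {mon : J → Mon ℓ} {c : J → KK} (S : NodeSystem k mon c)

theorem mon_apply (j : J) (s : Spec) : mon j (k, s) =
    dbl (rr ℓ k) (S.pt true j) (S.sg true j) s + dbl (rr ℓ k) (S.pt false j) (S.sg false j) s := by
  rw [← nodePart_apply, S.nodePart_eq j]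
  rfl

theorem pt_true (j : J) : S.pt true j = S.X j := rfl

theorem pt_false (j : J) : S.pt false j = (S.X j).mulQT (4 * S.gap j + 2) (-2 * S.gap j) := rfl

theorem pt_injective {κ κ' : Bool} {j : J} (h : S.pt κ j = S.pt κ' j) : κ = κ' := by
  have h1 := congrArg (fun s : Spec => s.2.1) h
  cases κ <;> cases κ' <;> try rfl
  all_goals
    simp only [pt, pairPt, Spec.mulQT] at h1
    omega

theorem exists_of_pos {j : J} {s : Spec} (h : 0 < mon j (k, s)) :
    ∃ κ, S.sg κ j = 1 ∧ s = S.pt κ j := by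
  rw [S.mon_apply] at h
  rcases dbl_apply (rr ℓ k) (S.pt true j) (S.sg true j) s with h1 | h1 | h1
  · exact ⟨true, h1.2⟩
  all_goals
    rcases dbl_apply (rr ℓ k) (S.pt false j) (S.sg false j) s with h2 | h2 | h2
    · exact ⟨false, h2.2⟩
    · omega
    · omega

theorem exists_of_neg {j : J} {s : Spec} (h : mon j (k, s) < 0) :
    ∃ κ, S.sg κ j = -1 ∧ s = (S.pt κ j).mulQT (-2 * rr ℓ k) 2 := by
  rw [S.mon_apply] at h
  rcases dbl_apply (rr ℓ k) (S.pt true j) (S.sg true j) s with h1 | h1 | h1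
  rotate_left
  · exact ⟨true, h1.2⟩
  all_goals
    rcases dbl_apply (rr ℓ k) (S.pt false j) (S.sg false j) s with h2 | h2 | h2
    · omega
    · exact ⟨false, h2.2⟩
    · omega

/-- The positions of two points, one of them possibly multiplied by `q^{-2r} t^2`. -/
theorem pt_eq_pt {j : J} {κ κ' : Bool} {m n m' n' : ℤ}
    (h : (S.pt κ j).mulQT m n = (S.pt κ' j).mulQT m' n') :
    (κ = κ' ∧ m = m' ∧ n = n') ∨
    (κ = true ∧ κ' = false ∧ m - m' = 4 * S.gap j + 2 ∧ n - n' = -2 * S.gap j) ∨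
    (κ = false ∧ κ' = true ∧ m' - m = 4 * S.gap j + 2 ∧ n' - n = -2 * S.gap j) := by
  have h1 := congrArg (fun s : Spec => s.2.1) h
  have h2 := congrArg (fun s : Spec => s.2.2) h
  cases κ <;> cases κ' <;> simp only [pt, pairPt, Spec.mulQT] at h1 h2 <;> simp <;> omega

theorem mulQT_zero (s : Spec) : s.mulQT 0 0 = s := by simp [Spec.mulQT]

theorem mulQT_mulQT (s : Spec) (m n m' n' : ℤ) :
    (s.mulQT m n).mulQT m' n' = s.mulQT (m + m') (n + n') := by simp [Spec.mulQT, add_assoc]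

theorem ne_of_sg {κ κ' : Bool} {j : J} (h : S.sg κ j = 1) (h' : S.sg κ' j = -1) : κ ≠ κ' := by
  rintro rfl
  rw [h] at h'
  exact absurd h' (by decide)

theorem pos_neg_ne {κ κ' : Bool} {j : J} (h : S.sg κ j = 1) (h' : S.sg κ' j = -1) :
    S.pt κ j ≠ (S.pt κ' j).mulQT (-2 * rr ℓ k) 2 := by
  intro e
  rw [← mulQT_zero (S.pt κ j)] at e
  have hr := rr_eq ℓ k
  have hg := S.gap_nonneg j
  have hne := S.ne_of_sg h h'
  rcases S.pt_eq_pt e with ⟨e1, -⟩ | ⟨-, -, e1, e2⟩ | ⟨-, -, e1, e2⟩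
  · exact hne e1
  · omega
  · omega

theorem pos_of_sg {κ : Bool} {j : J} (h : S.sg κ j = 1) : 0 < mon j (k, S.pt κ j) := by
  rw [S.mon_apply]
  cases κ
  · rcases dbl_apply (rr ℓ k) (S.pt false j) (S.sg false j) (S.pt false j) with h1 | h1 | h1
    · rcases dbl_apply (rr ℓ k) (S.pt true j) (S.sg true j) (S.pt false j) with h2 | h2 | h2
      · omega
      · exact absurd h2.2.2 (S.pos_neg_ne h h2.2.1)
      · omega
    · rw [h] at h1; exact absurd h1.2.1 (by decide)
    · exact absurd ⟨h, rfl⟩ h1.2.1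
  · rcases dbl_apply (rr ℓ k) (S.pt true j) (S.sg true j) (S.pt true j) with h1 | h1 | h1
    · rcases dbl_apply (rr ℓ k) (S.pt false j) (S.sg false j) (S.pt true j) with h2 | h2 | h2
      · omega
      · exact absurd h2.2.2 (S.pos_neg_ne h h2.2.1)
      · omega
    · rw [h] at h1; exact absurd h1.2.1 (by decide)
    · exact absurd ⟨h, rfl⟩ h1.2.1

theorem neg_of_sg {κ : Bool} {j : J} (h : S.sg κ j = -1) :
    mon j (k, (S.pt κ j).mulQT (-2 * rr ℓ k) 2) < 0 := by
  rw [S.mon_apply]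
  cases κ
  · rcases dbl_apply (rr ℓ k) (S.pt false j) (S.sg false j)
      ((S.pt false j).mulQT (-2 * rr ℓ k) 2) with h1 | h1 | h1
    · rw [h] at h1; exact absurd h1.2.1 (by decide)
    · rcases dbl_apply (rr ℓ k) (S.pt true j) (S.sg true j)
        ((S.pt false j).mulQT (-2 * rr ℓ k) 2) with h2 | h2 | h2
      · exact absurd h2.2.2.symm (S.pos_neg_ne h2.2.1 h)
      · omega
      · omega
    · exact absurd ⟨h, rfl⟩ h1.2.2
  · rcases dbl_apply (rr ℓ k) (S.pt true j) (S.sg true j)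
      ((S.pt true j).mulQT (-2 * rr ℓ k) 2) with h1 | h1 | h1
    · rw [h] at h1; exact absurd h1.2.1 (by decide)
    · rcases dbl_apply (rr ℓ k) (S.pt false j) (S.sg false j)
        ((S.pt true j).mulQT (-2 * rr ℓ k) 2) with h2 | h2 | h2
      · exact absurd h2.2.2.symm (S.pos_neg_ne h2.2.1 h)
      · omega
      · omega
    · exact absurd ⟨h, rfl⟩ h1.2.2

theorem generic (S : NodeSystem k mon c) (j : J) (s : Spec) :
    mon j (k, s) = -1 ∨ mon j (k, s) = 0 ∨ mon j (k, s) = 1 := by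
  rw [S.mon_apply]
  rcases dbl_apply (rr ℓ k) (S.pt true j) (S.sg true j) s with h1 | h1 | h1 <;>
    rcases dbl_apply (rr ℓ k) (S.pt false j) (S.sg false j) s with h2 | h2 | h2
  any_goals omega
  · exact absurd (S.pt_injective (h1.2.2.symm.trans h2.2.2)) (by decide)
  · exact absurd (S.pt_injective (Spec.mulQT_injective _ _ (h1.2.2.symm.trans h2.2.2))) (by decide)

/-- Two factors of equal sign are never at the distance `q^{-2r} t^2`, so the last two conditions
hold vacuously. The first fails only for a pattern of signs excluded by `sg_ne`. -/
theorem regular (S : NodeSystem k mon c) (j : J) (s : Spec) :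
    (0 < mon j (k, s) → 0 ≤ mon j (k, s.mulQT (-2 * rr ℓ k) 0) ∧ 0 ≤ mon j (k, s.mulQT 0 2)) ∧
    (0 < mon j (k, s) → 0 < mon j (k, s.mulQT (-2 * rr ℓ k) 2) →
      0 < mon j (k, s.mulQT (-2 * rr ℓ k) 0) ∧ 0 < mon j (k, s.mulQT 0 2)) ∧
    (mon j (k, s) < 0 → mon j (k, s.mulQT (-2 * rr ℓ k) 2) < 0 →
      mon j (k, s.mulQT (-2 * rr ℓ k) 0) < 0 ∧ mon j (k, s.mulQT 0 2) < 0) := by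
  have hr := rr_eq ℓ k
  have hg := S.gap_nonneg j
  refine ⟨fun h => ⟨?_, ?_⟩, fun h1 h2 => ?_, fun h1 h2 => ?_⟩
  · by_contra hneg
    obtain ⟨κ, e1, rfl⟩ := S.exists_of_pos h
    obtain ⟨κ', e2, e3⟩ := S.exists_of_neg (not_le.1 hneg)
    rcases S.pt_eq_pt e3 with ⟨_, _⟩ | ⟨_, _, _, _⟩ | ⟨_, _, _, _⟩ <;> omega
  · by_contra hneg
    obtain ⟨κ, e1, rfl⟩ := S.exists_of_pos h
    obtain ⟨κ', e2, e3⟩ := S.exists_of_neg (not_le.1 hneg)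
    rcases S.pt_eq_pt e3 with ⟨_, _⟩ | ⟨rfl, rfl, e4, e5⟩ | ⟨_, _, _, _⟩
    · omega
    · have e6 := S.sg_ne j (by omega) (by omega) e2
      rw [e1] at e6
      exact absurd e6 (by decide)
    · omega
  · exfalso
    obtain ⟨κ, e1, rfl⟩ := S.exists_of_pos h1
    obtain ⟨κ', e2, e3⟩ := S.exists_of_pos h2
    rw [← mulQT_zero (S.pt κ' j)] at e3
    rcases S.pt_eq_pt e3 with ⟨_, _⟩ | ⟨_, _, _, _⟩ | ⟨_, _, _, _⟩ <;> omega
  · exfalso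
    obtain ⟨κ, e1, rfl⟩ := S.exists_of_neg h1
    obtain ⟨κ', e2, e3⟩ := S.exists_of_neg h2
    rw [mulQT_mulQT] at e3
    rcases S.pt_eq_pt e3 with ⟨_, _⟩ | ⟨_, _, _, _⟩ | ⟨_, _, _, _⟩ <;> omega

/-- A positive variable that is not admissible must have another positive variable at `q^{-2r}` or
`t^2` times its point. Only `4m + 2 = 2r`, `m = 0` allows this, and then the factor is blocked. -/
theorem isAdmissible_iff (j : J) (s : Spec) : IsAdmissible (mon j) k s ↔
    ∃ κ, S.sg κ j = 1 ∧ ¬S.IsBlocked κ j ∧ s = S.pt κ j := by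
  have hr := rr_eq ℓ k
  have hg := S.gap_nonneg j
  constructor
  · rintro ⟨h1, h2, h3⟩
    obtain ⟨κ, e1, rfl⟩ := S.exists_of_pos h1
    refine ⟨κ, e1, ?_, rfl⟩
    rintro ⟨b1, b2, b3, b4⟩
    rw [e1] at b3 b4
    cases κ
    · have e2 := S.pos_of_sg b4
      have e3 : (S.pt false j).mulQT (-2 * rr ℓ k) 0 = S.pt true j := by
        rw [pt_false, pt_true, mulQT_mulQT, b1, b2]
        exact mulQT_zero _
      rw [e3] at h2
      exact absurd h2 e2.ne'
    · exact absurd b3 (by decide)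
  · rintro ⟨κ, e1, hb, rfl⟩
    have h1 := S.pos_of_sg e1
    obtain ⟨h2, h3⟩ := (S.regular j (S.pt κ j)).1 h1
    refine ⟨h1, le_antisymm ?_ h2, le_antisymm ?_ h3⟩
    · by_contra h4
      obtain ⟨κ', e2, e3⟩ := S.exists_of_pos (not_le.1 h4)
      rw [← mulQT_zero (S.pt κ' j)] at e3
      rcases S.pt_eq_pt e3 with ⟨_, _⟩ | ⟨_, _, _, _⟩ | ⟨rfl, rfl, e4, e5⟩
      · omega
      · omega
      · exact hb ⟨by omega, by omega, e1, e2.trans e1.symm⟩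
    · by_contra h4
      obtain ⟨κ', e2, e3⟩ := S.exists_of_pos (not_le.1 h4)
      rw [← mulQT_zero (S.pt κ' j)] at e3
      rcases S.pt_eq_pt e3 with ⟨_, _⟩ | ⟨_, _, _, _⟩ | ⟨_, _, _, _⟩ <;> omega

/-- A monomial with a negative factor arises from another one by an unblocked flip. -/
theorem exists_not_isBlocked {κ : Bool} {j : J} (h : S.sg κ j = -1) :
    ∃ κ', S.sg κ' j = -1 ∧ ¬S.IsBlocked κ' j := by
  by_cases hb : S.IsBlocked κ j
  · exact ⟨!κ, hb.2.2.2.trans h, IsBlocked.not S hb⟩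
  · exact ⟨κ, h, hb⟩

theorem mon_eq_of_neg {κ : Bool} {j : J} (h : S.sg κ j = -1) (hb : ¬S.IsBlocked κ j) :
    mon j = mon (S.flip κ j) - aMon k ((S.pt κ j).mulQT (-rr ℓ k) 1) ∧
      c j = c (S.flip κ j) * stepFactor (mon (S.flip κ j)) k (S.pt κ j) ∧
      IsAdmissible (mon (S.flip κ j)) k (S.pt κ j) := by
  have hs : S.sg κ j ≠ 0 := by rw [h]; decide
  have e1 : S.sg κ (S.flip κ j) = 1 := by rw [S.sg_flip κ j hs hb, h, neg_neg]
  have hb' := S.not_isBlocked_flip hs hb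
  have e2 := S.mon_flip κ _ e1 hb'
  have e3 := S.coeff_flip κ _ e1 hb'
  rw [S.flip_flip κ j hs hb] at e2 e3
  rw [← S.pt_flip hs hb κ]
  exact ⟨e2, e3, (S.isAdmissible_iff _ _).2 ⟨κ, e1, hb', rfl⟩⟩

theorem neg_transfer {κ : Bool} {j j' : J} (hm : mon j = mon j') (h : S.sg κ j = -1) :
    ∃ κ', S.sg κ' j' = -1 ∧ S.pt κ' j' = S.pt κ j := by
  have h1 := S.neg_of_sg h
  rw [hm] at h1
  obtain ⟨κ', e1, e2⟩ := S.exists_of_neg h1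
  exact ⟨κ', e1, (Spec.mulQT_injective _ _ e2).symm⟩

/-- Being blocked with a negative sign can be read off the monomial: it means that a second negative
exponent stands at `q^2` times the point. It is therefore common to all indices with the same
monomial. -/
theorem unblocked_transfer {κ : Bool} {j j' : J} (hm : mon j = mon j') (h : S.sg κ j = -1)
    (hb : ¬S.IsBlocked κ j) :
    ∃ κ', S.sg κ' j' = -1 ∧ ¬S.IsBlocked κ' j' ∧ S.pt κ' j' = S.pt κ j := by
  obtain ⟨κ', e1, e2⟩ := S.neg_transfer hm h
  refine ⟨κ', e1, ?_, e2⟩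
  rintro ⟨b1, b2, b3, b4⟩
  rw [e1] at b3 b4
  cases κ'
  · exact absurd b3 (by decide)
  obtain ⟨κ₂, e3, e4⟩ := S.neg_transfer hm.symm b4
  have e5 : (S.pt κ j).mulQT 2 0 = (S.pt κ₂ j).mulQT 0 0 := by
    rw [mulQT_zero, e4, ← e2, Bool.not_true, pt_true, pt_false, b2]
    rfl
  rcases S.pt_eq_pt e5 with ⟨_, _⟩ | ⟨rfl, rfl, e6, e7⟩ | ⟨_, _, _, _⟩
  · omega
  · exact hb ⟨b1, by omega, h, e3.trans h.symm⟩
  · omega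

end NodeSystem

/-! ### The fundamental field of a system of flips -/

/-- The height `(ρ^∨, ·)` of a monomial. -/
def height (M : Mon ℓ) : ℂ := M.sum fun p d => (d : ℂ) * (rhoCheck ℓ ⬝ᵥ fundWeight ℓ p.1)

theorem height_add (M N : Mon ℓ) : height (M + N) = height M + height N := by
  rw [height, height, height, Finsupp.sum_add_index' (by simp) (by intros; push_cast; ring)]

/-- The value is `(ρ^∨, α_k)`. Hence every step of the algorithm lowers the height by one, and
extremal arguments over the finite family replace an induction. -/
theorem height_aMon (k : Fin ℓ) (s : Spec) : height (aMon k s) = 1 := by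
  rw [height, aMon_sum _ (by simp) (by intros; push_cast; ring)]
  dsimp only
  rw [sum_ite_incidence k (fun j => ((1 : ℤ) : ℂ) * (rhoCheck ℓ ⬝ᵥ fundWeight ℓ j)),
    ← rhoCheck_dot_simpleRoot k, simpleRoot_eq k, dotProduct_sub, dotProduct_sum]
  simp [dotProduct_smul]
  ring

variable {J : Type} {mon : J → Mon ℓ}

theorem height_flip {c : J → KK} {k : Fin ℓ} (S : NodeSystem k mon c) {κ : Bool} {j : J}
    (h : S.sg κ j = -1) (hb : ¬S.IsBlocked κ j) :
    (height (mon (S.flip κ j))).re = (height (mon j)).re + 1 := by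
  have e := height_add (mon j) (aMon k ((S.pt κ j).mulQT (-rr ℓ k) 1))
  rw [(S.mon_eq_of_neg h hb).1, sub_add_cancel, height_aMon] at e
  rw [e, Complex.add_re, Complex.one_re, ← (S.mon_eq_of_neg h hb).1]

/-- Among the indices that are not created, one of maximal height is not the initial one, so it has
a negative factor that can be flipped back. The flip is higher, hence created, and one step of the
algorithm returns. -/
theorem created_of_nodeSystem [Fintype J] {c : J → KK} (S : ∀ k, NodeSystem k mon c) {j₀ : J}
    (h0 : c j₀ = 1) (hneg : ∀ j, j ≠ j₀ → ∃ k κ, (S k).sg κ j = -1) (j : J) :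
    Created (mon j₀) (mon j) (c j) := by
  classical
  by_contra hj
  obtain ⟨j, hj, hmax⟩ := Finset.exists_max_image
    (Finset.univ.filter fun j => ¬Created (mon j₀) (mon j) (c j)) (fun j => (height (mon j)).re)
    ⟨j, by simpa using hj⟩
  have hj' : ¬Created (mon j₀) (mon j) (c j) := by simpa using hj
  have hne : j ≠ j₀ := by
    rintro rfl
    rw [h0] at hj'
    exact hj' .start
  obtain ⟨k, κ, hκ⟩ := hneg j hne
  obtain ⟨κ, hκ, hb⟩ := (S k).exists_not_isBlocked hκ
  obtain ⟨e1, e2, e3⟩ := (S k).mon_eq_of_neg hκ hb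
  by_cases hc : Created (mon j₀) (mon ((S k).flip κ j)) (c ((S k).flip κ j))
  · apply hj'
    rw [e1, e2]
    exact .step k _ hc e3
  · have h1 := hmax ((S k).flip κ j) (by simpa using hc)
    rw [height_flip (S k) hκ hb] at h1
    linarith

/-- The coefficient is carried by the index, not by the sequence of steps. Together with injectivity
of `mon` this shows that all sequences lead to the same coefficient. -/
theorem exists_of_created {c : J → KK} (S : ∀ k, NodeSystem k mon c) {j₀ : J} (h0 : c j₀ = 1)
    {M : Mon ℓ} {d : KK} (h : Created (mon j₀) M d) : ∃ j, mon j = M ∧ c j = d := by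
  induction h with
  | start => exact ⟨j₀, rfl, h0⟩
  | step k s _ hs ih =>
    obtain ⟨j, rfl, rfl⟩ := ih
    obtain ⟨κ, e1, e2, rfl⟩ := ((S k).isAdmissible_iff j s).1 hs
    exact ⟨(S k).flip κ j, (S k).mon_flip κ j e1 e2, (S k).coeff_flip κ j e1 e2⟩

theorem isDominant_iff_of_nodeSystem {c : J → KK} (S : ∀ k, NodeSystem k mon c) {j₀ : J}
    (hd : IsDominant (mon j₀)) (hneg : ∀ j, j ≠ j₀ → ∃ k κ, (S k).sg κ j = -1) (j : J) :
    IsDominant (mon j) ↔ j = j₀ := by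
  refine ⟨fun h => ?_, fun h => h ▸ hd⟩
  by_contra hne
  obtain ⟨k, κ, hκ⟩ := hneg j hne
  exact absurd (h _) (not_le.2 ((S k).neg_of_sg hκ))

/-- Two different indices with the same monomial, of maximal height, have a common negative variable
that can be flipped back in both. The results have equal monomials and a greater height, so they
coincide, and flipping again identifies the two indices. -/
theorem mon_injective_of_nodeSystem [Fintype J] {c : J → KK} (S : ∀ k, NodeSystem k mon c) {j₀ : J}
    (hd : IsDominant (mon j₀)) (hneg : ∀ j, j ≠ j₀ → ∃ k κ, (S k).sg κ j = -1) :
    Function.Injective mon := by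
  classical
  intro j j' hjj'
  by_contra hne
  obtain ⟨j, hj, hmax⟩ := Finset.exists_max_image
    (Finset.univ.filter fun j => ∃ j', mon j = mon j' ∧ j ≠ j') (fun j => (height (mon j)).re)
    ⟨j, by simpa using ⟨j', hjj', hne⟩⟩
  obtain ⟨j', hm, hne⟩ : ∃ j', mon j = mon j' ∧ j ≠ j' := by simpa using hj
  have h0 : j ≠ j₀ := by
    rintro rfl
    have := (isDominant_iff_of_nodeSystem S hd hneg j').1 (hm ▸ hd)
    exact hne this.symm
  obtain ⟨k, κ, hκ⟩ := hneg j h0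
  obtain ⟨κ, hκ, hb⟩ := (S k).exists_not_isBlocked hκ
  obtain ⟨κ', hκ', hb', hpt⟩ := (S k).unblocked_transfer hm hκ hb
  have e1 := ((S k).mon_eq_of_neg hκ hb).1
  have e2 := ((S k).mon_eq_of_neg hκ' hb').1
  have hs : (S k).sg κ j ≠ 0 := by rw [hκ]; decide
  have hs' : (S k).sg κ' j' ≠ 0 := by rw [hκ']; decide
  have e3 : mon ((S k).flip κ j) = mon ((S k).flip κ' j') := by
    rw [hm, e2, hpt] at e1
    exact (sub_left_injective e1).symm
  by_cases e4 : (S k).flip κ j = (S k).flip κ' j'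
  · have e5 : κ = κ' := by
      apply (S k).pt_injective (j := (S k).flip κ j)
      rw [(S k).pt_flip hs hb, e4, (S k).pt_flip hs' hb', hpt]
    subst e5
    apply hne
    rw [← (S k).flip_flip κ j hs hb, e4, (S k).flip_flip κ j' hs' hb']
  · have h1 := hmax ((S k).flip κ j) (by simpa using ⟨_, e3, e4⟩)
    rw [height_flip (S k) hκ hb] at h1
    linarith

/-- A family of monomials closed under flips at all nodes, in which every monomial but one has a
negative factor, is the expansion of a fundamental field. -/
theorem isFundamentalField_of_nodeSystem {i : ℕ} [Fintype J] {c : J → K}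
    (S : ∀ k, NodeSystem k mon fun j => algebraMap K KK (c j)) (hu : ∀ j, IsUnit (c j)) {j₀ : J}
    (hmon : mon j₀ = Y ℓ i 0 0) (h0 : c j₀ = 1)
    (hneg : ∀ j, j ≠ j₀ → ∃ k κ, (S k).sg κ j = -1) : IsFundamentalField ℓ i mon c := by
  have h0' : algebraMap K KK (c j₀) = 1 := by rw [h0, map_one]
  have hd : IsDominant (mon j₀) := by
    rw [hmon, Y]
    split_ifs
    · intro p
      rw [Finsupp.single_apply]
      split_ifs <;> simp
    · exact fun p => le_rfl
  have hinj := mon_injective_of_nodeSystem S hd hneg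
  have hdom := isDominant_iff_of_nodeSystem S hd hneg
  refine ⟨mem_WW_of_nodeSystem S, hinj, hu, fun j => ?_, ⟨j₀, hmon, h0⟩, fun M d h => ?_,
    fun M d => ⟨fun h => ?_, ?_⟩⟩
  · rw [hdom, ← hmon, hinj.eq_iff]
  · rw [← hmon] at h
    obtain ⟨j, rfl, -⟩ := exists_of_created S h0' h
    exact ⟨fun p => (S p.1).generic j p.2, fun k s => (S k).regular j s⟩
  · rw [← hmon] at h
    exact exists_of_created S h0' h
  · rintro ⟨j, rfl, rfl⟩
    rw [← hmon]
    exact created_of_nodeSystem S h0' hneg j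

end DeformedW

end

noncomputable section

namespace DeformedW

open Polynomial PowerSeries

variable {ℓ : ℕ}

/-! ### Computations with monomials -/

theorem nodePart_add (M N : Mon ℓ) (a : Fin ℓ) : nodePart (M + N) a = nodePart M a + nodePart N a := by
  ext s; rfl

theorem nodePart_sub (M N : Mon ℓ) (a : Fin ℓ) : nodePart (M - N) a = nodePart M a - nodePart N a := by
  ext s; rfl

theorem nodePart_neg (M : Mon ℓ) (a : Fin ℓ) : nodePart (-M) a = -nodePart M a := by
  ext s; rfl

theorem nodePart_zero (a : Fin ℓ) : nodePart (0 : Mon ℓ) a = 0 := by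
  ext s; rfl

/-- Taking the part at a node, as a homomorphism. -/
def nodePartHom (a : Fin ℓ) : Mon ℓ →+ (Spec →₀ ℤ) where
  toFun M := nodePart M a
  map_zero' := nodePart_zero a
  map_add' M N := nodePart_add M N a

theorem nodePart_sum {ι : Type*} (s : Finset ι) (M : ι → Mon ℓ) (a : Fin ℓ) :
    nodePart (∑ i ∈ s, M i) a = ∑ i ∈ s, nodePart (M i) a :=
  map_sum (nodePartHom a) M s

/-- The point `q^m t^n`. -/
abbrev qtPt (m n : ℤ) : Spec := (1, m, n)

theorem nodePart_Y (k : ℕ) (m n : ℤ) (a : Fin ℓ) :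
    nodePart (Y ℓ k m n) a = if k = a.val + 1 then Finsupp.single (qtPt m n) 1 else 0 := by
  have := a.2
  ext s
  rw [nodePart_apply, Y]
  split_ifs with h1 h2 h2
  · rw [Finsupp.single_apply, Finsupp.single_apply]
    have : (⟨k - 1, by omega⟩ : Fin ℓ) = a := Fin.ext (by simp; omega)
    simp [this, Prod.ext_iff]
  · rw [Finsupp.single_apply, if_neg]
    · rfl
    · intro h
      have := congrArg (fun p : Fin ℓ × Spec => p.1.val) h
      simp only at this
      omega
  · omega
  · rfl

theorem Y_zero (ℓ : ℕ) (m n : ℤ) : Y ℓ 0 m n = 0 := by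
  rw [Y, dif_neg (by omega)]

theorem single_eq_Y (a : Fin ℓ) (m n : ℤ) :
    (Finsupp.single (a, qtPt m n) 1 : Mon ℓ) = Y ℓ (a.val + 1) m n := by
  rw [Y, dif_pos ⟨by omega, a.2⟩]
  rfl

theorem aMon_eq_Y (a : Fin ℓ) (m n : ℤ) : aMon a (qtPt m n) =
    Y ℓ (a.val + 1) (m + rr ℓ a) (n - 1) + Y ℓ (a.val + 1) (m - rr ℓ a) (n + 1) - Y ℓ a.val m n
      - (if a.val + 2 < ℓ then Y ℓ (a.val + 2) m n
        else if a.val + 2 = ℓ then Y ℓ ℓ (m + 1) n + Y ℓ ℓ (m - 1) n else 0) := by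
  rw [aMon, sum_incidence (fun j z => if z = 1 then (Finsupp.single (j, qtPt m n) 1 : Mon ℓ)
        else if z = 2 then
          Finsupp.single (j, (qtPt m n).mulQT 1 0) 1 + Finsupp.single (j, (qtPt m n).mulQT (-1) 0) 1
        else 0) (by simp) a]
  simp only [Spec.mulQT, single_eq_Y, add_zero, if_true, sub_sub, ← sub_eq_add_neg]
  congr 2
  · split_ifs with h
    · congr 1; omega
    · rw [show a.val = 0 by omega, Y_zero]
  · split_ifs <;> first | omega | rfl | skip
    all_goals simp_all

/-! ### Factors of the algorithm -/

theorem baseFactor_qt (r m n : ℤ) : baseFactor r (qt m n) = ratioFactor r m n := by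
  rw [baseFactor, ratioFactor, q_zpow_eq]
  have e : t ^ 2 = qt 0 2 := by rw [← t_zpow_eq]; rfl
  rw [e, ← qt_add, ← qt_add, ← qt_add, ← qt_add]
  rw [show -2 * r + m = m - 2 * r by ring, show -2 * r + 0 + m = m - 2 * r by ring,
    show 0 + 2 + n = n + 2 by ring, show 2 + n = n + 2 by ring, zero_add, zero_add]

theorem eval_div_mulQT (X : Spec) (m n : ℤ) : X.eval / (X.mulQT m n).eval = qt (-m) (-n) := by
  rw [Spec.eval_mulQT, qt_neg, div_mul_cancel_left₀ X.eval_ne_zero]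

theorem ne_mulQT (X : Spec) {m n : ℤ} (h : m ≠ 0 ∨ n ≠ 0) : X ≠ X.mulQT m n := by
  intro e
  have h1 := congrArg (fun s : Spec => s.2.1) e
  have h2 := congrArg (fun s : Spec => s.2.2) e
  simp only [Spec.mulQT] at h1 h2
  omega

theorem stepFactor_pos {M : Mon ℓ} {k : Fin ℓ} {X : Spec} {m n : ℤ} (h : m ≠ 0 ∨ n ≠ 0)
    (hM : nodePart M k = dbl (rr ℓ k) X 1 + dbl (rr ℓ k) (X.mulQT m n) 1) :
    stepFactor M k X = ratioFactor (rr ℓ k) (-m) (-n) := by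
  rw [stepFactor_add_single (ne_mulQT X h) one_ne_zero hM, zpow_one, eval_div_mulQT, baseFactor_qt]

/-- The variable of a negative factor sits at `q^{-2r} t^2` times its point; `ratioFactor_symm`
expresses the factor through the point itself. -/
theorem stepFactor_neg {M : Mon ℓ} {k : Fin ℓ} {X : Spec} {m n : ℤ}
    (h : m ≠ 2 * rr ℓ k ∨ n ≠ -2)
    (hM : nodePart M k = dbl (rr ℓ k) X 1 + dbl (rr ℓ k) (X.mulQT m n) (-1)) :
    stepFactor M k X = (ratioFactor (rr ℓ k) m n)⁻¹ := by
  have e : dbl (rr ℓ k) (X.mulQT m n) (-1) =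
      Finsupp.single (X.mulQT (m - 2 * rr ℓ k) (n + 2)) (-1) := by
    change -Finsupp.single ((X.mulQT m n).mulQT _ _) 1 = _
    rw [← Finsupp.single_neg, NodeSystem.mulQT_mulQT]
    congr 2
    ring
  rw [e] at hM
  rw [stepFactor_add_single (ne_mulQT X (by omega)) (by norm_num) hM, zpow_neg_one, eval_div_mulQT,
    baseFactor_qt, ← ratioFactor_symm]
  congr 2 <;> ring

/-- A system of flips with one factor at each monomial. -/
def NodeSystem.ofSingle {k : Fin ℓ} {J : Type} {mon : J → Mon ℓ} {c : J → KK} (X : J → Spec)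
    (s : J → SignType) (flip : J → J)
    (nodePart_eq : ∀ j, nodePart (mon j) k = dbl (rr ℓ k) (X j) (s j))
    (X_flip : ∀ j, s j ≠ 0 → X (flip j) = X j) (s_flip : ∀ j, s j ≠ 0 → s (flip j) = -s j)
    (flip_flip : ∀ j, s j ≠ 0 → flip (flip j) = j)
    (mon_flip : ∀ j, s j = 1 → mon (flip j) = mon j - aMon k ((X j).mulQT (-rr ℓ k) 1))
    (coeff_flip : ∀ j, s j = 1 → c (flip j) = c j) : NodeSystem k mon c where
  X := X
  gap _ := 0
  -- The second factor is a dummy of sign `0`, so no present factor can be blocked.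
  sg κ j := if κ then s j else 0
  flip _ := flip
  nodePart_eq j := (nodePart_eq j).trans (add_zero _).symm
  gap_nonneg _ _ := le_rfl
  sg_ne _ _ _ h := absurd (show (0 : SignType) = -1 from h) (by decide)
  X_flip κ j h _ := X_flip j (by cases κ <;> simp_all)
  gap_flip _ _ _ _ := rfl
  sg_flip κ j h _ := by
    cases κ
    · simp at h
    · exact s_flip j h
  sg_not_flip κ j h _ := by
    cases κ
    · simp at h
    · rfl
  flip_flip κ j h _ := flip_flip j (by cases κ <;> simp_all)
  mon_flip κ j h _ := by
    cases κ
    · exact absurd (show (0 : SignType) = 1 from h) (by decide)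
    · exact mon_flip j h
  coeff_flip κ j h _ := by
    cases κ
    · exact absurd (show (0 : SignType) = 1 from h) (by decide)
    · have h' : s j = 1 := h
      have e : stepFactor (mon j) k (pairPt (X j) 0 true) = 1 := by
        refine stepFactor_single ((nodePart_eq j).trans ?_)
        rw [h']
        rfl
      rw [e, mul_one]
      exact coeff_flip j h

end DeformedW

end

/-! ### The spinor field `T_ℓ`. -/

noncomputable section

namespace DeformedW

open Polynomial PowerSeries

variable {ℓ : ℕ}

/-! ### The spinor representation -/

/-- The partial sums `σ_1 + ⋯ + σ_{k-1}`. -/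
def psum (σ : Fin ℓ → ℤˣ) (k : Fin ℓ) : ℤ := ∑ p ∈ Finset.univ.filter (fun p => p < k), (σ p : ℤ)

theorem spinorMon_eq (σ : Fin ℓ → ℤˣ) : spinorMon ℓ σ =
    ∑ k : Fin ℓ, spinorFactor ℓ (σ k) (k.val + 1) (-2 * psum σ k) (psum σ k) := rfl

theorem psum_succ (σ : Fin ℓ → ℤˣ) {a b : Fin ℓ} (h : b.val = a.val + 1) :
    psum σ b = psum σ a + σ a := by
  have e : Finset.univ.filter (fun p => p < b) = insert a (Finset.univ.filter (fun p => p < a)) := by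
    ext p
    simp only [Finset.mem_filter, Finset.mem_univ, true_and, Finset.mem_insert, Fin.lt_def,
      Fin.ext_iff]
    omega
  rw [psum, psum, e, Finset.sum_insert (by simp), add_comm]

theorem psum_swap (σ : Fin ℓ → ℤˣ) {a b k : Fin ℓ} (h : a < k ↔ b < k) :
    psum (σ ∘ Equiv.swap a b) k = psum σ k := by
  rw [psum, psum]
  refine Finset.sum_equiv (Equiv.swap a b) (fun p => ?_) fun p _ => rfl
  simp only [Finset.mem_filter, Finset.mem_univ, true_and, Equiv.swap_apply_def]
  split_ifs with h1 h2
  · rw [h1, h]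
  · rw [h2, h]
  · rfl

theorem psum_congr {σ τ : Fin ℓ → ℤˣ} {k : Fin ℓ} (h : ∀ p, p < k → σ p = τ p) :
    psum σ k = psum τ k := by
  refine Finset.sum_congr rfl fun p hp => ?_
  rw [h p (Finset.mem_filter.1 hp).2]

theorem nodePart_spinorFactor_of_ne (σ : ℤˣ) {k a : Fin ℓ} (m n : ℤ) (h1 : k ≠ a)
    (h2 : k.val ≠ a.val + 1) : nodePart (spinorFactor ℓ σ (k.val + 1) m n) a = 0 := by
  have := k.2
  have := a.2
  rw [Ne, Fin.ext_iff] at h1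
  rw [spinorFactor]
  split_ifs
  · rw [nodePart_neg, nodePart_Y, if_neg (by omega), neg_zero]
  · exact nodePart_zero a
  · rw [nodePart_sub, nodePart_Y, nodePart_Y, if_neg (by omega), if_neg (by omega), sub_zero]
  · rw [nodePart_sub, nodePart_Y, nodePart_Y, if_neg (by omega), if_neg (by omega), sub_zero]

theorem spinorFactor_one_of_lt {k : ℕ} (hk : k < ℓ) (m n : ℤ) : spinorFactor ℓ 1 k m n = 0 := by
  rw [spinorFactor, if_pos rfl, if_neg hk.ne]

theorem spinorFactor_one_last (m n : ℤ) :
    spinorFactor ℓ 1 ℓ m n = -Y ℓ ℓ (m - 2 * ℓ) (n + ℓ + 1) := by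
  rw [spinorFactor, if_pos rfl, if_pos rfl]

theorem spinorFactor_neg_of_lt {k : ℕ} (hk : k < ℓ) (m n : ℤ) : spinorFactor ℓ (-1) k m n =
    Y ℓ k (m - 2 * ℓ + 3) (n + ℓ - 1) - Y ℓ (k - 1) (m - 2 * ℓ + 1) (n + ℓ) := by
  rw [spinorFactor, if_neg (by decide), if_neg hk.ne]

theorem spinorFactor_neg_last (m n : ℤ) : spinorFactor ℓ (-1) ℓ m n =
    Y ℓ ℓ (m - 2 * ℓ + 2) (n + ℓ - 1) - Y ℓ (ℓ - 1) (m - 2 * ℓ + 1) (n + ℓ) := by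
  rw [spinorFactor, if_neg (by decide), if_pos rfl]

/-- The point of a spinor monomial at a node. -/
def spinorPt (a : Fin ℓ) (σ : Fin ℓ → ℤˣ) : Spec :=
  if a.val + 1 < ℓ then qtPt (-2 * psum σ a - 2 * ℓ + 3) (psum σ a + ℓ - 1)
  else qtPt (-2 * psum σ a - 2 * ℓ + 2) (psum σ a + ℓ - 1)

/-- The sign of a spinor monomial at a node which is not the last one. -/
def spinorSign (a b : Fin ℓ) (σ : Fin ℓ → ℤˣ) : SignType :=
  if σ a = -1 ∧ σ b = 1 then 1 else if σ a = 1 ∧ σ b = -1 then -1 else 0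

/-- Only the factors at `a` and `b` contain `Y_a`, with exponents `+1` and `-1`, when their signs
are `-1`. If both signs are `-1`, the two variables coincide and cancel. -/
theorem spinor_nodePart {a b : Fin ℓ} (h : b.val = a.val + 1) (σ : Fin ℓ → ℤˣ) :
    nodePart (spinorMon ℓ σ) a = dbl (rr ℓ a) (spinorPt a σ) (spinorSign a b σ) := by
  have hb := b.2
  have hr : rr ℓ a = 2 := by rw [rr, if_neg (by omega)]
  have hab : a ≠ b := by rw [Ne, Fin.ext_iff]; omega
  rw [spinorMon_eq, nodePart_sum, Fintype.sum_eq_add a b hab fun x hx =>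
    nodePart_spinorFactor_of_ne _ _ _ hx.1 fun e => hx.2 (Fin.ext (e.trans h.symm)), psum_succ σ h]
  have hX : spinorPt a σ = qtPt (-2 * psum σ a - 2 * ℓ + 3) (psum σ a + ℓ - 1) := by
    rw [spinorPt, if_pos (by omega)]
  have eb : ∀ m n, nodePart (spinorFactor ℓ (-1) (b.val + 1) m n) a =
      -Finsupp.single (qtPt (m - 2 * ℓ + 1) (n + ℓ)) 1 := by
    intro m n
    rcases Nat.lt_or_ge (b.val + 1) ℓ with h' | h'
    · rw [spinorFactor_neg_of_lt h', nodePart_sub, nodePart_Y, nodePart_Y, if_neg (by omega),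
        if_pos (by omega), zero_sub]
    · have e : b.val + 1 = ℓ := by omega
      rw [e, spinorFactor_neg_last, nodePart_sub, nodePart_Y, nodePart_Y, if_neg (by omega),
        if_pos (by omega), zero_sub]
  have eb1 : ∀ m n, nodePart (spinorFactor ℓ 1 (b.val + 1) m n) a = 0 := by
    intro m n
    rcases Nat.lt_or_ge (b.val + 1) ℓ with h' | h'
    · rw [spinorFactor_one_of_lt h', nodePart_zero]
    · have e : b.val + 1 = ℓ := by omega
      rw [e, spinorFactor_one_last, nodePart_neg, nodePart_Y, if_neg (by omega), neg_zero]
  have ea : ∀ m n, nodePart (spinorFactor ℓ (-1) (a.val + 1) m n) a =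
      Finsupp.single (qtPt (m - 2 * ℓ + 3) (n + ℓ - 1)) 1 := by
    intro m n
    rw [spinorFactor_neg_of_lt (by omega), nodePart_sub, nodePart_Y, nodePart_Y, if_pos rfl,
      if_neg (by omega), sub_zero]
  have ea1 : ∀ m n, nodePart (spinorFactor ℓ 1 (a.val + 1) m n) a = 0 := by
    intro m n
    rw [spinorFactor_one_of_lt (by omega), nodePart_zero]
  rw [hX, hr, spinorSign]
  rcases Int.units_eq_one_or (σ a) with e1 | e1 <;> rcases Int.units_eq_one_or (σ b) with e2 | e2 <;>
    rw [e1, e2]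
  · rw [ea1, eb1]; rfl
  · rw [ea1, eb, zero_add]
    change _ = -Finsupp.single ((qtPt _ _).mulQT _ _) 1
    congr 2
    simp only [Spec.mulQT, qtPt, Units.val_one, Prod.mk.injEq, true_and]
    constructor <;> ring
  · rw [ea, eb1, add_zero]; rfl
  · rw [ea, eb]
    change _ = 0
    rw [add_neg_eq_zero]
    congr 2 <;> (rw [Units.val_neg, Units.val_one]; ring)

theorem spinor_nodePart_last {a : Fin ℓ} (h : a.val + 1 = ℓ) (σ : Fin ℓ → ℤˣ) :
    nodePart (spinorMon ℓ σ) a =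
      dbl (rr ℓ a) (spinorPt a σ) (if σ a = -1 then 1 else -1) := by
  have hr : rr ℓ a = 1 := by rw [rr, if_pos h]
  rw [spinorMon_eq, nodePart_sum, Fintype.sum_eq_single a fun x hx =>
    nodePart_spinorFactor_of_ne _ _ _ hx (by have := x.2; omega)]
  have hX : spinorPt a σ = qtPt (-2 * psum σ a - 2 * ℓ + 2) (psum σ a + ℓ - 1) := by
    rw [spinorPt, if_neg (by omega)]
  rw [hX, hr]
  rcases Int.units_eq_one_or (σ a) with e1 | e1 <;> rw [e1, h]
  · rw [spinorFactor_one_last, nodePart_neg, nodePart_Y, if_pos h.symm, if_neg (by decide)]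
    change _ = -Finsupp.single ((qtPt _ _).mulQT _ _) 1
    congr 2
    simp only [Spec.mulQT, qtPt, Prod.mk.injEq, true_and]
    constructor <;> ring
  · rw [spinorFactor_neg_last, nodePart_sub, nodePart_Y, nodePart_Y, if_pos h.symm,
      if_neg (by omega), sub_zero, if_pos rfl]
    rfl

/-- The exchange does not change the partial sums at nodes other than `b`, so only the factors at
`a` and `b` change, and their quotient is `A_a`. -/
theorem spinorMon_swap {a b : Fin ℓ} (h : b.val = a.val + 1) {σ : Fin ℓ → ℤˣ} (ha : σ a = -1)
    (hb : σ b = 1) : spinorMon ℓ (σ ∘ Equiv.swap a b) =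
      spinorMon ℓ σ - aMon a ((spinorPt a σ).mulQT (-rr ℓ a) 1) := by
  have hbl := b.2
  have hr : rr ℓ a = 2 := by rw [rr, if_neg (by omega)]
  have hab : a ≠ b := by rw [Ne, Fin.ext_iff]; omega
  rw [eq_sub_iff_add_eq, ← eq_sub_iff_add_eq', spinorMon_eq, spinorMon_eq, ← Finset.sum_sub_distrib,
    Fintype.sum_eq_add a b hab]
  · have hX : spinorPt a σ = qtPt (-2 * psum σ a - 2 * ℓ + 3) (psum σ a + ℓ - 1) := by
      rw [spinorPt, if_pos (by omega)]
    have p1 : psum (σ ∘ Equiv.swap a b) a = psum σ a :=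
      psum_swap σ (by simp only [Fin.lt_def]; omega)
    have s1 : (σ ∘ Equiv.swap a b) a = 1 := by simp [hb]
    have s2 : (σ ∘ Equiv.swap a b) b = -1 := by simp [ha]
    rw [psum_succ σ h, psum_succ (σ ∘ Equiv.swap a b) h, p1, s1, s2, ha, hb, hX, hr]
    change aMon a (qtPt _ _) = _
    rw [aMon_eq_Y, hr, spinorFactor_neg_of_lt (by omega), spinorFactor_one_of_lt (by omega)]
    generalize psum σ a = s
    rcases Nat.lt_or_ge (b.val + 1) ℓ with h' | h'
    · rw [if_pos (by omega), spinorFactor_one_of_lt h', spinorFactor_neg_of_lt h', h]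
      simp only [Units.val_one, Nat.add_sub_cancel]
      ring_nf
      abel
    · have e : b.val + 1 = ℓ := by omega
      rw [if_neg (by omega), if_pos (by omega), e, spinorFactor_one_last, spinorFactor_neg_last,
        show ℓ - 1 = a.val + 1 by omega]
      simp only [Units.val_neg, Units.val_one, Nat.add_sub_cancel]
      ring_nf
      abel
  · rintro x ⟨h1, h2⟩
    rw [psum_swap σ]
    · rw [Function.comp_apply, Equiv.swap_apply_of_ne_of_ne h1 h2, sub_self]
    · rw [Ne, Fin.ext_iff] at h1 h2
      simp only [Fin.lt_def]
      omega

theorem spinorMon_update {a : Fin ℓ} (h : a.val + 1 = ℓ) {σ : Fin ℓ → ℤˣ} (ha : σ a = -1) :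
    spinorMon ℓ (Function.update σ a (-σ a)) =
      spinorMon ℓ σ - aMon a ((spinorPt a σ).mulQT (-rr ℓ a) 1) := by
  have hr : rr ℓ a = 1 := by rw [rr, if_pos h]
  have hp : ∀ x, psum (Function.update σ a (-σ a)) x = psum σ x := fun x => by
    refine psum_congr fun p hp => Function.update_of_ne ?_ _ _
    rintro rfl
    have := x.2
    rw [Fin.lt_def] at hp
    omega
  rw [eq_sub_iff_add_eq, ← eq_sub_iff_add_eq', spinorMon_eq, spinorMon_eq, ← Finset.sum_sub_distrib,
    Fintype.sum_eq_single a]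
  · have hX : spinorPt a σ = qtPt (-2 * psum σ a - 2 * ℓ + 2) (psum σ a + ℓ - 1) := by
      rw [spinorPt, if_neg (by omega)]
    rw [hp, Function.update_self, ha, neg_neg, hX, hr]
    change aMon a (qtPt _ _) = _
    rw [aMon_eq_Y, hr, h, spinorFactor_neg_last, spinorFactor_one_last, if_neg (by omega),
      if_neg (by omega)]
    generalize psum σ a = s
    have e : ℓ - 1 = a.val := by omega
    rw [e]
    ring_nf
    abel
  · intro x hx
    rw [hp, Function.update_of_ne hx, sub_self]

theorem spinorMon_top (hℓ : 1 ≤ ℓ) : spinorMon ℓ (fun _ => -1) = Y ℓ ℓ 0 0 := by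
  have hp : ∀ k : Fin ℓ, psum (fun _ => -1) k = -(k.val : ℤ) := by
    intro k
    have e : Finset.univ.filter (fun p => p < k) = Finset.Iio k := by ext; simp
    simp [psum, e]
  -- The product telescopes. The last variable is set apart, because the general formula would give
  -- it the argument `z q` instead of `z`.
  set T : ℕ → Mon ℓ := fun k => if k = ℓ then Y ℓ ℓ 0 0 else Y ℓ k (2 * k - 2 * ℓ + 1) (ℓ - k) with hT
  have e : ∀ k : Fin ℓ, spinorFactor ℓ (-1) (k.val + 1) (-2 * psum (fun _ => -1) k)
      (psum (fun _ => -1) k) = T (k.val + 1) - T k := by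
    intro k
    have hk := k.2
    rw [hp, hT]
    dsimp only
    rw [if_neg hk.ne]
    by_cases h : k.val + 1 = ℓ
    · have e1 : (ℓ : ℤ) = k.val + 1 := by omega
      rw [if_pos h, h, spinorFactor_neg_last, show ℓ - 1 = k.val by omega, e1]
      ring_nf
    · rw [if_neg h, spinorFactor_neg_of_lt (by omega), Nat.add_sub_cancel]
      push_cast
      ring_nf
  rw [spinorMon_eq, Finset.sum_congr rfl fun k _ => e k,
    Fin.sum_univ_eq_sum_range (fun k => T (k + 1) - T k), Finset.sum_range_sub, hT]
  dsimp only
  rw [if_pos rfl, if_neg (by omega), Y_zero, sub_zero]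

/-- The flips of spinors at a node which is not the last one. -/
def spinorSystem {a b : Fin ℓ} (h : b.val = a.val + 1) :
    NodeSystem a (spinorMon ℓ) (fun _ => algebraMap K KK 1) :=
  have hs : ∀ σ : Fin ℓ → ℤˣ, spinorSign a b (σ ∘ Equiv.swap a b) = -spinorSign a b σ := by
    intro σ
    simp only [spinorSign, Function.comp_apply, Equiv.swap_apply_left, Equiv.swap_apply_right]
    rcases Int.units_eq_one_or (σ a) with e1 | e1 <;> rcases Int.units_eq_one_or (σ b) with e2 | e2 <;>
      rw [e1, e2] <;> decide
  NodeSystem.ofSingle (spinorPt a) (spinorSign a b) (fun σ => σ ∘ Equiv.swap a b)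
    (spinor_nodePart h)
    (fun σ _ => by
      have := b.2
      rw [spinorPt, spinorPt, psum_swap σ (by simp only [Fin.lt_def]; omega)])
    (fun σ _ => hs σ)
    (fun σ _ => by ext p; simp)
    (fun σ hσ => by
      rw [spinorSign] at hσ
      split_ifs at hσ with h1
      exact spinorMon_swap h h1.1 h1.2)
    fun _ _ => rfl

/-- The flips of spinors at the last node. -/
def spinorSystemLast {a : Fin ℓ} (h : a.val + 1 = ℓ) :
    NodeSystem a (spinorMon ℓ) (fun _ => algebraMap K KK 1) :=
  NodeSystem.ofSingle (spinorPt a) (fun σ => if σ a = -1 then 1 else -1)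
    (fun σ => Function.update σ a (-σ a)) (spinor_nodePart_last h)
    (fun σ _ => by
      rw [spinorPt, spinorPt, psum_congr fun p hp => Function.update_of_ne (ne_of_lt hp) _ _])
    (fun σ _ => by
      rw [Function.update_self]
      rcases Int.units_eq_one_or (σ a) with e1 | e1 <;> rw [e1] <;> decide)
    (fun σ _ => by rw [Function.update_self, neg_neg, Function.update_idem, Function.update_eq_self])
    (fun σ hσ => by
      split_ifs at hσ with h1
      exact spinorMon_update h h1)
    fun _ _ => rfl

/-- The flips of spinors. -/
def spinorSystems (a : Fin ℓ) : NodeSystem a (spinorMon ℓ) (fun _ => algebraMap K KK 1) :=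
  if h : a.val + 1 < ℓ then spinorSystem (b := ⟨a.val + 1, h⟩) rfl
  else spinorSystemLast (by have := a.2; omega)

theorem spinor_isFundamentalField (hℓ : 1 ≤ ℓ) :
    IsFundamentalField ℓ ℓ (spinorMon ℓ) fun _ => 1 := by
  refine isFundamentalField_of_nodeSystem spinorSystems (fun _ => isUnit_one) (spinorMon_top hℓ) rfl
    fun σ hσ => ?_
  classical
  obtain ⟨a, ha⟩ : ∃ a, σ a = 1 := by
    by_contra! hc
    exact hσ (funext fun a => (Int.units_eq_one_or (σ a)).resolve_left (hc a))
  -- At the last index of sign `1` the monomial has a negative factor: either this is the last node,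
  -- or the next sign is `-1`.
  obtain ⟨a, ha, hmax⟩ := Finset.exists_max_image (Finset.univ.filter fun a => σ a = 1) id
    ⟨a, by simpa using ha⟩
  have ha' : σ a = 1 := by simpa using ha
  refine ⟨a, true, ?_⟩
  by_cases h : a.val + 1 < ℓ
  · have hb : σ ⟨a.val + 1, h⟩ = -1 := by
      refine (Int.units_eq_one_or _).resolve_left fun hb => ?_
      have := hmax ⟨a.val + 1, h⟩ (by simpa using hb)
      rw [id, id, Fin.le_def] at this
      simp at this
    rw [spinorSystems, dif_pos h]
    change spinorSign a ⟨a.val + 1, h⟩ σ = -1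
    rw [spinorSign, ha', hb]
    decide
  · rw [spinorSystems, dif_neg h]
    change (if σ a = -1 then (1 : SignType) else -1) = -1
    rw [ha']
    decide

end DeformedW

end

/-! ### The tableau fields `T_i` for `i < ℓ`. -/

noncomputable section

namespace DeformedW

open Polynomial PowerSeries

variable {ℓ : ℕ}

/-! ### The monomials of the vector representation at a node -/

theorem single_qtPt_congr {m n m' n' : ℤ} (h1 : m = m') (h2 : n = n') :
    (Finsupp.single (qtPt m n) 1 : Spec →₀ ℤ) = Finsupp.single (qtPt m' n') 1 := by rw [h1, h2]

/-- A node before the last occurs in two pairs of consecutive letters, `k + 1`, `k + 2` and their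
conjugates `2ℓ - k`, `2ℓ + 1 - k`. These are the two factors of the node system. -/
theorem nodePart_Lam {k : Fin ℓ} (h : k.val + 1 < ℓ) {L : ℕ} (h1 : 1 ≤ L) (h2 : L ≤ 2 * ℓ + 1)
    (m n : ℤ) : nodePart (Lam ℓ L m n) k =
      if L = k.val + 1 then Finsupp.single (qtPt (m - 2 * k.val) (n + k.val)) 1
      else if L = k.val + 2 then -Finsupp.single (qtPt (m - 2 * k.val - 4) (n + k.val + 2)) 1
      else if L = 2 * ℓ - k.val then
        Finsupp.single (qtPt (m + 6 - 4 * ℓ + 2 * k.val) (n + 2 * ℓ - k.val - 2)) 1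
      else if L = 2 * ℓ + 1 - k.val then
        -Finsupp.single (qtPt (m + 6 - 4 * ℓ + 2 * k.val - 4) (n + 2 * ℓ - k.val)) 1
      else 0 := by
  rw [Lam]
  split_ifs <;> (try omega) <;> simp only [nodePart_sub, nodePart_add, nodePart_Y] <;>
    (repeat rw [if_neg (by omega)]) <;> (repeat rw [if_pos (by omega)]) <;>
    (repeat rw [if_neg (by omega)]) <;>
    simp only [sub_zero, zero_sub, add_zero, zero_add] <;>
    first | rfl | exact single_qtPt_congr (by omega) (by omega) |
      exact congrArg Neg.neg (single_qtPt_congr (by omega) (by omega))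

theorem nodePart_Lam_last {k : Fin ℓ} (h : k.val + 1 = ℓ) (hℓ : 2 ≤ ℓ) {L : ℕ} (h1 : 1 ≤ L)
    (h2 : L ≤ 2 * ℓ + 1) (m n : ℤ) : nodePart (Lam ℓ L m n) k =
      if L = ℓ then Finsupp.single (qtPt (m - 2 * ℓ + 3) (n + ℓ - 1)) 1 +
        Finsupp.single (qtPt (m - 2 * ℓ + 1) (n + ℓ - 1)) 1
      else if L = ℓ + 1 then Finsupp.single (qtPt (m - 2 * ℓ + 3) (n + ℓ - 1)) 1 -
        Finsupp.single (qtPt (m - 2 * ℓ - 1) (n + ℓ + 1)) 1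
      else if L = ℓ + 2 then -Finsupp.single (qtPt (m - 2 * ℓ + 1) (n + ℓ + 1)) 1 -
        Finsupp.single (qtPt (m - 2 * ℓ - 1) (n + ℓ + 1)) 1
      else 0 := by
  rw [Lam]
  split_ifs <;> (try omega) <;> simp only [nodePart_sub, nodePart_add, nodePart_Y] <;>
    (repeat rw [if_neg (by omega)]) <;> (repeat rw [if_pos (by omega)]) <;>
    (repeat rw [if_neg (by omega)]) <;>
    simp only [sub_zero, zero_sub, add_zero, zero_add]

/-- `Λ_L - Λ_{L+1}` is the monomial `A_k`, for `L = k + 1 < ℓ`. -/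
theorem Lam_sub_Lam_low {k : Fin ℓ} (h : k.val + 1 < ℓ) (m n : ℤ) :
    Lam ℓ (k.val + 1) m n - Lam ℓ (k.val + 2) m n =
      aMon k ((qtPt (m - 2 * k.val) (n + k.val)).mulQT (-rr ℓ k) 1) := by
  have hr : rr ℓ k = 2 := by rw [rr, if_neg (by omega)]
  change _ = aMon k (qtPt _ _)
  rw [aMon_eq_Y, hr, Lam, if_pos h, Lam]
  rcases Nat.lt_or_ge (k.val + 2) ℓ with h' | h'
  · rw [if_pos h', if_pos h']
    simp only [Nat.add_sub_cancel, show k.val + 2 - 1 = k.val + 1 by omega]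
    push_cast
    ring_nf
    abel
  · have e : k.val + 2 = ℓ := by omega
    rw [if_neg (by omega), if_pos e, if_neg (by omega), if_pos e]
    have e2 : (ℓ : ℤ) = k.val + 2 := by omega
    simp only [Nat.add_sub_cancel, show ℓ - 1 = k.val + 1 by omega, e2]
    push_cast
    ring_nf
    abel

/-- `Λ_L - Λ_{L+1}` is the monomial `A_k`, for `L = 2ℓ - k > ℓ + 1`. -/
theorem Lam_sub_Lam_high {k : Fin ℓ} (h : k.val + 1 < ℓ) (m n : ℤ) :
    Lam ℓ (2 * ℓ - k.val) m n - Lam ℓ (2 * ℓ - k.val + 1) m n =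
      aMon k ((qtPt (m + 6 - 4 * ℓ + 2 * k.val) (n + 2 * ℓ - k.val - 2)).mulQT (-rr ℓ k) 1) := by
  have hr : rr ℓ k = 2 := by rw [rr, if_neg (by omega)]
  change _ = aMon k (qtPt _ _)
  rw [aMon_eq_Y, hr, Lam, Lam, if_neg (show ¬2 * ℓ - k.val + 1 < ℓ by omega),
    if_neg (show ¬2 * ℓ - k.val + 1 = ℓ by omega), if_neg (show ¬2 * ℓ - k.val + 1 = ℓ + 1 by omega),
    if_neg (show ¬2 * ℓ - k.val + 1 = ℓ + 2 by omega), if_neg (show ¬2 * ℓ - k.val < ℓ by omega),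
    if_neg (show ¬2 * ℓ - k.val = ℓ by omega), if_neg (show ¬2 * ℓ - k.val = ℓ + 1 by omega)]
  have c1 : ((2 * ℓ - k.val : ℕ) : ℤ) = 2 * ℓ - k.val := by omega
  rcases Nat.lt_or_ge (k.val + 2) ℓ with h' | h'
  · rw [if_pos h', if_neg (by omega), show 2 * ℓ + 2 - (2 * ℓ - k.val + 1) = k.val + 1 by omega,
      show 2 * ℓ + 2 - (2 * ℓ - k.val) = k.val + 2 by omega]
    simp only [Nat.add_sub_cancel, show k.val + 2 - 1 = k.val + 1 by omega]
    push_cast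
    rw [c1]
    ring_nf
    abel
  · have e : k.val + 2 = ℓ := by omega
    rw [if_neg (show ¬k.val + 2 < ℓ by omega), if_pos e, if_pos (by omega),
      show 2 * ℓ + 2 - (2 * ℓ - k.val + 1) = k.val + 1 by omega]
    have e2 : (ℓ : ℤ) = k.val + 2 := by omega
    simp only [Nat.add_sub_cancel, show ℓ - 1 = k.val + 1 by omega]
    push_cast
    rw [c1, e2]
    ring_nf
    abel

/-- `Λ_ℓ - Λ_{ℓ+1}` is the monomial `A_ℓ`. -/
theorem Lam_sub_Lam_mid {k : Fin ℓ} (h : k.val + 1 = ℓ) (m n : ℤ) :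
    Lam ℓ ℓ m n - Lam ℓ (ℓ + 1) m n =
      aMon k ((qtPt (m - 2 * ℓ + 1) (n + ℓ - 1)).mulQT (-rr ℓ k) 1) := by
  have hr : rr ℓ k = 1 := by rw [rr, if_pos h]
  change _ = aMon k (qtPt _ _)
  rw [aMon_eq_Y, hr, Lam, Lam, if_neg (by omega), if_pos rfl, if_neg (by omega), if_neg (by omega),
    if_pos rfl, if_neg (by omega), if_neg (by omega), h, show ℓ - 1 = k.val by omega]
  ring_nf
  abel

/-- `Λ_{ℓ+1} - Λ_{ℓ+2}` is the monomial `A_ℓ`. -/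
theorem Lam_sub_Lam_mid_succ {k : Fin ℓ} (h : k.val + 1 = ℓ) (m n : ℤ) :
    Lam ℓ (ℓ + 1) m n - Lam ℓ (ℓ + 2) m n =
      aMon k ((qtPt (m - 2 * ℓ + 3) (n + ℓ - 1)).mulQT (-rr ℓ k) 1) := by
  have hr : rr ℓ k = 1 := by rw [rr, if_pos h]
  change _ = aMon k (qtPt _ _)
  rw [aMon_eq_Y, hr, Lam, Lam, if_neg (by omega), if_neg (by omega), if_pos rfl, if_neg (by omega),
    if_neg (by omega), if_neg (by omega), if_pos rfl, if_neg (by omega), if_neg (by omega), h,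
    show ℓ - 1 = k.val by omega]
  ring_nf
  abel

end DeformedW

end

noncomputable section

namespace DeformedW

open Polynomial PowerSeries

variable {ℓ i : ℕ}

/-! ### Tableaux as lattice paths -/

/-- A tableau, described by the numbers `N L` of its entries which are at most `L`. -/
@[ext]
structure LatticePath (ℓ i : ℕ) where
  /-- the number of entries which are at most `L` -/
  N : ℕ → ℕ
  zero : N 0 = 0
  last : ∀ L, 2 * ℓ + 1 ≤ L → N L = i
  mono : ∀ L, N L ≤ N (L + 1)
  -- Only the letter `ℓ + 1` may be repeated; it occurs `N (ℓ + 1) - N ℓ` times.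
  step : ∀ L, L ≠ ℓ → N (L + 1) ≤ N L + 1

namespace LatticePath

theorem monotone (N : LatticePath ℓ i) : Monotone N.N := monotone_nat_of_le_succ N.mono

/-- Changing a value of a path. -/
def set (N : LatticePath ℓ i) (L v : ℕ) (h1 : 1 ≤ L) (h2 : L ≤ 2 * ℓ) (hl : N.N (L - 1) ≤ v)
    (hu : v ≤ N.N (L + 1)) (hs : L ≠ ℓ + 1 → v ≤ N.N (L - 1) + 1)
    (hs' : L ≠ ℓ → N.N (L + 1) ≤ v + 1) : LatticePath ℓ i where
  N := Function.update N.N L v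
  zero := by rw [Function.update_of_ne (by omega), N.zero]
  last L' h := by rw [Function.update_of_ne (by omega), N.last L' h]
  mono L' := by
    rw [Function.update_apply, Function.update_apply]
    split_ifs with e1 e2 e2
    · omega
    · rw [e1]; exact hu
    · rw [← e2] at hl; exact hl
    · exact N.mono L'
  step L' h := by
    rw [Function.update_apply, Function.update_apply]
    split_ifs with e1 e2 e2
    · omega
    · have := hs (by omega)
      rwa [← e1, Nat.add_sub_cancel] at this
    · rw [e2]
      exact hs' (e2 ▸ h)
    · exact N.step L' h

/-- The reflection of a path at a place where it has a corner. -/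
def reflect (N : LatticePath ℓ i) (L : ℕ) (h1 : 1 ≤ L) (h2 : L ≤ 2 * ℓ) (h3 : L ≠ ℓ)
    (h4 : L ≠ ℓ + 1) : LatticePath ℓ i :=
  have e : L - 1 + 1 = L := by omega
  have m1 : N.N (L - 1) ≤ N.N L := by have := N.mono (L - 1); rwa [e] at this
  have s1 : N.N L ≤ N.N (L - 1) + 1 := by
    have := N.step (L - 1) (by omega)
    rwa [e] at this
  have m2 := N.mono L
  have s2 := N.step L h3
  N.set L (N.N (L - 1) + N.N (L + 1) - N.N L) h1 h2 (by omega) (by omega) (by omega) (by omega)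

theorem reflect_apply (N : LatticePath ℓ i) {L : ℕ} (h1 h2 h3 h4) (L' : ℕ) :
    (N.reflect L h1 h2 h3 h4).N L' =
      if L' = L then N.N (L - 1) + N.N (L + 1) - N.N L else N.N L' :=
  Function.update_apply _ _ _ _

theorem reflect_reflect (N : LatticePath ℓ i) {L : ℕ} (h1 h2 h3 h4) :
    (N.reflect L h1 h2 h3 h4).reflect L h1 h2 h3 h4 = N := by
  ext L'
  have e : L - 1 + 1 = L := by omega
  have m1 := N.mono (L - 1)
  rw [e] at m1
  have m2 := N.mono L
  simp only [reflect_apply]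
  split_ifs with e1 <;> first | omega | rfl | skip
  subst e1
  omega

end LatticePath

/-- The contribution of the letter `L` in the position `p`. -/
def letterMon (ℓ i L p : ℕ) : Mon ℓ :=
  Lam ℓ L (-2 * ((i : ℤ) - 1 - 2 * p)) ((i : ℤ) - 1 - 2 * p)

/-- The monomial of a path. -/
def pathMon (N : LatticePath ℓ i) : Mon ℓ :=
  ∑ L ∈ Finset.range (2 * ℓ + 1), ∑ p ∈ Finset.Ico (N.N L) (N.N (L + 1)), letterMon ℓ i (L + 1) p

/-- Positions in `[N L, N (L + 1))` carry the letter `L + 1`. Lowering `N L` by one changes the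
letter in a single position from `L` to `L + 1`. -/
theorem pathMon_lower (N N' : LatticePath ℓ i) {L : ℕ} (h1 : 1 ≤ L) (h2 : L ≤ 2 * ℓ)
    (hL : N'.N L + 1 = N.N L) (hne : ∀ L', L' ≠ L → N'.N L' = N.N L') :
    pathMon N' = pathMon N - (letterMon ℓ i L (N'.N L) - letterMon ℓ i (L + 1) (N'.N L)) := by
  obtain ⟨l, rfl⟩ : ∃ l, L = l + 1 := ⟨L - 1, by omega⟩
  rw [eq_sub_iff_add_eq, ← eq_sub_iff_add_eq', pathMon, pathMon, ← Finset.sum_sub_distrib,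
    Finset.sum_eq_add l (l + 1) (by omega)]
  · have m1 := N'.mono l
    have m2 := N.mono (l + 1)
    rw [hne l (by omega)] at m1
    rw [hne l (by omega), hne (l + 1 + 1) (by omega), ← hL, Finset.sum_Ico_succ_top m1,
      Finset.sum_eq_sum_Ico_succ_bot (show N'.N (l + 1) < N.N (l + 1 + 1) by omega)]
    abel
  · rintro L' - ⟨e1, e2⟩
    rw [hne L' e2, hne (L' + 1) (by omega), sub_self]
  · intro h
    exact absurd (Finset.mem_range.2 (by omega)) h
  · intro h
    exact absurd (Finset.mem_range.2 (by omega)) h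

/-- The sign of a corner of a path with consecutive values `x`, `y`, `z`. -/
def stepSign (x y z : ℕ) : SignType := if z = x + 1 then (if y = x + 1 then 1 else -1) else 0

/-- When both of two consecutive letters occur, they stand in neighbouring positions, and `hfg` says
that their variables then cancel. A variable survives only at a corner of the path. -/
theorem sum_corner {A : Type*} [AddCommGroup A] {x y z : ℕ} (h1 : x ≤ y) (h2 : y ≤ x + 1)
    (h3 : y ≤ z) (h4 : z ≤ y + 1) (f g : ℕ → A) (hfg : ∀ p, f p = g (p + 1)) :
    ∑ p ∈ Finset.Ico x y, f p + ∑ p ∈ Finset.Ico y z, -g p =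
      match stepSign x y z with
      | .zero => 0
      | .pos => f x
      | .neg => -g x := by
  have hy : y = x ∨ y = x + 1 := by omega
  have hz : z = y ∨ z = y + 1 := by omega
  rcases hy with rfl | rfl <;> rcases hz with rfl | rfl
  · have e : stepSign z z z = 0 := by simp [stepSign]
    rw [e]
    simp
  · have e : stepSign y y (y + 1) = -1 := by simp [stepSign]
    rw [e]
    simp
  · have e : stepSign x (x + 1) (x + 1) = 1 := by simp [stepSign]
    rw [e]
    simp
  · have e : stepSign x (x + 1) (x + 1 + 1) = 0 := by simp [stepSign]
    rw [e]
    simp [hfg]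

/-! ### The node `k < ℓ` -/

/-- The point of the letter `k + 1` in the position `p`. -/
def lowPt (ℓ i : ℕ) (k : Fin ℓ) (p : ℕ) : Spec :=
  qtPt (-2 * ((i : ℤ) - 1 - 2 * p) - 2 * k.val) ((i : ℤ) - 1 - 2 * p + k.val)

/-- The point of the letter `2ℓ - k` in the position `p`. -/
def highPt (ℓ i : ℕ) (k : Fin ℓ) (p : ℕ) : Spec :=
  qtPt (-2 * ((i : ℤ) - 1 - 2 * p) + 6 - 4 * ℓ + 2 * k.val)
    ((i : ℤ) - 1 - 2 * p + 2 * ℓ - k.val - 2)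

theorem sum_corner_dbl {x y z : ℕ} (h1 : x ≤ y) (h2 : y ≤ x + 1)
    (h3 : y ≤ z) (h4 : z ≤ y + 1) (pt : ℕ → Spec) (hpt : ∀ p, pt (p + 1) = (pt p).mulQT 4 (-2)) :
    ∑ p ∈ Finset.Ico x y, (Finsupp.single (pt p) 1 : Spec →₀ ℤ) +
      ∑ p ∈ Finset.Ico y z, -Finsupp.single ((pt p).mulQT (-4) 2) 1 =
      dbl 2 (pt x) (stepSign x y z) := by
  rw [sum_corner h1 h2 h3 h4 (fun p => (Finsupp.single (pt p) 1 : Spec →₀ ℤ))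
    (fun p => Finsupp.single ((pt p).mulQT (-4) 2) 1)]
  · cases stepSign x y z <;> rfl
  · intro p
    rw [hpt, NodeSystem.mulQT_mulQT]
    congr 1
    exact (NodeSystem.mulQT_zero _).symm

theorem nodePart_letterMon {k : Fin ℓ} (h : k.val + 1 < ℓ) {L : ℕ} (h1 : 1 ≤ L)
    (h2 : L ≤ 2 * ℓ + 1) (p : ℕ) : nodePart (letterMon ℓ i L p) k =
      if L = k.val + 1 then Finsupp.single (lowPt ℓ i k p) 1
      else if L = k.val + 2 then -Finsupp.single ((lowPt ℓ i k p).mulQT (-4) 2) 1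
      else if L = 2 * ℓ - k.val then Finsupp.single (highPt ℓ i k p) 1
      else if L = 2 * ℓ + 1 - k.val then -Finsupp.single ((highPt ℓ i k p).mulQT (-4) 2) 1
      else 0 := by
  rw [letterMon, nodePart_Lam h h1 h2]
  split_ifs
  · rfl
  · refine congrArg Neg.neg (single_qtPt_congr ?_ ?_) <;> simp only [lowPt] <;> omega
  · rfl
  · refine congrArg Neg.neg (single_qtPt_congr ?_ ?_) <;> simp only [highPt] <;> omega
  · rfl

theorem nodePart_pathMon {k : Fin ℓ} (h : k.val + 1 < ℓ) (N : LatticePath ℓ i) :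
    nodePart (pathMon N) k =
      dbl 2 (lowPt ℓ i k (N.N k.val)) (stepSign (N.N k.val) (N.N (k.val + 1)) (N.N (k.val + 2))) +
      dbl 2 (highPt ℓ i k (N.N (2 * ℓ - k.val - 1)))
        (stepSign (N.N (2 * ℓ - k.val - 1)) (N.N (2 * ℓ - k.val)) (N.N (2 * ℓ - k.val + 1))) := by
  set f : ℕ → (Spec →₀ ℤ) := fun L => ∑ p ∈ Finset.Ico (N.N L) (N.N (L + 1)),
    nodePart (letterMon ℓ i (L + 1) p) k with hf
  have e : nodePart (pathMon N) k = ∑ L ∈ Finset.range (2 * ℓ + 1), f L := by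
    rw [pathMon, nodePart_sum]
    exact Finset.sum_congr rfl fun L _ => nodePart_sum _ _ _
  have hs : ({k.val, k.val + 1, 2 * ℓ - k.val - 1, 2 * ℓ - k.val} : Finset ℕ) ⊆
      Finset.range (2 * ℓ + 1) := by
    intro L hL
    simp only [Finset.mem_insert, Finset.mem_singleton] at hL
    rw [Finset.mem_range]
    omega
  rw [e, ← Finset.sum_subset hs, Finset.sum_insert (by simp; omega),
    Finset.sum_insert (by simp; omega), Finset.sum_insert (by simp; omega), Finset.sum_singleton,
    ← add_assoc, hf]
  · dsimp only
    have e1 : 2 * ℓ - k.val - 1 + 1 = 2 * ℓ - k.val := by omega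
    rw [e1]
    congr 1
    · rw [← sum_corner_dbl (N.mono _) (N.step _ (by omega)) (N.mono _) (N.step _ (by omega))
        (lowPt ℓ i k)]
      · congr 1
        · refine Finset.sum_congr rfl fun p _ => ?_
          rw [nodePart_letterMon h (by omega) (by omega), if_pos rfl]
        · refine Finset.sum_congr rfl fun p _ => ?_
          rw [nodePart_letterMon h (by omega) (by omega), if_neg (by omega), if_pos rfl]
      · intro p
        simp only [lowPt, Spec.mulQT, qtPt, Prod.mk.injEq, true_and]
        omega
    · have m1 := N.mono (2 * ℓ - k.val - 1)
      have s1 := N.step (2 * ℓ - k.val - 1) (by omega)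
      rw [e1] at m1 s1
      rw [← sum_corner_dbl m1 s1 (N.mono _) (N.step _ (by omega)) (highPt ℓ i k)]
      · congr 1
        · refine Finset.sum_congr rfl fun p _ => ?_
          rw [nodePart_letterMon h (by omega) (by omega), if_neg (by omega), if_neg (by omega),
            if_pos rfl]
        · refine Finset.sum_congr rfl fun p _ => ?_
          rw [nodePart_letterMon h (by omega) (by omega), if_neg (by omega), if_neg (by omega),
            if_neg (by omega), if_pos (by omega)]
      · intro p
        simp only [highPt, Spec.mulQT, qtPt, Prod.mk.injEq, true_and]
        omega
  · intro L hL hL'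
    simp only [Finset.mem_insert, Finset.mem_singleton, Finset.mem_range, not_or] at hL hL'
    refine Finset.sum_eq_zero fun p _ => ?_
    rw [nodePart_letterMon h (by omega) (by omega), if_neg (by omega), if_neg (by omega),
      if_neg (by omega), if_neg (by omega)]

/-! ### Coefficients -/

/-- The contribution to the coefficient of the letters `j` and `2ℓ + 2 - j`. -/
def pairFactor (ℓ j x y z w : ℕ) : KK :=
  -- Both letters `j` and `2ℓ + 2 - j` occur, in the positions `x` and `z`.
  if y = x + 1 ∧ w = z + 1 then
    ratioFactor 2 (4 * ((z : ℤ) - x - ℓ + j) + 2) (-2 * ((z : ℤ) - x - ℓ + j))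
  else 1

/-- The contribution to the coefficient of `n` letters `ℓ + 1`. -/
def midFactor (n : ℕ) : KK := ∏ j ∈ Finset.range n, ratioFactor 1 (-(4 * (j : ℤ) + 2)) (2 * j)

/-- The coefficient of a path. -/
def pathCoeff (N : LatticePath ℓ i) : KK :=
  midFactor (N.N (ℓ + 1) - N.N ℓ) * ∏ j ∈ Finset.Icc 1 ℓ,
    pairFactor ℓ j (N.N (j - 1)) (N.N j) (N.N (2 * ℓ + 1 - j)) (N.N (2 * ℓ + 2 - j))

/-- The exponent of `q` has the form `4g + 2`, so it is neither `0` nor `4`. -/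
theorem isKUnit_pairFactor (ℓ j x y z w : ℕ) : IsKUnit (pairFactor ℓ j x y z w) := by
  rw [pairFactor]
  split_ifs
  · exact isKUnit_ratioFactor (by omega) (by omega) _
  · exact IsKUnit.one

theorem isKUnit_pathCoeff (N : LatticePath ℓ i) : IsKUnit (pathCoeff N) :=
  (IsKUnit.prod _ _ fun _ _ => isKUnit_ratioFactor (by omega) (by omega) _).mul
    (IsKUnit.prod _ _ fun _ _ => isKUnit_pairFactor _ _ _ _ _ _)

/-- The factor of the algorithm for two factors at a node. -/
def flipRatio (r g : ℤ) (κ : Bool) (σ : SignType) : KK :=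
  match κ, σ with
  | _, .zero => 1
  | true, .pos => ratioFactor r (-(4 * g + 2)) (2 * g)
  | true, .neg => (ratioFactor r (4 * g + 2) (-2 * g))⁻¹
  | false, .pos => ratioFactor r (4 * g + 2) (-2 * g)
  | false, .neg => (ratioFactor r (-(4 * g + 2)) (2 * g))⁻¹

/-- For `r = 1` a gap of `-1` would make a positive variable meet a negative one; `hg` excludes
this. -/
theorem stepFactor_eq_flipRatio {M : Mon ℓ} {k : Fin ℓ} {X : Spec} {g : ℤ} {κ : Bool}
    {σ : SignType} (hg : rr ℓ k = 1 → 0 ≤ g)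
    (hM : nodePart M k = dbl (rr ℓ k) (pairPt X g κ) 1 + dbl (rr ℓ k) (pairPt X g (!κ)) σ) :
    stepFactor M k (pairPt X g κ) = flipRatio (rr ℓ k) g κ σ := by
  have hr := rr_eq ℓ k
  have e : X = (pairPt X g false).mulQT (-(4 * g + 2)) (2 * g) := by
    rw [pairPt, NodeSystem.mulQT_mulQT]
    convert (NodeSystem.mulQT_zero X).symm using 2 <;> ring
  cases κ
  · change nodePart M k = dbl _ (pairPt X g false) 1 + dbl _ X σ at hM
    cases σ
    · exact stepFactor_single (hM.trans (add_zero _))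
    · rw [congrArg (dbl (rr ℓ k) · SignType.neg) e] at hM
      rw [stepFactor_neg (by omega) hM]
      rfl
    · rw [congrArg (dbl (rr ℓ k) · SignType.pos) e] at hM
      rw [stepFactor_pos (by omega) hM, neg_neg, flipRatio, neg_mul]
  · cases σ
    · exact stepFactor_single (hM.trans (add_zero _))
    · exact stepFactor_neg (by omega) hM
    · refine (stepFactor_pos (by omega) hM).trans ?_
      rw [flipRatio, neg_mul, neg_neg]

end DeformedW

end

noncomputable section

namespace DeformedW

open Polynomial PowerSeries

variable {ℓ i : ℕ}

namespace LatticePath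

/-- The sign of the corner of a path at `L`. -/
def sign (N : LatticePath ℓ i) (L : ℕ) : SignType := stepSign (N.N (L - 1)) (N.N L) (N.N (L + 1))

theorem reflect_apply_of_ne (N : LatticePath ℓ i) {L : ℕ} (h1 h2 h3 h4) {L' : ℕ} (h : L' ≠ L) :
    (N.reflect L h1 h2 h3 h4).N L' = N.N L' := by
  rw [reflect_apply, if_neg h]

theorem sign_reflect (N : LatticePath ℓ i) {L : ℕ} (h1 h2 h3 h4) :
    (N.reflect L h1 h2 h3 h4).sign L = -N.sign L := by
  have e : L - 1 + 1 = L := by omega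
  have m1 := N.mono (L - 1)
  have s1 := N.step (L - 1) (by omega)
  rw [e] at m1 s1
  have m2 := N.mono L
  have s2 := N.step L h3
  rw [sign, sign, N.reflect_apply_of_ne h1 h2 h3 h4 (L' := L - 1) (by omega),
    N.reflect_apply_of_ne h1 h2 h3 h4 (L' := L + 1) (by omega), reflect_apply, if_pos rfl, stepSign,
    stepSign]
  split_ifs <;> first | omega | rfl

theorem sign_reflect_of_ne (N : LatticePath ℓ i) {L : ℕ} (h1 h2 h3 h4) {L' : ℕ}
    (h : L' + 1 < L ∨ L + 1 < L') : (N.reflect L h1 h2 h3 h4).sign L' = N.sign L' := by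
  rw [sign, sign, reflect_apply_of_ne _ _ _ _ _ (by omega),
    reflect_apply_of_ne _ _ _ _ _ (by omega), reflect_apply_of_ne _ _ _ _ _ (by omega)]

theorem sign_eq_one_iff (N : LatticePath ℓ i) (L : ℕ) : N.sign L = 1 ↔
    N.N L = N.N (L - 1) + 1 ∧ N.N (L + 1) = N.N (L - 1) + 1 := by
  rw [sign, stepSign]
  split_ifs with e1 e2
  · simp [e1, e2]
  · simp [e1, e2]
  · simp [e1]

theorem pathMon_reflect (N : LatticePath ℓ i) {L : ℕ} (h1 h2 h3 h4) (h : N.sign L = 1) :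
    pathMon (N.reflect L h1 h2 h3 h4) = pathMon N -
      (letterMon ℓ i L (N.N (L - 1)) - letterMon ℓ i (L + 1) (N.N (L - 1))) := by
  obtain ⟨e1, e2⟩ := (N.sign_eq_one_iff L).1 h
  have e : (N.reflect L h1 h2 h3 h4).N L = N.N (L - 1) := by
    rw [reflect_apply, if_pos rfl]
    omega
  rw [pathMon_lower N (N.reflect L h1 h2 h3 h4) h1 h2 (by omega)
    fun L' h' => N.reflect_apply_of_ne _ _ _ _ h', e]

end LatticePath

/-! ### The coefficients at a node `k < ℓ` -/

/-- By the symmetry of the factor, the ratio at gap `g` seen from the first point is the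
contribution of a pair of letters with parameter `g + 1`. -/
theorem ratioFactor_succ (g : ℤ) :
    ratioFactor 2 (4 * (g + 1) + 2) (-2 * (g + 1)) = ratioFactor 2 (-(4 * g + 2)) (2 * g) := by
  rw [← ratioFactor_symm]
  congr 1 <;> ring

theorem pairFactor_of_steps {j x y z w : ℕ} {g : ℤ} (h : y = x + 1) (h' : w = z + 1)
    (hg : (z : ℤ) - x - ℓ + j = g) :
    pairFactor ℓ j x y z w = ratioFactor 2 (4 * g + 2) (-2 * g) := by
  rw [pairFactor, if_pos ⟨h, h'⟩, hg]

theorem pairFactor_of_not {j x y z w : ℕ} (h : ¬(y = x + 1 ∧ w = z + 1)) :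
    pairFactor ℓ j x y z w = 1 := if_neg h

theorem ratioFactor_ne_zero (g : ℤ) : ratioFactor 2 (4 * g + 2) (-2 * g) ≠ 0 :=
  isKUnit_ne_zero (isKUnit_ratioFactor (by omega) (by omega) _)

/-- Changing the letter `k + 1` into `k + 2` affects only the contributions of these two letters
with their conjugates. Which conjugates occur is decided by the other corner: a nonzero sign means
exactly one of them, sign `0` none or both, and in the last case the contributions agree. -/
theorem pairFactor_flip_true {k x x' y' z' : ℕ} (h1 : x' ≤ y') (h2 : y' ≤ x' + 1) (h3 : y' ≤ z')
    (h4 : z' ≤ y' + 1) {g : ℤ} (hg : (x' : ℤ) - x - ℓ + (k + 1) = g) :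
    pairFactor ℓ (k + 1) x x y' z' * pairFactor ℓ (k + 2) x (x + 1) x' y' =
      pairFactor ℓ (k + 1) x (x + 1) y' z' * pairFactor ℓ (k + 2) (x + 1) (x + 1) x' y' *
        flipRatio 2 g true (stepSign x' y' z') := by
  rw [pairFactor_of_not (by omega : ¬(x = x + 1 ∧ _)),
    pairFactor_of_not (by omega : ¬(x + 1 = x + 1 + 1 ∧ _)), one_mul, mul_one]
  have hy : y' = x' ∨ y' = x' + 1 := by omega
  have hz : z' = y' ∨ z' = y' + 1 := by omega
  rcases hy with rfl | rfl <;> rcases hz with rfl | rfl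
  · rw [pairFactor_of_not (by omega), pairFactor_of_not (by omega),
      show stepSign z' z' z' = .zero by simp [stepSign], flipRatio, one_mul]
  · rw [pairFactor_of_not (by omega), pairFactor_of_steps rfl rfl (g := g) (by push_cast; omega),
      show stepSign y' y' (y' + 1) = .neg by simp [stepSign], flipRatio,
      mul_inv_cancel₀ (ratioFactor_ne_zero g)]
  · rw [pairFactor_of_steps rfl rfl (g := g + 1) (by push_cast; omega),
      pairFactor_of_not (by omega), show stepSign x' (x' + 1) (x' + 1) = .pos by simp [stepSign],
      flipRatio, one_mul, ratioFactor_succ]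
  · rw [pairFactor_of_steps rfl rfl (g := g + 1) (by push_cast; omega),
      pairFactor_of_steps rfl rfl (g := g + 1) (by push_cast; omega),
      show stepSign x' (x' + 1) (x' + 1 + 1) = .zero by simp [stepSign], flipRatio, mul_one]

theorem pairFactor_flip_false {k x y z x' : ℕ} (h1 : x ≤ y) (h2 : y ≤ x + 1) (h3 : y ≤ z)
    (h4 : z ≤ y + 1) {g : ℤ} (hg : (x' : ℤ) - x - ℓ + (k + 1) = g) :
    pairFactor ℓ (k + 1) x y x' (x' + 1) * pairFactor ℓ (k + 2) y z x' x' =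
      pairFactor ℓ (k + 1) x y (x' + 1) (x' + 1) * pairFactor ℓ (k + 2) y z x' (x' + 1) *
        flipRatio 2 g false (stepSign x y z) := by
  rw [pairFactor_of_not (by omega : ¬(z = y + 1 ∧ x' = x' + 1)),
    pairFactor_of_not (by omega : ¬(y = x + 1 ∧ x' + 1 = x' + 1 + 1)), one_mul, mul_one]
  have hy : y = x ∨ y = x + 1 := by omega
  have hz : z = y ∨ z = y + 1 := by omega
  rcases hy with rfl | rfl <;> rcases hz with rfl | rfl
  · rw [pairFactor_of_not (by omega), pairFactor_of_not (by omega),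
      show stepSign z z z = .zero by simp [stepSign], flipRatio, one_mul]
  · rw [pairFactor_of_not (by omega), pairFactor_of_steps rfl rfl (g := g + 1) (by push_cast; omega),
      show stepSign y y (y + 1) = .neg by simp [stepSign], flipRatio, ratioFactor_succ,
      mul_inv_cancel₀]
    rw [← ratioFactor_succ]
    exact ratioFactor_ne_zero (g + 1)
  · rw [pairFactor_of_steps rfl rfl (g := g) (by push_cast; omega),
      pairFactor_of_not (by omega), show stepSign x (x + 1) (x + 1) = .pos by simp [stepSign],
      flipRatio, one_mul]
  · rw [pairFactor_of_steps rfl rfl (g := g) (by push_cast; omega),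
      pairFactor_of_steps rfl rfl (g := g) (by push_cast; omega),
      show stepSign x (x + 1) (x + 1 + 1) = .zero by simp [stepSign], flipRatio, mul_one]

/-- The factors of the coefficient of a path which depend on its values at `k + 1` and `2ℓ - k`. -/
def nodeFactor (k : ℕ) (N : LatticePath ℓ i) : KK :=
  pairFactor ℓ (k + 1) (N.N k) (N.N (k + 1)) (N.N (2 * ℓ - k)) (N.N (2 * ℓ - k + 1)) *
    pairFactor ℓ (k + 2) (N.N (k + 1)) (N.N (k + 2)) (N.N (2 * ℓ - k - 1)) (N.N (2 * ℓ - k))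

theorem pathCoeff_of_nodeFactor {k : ℕ} (h : k + 1 < ℓ) {N N' : LatticePath ℓ i} {d : KK}
    (hne : ∀ L, L ≠ k + 1 → L ≠ 2 * ℓ - k → N'.N L = N.N L)
    (hf : nodeFactor k N' = nodeFactor k N * d) : pathCoeff N' = pathCoeff N * d := by
  have e : ∀ N : LatticePath ℓ i, pathCoeff N = midFactor (N.N (ℓ + 1) - N.N ℓ) *
      (nodeFactor k N * ∏ j ∈ ((Finset.Icc 1 ℓ).erase (k + 1)).erase (k + 2),
        pairFactor ℓ j (N.N (j - 1)) (N.N j) (N.N (2 * ℓ + 1 - j)) (N.N (2 * ℓ + 2 - j))) := by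
    intro N
    rw [pathCoeff, ← Finset.mul_prod_erase (Finset.Icc 1 ℓ) _
      (show k + 1 ∈ Finset.Icc 1 ℓ by rw [Finset.mem_Icc]; omega),
      ← Finset.mul_prod_erase ((Finset.Icc 1 ℓ).erase (k + 1)) _
      (show k + 2 ∈ (Finset.Icc 1 ℓ).erase (k + 1) by
        rw [Finset.mem_erase, Finset.mem_Icc]; omega), nodeFactor, ← mul_assoc (pairFactor _ _ _ _ _ _)]
    rw [Nat.add_sub_cancel, show 2 * ℓ + 1 - (k + 1) = 2 * ℓ - k by omega,
      show 2 * ℓ + 2 - (k + 1) = 2 * ℓ - k + 1 by omega, show k + 2 - 1 = k + 1 by omega,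
      show 2 * ℓ + 1 - (k + 2) = 2 * ℓ - k - 1 by omega,
      show 2 * ℓ + 2 - (k + 2) = 2 * ℓ - k by omega]
  rw [e, e, hf, hne _ (by omega) (by omega), hne _ (by omega) (by omega)]
  have e2 : (∏ j ∈ ((Finset.Icc 1 ℓ).erase (k + 1)).erase (k + 2),
        pairFactor ℓ j (N'.N (j - 1)) (N'.N j) (N'.N (2 * ℓ + 1 - j)) (N'.N (2 * ℓ + 2 - j))) =
      ∏ j ∈ ((Finset.Icc 1 ℓ).erase (k + 1)).erase (k + 2),
        pairFactor ℓ j (N.N (j - 1)) (N.N j) (N.N (2 * ℓ + 1 - j)) (N.N (2 * ℓ + 2 - j)) := by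
    refine Finset.prod_congr rfl fun j hj => ?_
    rw [Finset.mem_erase, Finset.mem_erase, Finset.mem_Icc] at hj
    rw [hne _ (by omega) (by omega), hne _ (by omega) (by omega), hne _ (by omega) (by omega),
      hne _ (by omega) (by omega)]
  rw [e2]
  generalize midFactor _ = a, nodeFactor k N = b, (∏ j ∈ _, _ : KK) = e
  ring

/-! ### The node system at a node `k < ℓ` -/

/-- The place of the corners of a path which matter at the node `k`. -/
def corner (ℓ k : ℕ) : Bool → ℕ
  | true => k + 1
  | false => 2 * ℓ - k

theorem corner_spec {k : ℕ} (h : k + 1 < ℓ) (κ : Bool) : 1 ≤ corner ℓ k κ ∧ corner ℓ k κ ≤ 2 * ℓ ∧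
    corner ℓ k κ ≠ ℓ ∧ corner ℓ k κ ≠ ℓ + 1 ∧ k ≠ corner ℓ k κ ∧ 2 * ℓ - k - 1 ≠ corner ℓ k κ ∧
    (corner ℓ k (!κ) + 1 < corner ℓ k κ ∨ corner ℓ k κ + 1 < corner ℓ k (!κ)) := by
  cases κ <;> simp only [corner, Bool.not_true, Bool.not_false] <;> omega

/-- The reflection at a corner which matters at the node `k`. -/
def cornerFlip {k : ℕ} (h : k + 1 < ℓ) (κ : Bool) (N : LatticePath ℓ i) : LatticePath ℓ i :=
  N.reflect (corner ℓ k κ) (corner_spec h κ).1 (corner_spec h κ).2.1 (corner_spec h κ).2.2.1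
    (corner_spec h κ).2.2.2.1

/-- The distance of the two points at the node `k`. -/
def pathGap (ℓ k : ℕ) {i : ℕ} (N : LatticePath ℓ i) : ℤ :=
  (N.N (2 * ℓ - k - 1) : ℤ) - N.N k - ℓ + (k + 1)

theorem pairPt_pathGap {k : Fin ℓ} (N : LatticePath ℓ i) (κ : Bool) :
    pairPt (lowPt ℓ i k (N.N k.val)) (pathGap ℓ k.val N) κ =
      if κ then lowPt ℓ i k (N.N k.val) else highPt ℓ i k (N.N (2 * ℓ - k.val - 1)) := by
  cases κ
  · simp only [pairPt, pathGap, lowPt, highPt, qtPt, Spec.mulQT, Bool.false_eq_true, if_false,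
      Prod.mk.injEq, true_and]
    omega
  · rfl

theorem pathCoeff_cornerFlip {k : Fin ℓ} (h : k.val + 1 < ℓ) (κ : Bool) (N : LatticePath ℓ i)
    (hs : N.sign (corner ℓ k.val κ) = 1) :
    pathCoeff (cornerFlip h κ N) =
      pathCoeff N * flipRatio 2 (pathGap ℓ k.val N) κ (N.sign (corner ℓ k.val !κ)) := by
  obtain ⟨h1, h2, h3, h4, h5, h6, h7⟩ := corner_spec h κ
  obtain ⟨e1, e2⟩ := (N.sign_eq_one_iff _).1 hs
  have hv : (cornerFlip h κ N).N (corner ℓ k.val κ) = N.N (corner ℓ k.val κ - 1) := by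
    rw [cornerFlip, LatticePath.reflect_apply, if_pos rfl]
    omega
  have hv' : ∀ L, L ≠ corner ℓ k.val κ → (cornerFlip h κ N).N L = N.N L := fun L hL =>
    N.reflect_apply_of_ne _ _ _ _ hL
  cases κ <;> simp only [corner, Bool.not_true, Bool.not_false] at *
  · refine pathCoeff_of_nodeFactor h (fun L _ h' => hv' L h') ?_
    rw [nodeFactor, nodeFactor, hv, hv' _ (by omega), hv' _ (by omega), hv' _ (by omega),
      hv' _ (by omega), hv' _ (by omega), e1, e2]
    exact pairFactor_flip_false (N.mono _) (N.step _ (by omega)) (N.mono _) (N.step _ (by omega)) rfl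
  · refine pathCoeff_of_nodeFactor h (fun L h' _ => hv' L h') ?_
    have e : 2 * ℓ - k.val - 1 + 1 = 2 * ℓ - k.val := by omega
    have m1 := N.mono (2 * ℓ - k.val - 1)
    have s1 := N.step (2 * ℓ - k.val - 1) (by omega)
    rw [e] at m1 s1
    rw [Nat.add_sub_cancel] at hv e1 e2
    rw [nodeFactor, nodeFactor, hv, hv' _ (by omega), hv' _ (by omega), hv' _ (by omega),
      hv' _ (by omega), hv' _ (by omega), e1, e2]
    exact pairFactor_flip_true m1 s1 (N.mono _) (N.step _ (by omega)) rfl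

theorem pathMon_cornerFlip {k : Fin ℓ} (h : k.val + 1 < ℓ) (κ : Bool) (N : LatticePath ℓ i)
    (hs : N.sign (corner ℓ k.val κ) = 1) :
    pathMon (cornerFlip h κ N) = pathMon N -
      aMon k ((pairPt (lowPt ℓ i k (N.N k.val)) (pathGap ℓ k.val N) κ).mulQT (-rr ℓ k) 1) := by
  rw [cornerFlip, N.pathMon_reflect _ _ _ _ hs, pairPt_pathGap]
  cases κ
  · exact congrArg (pathMon N - ·) (Lam_sub_Lam_high h _ _)
  · exact congrArg (pathMon N - ·) (Lam_sub_Lam_low h _ _)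

theorem nodePart_pathMon_sign {k : Fin ℓ} (h : k.val + 1 < ℓ) (N : LatticePath ℓ i) :
    nodePart (pathMon N) k =
      dbl (rr ℓ k) (pairPt (lowPt ℓ i k (N.N k.val)) (pathGap ℓ k.val N) true)
        (N.sign (corner ℓ k.val true)) +
      dbl (rr ℓ k) (pairPt (lowPt ℓ i k (N.N k.val)) (pathGap ℓ k.val N) false)
        (N.sign (corner ℓ k.val false)) := by
  have hr : rr ℓ k = 2 := by rw [rr, if_neg (by omega)]
  rw [nodePart_pathMon h, pairPt_pathGap, pairPt_pathGap, hr]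
  rfl

/-- Paths at a node `k < ℓ`. -/
def NodeSystem.ofPath {k : Fin ℓ} (h : k.val + 1 < ℓ) :
    NodeSystem k (pathMon (ℓ := ℓ) (i := i)) pathCoeff :=
  have hr : rr ℓ k = 2 := by rw [rr, if_neg (by omega)]
  have hr' : rr ℓ k ≠ 1 := by omega
  { X := fun N => lowPt ℓ i k (N.N k.val)
    gap := pathGap ℓ k.val
    sg := fun κ N => N.sign (corner ℓ k.val κ)
    flip := cornerFlip h
    nodePart_eq := nodePart_pathMon_sign h
    gap_nonneg := fun _ e => absurd e hr'
    sg_ne := fun _ e => absurd e hr'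
    X_flip := fun κ N _ _ => congrArg (lowPt ℓ i k)
      (N.reflect_apply_of_ne _ _ _ _ (corner_spec h κ).2.2.2.2.1)
    gap_flip := fun κ N _ _ => by
      rw [pathGap, pathGap, cornerFlip,
        N.reflect_apply_of_ne _ _ _ _ (corner_spec h κ).2.2.2.2.1,
        N.reflect_apply_of_ne _ _ _ _ (corner_spec h κ).2.2.2.2.2.1]
    sg_flip := fun κ N _ _ => N.sign_reflect _ _ _ _
    sg_not_flip := fun κ N _ _ => N.sign_reflect_of_ne _ _ _ _ (corner_spec h κ).2.2.2.2.2.2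
    flip_flip := fun κ N _ _ => N.reflect_reflect _ _ _ _
    mon_flip := fun κ N hs _ => pathMon_cornerFlip h κ N hs
    coeff_flip := fun κ N hs _ => by
      rw [pathCoeff_cornerFlip h κ N hs, stepFactor_eq_flipRatio (fun e => absurd e hr'), hr]
      rw [nodePart_pathMon_sign h, ← hs]
      cases κ
      · exact add_comm _ _
      · rfl }

end DeformedW

end

noncomputable section

namespace DeformedW

open Polynomial PowerSeries

variable {ℓ i : ℕ}

/-! ### The coefficients at the last node -/

/-- The inner factors of the two short-root ratios cancel and leave a long-root ratio. This
reconciles the factors of the letters `ℓ + 1` with the contribution of the pair `ℓ`, `ℓ + 2` when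
both letters occur. -/
theorem ratioFactor_one_mul {g : ℤ} (hg : 1 ≤ g) :
    ratioFactor 1 (4 * g) (-2 * g) * ratioFactor 1 (4 * g + 2) (-2 * g) =
      ratioFactor 2 (4 * g + 2) (-2 * g) := by
  have h1 : 1 - qt (4 * g) (-2 * g) ≠ 0 := one_sub_qt_ne_zero (by omega)
  have h2 : 1 - qt (4 * g) (-2 * g + 2) ≠ 0 := one_sub_qt_ne_zero (by omega)
  have h3 : 1 - qt (4 * g + 2) (-2 * g) ≠ 0 := one_sub_qt_ne_zero (by omega)
  have h4 : 1 - qt (4 * g - 2) (-2 * g + 2) ≠ 0 := one_sub_qt_ne_zero (by omega)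
  simp only [ratioFactor, show 4 * g - 2 * 1 = 4 * g - 2 by ring,
    show 4 * g + 2 - 2 * 1 = 4 * g by ring, show 4 * g + 2 - 2 * 2 = 4 * g - 2 by ring]
  generalize 1 - qt (4 * g) (-2 * g) = a at *
  generalize 1 - qt (4 * g) (-2 * g + 2) = b at *
  generalize 1 - qt (4 * g + 2) (-2 * g) = c at *
  generalize 1 - qt (4 * g - 2) (-2 * g + 2) = d at *
  field_simp

/-- The factors of the coefficient of a path which depend on its values at `ℓ` and `ℓ + 1`. -/
def lastFactor (ℓ m₀ m₁ m₂ m₃ : ℕ) : KK := midFactor (m₂ - m₁) * pairFactor ℓ ℓ m₀ m₁ m₂ m₃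

theorem midFactor_succ (n : ℕ) :
    midFactor (n + 1) = midFactor n * ratioFactor 1 (-(4 * (n : ℤ) + 2)) (2 * n) :=
  Finset.prod_range_succ _ _

/-- The same last factor in its symmetric form, which is the one that occurs in
`ratioFactor_one_mul`. -/
theorem midFactor_succ' (n : ℕ) : midFactor (n + 1) =
    midFactor n * ratioFactor 1 (4 * ((n + 1 : ℕ) : ℤ)) (-2 * ((n + 1 : ℕ) : ℤ)) := by
  rw [midFactor_succ, ← ratioFactor_symm]
  congr 2 <;> push_cast <;> ring

theorem ratioFactor_one_ne_zero {m : ℤ} (h : m ≠ 0) (h' : m ≠ 2) (n : ℤ) :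
    ratioFactor 1 m n ≠ 0 :=
  isKUnit_ne_zero (isKUnit_ratioFactor h (by omega) _)

theorem lastFactor_flip_true_pos {m₀ g : ℕ} :
    lastFactor ℓ m₀ m₀ (m₀ + g + 1) (m₀ + g + 1) =
      lastFactor ℓ m₀ (m₀ + 1) (m₀ + g + 1) (m₀ + g + 1) * flipRatio 1 g true .pos := by
  rw [lastFactor, lastFactor, pairFactor_of_not (by omega), pairFactor_of_not (by omega), mul_one,
    mul_one, show m₀ + g + 1 - m₀ = g + 1 by omega, show m₀ + g + 1 - (m₀ + 1) = g by omega,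
    midFactor_succ, flipRatio]

theorem lastFactor_flip_true_neg {m₀ g : ℕ} (hg : 1 ≤ g) :
    lastFactor ℓ m₀ m₀ (m₀ + g) (m₀ + g + 1) =
      lastFactor ℓ m₀ (m₀ + 1) (m₀ + g) (m₀ + g + 1) * flipRatio 1 g true .neg := by
  obtain ⟨g, rfl⟩ : ∃ g', g = g' + 1 := ⟨g - 1, by omega⟩
  rw [lastFactor, lastFactor, pairFactor_of_not (by omega),
    pairFactor_of_steps rfl rfl (g := ((g + 1 : ℕ) : ℤ)) (by push_cast; ring), mul_one,
    show m₀ + (g + 1) - m₀ = g + 1 by omega, show m₀ + (g + 1) - (m₀ + 1) = g by omega,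
    midFactor_succ', flipRatio, ← ratioFactor_one_mul (by omega), mul_assoc, mul_assoc,
    mul_inv_cancel₀ (ratioFactor_one_ne_zero (by omega) (by omega) _), mul_one]

theorem lastFactor_flip_false_pos {m₀ g : ℕ} (hg : 1 ≤ g) :
    lastFactor ℓ m₀ (m₀ + 1) (m₀ + g) (m₀ + g + 1) =
      lastFactor ℓ m₀ (m₀ + 1) (m₀ + g + 1) (m₀ + g + 1) * flipRatio 1 g false .pos := by
  obtain ⟨g, rfl⟩ : ∃ g', g = g' + 1 := ⟨g - 1, by omega⟩
  rw [lastFactor, lastFactor, 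
    pairFactor_of_not (by omega : ¬(_ ∧ m₀ + (g + 1) + 1 = m₀ + (g + 1) + 1 + 1)),
    pairFactor_of_steps rfl rfl (g := ((g + 1 : ℕ) : ℤ)) (by push_cast; ring), mul_one,
    show m₀ + (g + 1) + 1 - (m₀ + 1) = g + 1 by omega,
    show m₀ + (g + 1) - (m₀ + 1) = g by omega,
    midFactor_succ', flipRatio, ← ratioFactor_one_mul (by omega), mul_assoc]

theorem lastFactor_flip_false_neg {m₀ g : ℕ} :
    lastFactor ℓ m₀ m₀ (m₀ + g) (m₀ + g + 1) =
      lastFactor ℓ m₀ m₀ (m₀ + g + 1) (m₀ + g + 1) * flipRatio 1 g false .neg := by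
  rw [lastFactor, lastFactor, pairFactor_of_not (by omega), pairFactor_of_not (by omega), mul_one,
    mul_one, show m₀ + g + 1 - m₀ = g + 1 by omega, show m₀ + g - m₀ = g by omega,
    midFactor_succ, flipRatio, mul_assoc,
    mul_inv_cancel₀ (ratioFactor_one_ne_zero (by omega) (by omega) _), mul_one]

theorem pathCoeff_of_lastFactor (hℓ : 1 ≤ ℓ) {N N' : LatticePath ℓ i} {d : KK}
    (hne : ∀ L, L ≠ ℓ → L ≠ ℓ + 1 → N'.N L = N.N L)
    (hf : lastFactor ℓ (N'.N (ℓ - 1)) (N'.N ℓ) (N'.N (ℓ + 1)) (N'.N (ℓ + 2)) =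
      lastFactor ℓ (N.N (ℓ - 1)) (N.N ℓ) (N.N (ℓ + 1)) (N.N (ℓ + 2)) * d) :
    pathCoeff N' = pathCoeff N * d := by
  have e : ∀ N : LatticePath ℓ i, pathCoeff N =
      lastFactor ℓ (N.N (ℓ - 1)) (N.N ℓ) (N.N (ℓ + 1)) (N.N (ℓ + 2)) *
      (∏ j ∈ (Finset.Icc 1 ℓ).erase ℓ,
        pairFactor ℓ j (N.N (j - 1)) (N.N j) (N.N (2 * ℓ + 1 - j)) (N.N (2 * ℓ + 2 - j))) := by
    intro N
    rw [pathCoeff, ← Finset.mul_prod_erase (Finset.Icc 1 ℓ) _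
      (show ℓ ∈ Finset.Icc 1 ℓ by rw [Finset.mem_Icc]; omega), lastFactor, mul_assoc,
      show 2 * ℓ + 1 - ℓ = ℓ + 1 by omega, show 2 * ℓ + 2 - ℓ = ℓ + 2 by omega]
  have e2 : (∏ j ∈ (Finset.Icc 1 ℓ).erase ℓ,
        pairFactor ℓ j (N'.N (j - 1)) (N'.N j) (N'.N (2 * ℓ + 1 - j)) (N'.N (2 * ℓ + 2 - j))) =
      ∏ j ∈ (Finset.Icc 1 ℓ).erase ℓ,
        pairFactor ℓ j (N.N (j - 1)) (N.N j) (N.N (2 * ℓ + 1 - j)) (N.N (2 * ℓ + 2 - j)) := by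
    refine Finset.prod_congr rfl fun j hj => ?_
    rw [Finset.mem_erase, Finset.mem_Icc] at hj
    rw [hne _ (by omega) (by omega), hne _ (by omega) (by omega), hne _ (by omega) (by omega),
      hne _ (by omega) (by omega)]
  rw [e, e, hf, e2, mul_right_comm]

/-! ### The monomials at the last node -/

/-- The first point of the letters `ℓ` and `ℓ + 1` in the position `p`. -/
def upPt (ℓ i : ℕ) (p : ℤ) : Spec :=
  qtPt (-2 * ((i : ℤ) - 1 - 2 * p) - 2 * ℓ + 3) ((i : ℤ) - 1 - 2 * p + ℓ - 1)

/-- The second point of the letter `ℓ` in the position `p`. -/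
def dnPt (ℓ i : ℕ) (p : ℤ) : Spec :=
  qtPt (-2 * ((i : ℤ) - 1 - 2 * p) - 2 * ℓ + 1) ((i : ℤ) - 1 - 2 * p + ℓ - 1)

theorem dnPt_mulQT (p : ℤ) : (dnPt ℓ i p).mulQT (-2) 2 = upPt ℓ i (p - 1) := by
  simp only [dnPt, upPt, Spec.mulQT, qtPt, Prod.mk.injEq, true_and]
  omega

/-- The two signs at the last node. -/
def lastSign (m₀ m₁ m₂ m₃ : ℕ) (κ : Bool) : SignType :=
  -- The sign is `0` when none of the letters `ℓ`, `ℓ + 1`, `ℓ + 2` occurs. Otherwise the first sign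
  -- is positive if `ℓ` occurs, and the second is positive if `ℓ + 2` does not.
  if m₃ = m₀ then 0 else
  match κ with
  | true => if m₁ = m₀ then -1 else 1
  | false => if m₂ = m₃ then 1 else -1

/-- The distance of the two points at the last node. -/
def lastGap (m₀ m₃ : ℕ) : ℤ := if m₃ = m₀ then 0 else (m₃ : ℤ) - m₀ - 1

theorem nodePart_letterMon_last {k : Fin ℓ} (h : k.val + 1 = ℓ) (hℓ : 2 ≤ ℓ) {L : ℕ} (h1 : 1 ≤ L)
    (h2 : L ≤ 2 * ℓ + 1) (p : ℕ) : nodePart (letterMon ℓ i L p) k =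
      if L = ℓ then Finsupp.single (upPt ℓ i p) 1 + Finsupp.single (dnPt ℓ i p) 1
      else if L = ℓ + 1 then Finsupp.single (upPt ℓ i p) 1 - Finsupp.single (upPt ℓ i (p - 1)) 1
      else if L = ℓ + 2 then -Finsupp.single ((upPt ℓ i p).mulQT (-2) 2) 1 -
        Finsupp.single (upPt ℓ i (p - 1)) 1
      else 0 := by
  rw [letterMon, nodePart_Lam_last h hℓ h1 h2]
  split_ifs
  · rfl
  · refine congrArg₂ (· - ·) rfl (single_qtPt_congr ?_ ?_) <;> omega
  · refine congrArg₂ (fun x y => -x - y) (single_qtPt_congr ?_ ?_) (single_qtPt_congr ?_ ?_) <;>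
      first | omega | (simp only [upPt, qtPt]; omega)
  · rfl

/-- The letter `ℓ + 1` in the position `p` contributes the difference of consecutive values of
`upPt`, so a row of such letters telescopes. One factor remains at each end of the block, and its
sign records whether the end is occupied by `ℓ` or by `ℓ + 2`. -/
theorem sum_Ico_letters {m₀ m₁ m₂ m₃ : ℕ} (h1 : m₀ ≤ m₁) (h2 : m₁ ≤ m₀ + 1) (h3 : m₁ ≤ m₂)
    (h4 : m₂ ≤ m₃) (h5 : m₃ ≤ m₂ + 1) :
    ∑ p ∈ Finset.Ico m₀ m₁, ((Finsupp.single (upPt ℓ i p) 1 : Spec →₀ ℤ) +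
        Finsupp.single (dnPt ℓ i p) 1) +
      (∑ p ∈ Finset.Ico m₁ m₂, ((Finsupp.single (upPt ℓ i p) 1 : Spec →₀ ℤ) -
        Finsupp.single (upPt ℓ i (p - 1)) 1) +
      ∑ p ∈ Finset.Ico m₂ m₃, (-(Finsupp.single ((upPt ℓ i p).mulQT (-2) 2) 1 : Spec →₀ ℤ) -
        Finsupp.single (upPt ℓ i (p - 1)) 1)) =
      dbl 1 (pairPt (dnPt ℓ i m₀) (lastGap m₀ m₃) true) (lastSign m₀ m₁ m₂ m₃ true) +
      dbl 1 (pairPt (dnPt ℓ i m₀) (lastGap m₀ m₃) false) (lastSign m₀ m₁ m₂ m₃ false) := by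
  have tel : ∑ p ∈ Finset.Ico m₁ m₂, ((Finsupp.single (upPt ℓ i p) 1 : Spec →₀ ℤ) -
        Finsupp.single (upPt ℓ i (p - 1)) 1) =
      Finsupp.single (upPt ℓ i (m₂ - 1)) 1 - Finsupp.single (upPt ℓ i (m₁ - 1)) 1 := by
    rw [← Finset.sum_Ico_sub (fun p : ℕ => (Finsupp.single (upPt ℓ i ((p : ℤ) - 1)) 1 : Spec →₀ ℤ))
      h3]
    refine Finset.sum_congr rfl fun p _ => ?_
    rw [Nat.cast_succ, add_sub_cancel_right]
  have hp : m₃ ≠ m₀ → pairPt (dnPt ℓ i m₀) (lastGap m₀ m₃) false = upPt ℓ i (m₃ - 1) := by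
    intro h
    rw [lastGap, if_neg h]
    simp only [pairPt, dnPt, upPt, Spec.mulQT, qtPt, Prod.mk.injEq, true_and]
    omega
  have d1 : ∀ X : Spec, dbl 1 X 1 = Finsupp.single X 1 := fun _ => rfl
  have d2 : ∀ X : Spec, dbl 1 X (-1) = -Finsupp.single (X.mulQT (-2) 2) 1 := fun _ => rfl
  have d0 : ∀ X : Spec, dbl 1 X 0 = 0 := fun _ => rfl
  rw [tel]
  have hy : m₁ = m₀ ∨ m₁ = m₀ + 1 := by omega
  have hz : m₃ = m₂ ∨ m₃ = m₂ + 1 := by omega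
  rcases hy with rfl | rfl <;> rcases hz with rfl | rfl
  · rw [Finset.Ico_self, Finset.Ico_self, Finset.sum_empty, Finset.sum_empty]
    by_cases h : m₃ = m₁
    · simp only [lastSign, h, if_true, d0]
      abel
    · rw [hp h]
      simp only [lastSign, if_neg h, if_true, d1, d2, pairPt, dnPt_mulQT]
      abel
  · have h : m₂ + 1 ≠ m₁ := by omega
    have h' : m₂ ≠ m₂ + 1 := by omega
    rw [Finset.Ico_self, Finset.sum_empty, Nat.Ico_succ_singleton, Finset.sum_singleton, hp h]
    simp only [lastSign, if_neg h, if_neg h', if_true, d2, pairPt, dnPt_mulQT, Nat.cast_succ,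
      add_sub_cancel_right]
    abel
  · have h : m₃ ≠ m₀ := by omega
    have h' : m₀ + 1 ≠ m₀ := by omega
    rw [Finset.Ico_self, Finset.sum_empty, Nat.Ico_succ_singleton, Finset.sum_singleton, hp h]
    simp only [lastSign, if_neg h, if_neg h', if_true, d1, pairPt, Nat.cast_succ,
      add_sub_cancel_right]
    abel
  · have h : m₂ + 1 ≠ m₀ := by omega
    have h' : m₀ + 1 ≠ m₀ := by omega
    have h'' : m₂ ≠ m₂ + 1 := by omega
    rw [Nat.Ico_succ_singleton, Nat.Ico_succ_singleton, Finset.sum_singleton, Finset.sum_singleton,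
      hp h]
    simp only [lastSign, if_neg h, if_neg h', if_neg h'', d1, d2, pairPt, Nat.cast_succ,
      add_sub_cancel_right]
    abel

theorem LatticePath.last_spec (hℓ : 1 ≤ ℓ) (N : LatticePath ℓ i) : N.N (ℓ - 1) ≤ N.N ℓ ∧
    N.N ℓ ≤ N.N (ℓ - 1) + 1 ∧ N.N ℓ ≤ N.N (ℓ + 1) ∧ N.N (ℓ + 1) ≤ N.N (ℓ + 2) ∧
    N.N (ℓ + 2) ≤ N.N (ℓ + 1) + 1 := by
  have m1 := N.mono (ℓ - 1)
  have s1 := N.step (ℓ - 1) (by omega)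
  rw [Nat.sub_add_cancel hℓ] at m1 s1
  exact ⟨m1, s1, N.mono _, N.mono _, N.step _ (by omega)⟩

theorem nodePart_pathMon_last {k : Fin ℓ} (h : k.val + 1 = ℓ) (hℓ : 2 ≤ ℓ) (N : LatticePath ℓ i) :
    nodePart (pathMon N) k =
      dbl (rr ℓ k) (pairPt (dnPt ℓ i (N.N (ℓ - 1))) (lastGap (N.N (ℓ - 1)) (N.N (ℓ + 2))) true)
        (lastSign (N.N (ℓ - 1)) (N.N ℓ) (N.N (ℓ + 1)) (N.N (ℓ + 2)) true) +
      dbl (rr ℓ k) (pairPt (dnPt ℓ i (N.N (ℓ - 1))) (lastGap (N.N (ℓ - 1)) (N.N (ℓ + 2))) false)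
        (lastSign (N.N (ℓ - 1)) (N.N ℓ) (N.N (ℓ + 1)) (N.N (ℓ + 2)) false) := by
  have hr : rr ℓ k = 1 := by rw [rr, if_pos h]
  set f : ℕ → (Spec →₀ ℤ) := fun L => ∑ p ∈ Finset.Ico (N.N L) (N.N (L + 1)),
    nodePart (letterMon ℓ i (L + 1) p) k with hf
  have e : nodePart (pathMon N) k = ∑ L ∈ Finset.range (2 * ℓ + 1), f L := by
    rw [pathMon, nodePart_sum]
    exact Finset.sum_congr rfl fun L _ => nodePart_sum _ _ _
  have hs : ({ℓ - 1, ℓ, ℓ + 1} : Finset ℕ) ⊆ Finset.range (2 * ℓ + 1) := by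
    intro L hL
    simp only [Finset.mem_insert, Finset.mem_singleton] at hL
    rw [Finset.mem_range]
    omega
  obtain ⟨h1, h2, h3, h4, h5⟩ := N.last_spec (by omega)
  rw [e, hr, ← sum_Ico_letters h1 h2 h3 h4 h5, ← Finset.sum_subset hs,
    Finset.sum_insert (by simp; omega), Finset.sum_insert (by simp), Finset.sum_singleton, hf]
  · dsimp only
    rw [Nat.sub_add_cancel (by omega : 1 ≤ ℓ)]
    congr 1
    · refine Finset.sum_congr rfl fun p _ => ?_
      rw [nodePart_letterMon_last h hℓ (by omega) (by omega), if_pos rfl]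
    · congr 1
      · refine Finset.sum_congr rfl fun p _ => ?_
        rw [nodePart_letterMon_last h hℓ (by omega) (by omega), if_neg (by omega), if_pos rfl]
      · refine Finset.sum_congr rfl fun p _ => ?_
        rw [nodePart_letterMon_last h hℓ (by omega) (by omega), if_neg (by omega),
          if_neg (by omega), if_pos rfl]
  · intro L hL hL'
    simp only [Finset.mem_insert, Finset.mem_singleton, Finset.mem_range, not_or] at hL hL'
    refine Finset.sum_eq_zero fun p _ => ?_
    rw [nodePart_letterMon_last h hℓ (by omega) (by omega), if_neg (by omega), if_neg (by omega),
      if_neg (by omega)]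

end DeformedW

end

noncomputable section

namespace DeformedW

open Polynomial PowerSeries

variable {ℓ i : ℕ}

/-! ### The node system at the last node -/

theorem lastSign_true_eq_one_iff {m₀ m₁ m₂ m₃ : ℕ} :
    lastSign m₀ m₁ m₂ m₃ true = 1 ↔ m₃ ≠ m₀ ∧ m₁ ≠ m₀ := by
  simp only [lastSign]
  split_ifs with h1 h2 <;> simp [*]

theorem lastSign_false_eq_one_iff {m₀ m₁ m₂ m₃ : ℕ} :
    lastSign m₀ m₁ m₂ m₃ false = 1 ↔ m₃ ≠ m₀ ∧ m₂ = m₃ := by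
  simp only [lastSign]
  split_ifs with h1 h2 <;> simp [*]

theorem lastSign_true_eq_neg_iff {m₀ m₁ m₂ m₃ : ℕ} :
    lastSign m₀ m₁ m₂ m₃ true = -1 ↔ m₃ ≠ m₀ ∧ m₁ = m₀ := by
  simp only [lastSign]
  split_ifs with h1 h2 <;> simp [*]

theorem lastSign_false_eq_neg_iff {m₀ m₁ m₂ m₃ : ℕ} :
    lastSign m₀ m₁ m₂ m₃ false = -1 ↔ m₃ ≠ m₀ ∧ m₂ ≠ m₃ := by
  simp only [lastSign]
  split_ifs with h1 h2 <;> simp [*]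

theorem lastSign_ne_zero_iff {m₀ m₁ m₂ m₃ : ℕ} {κ : Bool} :
    lastSign m₀ m₁ m₂ m₃ κ ≠ 0 ↔ m₃ ≠ m₀ := by
  cases κ <;> simp only [lastSign] <;> split_ifs <;> simp [*]

theorem lastGap_eq_zero_iff {m₀ m₃ : ℕ} (h : m₃ ≠ m₀) : lastGap m₀ m₃ = 0 ↔ m₃ = m₀ + 1 := by
  rw [lastGap, if_neg h]
  omega

namespace LatticePath

/-- The signs of a path at the last node. -/
def lastSg (κ : Bool) (N : LatticePath ℓ i) : SignType :=
  lastSign (N.N (ℓ - 1)) (N.N ℓ) (N.N (ℓ + 1)) (N.N (ℓ + 2)) κ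

/-- The change of a sign of a path at the last node is possible. -/
def CanFlip (N : LatticePath ℓ i) : Bool → Prop
  | true => 2 * N.N (ℓ - 1) + 1 - N.N ℓ ≤ N.N (ℓ + 1)
  | false => N.N ℓ ≤ 2 * N.N (ℓ + 2) - 1 - N.N (ℓ + 1)

/-- A flip at one end is impossible only if the block consists of the single letter `ℓ` or `ℓ + 2`
and the flip concerns the opposite end; one would have to change a letter `ℓ + 1` that is not there.
This is the blocked case. -/
theorem canFlip (hℓ : 1 ≤ ℓ) {N : LatticePath ℓ i} {κ : Bool} (h : N.lastSg κ ≠ 0)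
    (h' : ¬(lastGap (N.N (ℓ - 1)) (N.N (ℓ + 2)) = 0 ∧ N.lastSg κ = (if κ then -1 else 1) ∧
      N.lastSg (!κ) = N.lastSg κ)) : N.CanFlip κ := by
  obtain ⟨h1, h2, h3, h4, h5⟩ := N.last_spec hℓ
  have h0 := lastSign_ne_zero_iff.1 h
  rw [lastGap_eq_zero_iff h0] at h'
  cases κ
  · by_contra hc
    simp only [CanFlip] at hc
    have e1 : N.lastSg false = 1 := lastSign_false_eq_one_iff.2 ⟨h0, by omega⟩
    have e2 : N.lastSg true = 1 := lastSign_true_eq_one_iff.2 ⟨h0, by omega⟩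
    exact h' ⟨by omega, e1, e2.trans e1.symm⟩
  · by_contra hc
    simp only [CanFlip] at hc
    have e1 : N.lastSg true = -1 := lastSign_true_eq_neg_iff.2 ⟨h0, by omega⟩
    have e2 : N.lastSg false = -1 := lastSign_false_eq_neg_iff.2 ⟨h0, by omega⟩
    exact h' ⟨by omega, e1, e2.trans e1.symm⟩

open Classical in
/-- The change of a sign of a path at the last node. -/
def lastFlip (hℓ : 1 ≤ ℓ) (κ : Bool) (N : LatticePath ℓ i) : LatticePath ℓ i :=
  have hN := N.last_spec hℓ
  match κ with
  | true => if h : N.CanFlip true then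
      -- The new value exchanges `N (ℓ - 1)` and `N (ℓ - 1) + 1`; likewise the other flip exchanges
      -- `N (ℓ + 2) - 1` and `N (ℓ + 2)`.
      N.set ℓ (2 * N.N (ℓ - 1) + 1 - N.N ℓ) hℓ (by omega) (by omega) h (fun _ => by omega)
        (fun h => absurd rfl h)
    else N
  | false => if h : N.CanFlip false then
      N.set (ℓ + 1) (2 * N.N (ℓ + 2) - 1 - N.N (ℓ + 1)) (by omega) (by omega) h
        (show _ ≤ N.N (ℓ + 2) by omega) (fun h => absurd rfl h)
        (fun _ => show N.N (ℓ + 2) ≤ _ by omega)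
    else N

theorem lastFlip_true_apply (hℓ : 1 ≤ ℓ) {N : LatticePath ℓ i} (h : N.CanFlip true) (L : ℕ) :
    (lastFlip hℓ true N).N L = if L = ℓ then 2 * N.N (ℓ - 1) + 1 - N.N ℓ else N.N L := by
  rw [lastFlip, dif_pos h]
  exact Function.update_apply _ _ _ _

theorem lastFlip_false_apply (hℓ : 1 ≤ ℓ) {N : LatticePath ℓ i} (h : N.CanFlip false) (L : ℕ) :
    (lastFlip hℓ false N).N L =
      if L = ℓ + 1 then 2 * N.N (ℓ + 2) - 1 - N.N (ℓ + 1) else N.N L := by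
  rw [lastFlip, dif_pos h]
  exact Function.update_apply _ _ _ _

theorem lastFlip_true_values (hℓ : 1 ≤ ℓ) {N : LatticePath ℓ i} (h : N.CanFlip true) :
    (lastFlip hℓ true N).N (ℓ - 1) = N.N (ℓ - 1) ∧
    (lastFlip hℓ true N).N ℓ = 2 * N.N (ℓ - 1) + 1 - N.N ℓ ∧
    (lastFlip hℓ true N).N (ℓ + 1) = N.N (ℓ + 1) ∧
    (lastFlip hℓ true N).N (ℓ + 2) = N.N (ℓ + 2) := by
  refine ⟨?_, ?_, ?_, ?_⟩ <;> rw [lastFlip_true_apply hℓ h]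
  · exact if_neg (by omega)
  · exact if_pos rfl
  · exact if_neg (by omega)
  · exact if_neg (by omega)

theorem lastFlip_false_values (hℓ : 1 ≤ ℓ) {N : LatticePath ℓ i} (h : N.CanFlip false) :
    (lastFlip hℓ false N).N (ℓ - 1) = N.N (ℓ - 1) ∧
    (lastFlip hℓ false N).N ℓ = N.N ℓ ∧
    (lastFlip hℓ false N).N (ℓ + 1) = 2 * N.N (ℓ + 2) - 1 - N.N (ℓ + 1) ∧
    (lastFlip hℓ false N).N (ℓ + 2) = N.N (ℓ + 2) := by
  refine ⟨?_, ?_, ?_, ?_⟩ <;> rw [lastFlip_false_apply hℓ h]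
  · exact if_neg (by omega)
  · exact if_neg (by omega)
  · exact if_pos rfl
  · exact if_neg (by omega)

theorem lastFlip_outer (hℓ : 1 ≤ ℓ) {N : LatticePath ℓ i} {κ : Bool} (h : N.CanFlip κ) :
    (lastFlip hℓ κ N).N (ℓ - 1) = N.N (ℓ - 1) ∧ (lastFlip hℓ κ N).N (ℓ + 2) = N.N (ℓ + 2) := by
  cases κ
  · exact ⟨(lastFlip_false_values hℓ h).1, (lastFlip_false_values hℓ h).2.2.2⟩
  · exact ⟨(lastFlip_true_values hℓ h).1, (lastFlip_true_values hℓ h).2.2.2⟩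

theorem lastFlip_lastFlip (hℓ : 1 ≤ ℓ) {N : LatticePath ℓ i} {κ : Bool} (h : N.CanFlip κ) :
    lastFlip hℓ κ (lastFlip hℓ κ N) = N := by
  obtain ⟨h1, h2, h3, h4, h5⟩ := N.last_spec hℓ
  ext L
  cases κ
  · obtain ⟨e0, e1, e2, e3⟩ := lastFlip_false_values hℓ h
    have h' : (lastFlip hℓ false N).CanFlip false := by
      simp only [CanFlip, e1, e2, e3] at h ⊢
      omega
    rw [lastFlip_false_apply hℓ h', e2, e3]
    split_ifs with e
    · subst e
      omega
    · rw [lastFlip_false_apply hℓ h, if_neg e]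
  · obtain ⟨e0, e1, e2, e3⟩ := lastFlip_true_values hℓ h
    have h' : (lastFlip hℓ true N).CanFlip true := by
      simp only [CanFlip, e0, e1, e2] at h ⊢
      omega
    rw [lastFlip_true_apply hℓ h', e0, e1]
    split_ifs with e
    · subst e
      omega
    · rw [lastFlip_true_apply hℓ h, if_neg e]

theorem lastSg_lastFlip (hℓ : 1 ≤ ℓ) {N : LatticePath ℓ i} {κ : Bool} (h : N.CanFlip κ) :
    (lastFlip hℓ κ N).lastSg κ = -N.lastSg κ := by
  obtain ⟨h1, h2, h3, h4, h5⟩ := N.last_spec hℓ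
  cases κ
  · obtain ⟨e0, e1, e2, e3⟩ := lastFlip_false_values hℓ h
    rw [lastSg, lastSg, e0, e1, e2, e3]
    simp only [lastSign]
    split_ifs <;> first | omega | rfl
  · obtain ⟨e0, e1, e2, e3⟩ := lastFlip_true_values hℓ h
    rw [lastSg, lastSg, e0, e1, e2, e3]
    simp only [lastSign]
    split_ifs <;> first | omega | rfl

theorem lastSg_not_lastFlip (hℓ : 1 ≤ ℓ) {N : LatticePath ℓ i} {κ : Bool} (h : N.CanFlip κ) :
    (lastFlip hℓ κ N).lastSg (!κ) = N.lastSg (!κ) := by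
  cases κ
  · obtain ⟨e0, e1, e2, e3⟩ := lastFlip_false_values hℓ h
    rw [lastSg, lastSg, e0, e1, e2, e3]
    rfl
  · obtain ⟨e0, e1, e2, e3⟩ := lastFlip_true_values hℓ h
    rw [lastSg, lastSg, e0, e1, e2, e3]
    rfl

theorem pathMon_lastFlip {k : Fin ℓ} (hk : k.val + 1 = ℓ) (hℓ : 1 ≤ ℓ) {N : LatticePath ℓ i}
    {κ : Bool} (hs : N.lastSg κ = 1) (h : N.CanFlip κ) :
    pathMon (lastFlip hℓ κ N) = pathMon N - aMon k ((pairPt (dnPt ℓ i (N.N (ℓ - 1)))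
      (lastGap (N.N (ℓ - 1)) (N.N (ℓ + 2))) κ).mulQT (-rr ℓ k) 1) := by
  obtain ⟨h1, h2, h3, h4, h5⟩ := N.last_spec hℓ
  cases κ
  · obtain ⟨e0, e1, e2, e3⟩ := lastFlip_false_values hℓ h
    obtain ⟨s1, s2⟩ := lastSign_false_eq_one_iff.1 hs
    rw [pathMon_lower N (lastFlip hℓ false N) (L := ℓ + 1) (by omega) (by omega) (by omega)
      fun L hL => by rw [lastFlip_false_apply hℓ h, if_neg hL]]
    refine congrArg (pathMon N - ·) ((Lam_sub_Lam_mid_succ hk _ _).trans ?_)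
    congr 2
    rw [lastGap, if_neg s1]
    simp only [pairPt, dnPt, Spec.mulQT, qtPt, Prod.mk.injEq, true_and]
    omega
  · obtain ⟨e0, e1, e2, e3⟩ := lastFlip_true_values hℓ h
    obtain ⟨s1, s2⟩ := lastSign_true_eq_one_iff.1 hs
    rw [pathMon_lower N (lastFlip hℓ true N) (L := ℓ) (by omega) (by omega) (by omega)
      fun L hL => by rw [lastFlip_true_apply hℓ h, if_neg hL]]
    refine congrArg (pathMon N - ·) ((Lam_sub_Lam_mid hk _ _).trans ?_)
    congr 2
    simp only [pairPt, dnPt, qtPt, Prod.mk.injEq, true_and]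
    omega

theorem pathCoeff_lastFlip (hℓ : 1 ≤ ℓ) {N : LatticePath ℓ i} {κ : Bool} (hs : N.lastSg κ = 1)
    (h : N.CanFlip κ) : pathCoeff (lastFlip hℓ κ N) = pathCoeff N *
      flipRatio 1 (lastGap (N.N (ℓ - 1)) (N.N (ℓ + 2))) κ (N.lastSg !κ) := by
  obtain ⟨h1, h2, h3, h4, h5⟩ := N.last_spec hℓ
  have h0 := lastSign_ne_zero_iff.1 (show N.lastSg κ ≠ 0 by rw [hs]; decide)
  obtain ⟨g, hg⟩ : ∃ g, N.N (ℓ + 2) = N.N (ℓ - 1) + g + 1 :=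
    ⟨N.N (ℓ + 2) - N.N (ℓ - 1) - 1, by omega⟩
  have hg' : lastGap (N.N (ℓ - 1)) (N.N (ℓ + 2)) = g := by
    rw [lastGap, if_neg h0]
    omega
  rw [hg']
  cases κ
  · obtain ⟨e0, e1, e2, e3⟩ := lastFlip_false_values hℓ h
    obtain ⟨s1, s2⟩ := lastSign_false_eq_one_iff.1 hs
    refine pathCoeff_of_lastFactor hℓ
      (fun L hL hL' => by rw [lastFlip_false_apply hℓ h, if_neg hL']) ?_
    have e2' : (lastFlip hℓ false N).N (ℓ + 1) = N.N (ℓ - 1) + g := by omega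
    rw [e0, e1, e2', e3, s2, hg]
    simp only [CanFlip] at h
    rcases (by omega : N.N ℓ = N.N (ℓ - 1) ∨ N.N ℓ = N.N (ℓ - 1) + 1) with e | e
    · rw [Bool.not_false, show N.lastSg true = SignType.neg from
        lastSign_true_eq_neg_iff.2 ⟨h0, e⟩, e]
      exact lastFactor_flip_false_neg
    · rw [Bool.not_false, show N.lastSg true = SignType.pos from
        lastSign_true_eq_one_iff.2 ⟨h0, by omega⟩, e]
      exact lastFactor_flip_false_pos (by omega)
  · obtain ⟨e0, e1, e2, e3⟩ := lastFlip_true_values hℓ h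
    obtain ⟨s1, s2⟩ := lastSign_true_eq_one_iff.1 hs
    refine pathCoeff_of_lastFactor hℓ
      (fun L hL hL' => by rw [lastFlip_true_apply hℓ h, if_neg hL]) ?_
    have e1' : (lastFlip hℓ true N).N ℓ = N.N (ℓ - 1) := by omega
    have e : N.N ℓ = N.N (ℓ - 1) + 1 := by omega
    rw [e0, e1', e2, e3, e, hg]
    rcases (by omega : N.N (ℓ + 1) = N.N (ℓ - 1) + g ∨ N.N (ℓ + 1) = N.N (ℓ - 1) + g + 1) with e' | e'
    · rw [Bool.not_true, show N.lastSg false = SignType.neg from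
        lastSign_false_eq_neg_iff.2 ⟨h0, by omega⟩, e']
      exact lastFactor_flip_true_neg (by omega)
    · rw [Bool.not_true, show N.lastSg false = SignType.pos from
        lastSign_false_eq_one_iff.2 ⟨h0, by omega⟩, e']
      exact lastFactor_flip_true_pos

end LatticePath

open LatticePath in
/-- Paths at the last node. -/
def NodeSystem.ofPathLast {k : Fin ℓ} (h : k.val + 1 = ℓ) (hℓ : 2 ≤ ℓ) :
    NodeSystem k (pathMon (ℓ := ℓ) (i := i)) pathCoeff :=
  have hr : rr ℓ k = 1 := by rw [rr, if_pos h]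
  have hℓ' : 1 ≤ ℓ := by omega
  have hg : ∀ N : LatticePath ℓ i, 0 ≤ lastGap (N.N (ℓ - 1)) (N.N (ℓ + 2)) := fun N => by
    have := N.last_spec hℓ'
    rw [lastGap]
    split_ifs <;> omega
  have can : ∀ (κ : Bool) (N : LatticePath ℓ i), N.lastSg κ ≠ 0 →
      ¬(rr ℓ k = 1 ∧ lastGap (N.N (ℓ - 1)) (N.N (ℓ + 2)) = 0 ∧
        N.lastSg κ = (if κ then -1 else 1) ∧ N.lastSg (!κ) = N.lastSg κ) → N.CanFlip κ :=
    fun κ N h0 h' => N.canFlip hℓ' h0 fun h'' => h' ⟨hr, h''⟩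
  { X := fun N => dnPt ℓ i (N.N (ℓ - 1))
    gap := fun N => lastGap (N.N (ℓ - 1)) (N.N (ℓ + 2))
    sg := lastSg
    flip := lastFlip hℓ'
    nodePart_eq := nodePart_pathMon_last h hℓ
    gap_nonneg := fun N _ => hg N
    -- Gap `0` means a block of one letter. If this is `ℓ + 2`, it is not `ℓ`, so the first sign is
    -- negative as well.
    sg_ne := fun N _ e1 e2 => by
      obtain ⟨s1, s2⟩ := lastSign_false_eq_neg_iff.1 e2
      have := N.last_spec hℓ'
      rw [lastGap_eq_zero_iff s1] at e1
      exact lastSign_true_eq_neg_iff.2 ⟨s1, by omega⟩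
    X_flip := fun κ N h0 h' => by rw [(lastFlip_outer hℓ' (can κ N h0 h')).1]
    gap_flip := fun κ N h0 h' => by
      rw [(lastFlip_outer hℓ' (can κ N h0 h')).1, (lastFlip_outer hℓ' (can κ N h0 h')).2]
    sg_flip := fun κ N h0 h' => lastSg_lastFlip hℓ' (can κ N h0 h')
    sg_not_flip := fun κ N h0 h' => lastSg_not_lastFlip hℓ' (can κ N h0 h')
    flip_flip := fun κ N h0 h' => lastFlip_lastFlip hℓ' (can κ N h0 h')
    mon_flip := fun κ N hs h' => pathMon_lastFlip h hℓ' hs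
      (can κ N (by rw [hs]; decide) h')
    coeff_flip := fun κ N hs h' => by
      rw [pathCoeff_lastFlip hℓ' hs (can κ N (by rw [hs]; decide) h'),
        stepFactor_eq_flipRatio (fun _ => hg N), hr]
      rw [nodePart_pathMon_last h hℓ, ← hs]
      cases κ
      · exact add_comm _ _
      · rfl }

end DeformedW

end

noncomputable section

namespace DeformedW

open Polynomial PowerSeries

variable {ℓ i : ℕ}

/-! ### Tableaux and paths -/

namespace Tableau

theorem monotone (j : Tableau ℓ i) {α β : Fin i} (h : α ≤ β) : (j.1 α : ℕ) ≤ j.1 β := by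
  obtain ⟨d, hd⟩ : ∃ d, α.val + d = β.val := ⟨β.val - α.val, by omega⟩
  induction d generalizing β with
  | zero =>
    obtain rfl : α = β := Fin.ext hd
    exact le_rfl
  | succ d ih =>
    refine (ih (β := ⟨α.val + d, by omega⟩) (by rw [Fin.le_def]; simp) rfl).trans ?_
    have := j.2 ⟨α.val + d, by omega⟩ β (by rw [← hd]; rfl)
    omega

theorem exists_count (j : Tableau ℓ i) (L : ℕ) : ∃ n : ℕ, ∀ α : Fin i, n ≤ α.val → L < j.1 α :=
  ⟨i, fun α h => absurd α.2 (by omega)⟩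

open Classical in
/-- The number of entries of a tableau which are at most `L`. -/
def count (j : Tableau ℓ i) (L : ℕ) : ℕ := Nat.find (j.exists_count L)

theorem lt_count_iff (j : Tableau ℓ i) (L : ℕ) (α : Fin i) :
    α.val < j.count L ↔ (j.1 α : ℕ) ≤ L := by
  classical
  constructor
  · intro h
    have := Nat.find_min (j.exists_count L) h
    push Not at this
    obtain ⟨β, h1, h2⟩ := this
    exact (j.monotone h1).trans h2
  · intro h
    by_contra h'
    exact absurd (Nat.find_spec (j.exists_count L) α (not_lt.1 h')) (not_lt.2 h)

theorem count_le (j : Tableau ℓ i) {L n : ℕ} (h : ∀ α : Fin i, n ≤ α.val → L < j.1 α) :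
    j.count L ≤ n := by
  classical
  exact Nat.find_min' _ h

theorem lt_of_count_le (j : Tableau ℓ i) {L : ℕ} {α : Fin i} (h : j.count L ≤ α.val) :
    L < j.1 α := by
  by_contra h'
  exact absurd ((j.lt_count_iff L α).2 (not_lt.1 h')) (not_lt.2 h)

/-- The path of a tableau. -/
def path (j : Tableau ℓ i) : LatticePath ℓ i where
  N := j.count
  zero := Nat.le_zero.1 <| j.count_le fun α _ => (Finset.mem_Icc.1 (j.1 α).2).1
  last L hL := by
    refine le_antisymm (j.count_le fun α h => absurd α.2 (by omega)) ?_
    by_contra h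
    have := (Finset.mem_Icc.1 (j.1 ⟨j.count L, by omega⟩).2).2
    have := j.lt_of_count_le (L := L) (α := ⟨j.count L, by omega⟩) le_rfl
    omega
  mono L := j.count_le fun α h => by
    have := j.lt_of_count_le h
    omega
  step L hL := j.count_le fun α h => by
    have h1 := j.lt_of_count_le (L := L) (α := ⟨α.val - 1, by omega⟩) (by simp only; omega)
    have h2 := j.2 ⟨α.val - 1, by omega⟩ α (by simp only; omega)
    omega

end Tableau

namespace LatticePath

theorem le_last (N : LatticePath ℓ i) (L : ℕ) : N.N L ≤ i :=
  (N.monotone (le_max_left L (2 * ℓ + 1))).trans (N.last _ (le_max_right _ _)).le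

theorem exists_entry (N : LatticePath ℓ i) (α : Fin i) : ∃ L, α.val < N.N L :=
  ⟨2 * ℓ + 1, by rw [N.last _ le_rfl]; exact α.2⟩

open Classical in
/-- The entries of the tableau of a path. -/
def entry (N : LatticePath ℓ i) (α : Fin i) : ℕ := Nat.find (N.exists_entry α)

theorem entry_le_iff (N : LatticePath ℓ i) (α : Fin i) (L : ℕ) : N.entry α ≤ L ↔ α.val < N.N L := by
  classical
  exact ⟨fun h => (Nat.find_spec (N.exists_entry α)).trans_le (N.monotone h),
    fun h => Nat.find_min' _ h⟩

theorem entry_mem (N : LatticePath ℓ i) (α : Fin i) : N.entry α ∈ Finset.Icc 1 (2 * ℓ + 1) := by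
  rw [Finset.mem_Icc]
  constructor
  · by_contra h
    have := (N.entry_le_iff α 0).1 (by omega)
    rw [N.zero] at this
    omega
  · rw [entry_le_iff, N.last _ le_rfl]
    exact α.2

/-- The tableau of a path. -/
def tableau (N : LatticePath ℓ i) : Tableau ℓ i :=
  ⟨fun α => ⟨N.entry α, N.entry_mem α⟩, fun α β h => by
    have h1 : N.entry α ≤ N.entry β := by
      have := (N.entry_le_iff β _).1 le_rfl
      rw [entry_le_iff]
      omega
    have h2 := (Finset.mem_Icc.1 (N.entry_mem α)).1
    have h3 := mt (N.entry_le_iff α (N.entry α - 1)).2 (by omega)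
    have h4 := (N.entry_le_iff β _).1 le_rfl
    have h5 := N.step (N.entry α - 1)
    rw [Nat.sub_add_cancel h2] at h5
    rcases h1.lt_or_eq with h1 | h1
    · exact Or.inl h1
    · right
      change N.entry α = ℓ + 1 ∧ N.entry β = ℓ + 1
      rw [← h1] at h4 ⊢
      by_contra h'
      have := h5 (by omega)
      omega⟩

end LatticePath

/-- Tableaux and paths. -/
def tableauEquiv (ℓ i : ℕ) : Tableau ℓ i ≃ LatticePath ℓ i where
  toFun := Tableau.path
  invFun := LatticePath.tableau
  left_inv j := by
    refine Subtype.ext (funext fun α => Subtype.ext (eq_of_forall_ge_iff fun L => ?_))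
    exact (j.path.entry_le_iff α L).trans (j.lt_count_iff L α)
  right_inv N := by
    ext L
    have key : ∀ α : Fin i, α.val < N.tableau.path.N L ↔ α.val < N.N L := fun α =>
      (N.tableau.lt_count_iff L α).trans (N.entry_le_iff α L)
    have h1 := N.tableau.path.le_last L
    have h2 := N.le_last L
    refine le_antisymm (not_lt.1 fun h => ?_) (not_lt.1 fun h => ?_)
    · exact lt_irrefl _ ((key ⟨N.N L, by omega⟩).1 h)
    · exact lt_irrefl _ ((key ⟨N.tableau.path.N L, by omega⟩).2 h)

/-- The product over positions is regrouped by letters: the position `α` carries `L + 1` exactly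
when `N L ≤ α < N (L + 1)`. -/
theorem tableauMon_eq (j : Tableau ℓ i) : tableauMon ℓ i j = pathMon j.path := by
  have e : ∀ L, ∑ p ∈ Finset.Ico (j.path.N L) (j.path.N (L + 1)), letterMon ℓ i (L + 1) p =
      ∑ α : Fin i, if (j.1 α : ℕ) = L + 1 then letterMon ℓ i (L + 1) α.val else 0 := by
    intro L
    have h1 : ∀ α : Fin i, ((j.1 α : ℕ) = L + 1) =
        (α.val ∈ Finset.Ico (j.path.N L) (j.path.N (L + 1))) := by
      intro α
      have h1 : α.val < j.path.N L ↔ _ := j.lt_count_iff L α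
      have h2 : α.val < j.path.N (L + 1) ↔ _ := j.lt_count_iff (L + 1) α
      rw [eq_iff_iff, Finset.mem_Ico]
      omega
    simp only [h1]
    rw [Fin.sum_univ_eq_sum_range (fun p => if p ∈ Finset.Ico (j.path.N L) (j.path.N (L + 1)) then
      letterMon ℓ i (L + 1) p else 0) i, ← Finset.sum_filter]
    refine Finset.sum_congr ?_ fun _ _ => rfl
    ext p
    have := j.path.le_last (L + 1)
    rw [Finset.mem_filter, Finset.mem_range, Finset.mem_Ico]
    omega
  rw [pathMon, Finset.sum_congr rfl fun L _ => e L, Finset.sum_comm, tableauMon]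
  refine Finset.sum_congr rfl fun α _ => ?_
  have h := Finset.mem_Icc.1 (j.1 α).2
  have h' : (j.1 α : ℕ) - 1 + 1 = j.1 α := by omega
  rw [Finset.sum_eq_single ((j.1 α : ℕ) - 1), h', if_pos rfl]
  · rfl
  · intro L _ hL
    exact if_neg (by omega)
  · intro hL
    exact absurd (Finset.mem_range.2 (by omega)) hL

/-! ### The dominant path -/

/-- The path of the dominant monomial. -/
def topPath (h : i ≤ 2 * ℓ + 1) : LatticePath ℓ i where
  N L := min L i
  zero := by omega
  last := by omega
  mono := by omega
  step := by omega

/-- The entries are `1, …, i`, and the product telescopes from `Y_0 = 1` to `Y_i`. The assumption `i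
< ℓ` keeps all letters in the range of the first formula for `Λ`. -/
theorem pathMon_topPath (h : i < ℓ) : pathMon (topPath (ℓ := ℓ) (i := i) (by omega)) = Y ℓ i 0 0 := by
  have e : ∀ L, L < i → letterMon ℓ i (L + 1) L =
      Y ℓ (L + 1) (2 * ((L + 1 : ℕ) - i)) (i - (L + 1 : ℕ)) - Y ℓ L (2 * (L - i)) (i - L) := by
    intro L hL
    rw [letterMon, Lam, if_pos (by omega), Nat.add_sub_cancel]
    congr 2 <;> push_cast <;> ring
  have hs : Finset.range i ⊆ Finset.range (2 * ℓ + 1) :=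
    Finset.range_subset_range.2 (by omega)
  rw [pathMon, ← Finset.sum_subset hs]
  · rw [← sub_zero (Y ℓ i 0 0), ← Y_zero ℓ (2 * ((0 : ℕ) - i)) (i - (0 : ℕ))]
    have := Finset.sum_range_sub (fun L : ℕ => Y ℓ L (2 * (L - i)) (i - L)) i
    rw [sub_self, mul_zero] at this
    rw [← this]
    refine Finset.sum_congr rfl fun L hL => ?_
    rw [Finset.mem_range] at hL
    rw [← e L hL]
    change ∑ p ∈ Finset.Ico (min L i) (min (L + 1) i), _ = _
    rw [min_eq_left hL.le, min_eq_left hL, Nat.Ico_succ_singleton, Finset.sum_singleton]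
  · intro L _ hL
    rw [Finset.mem_range] at hL
    change ∑ p ∈ Finset.Ico (min L i) (min (L + 1) i), _ = _
    rw [min_eq_right (by omega), min_eq_right (by omega), Finset.Ico_self, Finset.sum_empty]

theorem pathCoeff_topPath (h : i < ℓ) :
    pathCoeff (topPath (ℓ := ℓ) (i := i) (by omega)) = 1 := by
  have e : ∀ L, i ≤ L → (topPath (ℓ := ℓ) (i := i) (by omega)).N L = i := fun L hL =>
    min_eq_right hL
  rw [pathCoeff, e _ (by omega), e _ (by omega), Nat.sub_self, midFactor, Finset.prod_range_zero,
    one_mul]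
  refine Finset.prod_eq_one fun j hj => ?_
  rw [Finset.mem_Icc] at hj
  rw [e _ (by omega : i ≤ 2 * ℓ + 1 - j), e _ (by omega : i ≤ 2 * ℓ + 2 - j)]
  exact pairFactor_of_not (by omega)

/-- A path which is not the dominant one has a corner of negative sign. -/
theorem LatticePath.exists_corner (h : i < ℓ) {N : LatticePath ℓ i}
    (hN : N ≠ topPath (by omega)) :
    ∃ L, 1 ≤ L ∧ L ≤ 2 * ℓ ∧ N.N L = N.N (L - 1) ∧ N.N L < N.N (L + 1) := by
  by_contra hc
  push Not at hc
  -- In the absence of a flat step followed by a rise, a path that is flat once remains flat, so it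
  -- has already reached its final value `i`.
  have const : ∀ L, N.N (L + 1) = N.N L → N.N L = i := by
    intro L hL
    have : ∀ d, N.N (L + d) = N.N L ∧ N.N (L + d + 1) = N.N L := by
      intro d
      induction d with
      | zero => exact ⟨rfl, hL⟩
      | succ d ih =>
        refine ⟨ih.2, ?_⟩
        rcases Nat.lt_or_ge (2 * ℓ) (L + d + 1) with hd | hd
        · rw [N.last _ (by omega), ← ih.2, N.last _ (by omega)]
        · have := hc (L + d + 1) (by omega) hd (by rw [ih.2, Nat.add_sub_cancel, ih.1])
          have := N.mono (L + d + 1)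
          rw [← add_assoc]
          omega
    rw [← (this (2 * ℓ + 1)).1, N.last _ (by omega)]
  -- Hence the path rises by one at each step until it reaches `i`, which happens before `ℓ`; the
  -- unbounded step at `ℓ` plays no role.
  have low : ∀ L, L ≤ ℓ → N.N L = min L i := by
    intro L
    induction L with
    | zero => intro _; rw [N.zero, Nat.zero_min]
    | succ L ih =>
      intro hL
      have h1 := ih (by omega)
      have h2 := N.mono L
      have h3 := N.step L (by omega)
      have h4 := N.le_last (L + 1)
      have h5 := const L
      omega
  refine hN (LatticePath.ext (funext fun L => ?_))
  change N.N L = min L i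
  rcases le_total L ℓ with hL | hL
  · exact low L hL
  · have h1 := N.monotone hL
    have h2 := low ℓ le_rfl
    have h3 := N.le_last L
    omega

/-! ### The fundamental fields -/

/-- The system of paths at each node. -/
def pathSystem (hℓ : 2 ≤ ℓ) (k : Fin ℓ) : NodeSystem k (pathMon (ℓ := ℓ) (i := i)) pathCoeff :=
  if h : k.val + 1 < ℓ then NodeSystem.ofPath h else NodeSystem.ofPathLast (by omega) hℓ

/-- The corner at `L` belongs to the node `L` if `L < ℓ`, to the node `2ℓ + 1 - L` if `L > ℓ + 1`,
counted from `1`, and to the last node otherwise. -/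
theorem exists_sg_eq_neg (hℓ : 2 ≤ ℓ) {N : LatticePath ℓ i} {L : ℕ} (h1 : 1 ≤ L) (h2 : L ≤ 2 * ℓ)
    (h3 : N.N L = N.N (L - 1)) (h4 : N.N L < N.N (L + 1)) :
    ∃ k κ, (pathSystem hℓ k).sg κ N = -1 := by
  by_cases hL : L = ℓ ∨ L = ℓ + 1
  · have e : pathSystem (i := i) hℓ ⟨ℓ - 1, by omega⟩ =
        NodeSystem.ofPathLast (by simp only; omega) hℓ := dif_neg (by simp only; omega)
    obtain ⟨m1, m2, m3, m4, m5⟩ := N.last_spec (by omega)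
    rcases hL with rfl | rfl
    · refine ⟨_, true, (congrArg (fun S => S.sg true N) e).trans ?_⟩
      exact (lastSign_true_eq_neg_iff (m₂ := N.N (L + 1))).2 ⟨by omega, h3⟩
    · refine ⟨_, false, (congrArg (fun S => S.sg false N) e).trans ?_⟩
      rw [Nat.add_sub_cancel] at h3
      have h4 : N.N (ℓ + 1) < N.N (ℓ + 2) := h4
      exact (lastSign_false_eq_neg_iff (m₁ := N.N ℓ)).2 ⟨by omega, by omega⟩
  · have s := N.step L (by omega)
    have hs : N.sign L = -1 := by
      rw [LatticePath.sign, stepSign, if_pos (by omega), if_neg (by omega)]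
    rcases Nat.lt_or_ge L ℓ with h | h
    · have hk : L - 1 + 1 < ℓ := by omega
      refine ⟨⟨L - 1, by omega⟩, true, ?_⟩
      rw [pathSystem, dif_pos hk]
      change N.sign (L - 1 + 1) = -1
      rwa [Nat.sub_add_cancel h1]
    · have hk : 2 * ℓ - L + 1 < ℓ := by omega
      refine ⟨⟨2 * ℓ - L, by omega⟩, false, ?_⟩
      rw [pathSystem, dif_pos hk]
      change N.sign (2 * ℓ - (2 * ℓ - L)) = -1
      rwa [Nat.sub_sub_self h2]

instance : Fintype (LatticePath ℓ i) := Fintype.ofEquiv _ (tableauEquiv ℓ i)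

theorem path_isFundamentalField (hℓ : 2 ≤ ℓ) (hi : i < ℓ) :
    ∃ c : LatticePath ℓ i → K, IsFundamentalField ℓ i pathMon c := by
  choose c hc using fun N : LatticePath ℓ i => isKUnit_pathCoeff N
  refine ⟨c, ?_⟩
  -- The systems are built for `pathCoeff`. Stating the claim for any `d` equal to it carries both
  -- the systems and their signs over to the images of the chosen elements of `K`.
  have key : ∀ d : LatticePath ℓ i → KK, d = pathCoeff →
      ∃ S : ∀ k, NodeSystem k (pathMon (ℓ := ℓ) (i := i)) d,
        ∀ N, N ≠ topPath (by omega) → ∃ k κ, (S k).sg κ N = -1 := by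
    rintro _ rfl
    refine ⟨pathSystem hℓ, fun N hN => ?_⟩
    obtain ⟨L, h1, h2, h3, h4⟩ := LatticePath.exists_corner hi hN
    exact exists_sg_eq_neg hℓ h1 h2 h3 h4
  obtain ⟨S, hS⟩ := key (fun N => algebraMap K KK (c N)) (funext fun N => (hc N).2)
  refine isFundamentalField_of_nodeSystem S (fun N => (hc N).1) (pathMon_topPath hi) ?_ hS
  apply IsFractionRing.injective K KK
  rw [(hc _).2, pathCoeff_topPath hi, map_one]

theorem IsFundamentalField.comp_equiv {J J' : Type} [Fintype J] [Fintype J'] {mon : J' → Mon ℓ}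
    {c : J' → K} (h : IsFundamentalField ℓ i mon c) (e : J ≃ J') :
    IsFundamentalField ℓ i (fun j => mon (e j)) fun j => c (e j) where
  mem_W := by
    rw [e.sum_comp fun j => c j • monField (mon j)]
    exact h.mem_W
  mon_injective := h.mon_injective.comp e.injective
  coeff_isUnit j := h.coeff_isUnit _
  dominant_iff j := h.dominant_iff _
  top := by
    obtain ⟨j, hj⟩ := h.top
    exact ⟨e.symm j, by rwa [e.apply_symm_apply]⟩
  regular := h.regular
  created_iff M d := by
    rw [h.created_iff, e.exists_congr_left]
    simp only [e.apply_symm_apply]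

theorem tableau_isFundamentalField (hℓ : 2 ≤ ℓ) (hi : i < ℓ) :
    ∃ c : Tableau ℓ i → K, IsFundamentalField ℓ i (tableauMon ℓ i) c := by
  obtain ⟨c, hc⟩ := path_isFundamentalField hℓ hi
  refine ⟨fun j => c (tableauEquiv ℓ i j), ?_⟩
  rw [show tableauMon ℓ i = fun j => pathMon (tableauEquiv ℓ i j) from funext tableauMon_eq]
  exact hc.comp_equiv (tableauEquiv ℓ i)

end DeformedW

end

theorem mainTheorem4 (ℓ : ℕ) (hℓ : 2 ≤ ℓ) :
    (∀ i : ℕ, 1 ≤ i → i ≤ ℓ - 1 → ∃ c : DeformedW.Tableau ℓ i → DeformedW.K,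
      DeformedW.IsFundamentalField ℓ i (DeformedW.tableauMon ℓ i) c) ∧
    (∃ c : (Fin ℓ → ℤˣ) → DeformedW.K,
      DeformedW.IsFundamentalField ℓ ℓ (DeformedW.spinorMon ℓ) c) := by
  exact ⟨fun _ _ h => DeformedW.tableau_isFundamentalField hℓ (by omega),
    _, DeformedW.spinor_isFundamentalField (by omega)⟩
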